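/- **Theorem 1.7 (fluctuations).** Fix $\sigma>0$. For each $N$ let $\mathbf W_N$ be a random $N\times N$ matrix of one of the following two kinds. *Real symmetric case* ($\rho=1$): $\mathbf W_N$ is real symmetric, the entries $(\mathbf W_N)_{jk}$, $1\le j\le k\le N$, are independent and centered, and $\mathbb V[(\mathbf W_N)_{jk}]=\sigma^2$ for $j<k$. *Hermitian case* ($\rho=0$): $\mathbf W_N$ is Hermitian, the random variables $\Re(\mathbf W_N)_{jk},\ \Im(\mathbf W_N)_{jk}$ $(1\le j<k\le N)$ and $(\mathbf W_N)_{ii}$ $(1\le i\le N)$ are independent and centered, and $\mathbb V\,\Re(\mathbf W_N)_{jk}=\mathbb V\,\Im(\mathbf W_N)_{jk}=\sigma^2/2$ for $j<k$. In both cases assume $\sup_{j\ne k,N}\mathbb E|(\mathbf W_N)_{jk}|^4<\infty$, $\sup_{i,N}\mathbb E|(\mathbf W_N)_{ii}|^2<\infty$ and, for every $\varepsilon>0$, as $N\to\infty$, $$\frac1{N^2}\sum_{i<j}\mathbb E\Big(|(\mathbf W_N)_{ij}|^4\mathbf 1_{|(\mathbf W_N)_{ij}|\ge\varepsilon N^{1/4}}\Big)\to0,\qquad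 \frac1N\sum_i\mathbb E\Big(|(\mathbf W_N)_{ii}|^2\mathbf 1_{|(\mathbf W_N)_{ii}|\ge\varepsilon \sqrt N}\Big)\to0 .$$ Put $(\widehat{\mathbf W}_N)_{ij}=(\mathbf W_N)_{ij}(1-\delta_{ij})\mathbf 1_{|(\mathbf W_N)_{ij}|\le N^{1/4}}-\mathbb E\big[(\mathbf W_N)_{ij}(1-\delta_{ij})\mathbf 1_{|(\mathbf W_N)_{ij}|\le N^{1/4}}\big]$, $\widehat{\mathbf X}_N=N^{-1/2}\widehat{\mathbf W}_N$ and $\widehat{\mathbf R}_N(z)=(z\mathbf I_N-\widehat{\mathbf X}_N)^{-1}$ for $z\in\mathbb C\setminus\mathbb R$. Let $$g_\sigma(z)=\int_{-2\sigma}^{2\sigma}\frac{1}{z-x}\,\frac{\sqrt{4\sigma^2-x^2}}{2\pi\sigma^2}\,dx,\qquad \Pi(z_1,z_2)=-g_\sigma(z_1)g_\sigma(z_2)+\frac{g_\sigma(z_1)g_\sigma(z_2)}{1-\sigma^2g_\sigma(z_1)g_\sigma(z_2)} .$$ Fix $m$. For all large $N$ let $\mathbf u_N^1,\dots,\mathbf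 u_N^m$ be mutually orthogonal unit vectors of $\mathbb C^N$ (of $\mathbb R^N$ in the real symmetric case) such that $\|\mathbf u_N^l\|_\infty\to0$ as $N\to\infty$ for every $l$. With $\langle u,v\rangle=\sum_i\overline{u_i}v_i$, let $\mathbf G_N(z)$ be the $m\times m$ matrix with entries $$\mathbf G_N(z)_{lp}=\sqrt N\Big(\langle\mathbf u_N^l,\widehat{\mathbf R}_N(z)\mathbf u_N^p\rangle-\mathbb E\langle\mathbf u_N^l,\widehat{\mathbf R}_N(z)\mathbf u_N^p\rangle\Big),\qquad z\in\mathbb C\setminus\mathbb R .$$ Then, as $N\to\infty$, $\mathbf G_N$ converges in finite-dimensional distributions on $\mathbb C\setminus\mathbb R$ to an $m\times m$ matrix-valued random field $\mathbf\Gamma(z)$: for all $z_1,\dots,z_n\in\mathbb C\setminus\mathbb R$, $(\mathbf G_N(z_1),\dots,\mathbf G_N(z_n))$ converges in distribution to $(\mathbf\Gamma(z_1),\dots,\mathbf\Gamma(z_n))$. Here the entries $\Gamma_{lp}$, $l\le p$, are independent processes, each a centered Gaussian process (jointly in its real and imaginary parts), with covariances $$\begin{aligned} \mathbb E[\Re\Gamma_{lp}(z_1)\Re\Gamma_{lp}(z_2)]={}&\tfrac{\rho}{4}\big(\Pi(z_1,z_2)+\Pi(\bar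 z_1,\bar z_2)\big)+\tfrac14\big(\Pi(z_1,\bar z_2)+\Pi(\bar z_1,z_2)\big)\\ &+\tfrac{\delta_{lp}}4\big(\rho(\Pi(z_1,\bar z_2)+\Pi(\bar z_1,z_2))+\Pi(z_1,z_2)+\Pi(\bar z_1,\bar z_2)\big),\\ \mathbb E[\Re\Gamma_{lp}(z_1)\Im\Gamma_{lp}(z_2)]={}&\tfrac{\rho}{4i}\big(\Pi(z_1,z_2)-\Pi(\bar z_1,\bar z_2)\big)+\tfrac1{4i}\big(-\Pi(z_1,\bar z_2)+\Pi(\bar z_1,z_2)\big)\\ &+\tfrac{\delta_{lp}}{4i}\big(\rho(-\Pi(z_1,\bar z_2)+\Pi(\bar z_1,z_2))+\Pi(z_1,z_2)-\Pi(\bar z_1,\bar z_2)\big),\\ \mathbb E[\Im\Gamma_{lp}(z_1)\Im\Gamma_{lp}(z_2)]={}&-\tfrac{\rho}{4}\big(\Pi(z_1,z_2)+\Pi(\bar z_1,\bar z_2)\big)+\tfrac14\big(\Pi(z_1,\bar z_2)+\Pi(\bar z_1,z_2)\big)\\ &-\tfrac{\delta_{lp}}4\big(\rho(-\Pi(z_1,\bar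 z_2)-\Pi(\bar z_1,z_2))+\Pi(z_1,z_2)+\Pi(\bar z_1,\bar z_2)\big), \end{aligned}$$ and $\Gamma_{lp}(z)=\overline{\Gamma_{pl}(\bar z)}$ for $l>p$. -/

import Mathlib

open Filter Topology MeasureTheory ProbabilityTheory
open scoped ComplexConjugate

noncomputable section

namespace WignerFluct

/-- The density of the semicircle distribution of variance `σ ^ 2` (to be used on `[-2σ, 2σ]`). -/
def semicircleDensity (σ x : ℝ) : ℝ :=
  1 / (2 * Real.pi * σ ^ 2) * Real.sqrt (4 * σ ^ 2 - x ^ 2)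

/-- The Stieltjes transform `g_σ(z) = ∫ dμ_sc(x) / (z - x)` of the semicircle distribution. -/
def stieltjes (σ : ℝ) (z : ℂ) : ℂ :=
  ∫ x in Set.Icc (-(2 * σ)) (2 * σ), (semicircleDensity σ x : ℂ) / (z - (x : ℂ))

/-- `Π(z₁, z₂) = -g(z₁) g(z₂) + g(z₁) g(z₂) / (1 - σ² g(z₁) g(z₂))`. -/
def covPi (σ : ℝ) (z₁ z₂ : ℂ) : ℂ :=
  -(stieltjes σ z₁ * stieltjes σ z₂) +
    stieltjes σ z₁ * stieltjes σ z₂ / (1 - (σ : ℂ) ^ 2 * stieltjes σ z₁ * stieltjes σ z₂)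

section OneMatrix

variable {Ω : Type*} [MeasurableSpace Ω] {N : ℕ}

/-- The Lindeberg quantity for the fourth moments of the off-diagonal entries:
`L_N(ε) = N⁻² ∑_{i < j} E(|W_ij|⁴ 1{|W_ij| ≥ ε N^{1/4}})`. -/
def offDiagLindeberg (P : Measure Ω) (W : Ω → Matrix (Fin N) (Fin N) ℂ) (ε : ℝ) : ℝ :=
  1 / (N : ℝ) ^ 2 * ∑ i : Fin N, ∑ j ∈ Finset.Ioi i,
    ∫ ω in {ω | ε * (N : ℝ) ^ ((1 : ℝ) / 4) ≤ ‖W ω i j‖}, ‖W ω i j‖ ^ 4 ∂P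

/-- The Lindeberg quantity for the second moments of the diagonal entries:
`l_N(ε) = N⁻¹ ∑_i E(|W_ii|² 1{|W_ii| ≥ ε √N})`. -/
def diagLindeberg (P : Measure Ω) (W : Ω → Matrix (Fin N) (Fin N) ℂ) (ε : ℝ) : ℝ :=
  1 / (N : ℝ) * ∑ i : Fin N,
    ∫ ω in {ω | ε * Real.sqrt (N : ℝ) ≤ ‖W ω i i‖}, ‖W ω i i‖ ^ 2 ∂P

/-- The entries of `W` with the diagonal removed and truncated at level `N^{1/4}`:
`W_ij 1{i ≠ j} 1{|W_ij| ≤ N^{1/4}}`. -/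
def truncEntry (W : Ω → Matrix (Fin N) (Fin N) ℂ) (ω : Ω) (i j : Fin N) : ℂ :=
  if i ≠ j ∧ ‖W ω i j‖ ≤ (N : ℝ) ^ ((1 : ℝ) / 4) then W ω i j else 0

/-- The truncated, recentred matrix `Ŵ`. -/
def truncW (P : Measure Ω) (W : Ω → Matrix (Fin N) (Fin N) ℂ) (ω : Ω) :
    Matrix (Fin N) (Fin N) ℂ :=
  Matrix.of fun i j => truncEntry W ω i j - ∫ ω', truncEntry W ω' i j ∂P

/-- `X̂ = Ŵ / √N`. -/
def truncX (P : Measure Ω) (W : Ω → Matrix (Fin N) (Fin N) ℂ) (ω : Ω) :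
    Matrix (Fin N) (Fin N) ℂ :=
  ((1 / Real.sqrt (N : ℝ) : ℝ) : ℂ) • truncW P W ω

/-- The truncated resolvent `R̂(z) = (z I - X̂)⁻¹`. -/
def truncResolvent (P : Measure Ω) (W : Ω → Matrix (Fin N) (Fin N) ℂ) (z : ℂ) (ω : Ω) :
    Matrix (Fin N) (Fin N) ℂ :=
  (z • (1 : Matrix (Fin N) (Fin N) ℂ) - truncX P W ω)⁻¹

/-- The bilinear form `⟨u, R̂(z) v⟩ = ∑ᵢ conj(uᵢ) (R̂(z) v)ᵢ`. -/
def bilin (P : Measure Ω) (W : Ω → Matrix (Fin N) (Fin N) ℂ) (u v : EuclideanSpace ℂ (Fin N))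
    (z : ℂ) (ω : Ω) : ℂ :=
  ∑ i : Fin N, conj (u i) * ∑ j : Fin N, truncResolvent P W z ω i j * v j

/-- The matrix `G_N(z)`, with entries `√N (⟨uˡ, R̂(z) uᵖ⟩ - E ⟨uˡ, R̂(z) uᵖ⟩)`. -/
def fluctMatrix (P : Measure Ω) (W : Ω → Matrix (Fin N) (Fin N) ℂ) {m : ℕ}
    (u : Fin m → EuclideanSpace ℂ (Fin N)) (z : ℂ) (ω : Ω) : Matrix (Fin m) (Fin m) ℂ :=
  Matrix.of fun l p =>
    (Real.sqrt (N : ℝ) : ℂ) * (bilin P W (u l) (u p) z ω - ∫ ω', bilin P W (u l) (u p) z ω' ∂P)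

end OneMatrix

section Ensembles

variable {Ω : ℕ → Type*} [∀ N, MeasurableSpace (Ω N)]

/-- The conditions shared by the real symmetric and the Hermitian ensembles: random Hermitian
matrices with centred entries, uniformly bounded fourth moments off the diagonal and second moments
on the diagonal, and the two Lindeberg conditions. -/
structure WignerMoments (P : ∀ N, Measure (Ω N))
    (W : ∀ N, Ω N → Matrix (Fin N) (Fin N) ℂ) : Prop where
  measurable : ∀ N (i j : Fin N), Measurable fun ω => W N ω i j
  isHermitian : ∀ N ω, (W N ω).IsHermitian
  mean : ∀ N (i j : Fin N), ∫ ω, W N ω i j ∂P N = 0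
  fourth_moment : ∃ C : NNReal, ∀ N (i j : Fin N), i ≠ j → ∫⁻ ω, ‖W N ω i j‖ₑ ^ 4 ∂P N ≤ C
  diag_second_moment : ∃ C : NNReal, ∀ N (i : Fin N), ∫⁻ ω, ‖W N ω i i‖ₑ ^ 2 ∂P N ≤ C
  lindeberg : ∀ ε : ℝ, 0 < ε →
    Tendsto (fun N => offDiagLindeberg (P N) (W N) ε) atTop (𝓝 0)
  diag_lindeberg : ∀ ε : ℝ, 0 < ε →
    Tendsto (fun N => diagLindeberg (P N) (W N) ε) atTop (𝓝 0)

/-- Real symmetric Wigner matrices `W_N`, `N ∈ ℕ`, with off-diagonal variance `σ ^ 2`. -/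
structure IsRealWigner (P : ∀ N, Measure (Ω N))
    (W : ∀ N, Ω N → Matrix (Fin N) (Fin N) ℂ) (σ : ℝ) : Prop extends WignerMoments P W where
  real_entries : ∀ N ω (i j : Fin N), (W N ω i j).im = 0
  indep : ∀ N, iIndepFun
    (fun (q : {q : Fin N × Fin N // q.1 ≤ q.2}) (ω : Ω N) => (W N ω q.1.1 q.1.2).re) (P N)
  variance : ∀ N (i j : Fin N), i < j → Var[fun ω => (W N ω i j).re; P N] = σ ^ 2

/-- The real random variables `Re W_jk` and `Im W_jk` for `j < k`, and `W_ii`. -/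
def hermitianCoord {N : ℕ} {Ω' : Type*} (W : Ω' → Matrix (Fin N) (Fin N) ℂ) :
    ({q : Fin N × Fin N // q.1 < q.2} ⊕ {q : Fin N × Fin N // q.1 < q.2}) ⊕ Fin N → Ω' → ℝ
  | .inl (.inl q) => fun ω => (W ω q.1.1 q.1.2).re
  | .inl (.inr q) => fun ω => (W ω q.1.1 q.1.2).im
  | .inr i => fun ω => (W ω i i).re

/-- Hermitian Wigner matrices `W_N`, `N ∈ ℕ`, whose off-diagonal entries have independent real and
imaginary parts of variance `σ ^ 2 / 2`. -/
structure IsHermitianWigner (P : ∀ N, Measure (Ω N))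
    (W : ∀ N, Ω N → Matrix (Fin N) (Fin N) ℂ) (σ : ℝ) : Prop extends WignerMoments P W where
  indep : ∀ N, iIndepFun (hermitianCoord (W N)) (P N)
  variance_re : ∀ N (i j : Fin N), i < j → Var[fun ω => (W N ω i j).re; P N] = σ ^ 2 / 2
  variance_im : ∀ N (i j : Fin N), i < j → Var[fun ω => (W N ω i j).im; P N] = σ ^ 2 / 2

end Ensembles

/-- The random matrix-valued field `Γ(z)`, `z ∈ ℂ \ ℝ`, described by its law: for `l ≤ p` the entries
`Γ_lp` are independent, centred Gaussian processes (jointly in the real and imaginary parts), with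
the stated covariances, and `Γ_lp(z) = conj Γ_pl(conj z)` for `l > p`. -/
structure IsLimitField {Ω' : Type*} [MeasurableSpace Ω'] (Q : Measure Ω') (σ ρ : ℝ) {m : ℕ}
    (Γ : ℂ → Ω' → Matrix (Fin m) (Fin m) ℂ) : Prop where
  indep : iIndepFun
    (fun (q : {q : Fin m × Fin m // q.1 ≤ q.2}) (ω : Ω') (z : {z : ℂ // z.im ≠ 0}) =>
      Γ z ω q.1.1 q.1.2) Q
  gaussian : ∀ l p : Fin m, l ≤ p →
    IsGaussianProcess (fun (z : {z : ℂ // z.im ≠ 0}) (ω : Ω') => Γ z ω l p) Q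
  mean : ∀ l p : Fin m, l ≤ p → ∀ z : ℂ, z.im ≠ 0 → ∫ ω, Γ z ω l p ∂Q = 0
  cov_re_re : ∀ l p : Fin m, l ≤ p → ∀ z₁ z₂ : ℂ, z₁.im ≠ 0 → z₂.im ≠ 0 →
    ((∫ ω, (Γ z₁ ω l p).re * (Γ z₂ ω l p).re ∂Q : ℝ) : ℂ) =
      ρ / 4 * (covPi σ z₁ z₂ + covPi σ (conj z₁) (conj z₂))
      + 1 / 4 * (covPi σ z₁ (conj z₂) + covPi σ (conj z₁) z₂)
      + (if l = p then 1 else 0) / 4 *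
        (ρ * (covPi σ z₁ (conj z₂) + covPi σ (conj z₁) z₂)
          + covPi σ z₁ z₂ + covPi σ (conj z₁) (conj z₂))
  cov_re_im : ∀ l p : Fin m, l ≤ p → ∀ z₁ z₂ : ℂ, z₁.im ≠ 0 → z₂.im ≠ 0 →
    ((∫ ω, (Γ z₁ ω l p).re * (Γ z₂ ω l p).im ∂Q : ℝ) : ℂ) =
      ρ / (4 * Complex.I) * (covPi σ z₁ z₂ - covPi σ (conj z₁) (conj z₂))
      + 1 / (4 * Complex.I) * (-covPi σ z₁ (conj z₂) + covPi σ (conj z₁) z₂)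
      + (if l = p then 1 else 0) / (4 * Complex.I) *
        (ρ * (-covPi σ z₁ (conj z₂) + covPi σ (conj z₁) z₂)
          + covPi σ z₁ z₂ - covPi σ (conj z₁) (conj z₂))
  cov_im_im : ∀ l p : Fin m, l ≤ p → ∀ z₁ z₂ : ℂ, z₁.im ≠ 0 → z₂.im ≠ 0 →
    ((∫ ω, (Γ z₁ ω l p).im * (Γ z₂ ω l p).im ∂Q : ℝ) : ℂ) =
      -ρ / 4 * (covPi σ z₁ z₂ + covPi σ (conj z₁) (conj z₂))
      + 1 / 4 * (covPi σ z₁ (conj z₂) + covPi σ (conj z₁) z₂)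
      + -(if l = p then 1 else 0) / 4 *
        (ρ * (-covPi σ z₁ (conj z₂) - covPi σ (conj z₁) z₂)
          + covPi σ z₁ z₂ + covPi σ (conj z₁) (conj z₂))
  symm : ∀ l p : Fin m, p < l → ∀ z : ℂ, z.im ≠ 0 → ∀ ω, Γ z ω l p = conj (Γ (conj z) ω p l)

end WignerFluct

end

noncomputable section

namespace WignerFluct

set_option linter.unusedSectionVars false
set_option linter.unusedVariables false

open Finset (mul_sum sum_congr sum_le_sum sum_add_distrib sum_mul card_univ univ sum_nonneg
  sum_sub_distrib sum_const sum_comm mem_univ single_le_sum sum_mul_sum sum_eq_single)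
open Complex (I exp norm_real)
open Real (norm_of_nonneg)
open RCLike (norm_conj)
open Fintype (card)
open Function (update)
open scoped Matrix Matrix.Norms.L2Operator

variable {n β : Type} [Fintype n] [DecidableEq n] [Fintype β]

local notation "𝕄" => Matrix n n ℂ
-- Abbreviations for matrices with the entries `(i, j)`, `(j, i)` erased, their resolvents and masses,
-- in terms of the variables `X`, `w`, `T`, `z`, `h`, `i`, `j` of the context.
set_option hygiene false in
local notation "Xe" => erase (X w) i j
set_option hygiene false in
local notation "Xt" => ‖X w i j‖ / h
set_option hygiene false in
local notation "Xm" => T.mass Xe i + T.mass Xe j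
set_option hygiene false in
local notation "Xr" => err h (T.mass Xe i) (T.mass Xe j)
set_option hygiene false in
local notation "Xo" => erase X i j
set_option hygiene false in
local notation "Ro" => res z Xo
set_option hygiene false in
local notation "So" => res (conj z) Xo
set_option hygiene false in
local notation "Mo" => T.mass Xo i + T.mass Xo j
set_option hygiene false in
local notation "Co" y:max => ‖(Ro *ᵥ y) i‖ + ‖(Ro *ᵥ y) j‖

/-- The Euclidean norm of a complex vector. -/
def l2 {n : Type*} [Fintype n] (y : n → ℂ) : ℝ := ‖(WithLp.toLp 2 y : EuclideanSpace ℂ n)‖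

lemma l2_nonneg (y : n → ℂ) : 0 ≤ l2 y := norm_nonneg _

lemma l2_sq (y : n → ℂ) : l2 y ^ 2 = ∑ i, ‖y i‖ ^ 2 := by simp [l2, EuclideanSpace.norm_sq_eq]

lemma norm_apply_le_l2 (y : n → ℂ) (i : n) : ‖y i‖ ≤ l2 y := by
  refine le_of_sq_le_sq ?_ (l2_nonneg y) |>.trans le_rfl
  rw [l2_sq]
  exact single_le_sum (f := fun i => ‖y i‖ ^ 2) (fun _ _ => by positivity) (mem_univ i)

lemma sum_norm_mul_norm_le (x y : n → ℂ) : ∑ i, ‖x i‖ * ‖y i‖ ≤ l2 x * l2 y := by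
  refine le_of_sq_le_sq ?_ (mul_nonneg (l2_nonneg x) (l2_nonneg y))
  rw [mul_pow, l2_sq, l2_sq]
  exact Finset.sum_mul_sq_le_sq_mul_sq _ _ _

lemma norm_sum_conj_mul_le (x y : n → ℂ) : ‖∑ i, conj (x i) * y i‖ ≤ l2 x * l2 y := by
  refine (norm_sum_le _ _).trans (le_trans (le_of_eq ?_) (sum_norm_mul_norm_le x y))
  simp

lemma l2_mulVec_le (A : 𝕄) (y : n → ℂ) : l2 (A *ᵥ y) ≤ ‖A‖ * l2 y :=
  Matrix.l2_opNorm_mulVec A (WithLp.toLp 2 y)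

lemma l2_single (i : n) : l2 (Pi.single i (1 : ℂ)) = 1 := by
  have : l2 (Pi.single i (1 : ℂ)) ^ 2 = 1 := by rw [l2_sq, sum_eq_single i] <;> simp +contextual
  exact (pow_eq_one_iff_of_nonneg (l2_nonneg _) two_ne_zero).1 this

lemma l2_col_le (A : 𝕄) (j : n) : l2 (fun i => A i j) ≤ ‖A‖ := by
  have := l2_mulVec_le A (Pi.single j 1)
  rw [l2_single, mul_one] at this
  convert this using 2
  simp
  rfl

lemma norm_entry_le (A : 𝕄) (i j : n) : ‖A i j‖ ≤ ‖A‖ :=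
  (norm_apply_le_l2 (fun i => A i j) i).trans (l2_col_le A j)

lemma l2_row_le (A : 𝕄) (i : n) : l2 (fun j => A i j) ≤ ‖A‖ := by
  have h := l2_col_le Aᴴ i
  rw [Matrix.l2_opNorm_conjTranspose] at h
  refine le_trans (le_of_eq ?_) h
  refine (sq_eq_sq₀ (l2_nonneg _) (l2_nonneg _)).1 ?_
  simp [l2_sq]

lemma sum_norm_le_l2 (y : n → ℂ) : ∑ i, ‖y i‖ ≤ √(card n) * l2 y := by
  have := sum_norm_mul_norm_le (fun _ : n => (1 : ℂ)) y
  have h1 : l2 (fun _ : n => (1 : ℂ)) = √(card n) := by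
    rw [← Real.sqrt_sq (l2_nonneg _), l2_sq]; simp
  simpa [h1] using this

lemma opNorm_le_of_forall_l2 (A : 𝕄) {C : ℝ} (hC : 0 ≤ C)
    (h : ∀ y, l2 (A *ᵥ y) ≤ C * l2 y) : ‖A‖ ≤ C := by
  rw [Matrix.l2_opNorm_def]
  refine ContinuousLinearMap.opNorm_le_bound _ hC fun x => ?_
  exact h x.ofLp

/-- The resolvent of a matrix. -/
def res (z : ℂ) (X : 𝕄) : 𝕄 := (z • (1 : 𝕄) - X)⁻¹

lemma im_star_dotProduct_mulVec {X : 𝕄} (hX : X.IsHermitian) (w : n → ℂ) :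
    (star w ⬝ᵥ (X *ᵥ w)).im = 0 := by
  have h : star (star w ⬝ᵥ (X *ᵥ w)) = star w ⬝ᵥ (X *ᵥ w) := by
    conv_lhs => rw [← Matrix.star_dotProduct_star, star_star, Matrix.star_mulVec, hX.eq,
      ← Matrix.dotProduct_mulVec]
  have h2 := congrArg Complex.im h
  simp at h2
  linarith

lemma abs_im_mul_l2_le {X : 𝕄} (hX : X.IsHermitian) (z : ℂ) (w : n → ℂ) :
    |z.im| * l2 w ≤ l2 ((z • (1 : 𝕄) - X) *ᵥ w) := by
  rcases (l2_nonneg w).eq_or_lt with h0 | h0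
  · rw [← h0]; simpa using l2_nonneg _
  have h1 : star w ⬝ᵥ ((z • (1 : 𝕄) - X) *ᵥ w) = z * ((l2 w ^ 2 : ℝ) : ℂ) - star w ⬝ᵥ (X *ᵥ w) := by
    rw [Matrix.sub_mulVec, dotProduct_sub, Matrix.smul_mulVec, Matrix.one_mulVec, dotProduct_smul]
    congr 1
    rw [l2_sq, smul_eq_mul]
    congr 1
    simp only [dotProduct, Pi.star_apply, RCLike.star_def, Complex.ofReal_sum]
    refine sum_congr rfl fun i _ => ?_
    rw [Complex.conj_mul']; simp
  have h2 : |z.im| * l2 w ^ 2 ≤ l2 w * l2 ((z • (1 : 𝕄) - X) *ᵥ w) := by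
    have := norm_sum_conj_mul_le w ((z • (1 : 𝕄) - X) *ᵥ w)
    refine le_trans ?_ this
    change _ ≤ ‖star w ⬝ᵥ ((z • (1 : 𝕄) - X) *ᵥ w)‖
    refine le_trans (le_of_eq ?_) (Complex.abs_im_le_norm _)
    rw [h1, Complex.sub_im, im_star_dotProduct_mulVec hX]
    rw [Complex.mul_im, Complex.ofReal_im, Complex.ofReal_re]
    simp [abs_mul]
  nlinarith

lemma isUnit_det_resolvent {X : 𝕄} (hX : X.IsHermitian) {z : ℂ} (hz : z.im ≠ 0) :
    IsUnit (z • (1 : 𝕄) - X).det := by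
  rw [← Matrix.isUnit_iff_isUnit_det, ← Matrix.mulVec_injective_iff_isUnit]
  intro v w hvw
  have h := abs_im_mul_l2_le hX z (v - w)
  rw [Matrix.mulVec_sub, sub_eq_zero.2 hvw] at h
  have h0 : l2 (0 : n → ℂ) = 0 := by simp [l2]
  rw [h0] at h
  have h1 : l2 (v - w) = 0 :=
    le_antisymm (by have := abs_pos.2 hz; nlinarith [l2_nonneg (v - w)]) (l2_nonneg _)
  ext i
  have := norm_apply_le_l2 (v - w) i
  rw [h1] at this
  exact sub_eq_zero.1 (norm_le_zero_iff.1 this)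

lemma resolvent_mul {X : 𝕄} (hX : X.IsHermitian) {z : ℂ} (hz : z.im ≠ 0) :
    (z • (1 : 𝕄) - X) * res z X = 1 :=
  Matrix.mul_nonsing_inv _ (isUnit_det_resolvent hX hz)

lemma mul_resolvent {X : 𝕄} (hX : X.IsHermitian) {z : ℂ} (hz : z.im ≠ 0) :
    res z X * (z • (1 : 𝕄) - X) = 1 :=
  Matrix.nonsing_inv_mul _ (isUnit_det_resolvent hX hz)

lemma smul_resolvent {X : 𝕄} (hX : X.IsHermitian) {z : ℂ} (hz : z.im ≠ 0) :
    z • res z X = 1 + X * res z X := by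
  have := resolvent_mul hX hz
  rw [sub_mul, smul_mul_assoc, one_mul] at this
  rw [← this]; abel

/-- A bound for the resolvents used: `|Im z| ≥ 1 / K`. -/
lemma norm_res_le {X : 𝕄} (hX : X.IsHermitian) {z : ℂ} {K : ℝ}
    (hz : 1 ≤ K * |z.im|) : ‖res z X‖ ≤ K := by
  have hz0 : z.im ≠ 0 := by rintro h; simp [h] at hz; linarith
  have hK : 0 < K := by
    by_contra h; push Not at h
    nlinarith [abs_nonneg z.im]
  refine opNorm_le_of_forall_l2 _ hK.le fun y => ?_
  have h := abs_im_mul_l2_le hX z (res z X *ᵥ y)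
  rw [Matrix.mulVec_mulVec, resolvent_mul hX hz0, Matrix.one_mulVec] at h
  nlinarith [l2_nonneg (res z X *ᵥ y), l2_nonneg y]

lemma im_ne_of {x K : ℝ} (hz : 1 ≤ K * |x|) : x ≠ 0 := by rintro h; simp [h] at hz; linarith

lemma conjTranspose_resolvent {X : 𝕄} (hX : X.IsHermitian) (z : ℂ) :
    (res z X)ᴴ = res (conj z) X := by
  unfold res
  rw [Matrix.conjTranspose_nonsing_inv, Matrix.conjTranspose_sub, hX.eq, Matrix.conjTranspose_smul]
  simp

lemma transpose_resolvent {X : 𝕄} (hX : Xᵀ = X) (z : ℂ) : (res z X)ᵀ = res z X := by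
  unfold res
  rw [Matrix.transpose_nonsing_inv, Matrix.transpose_sub, hX, Matrix.transpose_smul]
  simp

lemma resolvent_sub_of_hermitian {X Y : 𝕄} (hX : X.IsHermitian) (hY : Y.IsHermitian)
    {z : ℂ} (hz : z.im ≠ 0) : res z X - res z Y = res z X * (X - Y) * res z Y := by
  have h1 := resolvent_mul hY hz
  have h2 := mul_resolvent hX hz
  have : X - Y = (z • (1 : 𝕄) - Y) - (z • (1 : 𝕄) - X) := by abel
  rw [this, mul_sub, sub_mul, h2, mul_assoc, h1]; simp

lemma resolvent_identity {X : 𝕄} (hX : X.IsHermitian) {z z' : ℂ} (hz : z.im ≠ 0)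
    (hz' : z'.im ≠ 0) : res z X - res z' X = (z' - z) • (res z X * res z' X) := by
  have h1 := resolvent_mul hX hz'
  have h2 := mul_resolvent hX hz
  calc res z X - res z' X = res z X * ((z' • (1 : 𝕄) - X) * res z' X)
      - (res z X * (z • (1 : 𝕄) - X)) * res z' X := by rw [h1, h2]; simp
    _ = (z' - z) • (res z X * res z' X) := by
      simp only [sub_mul, mul_sub, smul_mul_assoc, mul_smul_comm, one_mul, mul_one, sub_smul,
        mul_assoc]
      abel

/-- The matrix with the entries at `(i, j)` and `(j, i)` replaced by zero. -/
def erase (X : 𝕄) (i j : n) : 𝕄 := X - Matrix.single i j (X i j) - Matrix.single j i (X j i)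

lemma erase_isHermitian {X : 𝕄} (hX : X.IsHermitian) (i j : n) : (Xo).IsHermitian := by
  have h : ∀ i j, conj (X i j) = X j i := fun i j => hX.apply j i
  unfold erase Matrix.IsHermitian
  rw [Matrix.conjTranspose_sub, Matrix.conjTranspose_sub, hX.eq, Matrix.conjTranspose_single,
    Matrix.conjTranspose_single]
  simp only [RCLike.star_def, h]
  abel

/-- `res z X - res z (erase X i j)`, with the resolvents in either order. -/
lemma resolvent_erase {X : 𝕄} (hX : X.IsHermitian) {z : ℂ} (hz : z.im ≠ 0) (i j : n) :
    res z X = Ro + Ro *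
      (Matrix.single i j (X i j) + Matrix.single j i (conj (X i j))) * res z X := by
  have h := resolvent_sub_of_hermitian (erase_isHermitian hX i j) hX hz
  have h2 : Xo - X = -(Matrix.single i j (X i j) + Matrix.single j i (conj (X i j))) := by
    have h : conj (X i j) = X j i := hX.apply j i
    rw [h]; unfold erase; abel
  rw [h2] at h
  rw [mul_neg, neg_mul, sub_eq_iff_eq_add, neg_add_eq_sub, eq_sub_iff_add_eq] at h
  exact h.symm

lemma resolvent_erase' {X : 𝕄} (hX : X.IsHermitian) {z : ℂ} (hz : z.im ≠ 0) (i j : n) :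
    res z X = Ro + res z X *
      (Matrix.single i j (X i j) + Matrix.single j i (conj (X i j))) * Ro := by
  have h := resolvent_sub_of_hermitian hX (erase_isHermitian hX i j) hz
  have h2 : X - Xo = (Matrix.single i j (X i j) + Matrix.single j i (conj (X i j))) := by
    have h : conj (X i j) = X j i := hX.apply j i
    rw [h]; unfold erase; abel
  rw [h2, sub_eq_iff_eq_add'] at h
  exact h

lemma pair_mulVec (i j : n) (x : ℂ) (w : n → ℂ) :
    (Matrix.single i j x + Matrix.single j i (conj x)) *ᵥ w =
      Pi.single i (x * w j) + Pi.single j (conj x * w i) := by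
  rw [Matrix.add_mulVec]
  simp [Matrix.single_mulVec]
  rfl

lemma mul_pair_mul_mulVec (A B : 𝕄) (i j : n) (x : ℂ) (y : n → ℂ) (k : n) :
    ((A * (Matrix.single i j x + Matrix.single j i (conj x)) * B) *ᵥ y) k =
      x * A k i * (B *ᵥ y) j + conj x * A k j * (B *ᵥ y) i := by
  rw [← Matrix.mulVec_mulVec, ← Matrix.mulVec_mulVec, pair_mulVec, Matrix.mulVec_add,
    Matrix.mulVec_single, Matrix.mulVec_single]
  simp
  ring

lemma resolvent_erase_mulVec {X : 𝕄} (hX : X.IsHermitian) {z : ℂ} (hz : z.im ≠ 0)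
    (i j : n) (y : n → ℂ) (k : n) :
    (res z X *ᵥ y) k = (Ro *ᵥ y) k + (X i j * Ro k i * (res z X *ᵥ y) j +
        conj (X i j) * Ro k j * (res z X *ᵥ y) i) := by
  conv_lhs => rw [resolvent_erase hX hz i j, Matrix.add_mulVec, Pi.add_apply, mul_pair_mul_mulVec]

lemma resolvent_erase_mulVec' {X : 𝕄} (hX : X.IsHermitian) {z : ℂ} (hz : z.im ≠ 0)
    (i j : n) (y : n → ℂ) (k : n) :
    (res z X *ᵥ y) k = (Ro *ᵥ y) k + (X i j * res z X k i * (Ro *ᵥ y) j +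
        conj (X i j) * res z X k j * (Ro *ᵥ y) i) := by
  conv_lhs => rw [resolvent_erase' hX hz i j, Matrix.add_mulVec, Pi.add_apply, mul_pair_mul_mulVec]

lemma res_apply_eq (z : ℂ) (X : 𝕄) (k l : n) : res z X k l = (res z X *ᵥ Pi.single l 1) k := by simp

/-- The sesquilinear form `⟨u, (z - X)⁻¹ v⟩`. -/
def form (z : ℂ) (u v : n → ℂ) (X : 𝕄) : ℂ := ∑ i, conj (u i) * (res z X *ᵥ v) i

lemma sum_conj_mul_mulVec (A : 𝕄) (u v : n → ℂ) :
    ∑ i, conj (u i) * (A *ᵥ v) i = ∑ i, conj ((Aᴴ *ᵥ u) i) * v i := by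
  change star u ⬝ᵥ (A *ᵥ v) = star (Aᴴ *ᵥ u) ⬝ᵥ v
  rw [Matrix.star_mulVec, Matrix.conjTranspose_conjTranspose, Matrix.dotProduct_mulVec]

lemma form_eq_left {X : 𝕄} (hX : X.IsHermitian) (z : ℂ) (u v : n → ℂ) :
    form z u v X = ∑ i, conj ((res (conj z) X *ᵥ u) i) * v i := by
  rw [form, sum_conj_mul_mulVec, conjTranspose_resolvent hX]

lemma form_erase {X : 𝕄} (hX : X.IsHermitian) {z : ℂ} (hz : z.im ≠ 0) (i j : n) (u v : n → ℂ) :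
    form z u v X = form z u v Xo + (X i j * conj ((So *ᵥ u) i) * (res z X *ᵥ v) j +
        conj (X i j) * conj ((So *ᵥ u) j) * (res z X *ᵥ v) i) := by
  have hX0 := erase_isHermitian hX i j
  conv_lhs => rw [form, resolvent_erase hX hz i j, Matrix.add_mulVec]
  simp_rw [Pi.add_apply]
  rw [sum_congr rfl fun i _ => mul_add _ _ _, sum_add_distrib, form]
  congr 1
  rw [mul_assoc, ← Matrix.mulVec_mulVec, sum_conj_mul_mulVec, conjTranspose_resolvent hX0,
    ← Matrix.mulVec_mulVec, pair_mulVec]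
  simp only [Pi.add_apply, mul_add, sum_add_distrib, Pi.single_apply, mul_ite, mul_zero,
    Finset.sum_ite_eq', mem_univ, if_true]
  ring

lemma norm_form_le {X : 𝕄} (hX : X.IsHermitian) {z : ℂ} {K : ℝ}
    (hz : 1 ≤ K * |z.im|) (u v : n → ℂ) : ‖form z u v X‖ ≤ K * (l2 u * l2 v) := by
  refine (norm_sum_conj_mul_le _ _).trans ?_
  have h1 := l2_mulVec_le (res z X) v
  have h2 := norm_res_le hX hz
  nlinarith [l2_nonneg u, l2_nonneg v, mul_nonneg (l2_nonneg u) (l2_nonneg v),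
    mul_le_mul_of_nonneg_left h1 (l2_nonneg u),
    mul_le_mul_of_nonneg_left h2 (mul_nonneg (l2_nonneg u) (l2_nonneg v))]

/-- The size of the error terms, as a function of `h = N ^ (-1/2)` and of the masses `x`, `y` that
the test vectors put on the row and on the column of an entry. -/
def err (h x y : ℝ) : ℝ :=
  h ^ 3 * (x + y) + h ^ 2 * (x + y) ^ 2 + h * ((x + y) * (x * y) + y ^ 3) + (x * y) ^ 2

variable {h t x y B : ℝ}

lemma err_nonneg (hh : 0 ≤ h) (hx : 0 ≤ x) (hy : 0 ≤ y) : 0 ≤ err h x y := by unfold err; positivity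

lemma le_one_add_pow_four (t : ℝ) : t ≤ 1 + t ^ 4 := by
  nlinarith [sq_nonneg (t ^ 2 - 1), sq_nonneg (t - 1)]
lemma sq_le_one_add_pow_four (t : ℝ) : t ^ 2 ≤ 1 + t ^ 4 := by nlinarith [sq_nonneg (t ^ 2 - 1)]
lemma cube_le_one_add_pow_four (ht : 0 ≤ t) : t ^ 3 ≤ 1 + t ^ 4 := by
  nlinarith [sq_nonneg (t ^ 2 - 1), sq_nonneg (t ^ 2 - t), mul_nonneg ht (sq_nonneg (t - 1)),
    sq_nonneg (t - 1)]

lemma err_ge1 (hh : 0 ≤ h) (hx : 0 ≤ x) (hy : 0 ≤ y) : h ^ 3 * (x + y) ≤ err h x y := by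
  have : 0 ≤ h ^ 2 * (x + y) ^ 2 + h * ((x + y) * (x * y) + y ^ 3) + (x * y) ^ 2 := by positivity
  unfold err; linarith
lemma err_ge2 (hh : 0 ≤ h) (hx : 0 ≤ x) (hy : 0 ≤ y) : h ^ 2 * (x + y) ^ 2 ≤ err h x y := by
  have : 0 ≤ h ^ 3 * (x + y) + h * ((x + y) * (x * y) + y ^ 3) + (x * y) ^ 2 := by positivity
  unfold err; linarith
lemma err_ge3 (hh : 0 ≤ h) (hx : 0 ≤ x) (hy : 0 ≤ y) :
    h * ((x + y) * (x * y) + y ^ 3) ≤ err h x y := by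
  have : 0 ≤ h ^ 3 * (x + y) + h ^ 2 * (x + y) ^ 2 + (x * y) ^ 2 := by positivity
  unfold err; linarith
lemma err_ge4 (hh : 0 ≤ h) (hx : 0 ≤ x) (hy : 0 ≤ y) : (x * y) ^ 2 ≤ err h x y := by
  have : 0 ≤ h ^ 3 * (x + y) + h ^ 2 * (x + y) ^ 2 + h * ((x + y) * (x * y) + y ^ 3) := by
    positivity
  unfold err; linarith

lemma sq_add_mul_le (hx : 0 ≤ x) (hy : 0 ≤ y) :
    (x + y) ^ 2 * y ≤ 2 * ((x + y) * (x * y) + y ^ 3) := by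
  have : 0 ≤ x ^ 2 * y := by positivity
  have : 0 ≤ y ^ 3 := by positivity
  nlinarith

/-- Bounds for the change of the exponential factor, for `δ₁` its linear part. -/
structure ExpBounds (h t x y B : ℝ) (e e₀ d : ℂ) : Prop where
  norm_eq : ‖e‖ = 1
  norm_eq₀ : ‖e₀‖ = 1
  sub_le : ‖e - e₀‖ ≤ 2 * B ^ 2 * (t * (x * y) + h * t ^ 2 * (x + y) ^ 2)
  sub_sub_le : ‖e - e₀ - e₀ * d‖ ≤ 24 * B ^ 4 * (t ^ 2 * (x * y) ^ 2 + h ^ 2 * t ^ 4 * (x + y) ^ 4)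
    + B ^ 2 * (h * t ^ 2 * (x + y) ^ 2)

lemma mul_le_err {P Q c E t : ℝ} (hE : 0 ≤ E) (hP0 : 0 ≤ P) (hc : 0 ≤ c)
    (hP : P ≤ 1 + t ^ 4) (hQ : Q ≤ c * E) : P * Q ≤ c * ((1 + t ^ 4) * E) := by
  calc P * Q ≤ P * (c * E) := mul_le_mul_of_nonneg_left hQ hP0
    _ ≤ (1 + t ^ 4) * (c * E) := mul_le_mul_of_nonneg_right hP (mul_nonneg hc hE)
    _ = _ := by ring

structure Scales (h t x y B : ℝ) : Prop where
  h0 : 0 < h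
  h1 : h ≤ 1
  t0 : 0 ≤ t
  ht : h * t ^ 2 ≤ 4
  x0 : 0 ≤ x
  y0 : 0 ≤ y
  B1 : 1 ≤ B
  s : x + y ≤ B

namespace Scales

variable (H : Scales h t x y B)
include H

lemma errNonneg : 0 ≤ err h x y := err_nonneg H.h0.le H.x0 H.y0

/-- `h ^ k * s ^ l` for `l ≥ k = 2`. -/
lemma pow_s_le (l : ℕ) : h ^ 2 * (x + y) ^ (2 + l) ≤ B ^ l * err h x y := by
  have hs : 0 ≤ x + y := add_nonneg H.x0 H.y0
  have h1 := pow_le_pow_left₀ hs H.s l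
  calc h ^ 2 * (x + y) ^ (2 + l) = (x + y) ^ l * (h ^ 2 * (x + y) ^ 2) := by ring
    _ ≤ B ^ l * err h x y := by
      have := H.h0
      exact mul_le_mul h1 (err_ge2 H.h0.le H.x0 H.y0) (by positivity)
        (pow_nonneg (by linarith [H.B1]) _)

lemma mul_le (k : ℕ) (hk : k ≤ 4) {Q c : ℝ} (hc : 0 ≤ c) (hQ : Q ≤ c * err h x y) :
    t ^ k * Q ≤ c * ((1 + t ^ 4) * err h x y) := by
  have ht := H.t0
  refine mul_le_err H.errNonneg (by positivity) hc ?_ hQ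
  rcases le_total t 1 with h | h
  · linarith [pow_le_one₀ ht h (n := k), pow_nonneg ht 4]
  · linarith [pow_le_pow_right₀ h hk]

lemma ge1 : h ^ 3 * (x + y) ≤ 1 * err h x y := by rw [one_mul]; exact err_ge1 H.h0.le H.x0 H.y0

lemma ge4 : (x * y) ^ 2 ≤ 1 * err h x y := by rw [one_mul]; exact err_ge4 H.h0.le H.x0 H.y0

lemma sp_le : h * ((x + y) * (x * y)) ≤ 1 * err h x y := by
  have h3 := err_ge3 H.h0.le H.x0 H.y0
  have : 0 ≤ h * y ^ 3 := by have := H.h0; have := H.y0; positivity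
  linarith

lemma ssy_le : h * ((x + y) ^ 2 * y) ≤ 2 * err h x y := by
  have h3 := err_ge3 H.h0.le H.x0 H.y0
  have := mul_le_mul_of_nonneg_left (sq_add_mul_le H.x0 H.y0) H.h0.le
  linarith

lemma third_order {w w₀ l q e e₀ d : ℂ} (he : ExpBounds h t x y B e e₀ d)
    (h1 : ‖w - w₀ - l - q‖ ≤ 4 * B ^ 3 * ((h * t) ^ 3 * (x + y)))
    (h2 : ‖w - w₀‖ ≤ B * (h * t * (x + y))) (h3 : ‖w₀‖ ≤ y) :
    t * ‖w * e - e₀ * (w₀ + l + w₀ * d + q)‖ ≤ 500 * B ^ 6 * ((1 + t ^ 4) * err h x y) := by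
  have ⟨hh, h1', ht0, ht2, hx, hy, hB, hsB⟩ := H
  have hE := H.errNonneg
  have hB0 : 0 < B := by linarith
  have hs : 0 ≤ x + y := add_nonneg hx hy
  have key : w * e - e₀ * (w₀ + l + w₀ * d + q) = e₀ * (w - w₀ - l - q) + (w - w₀) * (e - e₀)
      + w₀ * (e - e₀ - e₀ * d) := by ring
  have hn : ‖w * e - e₀ * (w₀ + l + w₀ * d + q)‖ ≤ 4 * B ^ 3 * ((h * t) ^ 3 * (x + y))
      + B * (h * t * (x + y)) * (2 * B ^ 2 * (t * (x * y) + h * t ^ 2 * (x + y) ^ 2))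
      + y * (24 * B ^ 4 * (t ^ 2 * (x * y) ^ 2 + h ^ 2 * t ^ 4 * (x + y) ^ 4)
    + B ^ 2 * (h * t ^ 2 * (x + y) ^ 2)) := by
    rw [key]
    refine (norm_add₃_le).trans ?_
    rw [norm_mul, norm_mul, norm_mul, he.norm_eq₀, one_mul]
    have := he.sub_le
    have := he.sub_sub_le
    gcongr
  refine (mul_le_mul_of_nonneg_left hn ht0).trans ?_
  set W := (1 + t ^ 4) * err h x y with hW
  have hW0 : 0 ≤ W := by positivity
  have a1 := H.mul_le 4 (by norm_num) zero_le_one H.ge1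
  have a2 := H.mul_le 3 (by norm_num) zero_le_one H.sp_le
  have a3 := H.mul_le 4 (by norm_num) (by positivity) (H.pow_s_le 1)
  have a4 := H.mul_le 3 (by norm_num) zero_le_one H.ge4
  have a5 := H.mul_le 3 (by norm_num) zero_le_two H.ssy_le
  have hyB : y ≤ B := by linarith
  have b5 : t * (y * (h ^ 2 * t ^ 4 * (x + y) ^ 4)) ≤ 8 * B ^ 2 * W := by
    calc t * (y * (h ^ 2 * t ^ 4 * (x + y) ^ 4))
        = (h * t ^ 2) * (x + y) ^ 2 * (t ^ 3 * (h * ((x + y) ^ 2 * y))) := by ring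
      _ ≤ 4 * B ^ 2 * (2 * W) := by
        have := pow_le_pow_left₀ hs H.s 2
        gcongr
      _ = _ := by ring
  have b4 : t * (y * (t ^ 2 * (x * y) ^ 2)) ≤ B * W := by
    calc t * (y * (t ^ 2 * (x * y) ^ 2)) = y * (t ^ 3 * (x * y) ^ 2) := by ring
      _ ≤ B * (1 * W) := by gcongr
      _ = _ := by ring
  have p1 : ∀ k ≤ 6, B ^ k * W ≤ B ^ 6 * W := fun k hk =>
    mul_le_mul_of_nonneg_right (pow_le_pow_right₀ hB hk) hW0
  calc t * (4 * B ^ 3 * ((h * t) ^ 3 * (x + y))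
      + B * (h * t * (x + y)) * (2 * B ^ 2 * (t * (x * y) + h * t ^ 2 * (x + y) ^ 2))
      + y * (24 * B ^ 4 * (t ^ 2 * (x * y) ^ 2 + h ^ 2 * t ^ 4 * (x + y) ^ 4)
        + B ^ 2 * (h * t ^ 2 * (x + y) ^ 2)))
      = 4 * B ^ 3 * (t ^ 4 * (h ^ 3 * (x + y))) + 2 * B ^ 3 * (t ^ 3 * (h * ((x + y) * (x * y))))
        + 2 * B ^ 3 * (t ^ 4 * (h ^ 2 * (x + y) ^ (2 + 1)))
        + 24 * B ^ 4 * (t * (y * (t ^ 2 * (x * y) ^ 2)))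
        + 24 * B ^ 4 * (t * (y * (h ^ 2 * t ^ 4 * (x + y) ^ 4)))
        + B ^ 2 * (t ^ 3 * (h * ((x + y) ^ 2 * y))) := by ring
    _ ≤ 4 * B ^ 3 * (1 * W) + 2 * B ^ 3 * (1 * W) + 2 * B ^ 3 * (B ^ 1 * W)
        + 24 * B ^ 4 * (B * W) + 24 * B ^ 4 * (8 * B ^ 2 * W) + B ^ 2 * (2 * W) := by gcongr
    _ = 6 * (B ^ 3 * W) + 2 * (B ^ 4 * W) + 24 * (B ^ 5 * W) + 192 * (B ^ 6 * W)
        + 2 * (B ^ 2 * W) := by ring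
    _ ≤ 500 * B ^ 6 * W := by
      have := p1 2 (by norm_num); have := p1 3 (by norm_num); have := p1 4 (by norm_num)
      have := p1 5 (by norm_num); have : 0 ≤ B ^ 6 * W := by positivity
      linarith

lemma second_order {g g₀ g₁ e e₀ d : ℂ} (he : ExpBounds h t x y B e e₀ d)
    (h1 : ‖g - g₀ - g₁‖ ≤ 6 * B ^ 3 * ((h * t) ^ 2 * (x + y)))
    (h2 : ‖g - g₀‖ ≤ 6 * B ^ 3 * (h * t * (x + y))) (h3 : ‖g₀‖ ≤ B * (x + y)) :
    h * ‖g * e - g₀ * e₀ - e₀ * (g₁ + g₀ * d)‖ ≤ 500 * B ^ 8 * ((1 + t ^ 4) * err h x y) := by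
  have ⟨hh, h1', ht0, ht2, hx, hy, hB, hsB⟩ := H
  have hE := H.errNonneg
  have hB0 : 0 < B := by linarith
  have hs : 0 ≤ x + y := add_nonneg hx hy
  have key : g * e - g₀ * e₀ - e₀ * (g₁ + g₀ * d) = e₀ * (g - g₀ - g₁) + (g - g₀) * (e - e₀)
      + g₀ * (e - e₀ - e₀ * d) := by ring
  have hn : ‖g * e - g₀ * e₀ - e₀ * (g₁ + g₀ * d)‖ ≤ 6 * B ^ 3 * ((h * t) ^ 2 * (x + y))
      + 6 * B ^ 3 * (h * t * (x + y)) * (2 * B ^ 2 * (t * (x * y) + h * t ^ 2 * (x + y) ^ 2))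
      + B * (x + y) * (24 * B ^ 4 * (t ^ 2 * (x * y) ^ 2 + h ^ 2 * t ^ 4 * (x + y) ^ 4)
    + B ^ 2 * (h * t ^ 2 * (x + y) ^ 2)) := by
    rw [key]
    refine (norm_add₃_le).trans ?_
    rw [norm_mul, norm_mul, norm_mul, he.norm_eq₀, one_mul]
    have := he.sub_le
    have := he.sub_sub_le
    gcongr
  refine (mul_le_mul_of_nonneg_left hn hh.le).trans ?_
  set W := (1 + t ^ 4) * err h x y with hW
  have hW0 : 0 ≤ W := by positivity
  have hxyB : x * y ≤ B ^ 2 := by nlinarith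
  have a1 := H.mul_le 2 (by norm_num) zero_le_one H.ge1
  have a2 := H.mul_le 2 (by norm_num) zero_le_one H.sp_le
  have a3 := H.mul_le 3 (by norm_num) (by positivity) (H.pow_s_le 1)
  have a4 := H.mul_le 2 (by norm_num) (by positivity) (H.pow_s_le 1)
  have a5 := H.mul_le 4 (by norm_num) (by positivity) (H.pow_s_le 3)
  have p1 : ∀ k ≤ 8, B ^ k * W ≤ B ^ 8 * W := fun k hk =>
    mul_le_mul_of_nonneg_right (pow_le_pow_right₀ hB hk) hW0
  calc h * (6 * B ^ 3 * ((h * t) ^ 2 * (x + y))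
      + 6 * B ^ 3 * (h * t * (x + y)) * (2 * B ^ 2 * (t * (x * y) + h * t ^ 2 * (x + y) ^ 2))
      + B * (x + y) * (24 * B ^ 4 * (t ^ 2 * (x * y) ^ 2 + h ^ 2 * t ^ 4 * (x + y) ^ 4)
        + B ^ 2 * (h * t ^ 2 * (x + y) ^ 2)))
      = 6 * B ^ 3 * (t ^ 2 * (h ^ 3 * (x + y))) + 12 * B ^ 5 * h * (t ^ 2 * (h * ((x + y) * (x * y))))
        + 12 * B ^ 5 * h * (t ^ 3 * (h ^ 2 * (x + y) ^ (2 + 1)))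
        + 24 * B ^ 5 * (x * y) * (t ^ 2 * (h * ((x + y) * (x * y))))
        + 24 * B ^ 5 * h * (t ^ 4 * (h ^ 2 * (x + y) ^ (2 + 3)))
        + B ^ 3 * (t ^ 2 * (h ^ 2 * (x + y) ^ (2 + 1))) := by ring
    _ ≤ 6 * B ^ 3 * (1 * W) + 12 * B ^ 5 * 1 * (1 * W) + 12 * B ^ 5 * 1 * (B ^ 1 * W)
        + 24 * B ^ 5 * (B ^ 2) * (1 * W) + 24 * B ^ 5 * 1 * (B ^ 3 * W) + B ^ 3 * (B ^ 1 * W) := by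
      gcongr
    _ = 6 * (B ^ 3 * W) + B ^ 4 * W + 12 * (B ^ 5 * W) + 12 * (B ^ 6 * W) + 24 * (B ^ 7 * W)
        + 24 * (B ^ 8 * W) := by ring
    _ ≤ 500 * B ^ 8 * W := by
      have := p1 3 (by norm_num); have := p1 4 (by norm_num)
      have := p1 5 (by norm_num); have := p1 6 (by norm_num); have := p1 7 (by norm_num)
      have : 0 ≤ B ^ 8 * W := by positivity
      linarith

lemma first_order {g g₀ e e₀ d : ℂ} (he : ExpBounds h t x y B e e₀ d)
    (h2 : ‖g - g₀‖ ≤ 10 * B ^ 3 * (h * t * (x + y))) (h3 : ‖g₀‖ ≤ B ^ 2 * (x + y)) :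
    h ^ 2 * ‖g * e - g₀ * e₀‖ ≤ 100 * B ^ 5 * ((1 + t ^ 4) * err h x y) := by
  have ⟨hh, h1', ht0, ht2, hx, hy, hB, hsB⟩ := H
  have hE := H.errNonneg
  have hB0 : 0 < B := by linarith
  have hs : 0 ≤ x + y := add_nonneg hx hy
  have key : g * e - g₀ * e₀ = (g - g₀) * e + g₀ * (e - e₀) := by ring
  have hn : ‖g * e - g₀ * e₀‖ ≤ 10 * B ^ 3 * (h * t * (x + y))
      + B ^ 2 * (x + y) * (2 * B ^ 2 * (t * (x * y) + h * t ^ 2 * (x + y) ^ 2)) := by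
    rw [key]
    refine (norm_add_le _ _).trans ?_
    rw [norm_mul, norm_mul, he.norm_eq, mul_one]
    have := he.sub_le
    gcongr
  refine (mul_le_mul_of_nonneg_left hn (by positivity)).trans ?_
  set W := (1 + t ^ 4) * err h x y with hW
  have hW0 : 0 ≤ W := by positivity
  have a1 := H.mul_le 1 (by norm_num) zero_le_one H.ge1
  have a2 := H.mul_le 1 (by norm_num) zero_le_one H.sp_le
  have a4 := H.mul_le 2 (by norm_num) (by positivity) (H.pow_s_le 1)
  have p1 : ∀ k ≤ 5, B ^ k * W ≤ B ^ 5 * W := fun k hk =>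
    mul_le_mul_of_nonneg_right (pow_le_pow_right₀ hB hk) hW0
  calc h ^ 2 * (10 * B ^ 3 * (h * t * (x + y))
      + B ^ 2 * (x + y) * (2 * B ^ 2 * (t * (x * y) + h * t ^ 2 * (x + y) ^ 2)))
      = 10 * B ^ 3 * (t ^ 1 * (h ^ 3 * (x + y))) + 2 * B ^ 4 * h * (t ^ 1 * (h * ((x + y) * (x * y))))
        + 2 * B ^ 4 * h * (t ^ 2 * (h ^ 2 * (x + y) ^ (2 + 1))) := by ring
    _ ≤ 10 * B ^ 3 * (1 * W) + 2 * B ^ 4 * 1 * (1 * W) + 2 * B ^ 4 * 1 * (B ^ 1 * W) := by gcongr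
    _ = 10 * (B ^ 3 * W) + 2 * (B ^ 4 * W) + 2 * (B ^ 5 * W) := by ring
    _ ≤ 100 * B ^ 5 * W := by
      have := p1 3 (by norm_num); have := p1 4 (by norm_num)
      have : 0 ≤ B ^ 5 * W := by positivity
      linarith

/-- The first order bound for a product of three test vectors, evaluated at both ends of an entry
and a second time at the column. -/
lemma triple {α α₀ β β₀ γ γ₀ e e₀ d : ℂ} (he : ExpBounds h t x y B e e₀ d)
    (hα : ‖α - α₀‖ ≤ B * (h * t * (x + y))) (hβ : ‖β - β₀‖ ≤ B * (h * t * (x + y)))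
    (hγ : ‖γ - γ₀‖ ≤ B * (h * t * (x + y)))
    (hαβ : (‖α₀‖ ≤ x ∧ ‖β₀‖ ≤ y) ∨ (‖α₀‖ ≤ y ∧ ‖β₀‖ ≤ x)) (hγ₀ : ‖γ₀‖ ≤ y) :
    ‖α * β * γ * e - α₀ * β₀ * γ₀ * e₀‖ ≤ 100 * B ^ 6 * ((1 + t ^ 4) * err h x y) := by
  have ⟨hh, h1', ht0, ht2, hx, hy, hB, hsB⟩ := H
  have hE := H.errNonneg
  have hB0 : 0 < B := by linarith
  have hs : 0 ≤ x + y := add_nonneg hx hy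
  set D := B * (h * t * (x + y)) with hD
  have hD0 : 0 ≤ D := by positivity
  have key : α * β * γ * e - α₀ * β₀ * γ₀ * e₀ = e * ((α - α₀) * (β₀ * γ₀) + (β - β₀) * (α₀ * γ₀)
      + (γ - γ₀) * (α₀ * β₀) + ((α - α₀) * (β - β₀) * γ₀ + (α - α₀) * (γ - γ₀) * β₀ +
        (β - β₀) * (γ - γ₀) * α₀) + (α - α₀) * (β - β₀) * (γ - γ₀))
      + (α₀ * β₀) * γ₀ * (e - e₀) := by ring
  have m1 : ‖α₀‖ * ‖β₀‖ ≤ x * y := by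
    rcases hαβ with ⟨h1, h2⟩ | ⟨h1, h2⟩
    · gcongr
    · rw [mul_comm x y]; gcongr
  have m2 : ‖α₀‖ * ‖γ₀‖ + ‖β₀‖ * ‖γ₀‖ ≤ (x + y) * y := by
    rcases hαβ with ⟨h1, h2⟩ | ⟨h1, h2⟩ <;>
    nlinarith [norm_nonneg γ₀, norm_nonneg α₀, norm_nonneg β₀, mul_le_mul_of_nonneg_left hγ₀ (add_nonneg (norm_nonneg α₀) (norm_nonneg β₀))]
  have m3 : ‖α₀‖ + ‖β₀‖ + ‖γ₀‖ ≤ 2 * (x + y) := by rcases hαβ with ⟨h1, h2⟩ | ⟨h1, h2⟩ <;> linarith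
  have hn : ‖α * β * γ * e - α₀ * β₀ * γ₀ * e₀‖ ≤ D * ((x + y) * y) + D * (x * y)
      + D ^ 2 * (2 * (x + y)) + D ^ 3
      + (x * y) * y * (2 * B ^ 2 * (t * (x * y) + h * t ^ 2 * (x + y) ^ 2)) := by
    rw [key]
    refine (norm_add_le _ _).trans (add_le_add ?_ ?_)
    · rw [norm_mul, he.norm_eq, one_mul]
      have n1 : ‖(α - α₀) * (β₀ * γ₀) + (β - β₀) * (α₀ * γ₀)
      + (γ - γ₀) * (α₀ * β₀) + ((α - α₀) * (β - β₀) * γ₀ + (α - α₀) * (γ - γ₀) * β₀ +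
        (β - β₀) * (γ - γ₀) * α₀) + (α - α₀) * (β - β₀) * (γ - γ₀)‖ ≤
        D * (‖β₀‖ * ‖γ₀‖) + D * (‖α₀‖ * ‖γ₀‖) + D * (‖α₀‖ * ‖β₀‖)
        + (D * D * ‖γ₀‖ + D * D * ‖β₀‖ + D * D * ‖α₀‖) + D * D * D := by
        refine (norm_add_le _ _).trans (add_le_add ((norm_add_le _ _).trans (add_le_add
          (norm_add₃_le.trans ?_) (norm_add₃_le.trans ?_))) ?_) <;> simp only [norm_mul] <;> gcongr
      refine n1.trans ?_
      nlinarith [mul_le_mul_of_nonneg_left m1 hD0, mul_le_mul_of_nonneg_left m2 hD0,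
        mul_le_mul_of_nonneg_left m3 (sq_nonneg D)]
    · rw [norm_mul, norm_mul, norm_mul]
      have := he.sub_le
      gcongr
  refine hn.trans ?_
  set W := (1 + t ^ 4) * err h x y with hW
  have hW0 : 0 ≤ W := by positivity
  have hyB : y ≤ B := by linarith
  have a1 := H.mul_le 1 (by norm_num) zero_le_two H.ssy_le
  have a2 := H.mul_le 1 (by norm_num) zero_le_one H.sp_le
  have a3 := H.mul_le 2 (by norm_num) (by positivity) (H.pow_s_le 1)
  have a4 := H.mul_le 3 (by norm_num) (by positivity) (H.pow_s_le 1)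
  have a5 := H.mul_le 1 (by norm_num) zero_le_one H.ge4
  have a6 := H.mul_le 2 (by norm_num) zero_le_one H.sp_le
  have p1 : ∀ k ≤ 6, B ^ k * W ≤ B ^ 6 * W := fun k hk =>
    mul_le_mul_of_nonneg_right (pow_le_pow_right₀ hB hk) hW0
  calc D * ((x + y) * y) + D * (x * y) + D ^ 2 * (2 * (x + y)) + D ^ 3
      + (x * y) * y * (2 * B ^ 2 * (t * (x * y) + h * t ^ 2 * (x + y) ^ 2))
      = B * (t ^ 1 * (h * ((x + y) ^ 2 * y))) + B * (t ^ 1 * (h * ((x + y) * (x * y))))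
        + 2 * B ^ 2 * (t ^ 2 * (h ^ 2 * (x + y) ^ (2 + 1)))
        + B ^ 3 * h * (t ^ 3 * (h ^ 2 * (x + y) ^ (2 + 1)))
        + 2 * B ^ 2 * y * (t ^ 1 * (x * y) ^ 2)
        + 2 * B ^ 2 * y * (x + y) * (t ^ 2 * (h * ((x + y) * (x * y)))) := by rw [hD]; ring
    _ ≤ B * (2 * W) + B * (1 * W) + 2 * B ^ 2 * (B ^ 1 * W) + B ^ 3 * 1 * (B ^ 1 * W)
        + 2 * B ^ 2 * B * (1 * W) + 2 * B ^ 2 * B * B * (1 * W) := by gcongr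
    _ = 3 * (B ^ 1 * W) + 4 * (B ^ 3 * W) + 3 * (B ^ 4 * W) := by ring
    _ ≤ 100 * B ^ 6 * W := by
      have := p1 1 (by norm_num); have := p1 3 (by norm_num); have := p1 4 (by norm_num)
      have : 0 ≤ B ^ 6 * W := by positivity
      linarith

end Scales

set_option maxHeartbeats 1000000 in
/-- Comparison of the error sizes for nearby masses. -/
lemma err_le_of_near {h d x y x' y' B : ℝ} (hh : 0 ≤ h) (h1 : h ≤ 1) (hx : 0 ≤ x) (hy : 0 ≤ y)
    (hx' : 0 ≤ x') (hy' : 0 ≤ y') (hB : 1 ≤ B) (hd : 0 ≤ d) (hd2 : d ≤ 2)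
    (hsx : x' ≤ x + B * (d * (x + y))) (hsy : y' ≤ y + B * (d * (x + y))) :
    err h x' y' ≤ 1000 * B ^ 4 * (err h x y + h * (d * (x + y) ^ 3) + d ^ 2 * (x + y) ^ 4) := by
  set s := x + y with hs
  have hs0 : 0 ≤ s := add_nonneg hx hy
  have hB0 : 0 < B := by linarith
  set D := B * (d * s) with hD
  have hD0 : 0 ≤ D := by positivity
  have hDs : D ≤ 2 * B * s := by
    have := mul_le_mul_of_nonneg_right hd2 (mul_nonneg hB0.le hs0)
    rw [hD]; linarith
  have hBs : s ≤ B * s := le_mul_of_one_le_left hs0 hB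
  have hs' : x' + y' ≤ 5 * B * s := by linarith
  have hs'0 : 0 ≤ x' + y' := by positivity
  have hp : x' * y' ≤ x * y + 3 * B * (D * s) := by
    have h2 : x' * y' ≤ (x + D) * (y + D) := by gcongr
    have h3 := mul_le_mul_of_nonneg_left hDs hD0
    have h4 := mul_le_mul_of_nonneg_left hBs hD0
    have h5 : (x + D) * (y + D) = x * y + D * s + D * D := by rw [hs]; ring
    linarith
  have hp2 : (x' * y') ^ 2 ≤ 2 * (x * y) ^ 2 + 18 * B ^ 2 * (D * s) ^ 2 := by
    have h0 : 0 ≤ x' * y' := by positivity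
    have h2 := pow_le_pow_left₀ h0 hp 2
    have h3 := sq_nonneg (x * y - 3 * B * (D * s))
    linarith
  have hy3 : y' ^ 3 ≤ 4 * y ^ 3 + 16 * B ^ 2 * (D * s ^ 2) := by
    have h3 := pow_le_pow_left₀ hy' hsy 3
    have h4 : (y + D) ^ 3 ≤ 4 * y ^ 3 + 4 * D ^ 3 := by
      nlinarith [mul_nonneg (add_nonneg hy hD0) (sq_nonneg (y - D))]
    have h5 : D ^ 3 ≤ D * (2 * B * s) ^ 2 := by
      have h6 := mul_le_mul_of_nonneg_left (pow_le_pow_left₀ hD0 hDs 2) hD0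
      linarith
    linarith
  have hsp : (x' + y') * (x' * y') ≤ 5 * B * s * (x * y) + 15 * B ^ 2 * (D * s ^ 2) := by
    have h0 : 0 ≤ x' * y' := by positivity
    have : (x' + y') * (x' * y') ≤ (5 * B * s) * (x * y + 3 * B * (D * s)) := by gcongr
    linarith
  have hs2 : (x' + y') ^ 2 ≤ 25 * B ^ 2 * s ^ 2 := by
    have := pow_le_pow_left₀ hs'0 hs' 2
    linarith
  have t1 : h ^ 3 * (x' + y') ≤ 5 * B * (h ^ 3 * s) := by
    calc h ^ 3 * (x' + y') ≤ h ^ 3 * (5 * B * s) := by gcongr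
      _ = _ := by ring
  have t2 : h ^ 2 * (x' + y') ^ 2 ≤ 25 * B ^ 2 * (h ^ 2 * s ^ 2) := by
    calc h ^ 2 * (x' + y') ^ 2 ≤ h ^ 2 * (25 * B ^ 2 * s ^ 2) := by gcongr
      _ = _ := by ring
  have t3 : h * ((x' + y') * (x' * y') + y' ^ 3) ≤ 5 * B * (h * (s * (x * y) + y ^ 3))
      + 31 * B ^ 3 * (h * (d * s ^ 3)) := by
    calc h * ((x' + y') * (x' * y') + y' ^ 3) ≤ h * (5 * B * s * (x * y) + 15 * B ^ 2 * (D * s ^ 2)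
        + (4 * y ^ 3 + 16 * B ^ 2 * (D * s ^ 2))) := by gcongr
      _ ≤ h * (5 * B * s * (x * y) + 15 * B ^ 2 * (D * s ^ 2)
        + (5 * B * y ^ 3 + 16 * B ^ 2 * (D * s ^ 2))) := by
        have : 4 ≤ 5 * B := by linarith
        gcongr
      _ = _ := by rw [hD]; ring
  have t4 : (x' * y') ^ 2 ≤ 2 * (x * y) ^ 2 + 18 * B ^ 4 * (d ^ 2 * s ^ 4) := by
    refine hp2.trans (le_of_eq ?_); rw [hD]; ring
  have hpw : ∀ k ≤ 4, B ^ k ≤ B ^ 4 := fun k hk => pow_le_pow_right₀ hB hk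
  have e1 : 0 ≤ h ^ 3 * s := by positivity
  have e2 : 0 ≤ h ^ 2 * s ^ 2 := by positivity
  have e3 : 0 ≤ h * (s * (x * y) + y ^ 3) := by positivity
  have e4 : 0 ≤ (x * y) ^ 2 := by positivity
  have e5 : 0 ≤ h * (d * s ^ 3) := by positivity
  have e6 : 0 ≤ d ^ 2 * s ^ 4 := by positivity
  have hB4 : 1 ≤ B ^ 4 := one_le_pow₀ hB
  have q1 := hpw 1 (by norm_num); have q2 := hpw 2 (by norm_num); have q3 := hpw 3 (by norm_num)
  rw [pow_one] at q1
  unfold err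
  calc _ ≤ 5 * B * (h ^ 3 * s) + 25 * B ^ 2 * (h ^ 2 * s ^ 2)
      + (5 * B * (h * (s * (x * y) + y ^ 3)) + 31 * B ^ 3 * (h * (d * s ^ 3)))
      + (2 * (x * y) ^ 2 + 18 * B ^ 4 * (d ^ 2 * s ^ 4)) := by gcongr
    _ ≤ 5 * B ^ 4 * (h ^ 3 * s) + 25 * B ^ 4 * (h ^ 2 * s ^ 2)
      + (5 * B ^ 4 * (h * (s * (x * y) + y ^ 3)) + 31 * B ^ 4 * (h * (d * s ^ 3)))
      + (2 * B ^ 4 * (x * y) ^ 2 + 18 * B ^ 4 * (d ^ 2 * s ^ 4)) := by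
        gcongr
        linarith
    _ ≤ _ := by
      rw [← hs]
      have f1 := mul_nonneg (by positivity : (0:ℝ) ≤ B ^ 4) e1
      have f2 := mul_nonneg (by positivity : (0:ℝ) ≤ B ^ 4) e2
      have f3 := mul_nonneg (by positivity : (0:ℝ) ≤ B ^ 4) e3
      have f4 := mul_nonneg (by positivity : (0:ℝ) ≤ B ^ 4) e4
      have f5 := mul_nonneg (by positivity : (0:ℝ) ≤ B ^ 4) e5
      have f6 := mul_nonneg (by positivity : (0:ℝ) ≤ B ^ 4) e6
      linarith

lemma norm_exp_I_mul_sub_le (x : ℝ) : ‖exp (I * x) - 1 - I * x‖ ≤ 3 * x ^ 2 := by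
  have hn : ‖I * (x : ℂ)‖ = |x| := by simp
  rcases le_or_gt |x| 1 with h | h
  · have := Complex.norm_exp_sub_one_sub_id_le (x := I * x) (by rw [hn]; exact h)
    rw [hn, sq_abs] at this
    nlinarith [sq_nonneg x]
  · have h1 : ‖exp (I * x) - 1‖ ≤ |x| := by
      simpa using Real.norm_exp_I_mul_ofReal_sub_one_le (x := x)
    have h2 := norm_sub_le (exp (I * x) - 1) (I * x)
    rw [hn] at h2
    nlinarith [sq_abs x]

/-- Spectral parameters `z b` together with pairs of test vectors `u b`, `v b`. -/
structure Family (n β : Type) where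
  z : β → ℂ
  u : β → n → ℂ
  v : β → n → ℂ

namespace Family

variable (T : Family n β)

def left (b : β) (X : 𝕄) : n → ℂ := res (conj (T.z b)) X *ᵥ T.u b

def right (b : β) (X : 𝕄) : n → ℂ := res (T.z b) X *ᵥ T.v b

/-- The form `⟨u_b, (z_b - X)⁻¹ v_b⟩`. -/
def formAt (b : β) (X : 𝕄) : ℂ := form (T.z b) (T.u b) (T.v b) X

/-- The mass that the vectors `(z_b - X)⁻¹ v_b` and `(conj z_b - X)⁻¹ u_b` put on an index. -/
def mass (X : 𝕄) (i : n) : ℝ := ∑ b, (‖T.left b X i‖ + ‖T.right b X i‖)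

def lin (c : β → ℂ) (X : 𝕄) : ℂ := ∑ b, c b * T.formAt b X

/-- The oscillating factor `exp (i κ ∑ c_b ⟨u_b, (z_b - X)⁻¹ v_b⟩)`. -/
def osc (κ : ℝ) (c : β → ℂ) (X : 𝕄) : ℂ := exp (I * (κ * T.lin c X))

/-- The uniform bounds on a test family, and on coefficients making the linear form real. -/
structure Good (T : Family n β) (c : β → ℂ) (A : ℝ) : Prop where
  one_le : 1 ≤ A
  im : ∀ b, 1 ≤ A * |(T.z b).im|
  u_le : ∀ b, l2 (T.u b) ≤ 1
  v_le : ∀ b, l2 (T.v b) ≤ 1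
  card_le : (card β : ℝ) ≤ A
  c_le : ∀ b, ‖c b‖ ≤ A
  real : ∀ X : 𝕄, X.IsHermitian → (T.lin c X).im = 0

lemma mass_nonneg (X : 𝕄) (i : n) : 0 ≤ T.mass X i := sum_nonneg fun _ _ => by positivity

lemma norm_left_le (X : 𝕄) (b : β) (i : n) : ‖T.left b X i‖ ≤ T.mass X i := by
  refine le_trans ?_ (single_le_sum (f := fun b => ‖T.left b X i‖ + ‖T.right b X i‖)
    (fun _ _ => by positivity) (mem_univ b))
  linarith [norm_nonneg (T.right b X i)]

lemma norm_right_le (X : 𝕄) (b : β) (i : n) : ‖T.right b X i‖ ≤ T.mass X i := by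
  refine le_trans ?_ (single_le_sum (f := fun b => ‖T.left b X i‖ + ‖T.right b X i‖)
    (fun _ _ => by positivity) (mem_univ b))
  linarith [norm_nonneg (T.left b X i)]

end Family

variable {X : Matrix n n ℂ} {z : ℂ} {A : ℝ}

lemma norm_res_entry_le (hX : X.IsHermitian) (hz : 1 ≤ A * |z.im|) (i j : n) :
    ‖res z X i j‖ ≤ A := (norm_entry_le _ _ _).trans (norm_res_le hX hz)

lemma abs_im_conj {z : ℂ} (hz : 1 ≤ A * |z.im|) : 1 ≤ A * |(conj z).im| := by simpa using hz

lemma norm_res_mulVec_sub_le (hX : X.IsHermitian) (hz : 1 ≤ A * |z.im|) (i j : n)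
    (y : n → ℂ) (k : n) :
    ‖(res z X *ᵥ y) k - (Ro *ᵥ y) k‖ ≤ A * (‖X i j‖ * (Co y)) := by
  rw [resolvent_erase_mulVec' hX (im_ne_of hz) i j y k, add_sub_cancel_left]
  refine (norm_add_le _ _).trans ?_
  simp only [norm_mul, norm_conj]
  have h1 := norm_res_entry_le hX hz k i
  have h2 := norm_res_entry_le hX hz k j
  calc _ ≤ ‖X i j‖ * A * ‖(Ro *ᵥ y) j‖ +
        ‖X i j‖ * A * ‖(Ro *ᵥ y) i‖ := by gcongr
    _ = _ := by ring

lemma norm_res_mulVec_sub_le' (hX : X.IsHermitian) (hz : 1 ≤ A * |z.im|) (i j : n)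
    (y : n → ℂ) (k : n) :
    ‖(Ro *ᵥ y) k - (res z X *ᵥ y) k‖ ≤ A * (‖X i j‖ *
      (‖(res z X *ᵥ y) i‖ + ‖(res z X *ᵥ y) j‖)) := by
  rw [resolvent_erase_mulVec hX (im_ne_of hz) i j y k, sub_add_cancel_left, norm_neg]
  refine (norm_add_le _ _).trans ?_
  simp only [norm_mul, norm_conj]
  have h1 := norm_res_entry_le (erase_isHermitian hX i j) hz k i
  have h2 := norm_res_entry_le (erase_isHermitian hX i j) hz k j
  calc _ ≤ ‖X i j‖ * A * ‖(res z X *ᵥ y) j‖ +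
        ‖X i j‖ * A * ‖(res z X *ᵥ y) i‖ := by gcongr
    _ = _ := by ring

/-- The first order term of the expansion of `(z - X)⁻¹ y` in the entry `(i, j)`. -/
def lin1 (z : ℂ) (X : 𝕄) (i j : n) (y : n → ℂ) (k : n) : ℂ := X i j * (Ro k i * (Ro *ᵥ y) j) +
    conj (X i j) * (Ro k j * (Ro *ᵥ y) i)

lemma norm_second_order_le (hX : X.IsHermitian) (hz : 1 ≤ A * |z.im|) (i j : n)
    (y : n → ℂ) (k : n) :
    ‖(res z X *ᵥ y) k - (Ro *ᵥ y) k - lin1 z X i j y k‖ ≤ 2 * A ^ 2 * (‖X i j‖ ^ 2 * (Co y)) := by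
  have key : (res z X *ᵥ y) k - (Ro *ᵥ y) k - lin1 z X i j y k =
      X i j * (Ro k i * ((res z X *ᵥ y) j - (Ro *ᵥ y) j)) +
      conj (X i j) * (Ro k j * ((res z X *ᵥ y) i - (Ro *ᵥ y) i)) := by
    rw [resolvent_erase_mulVec hX (im_ne_of hz) i j y k, lin1]; ring
  rw [key]
  refine (norm_add_le _ _).trans ?_
  simp only [norm_mul, norm_conj]
  have h1 := norm_res_entry_le (erase_isHermitian hX i j) hz k i
  have h2 := norm_res_entry_le (erase_isHermitian hX i j) hz k j
  have h3 := norm_res_mulVec_sub_le hX hz i j y j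
  have h4 := norm_res_mulVec_sub_le hX hz i j y i
  have hA : 0 ≤ A := (norm_nonneg _).trans h1
  calc _ ≤ ‖X i j‖ * (A * (A * (‖X i j‖ *
      (Co y)))) +
      ‖X i j‖ * (A * (A * (‖X i j‖ *
      (Co y)))) := by gcongr
    _ = _ := by ring

/-- The second order term of the expansion of `(z - X)⁻¹ y` in the entry `(i, j)`. -/
def lin2 (z : ℂ) (X : 𝕄) (i j : n) (y : n → ℂ) (k : n) : ℂ := X i j * (Ro k i * lin1 z X i j y j) +
    conj (X i j) * (Ro k j * lin1 z X i j y i)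

lemma norm_third_order_le (hX : X.IsHermitian) (hz : 1 ≤ A * |z.im|) (i j : n) (y : n → ℂ) (k : n) :
    ‖(res z X *ᵥ y) k - (Ro *ᵥ y) k - lin1 z X i j y k - lin2 z X i j y k‖ ≤
      4 * A ^ 3 * (‖X i j‖ ^ 3 * (Co y)) := by
  have key : (res z X *ᵥ y) k - (Ro *ᵥ y) k - lin1 z X i j y k - lin2 z X i j y k =
      X i j * (Ro k i * ((res z X *ᵥ y) j - (Ro *ᵥ y) j - lin1 z X i j y j)) +
      conj (X i j) * (Ro k j * ((res z X *ᵥ y) i - (Ro *ᵥ y) i - lin1 z X i j y i)) := by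
    rw [resolvent_erase_mulVec hX (im_ne_of hz) i j y k, lin2]
    nth_rewrite 1 [lin1]
    ring
  rw [key]
  refine (norm_add_le _ _).trans ?_
  simp only [norm_mul, norm_conj]
  have h1 := norm_res_entry_le (erase_isHermitian hX i j) hz k i
  have h2 := norm_res_entry_le (erase_isHermitian hX i j) hz k j
  have h3 := norm_second_order_le hX hz i j y j
  have h4 := norm_second_order_le hX hz i j y i
  have hA : 0 ≤ A := (norm_nonneg _).trans h1
  calc _ ≤ ‖X i j‖ * (A * (2 * A ^ 2 * (‖X i j‖ ^ 2 *
      (Co y)))) +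
      ‖X i j‖ * (A * (2 * A ^ 2 * (‖X i j‖ ^ 2 *
      (Co y)))) := by gcongr
    _ = _ := by ring

/-- The first order term of the expansion of `⟨u, (z - X)⁻¹ v⟩` in the entry `(i, j)`. -/
def formLin (z : ℂ) (u v : n → ℂ) (X : 𝕄) (i j : n) : ℂ :=
  X i j * (conj ((So *ᵥ u) i) * (Ro *ᵥ v) j) + conj (X i j) * (conj ((So *ᵥ u) j) * (Ro *ᵥ v) i)

section FormBounds

variable (u v : n → ℂ) (i j : n)

lemma norm_formLin_le : ‖formLin z u v X i j‖ ≤ ‖X i j‖ * (‖(So *ᵥ u) i‖ * ‖(Ro *ᵥ v) j‖ +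
      ‖(So *ᵥ u) j‖ * ‖(Ro *ᵥ v) i‖) := by
  refine (norm_add_le _ _).trans (le_of_eq ?_)
  simp only [norm_mul, norm_conj]
  ring

lemma norm_form_sub_sub_le (hX : X.IsHermitian) (hz : 1 ≤ A * |z.im|) :
    ‖form z u v X - form z u v Xo - formLin z u v X i j‖ ≤ A * (‖X i j‖ ^ 2 *
      ((‖(So *ᵥ u) i‖ + ‖(So *ᵥ u) j‖) *
      (Co v))) := by
  have key : form z u v X - form z u v Xo - formLin z u v X i j = X i j * (conj ((So *ᵥ u) i) *
        ((res z X *ᵥ v) j - (Ro *ᵥ v) j)) +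
      conj (X i j) * (conj ((So *ᵥ u) j) * ((res z X *ᵥ v) i - (Ro *ᵥ v) i)) := by
    rw [form_erase hX (im_ne_of hz) i j u v, formLin]; ring
  rw [key]
  refine (norm_add_le _ _).trans ?_
  simp only [norm_mul, norm_conj]
  have h3 := norm_res_mulVec_sub_le hX hz i j v j
  have h4 := norm_res_mulVec_sub_le hX hz i j v i
  calc _ ≤ ‖X i j‖ * (‖(So *ᵥ u) i‖ * (A * (‖X i j‖ *
        (Co v)))) +
      ‖X i j‖ * (‖(So *ᵥ u) j‖ * (A * (‖X i j‖ * (Co v)))) := by gcongr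
    _ = _ := by ring

end FormBounds

namespace Family

variable {T : Family n β} {c : β → ℂ}

lemma mass_le (hX : X.IsHermitian) (hT : T.Good c A) (i : n) : T.mass X i ≤ 2 * A ^ 2 := by
  have hA := hT.one_le
  have h : ∀ b, ‖T.left b X i‖ + ‖T.right b X i‖ ≤ 2 * A := fun b => by
    have h1 := (norm_apply_le_l2 _ i).trans (l2_mulVec_le (res (conj (T.z b)) X) (T.u b))
    have h2 := (norm_apply_le_l2 _ i).trans (l2_mulVec_le (res (T.z b) X) (T.v b))
    have h3 := norm_res_le hX (abs_im_conj (hT.im b))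
    have h4 := norm_res_le hX (hT.im b)
    have h5 : ‖res (conj (T.z b)) X‖ * l2 (T.u b) ≤ A * 1 :=
      mul_le_mul h3 (hT.u_le b) (l2_nonneg _) (by linarith)
    have h6 : ‖res (T.z b) X‖ * l2 (T.v b) ≤ A * 1 :=
      mul_le_mul h4 (hT.v_le b) (l2_nonneg _) (by linarith)
    unfold left right
    linarith
  refine (sum_le_sum fun b _ => h b).trans ?_
  rw [sum_const, card_univ, nsmul_eq_mul]
  nlinarith [hT.card_le]

lemma sum_mass_sq_le (hX : X.IsHermitian) (hT : T.Good c A) : ∑ i, T.mass X i ^ 2 ≤ 4 * A ^ 4 := by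
  have hA := hT.one_le
  have h : ∀ i, T.mass X i ^ 2 ≤
      A * ∑ b, (2 * ‖T.left b X i‖ ^ 2 + 2 * ‖T.right b X i‖ ^ 2) := fun i => by
    have h1 := Finset.sum_mul_sq_le_sq_mul_sq univ (fun _ : β => (1 : ℝ))
      (fun b => ‖T.left b X i‖ + ‖T.right b X i‖)
    simp only [one_mul, one_pow, sum_const, card_univ, nsmul_eq_mul, mul_one] at h1
    refine h1.trans ?_
    refine mul_le_mul hT.card_le (sum_le_sum fun b _ => ?_)
      (sum_nonneg fun _ _ => by positivity) (by linarith)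
    nlinarith [sq_nonneg (‖T.left b X i‖ - ‖T.right b X i‖)]
  refine (sum_le_sum fun i _ => h i).trans ?_
  rw [← mul_sum, sum_comm]
  have h2 : ∀ b, ∑ i, (2 * ‖T.left b X i‖ ^ 2 + 2 * ‖T.right b X i‖ ^ 2) ≤ 4 * A ^ 2 := fun b => by
    rw [sum_add_distrib, ← mul_sum, ← mul_sum, ← l2_sq, ← l2_sq]
    have h1 := l2_mulVec_le (res (conj (T.z b)) X) (T.u b)
    have h2 := l2_mulVec_le (res (T.z b) X) (T.v b)
    have h3 := norm_res_le hX (abs_im_conj (hT.im b))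
    have h4 := norm_res_le hX (hT.im b)
    have h5 : ‖res (conj (T.z b)) X‖ * l2 (T.u b) ≤ A * 1 :=
      mul_le_mul h3 (hT.u_le b) (l2_nonneg _) (by linarith)
    have h6 : ‖res (T.z b) X‖ * l2 (T.v b) ≤ A * 1 :=
      mul_le_mul h4 (hT.v_le b) (l2_nonneg _) (by linarith)
    have h7 := pow_le_pow_left₀ (l2_nonneg _) (h1.trans h5) 2
    have h8 := pow_le_pow_left₀ (l2_nonneg _) (h2.trans h6) 2
    unfold left right
    linarith
  calc A * ∑ b, ∑ i, (2 * ‖T.left b X i‖ ^ 2 + 2 * ‖T.right b X i‖ ^ 2)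
      ≤ A * ∑ _b : β, 4 * A ^ 2 := by gcongr with b; exact h2 b
    _ ≤ A * (A * (4 * A ^ 2)) := by
      rw [sum_const, card_univ, nsmul_eq_mul]
      have := hT.card_le
      gcongr
    _ = _ := by ring

lemma mass_le_mass_erase (hX : X.IsHermitian) (hT : T.Good c A) (i j k : n) :
    T.mass X k ≤ T.mass Xo k + A * (‖X i j‖ * Mo) := by
  unfold mass
  rw [← sum_add_distrib, mul_sum, mul_sum, ← sum_add_distrib]
  refine sum_le_sum fun b _ => ?_
  have h1 := norm_res_mulVec_sub_le hX (hT.im b) i j (T.v b) k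
  have h2 := norm_res_mulVec_sub_le hX (abs_im_conj (hT.im b)) i j (T.u b) k
  have h3 := norm_sub_norm_le ((res (T.z b) X *ᵥ T.v b) k) ((res (T.z b) Xo *ᵥ T.v b) k)
  have h4 := norm_sub_norm_le ((res (conj (T.z b)) X *ᵥ T.u b) k)
    ((res (conj (T.z b)) Xo *ᵥ T.u b) k)
  unfold left right
  linarith

lemma mass_erase_le_mass (hX : X.IsHermitian) (hT : T.Good c A) (i j k : n) :
    T.mass Xo k ≤ T.mass X k + A * (‖X i j‖ * (T.mass X i + T.mass X j)) := by
  unfold mass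
  rw [← sum_add_distrib, mul_sum, mul_sum, ← sum_add_distrib]
  refine sum_le_sum fun b _ => ?_
  have h1 := norm_res_mulVec_sub_le' hX (hT.im b) i j (T.v b) k
  have h2 := norm_res_mulVec_sub_le' hX (abs_im_conj (hT.im b)) i j (T.u b) k
  have h3 := norm_sub_norm_le ((res (T.z b) Xo *ᵥ T.v b) k) ((res (T.z b) X *ᵥ T.v b) k)
  have h4 := norm_sub_norm_le ((res (conj (T.z b)) Xo *ᵥ T.u b) k)
    ((res (conj (T.z b)) X *ᵥ T.u b) k)
  unfold left right
  linarith

/-- The first order term of the exponent. -/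
def linLin (T : Family n β) (c : β → ℂ) (X : 𝕄) (i j : n) : ℂ :=
  ∑ b, c b * formLin (T.z b) (T.u b) (T.v b) X i j

lemma norm_linLin_le (hX : X.IsHermitian) (hT : T.Good c A) (i j : n) :
    ‖T.linLin c X i j‖ ≤ 2 * A ^ 2 * (‖X i j‖ * (T.mass Xo i * T.mass Xo j)) := by
  have hA := hT.one_le
  have h : ∀ b, ‖c b * formLin (T.z b) (T.u b) (T.v b) X i j‖ ≤
      A * (‖X i j‖ * (2 * (T.mass Xo i * T.mass Xo j))) := fun b => by
    rw [norm_mul]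
    have h1 := norm_formLin_le (z := T.z b) (X := X) (T.u b) (T.v b) i j
    have a1 := T.norm_left_le Xo b i
    have a2 := T.norm_left_le Xo b j
    have a3 := T.norm_right_le Xo b i
    have a4 := T.norm_right_le Xo b j
    unfold left at a1 a2
    unfold right at a3 a4
    refine mul_le_mul (hT.c_le b) (h1.trans ?_) (norm_nonneg _) (by linarith)
    have b1 := mul_le_mul a1 a4 (norm_nonneg _) (T.mass_nonneg _ _)
    have b2 := mul_le_mul a2 a3 (norm_nonneg _) (T.mass_nonneg _ _)
    refine mul_le_mul_of_nonneg_left ?_ (norm_nonneg _)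
    linarith
  refine (norm_sum_le _ _).trans ((sum_le_sum fun b _ => h b).trans ?_)
  rw [sum_const, card_univ, nsmul_eq_mul]
  have := T.mass_nonneg Xo i
  have := T.mass_nonneg Xo j
  calc _ ≤ A * (A * (‖X i j‖ * (2 * (T.mass Xo i * T.mass Xo j)))) := by
        have := hT.card_le
        gcongr
    _ = _ := by ring

lemma norm_lin_sub_sub_le (hX : X.IsHermitian) (hT : T.Good c A) (i j : n) :
    ‖T.lin c X - T.lin c Xo - T.linLin c X i j‖ ≤ A ^ 3 * (‖X i j‖ ^ 2 * Mo ^ 2) := by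
  have hA := hT.one_le
  have h : ∀ b, ‖c b * (T.formAt b X - T.formAt b Xo - formLin (T.z b) (T.u b) (T.v b) X i j)‖ ≤
      A * (A * (‖X i j‖ ^ 2 * Mo ^ 2)) :=
    fun b => by
    rw [norm_mul]
    have h1 := norm_form_sub_sub_le (T.u b) (T.v b) i j hX (hT.im b)
    have a1 := T.norm_left_le Xo b i
    have a2 := T.norm_left_le Xo b j
    have a3 := T.norm_right_le Xo b i
    have a4 := T.norm_right_le Xo b j
    unfold left at a1 a2
    unfold right at a3 a4
    refine mul_le_mul (hT.c_le b) (h1.trans ?_) (norm_nonneg _) (by linarith)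
    have := T.mass_nonneg Xo i
    have := T.mass_nonneg Xo j
    rw [pow_two (_ + _)]
    gcongr
  have key : T.lin c X - T.lin c Xo - T.linLin c X i j = ∑ b, c b * (T.formAt b X - T.formAt b Xo
      - formLin (T.z b) (T.u b) (T.v b) X i j) := by
    simp only [lin, linLin, mul_sub, sum_sub_distrib]
  rw [key]
  refine (norm_sum_le _ _).trans ((sum_le_sum fun b _ => h b).trans ?_)
  rw [sum_const, card_univ, nsmul_eq_mul]
  calc _ ≤ A * (A * (A * (‖X i j‖ ^ 2 *
        Mo ^ 2))) := by
        have := hT.card_le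
        gcongr
    _ = _ := by ring

lemma osc_eq (hX : X.IsHermitian) (hT : T.Good c A) (κ : ℝ) :
    T.osc κ c X = exp (I * ((κ * (T.lin c X).re : ℝ) : ℂ)) := by
  unfold osc
  congr 2
  rw [Complex.ofReal_mul]
  congr 1
  apply Complex.ext <;> simp [hT.real X hX]

lemma norm_osc (hX : X.IsHermitian) (hT : T.Good c A) (κ : ℝ) : ‖T.osc κ c X‖ = 1 := by
  rw [osc_eq hX hT, Complex.norm_exp_I_mul_ofReal]

lemma three_mul_sq_le {A a b d : ℝ} (hA : 1 ≤ A) (ha : 0 ≤ a) (hb : 0 ≤ b)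
    (hd : |d| ≤ 2 * A ^ 3 * (a + b)) : 3 * d ^ 2 ≤ 24 * (4 * A ^ 2) ^ 4 * (a ^ 2 + b ^ 2) := by
  rw [← sq_abs]
  have h4 := pow_le_pow_left₀ (abs_nonneg d) hd 2
  have p68 : A ^ 6 ≤ A ^ 8 := pow_le_pow_right₀ hA (by norm_num)
  have h5 : (a + b) ^ 2 ≤ 2 * (a ^ 2 + b ^ 2) := by linarith [sq_nonneg (a - b)]
  calc 3 * |d| ^ 2 ≤ 3 * (2 * A ^ 3 * (a + b)) ^ 2 := by linarith
    _ = 12 * A ^ 6 * (a + b) ^ 2 := by ring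
    _ ≤ 12 * A ^ 8 * (2 * (a ^ 2 + b ^ 2)) := by gcongr
    _ ≤ _ := by
      have : 0 ≤ A ^ 8 * (a ^ 2 + b ^ 2) := by positivity
      linarith

set_option maxHeartbeats 1000000 in
/-- The change of the oscillating factor when an entry is erased. -/
lemma expBounds (hX : X.IsHermitian) (hT : T.Good c A) (i j : n) {h t : ℝ} (hh : 0 < h)
    (ht : 0 ≤ t) (hξ : ‖X i j‖ = h * t) :
    ExpBounds h t (T.mass Xo i) (T.mass Xo j) (4 * A ^ 2) (T.osc h⁻¹ c X) (T.osc h⁻¹ c Xo)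
      (I * ((h⁻¹ : ℝ) * T.linLin c X i j)) := by
  have hA := hT.one_le
  have hX0 := erase_isHermitian hX i j
  set x := T.mass Xo i with hx
  set y := T.mass Xo j with hy
  have hx0 : 0 ≤ x := T.mass_nonneg _ _
  have hy0 : 0 ≤ y := T.mass_nonneg _ _
  have h1 := norm_linLin_le hX hT i j
  have h2 := norm_lin_sub_sub_le hX hT i j
  rw [hξ, ← hx, ← hy] at h1 h2
  clear_value x y
  set δ : ℝ := h⁻¹ * ((T.lin c X).re - (T.lin c Xo).re) with hδ
  have hδc : ((δ : ℝ) : ℂ) = (h⁻¹ : ℝ) * (T.lin c X - T.lin c Xo) := by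
    rw [hδ, Complex.ofReal_mul]
    congr 1
    apply Complex.ext <;> simp [hT.real X hX, hT.real _ hX0]
  have hosc : T.osc h⁻¹ c X = T.osc h⁻¹ c Xo * exp (I * δ) := by
    unfold osc
    rw [hδc, ← Complex.exp_add]
    congr 1; ring
  have hhn : ‖((h⁻¹ : ℝ) : ℂ)‖ = h⁻¹ := by simp [abs_of_pos hh]
  have hd : ‖(δ : ℂ) - (h⁻¹ : ℝ) * T.linLin c X i j‖ ≤ A ^ 3 * (h * t ^ 2 * (x + y) ^ 2) := by
    rw [hδc, ← mul_sub, norm_mul, hhn]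
    calc h⁻¹ * _ ≤ h⁻¹ * (A ^ 3 * ((h * t) ^ 2 * (x + y) ^ 2)) := by gcongr
      _ = _ := by field_simp
  have hl : ‖((h⁻¹ : ℝ) : ℂ) * T.linLin c X i j‖ ≤ 2 * A ^ 2 * (t * (x * y)) := by
    rw [norm_mul, hhn]
    calc h⁻¹ * _ ≤ h⁻¹ * (2 * A ^ 2 * (h * t * (x * y))) := by gcongr
      _ = _ := by field_simp
  have hδn : |δ| ≤ 2 * A ^ 3 * (t * (x * y) + h * t ^ 2 * (x + y) ^ 2) := by
    have h3 := norm_add_le ((δ : ℂ) - (h⁻¹ : ℝ) * T.linLin c X i j) ((h⁻¹ : ℝ) * T.linLin c X i j)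
    rw [sub_add_cancel, norm_real, Real.norm_eq_abs] at h3
    have e1 : 0 ≤ t * (x * y) := by positivity
    have e2 : 0 ≤ h * t ^ 2 * (x + y) ^ 2 := by positivity
    have e3 : A ^ 2 ≤ A ^ 3 := pow_le_pow_right₀ hA (by norm_num)
    have e4 : 0 ≤ A ^ 3 := by positivity
    have e5 := mul_le_mul_of_nonneg_right e3 e1
    have e6 := mul_nonneg e4 e2
    linarith
  clear_value δ
  have p34 : A ^ 3 ≤ A ^ 4 := pow_le_pow_right₀ hA (by norm_num)
  have n0 := norm_osc hX0 hT h⁻¹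
  refine ⟨norm_osc hX hT _, n0, ?_, ?_⟩
  · rw [hosc, ← mul_sub_one, norm_mul, n0, one_mul]
    refine Real.norm_exp_I_mul_ofReal_sub_one_le.trans ?_
    rw [Real.norm_eq_abs]
    refine hδn.trans ?_
    refine mul_le_mul_of_nonneg_right ?_ (by positivity)
    have : 0 ≤ A ^ 4 := by positivity
    linarith
  · have key : T.osc h⁻¹ c X - T.osc h⁻¹ c Xo - T.osc h⁻¹ c Xo *
        (I * ((h⁻¹ : ℝ) * T.linLin c X i j)) = T.osc h⁻¹ c Xo *
        ((exp (I * δ) - 1 - I * δ) +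
          I * ((δ : ℂ) - (h⁻¹ : ℝ) * T.linLin c X i j)) := by rw [hosc]; ring
    rw [key, norm_mul, n0, one_mul]
    refine (norm_add_le _ _).trans (add_le_add ?_ ?_)
    · refine (norm_exp_I_mul_sub_le δ).trans ((three_mul_sq_le hA (by positivity) (by positivity)
        hδn).trans (le_of_eq ?_))
      ring
    · rw [norm_mul, Complex.norm_I, one_mul]
      refine hd.trans (mul_le_mul_of_nonneg_right ?_ (by positivity))
      have : 0 ≤ A ^ 4 := by positivity
      linarith

lemma scales (hX : X.IsHermitian) (hT : T.Good c A) (i j : n) {h t : ℝ} (hh : 0 < h) (h1 : h ≤ 1)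
    (ht : 0 ≤ t) (hht : h * t ^ 2 ≤ 4) :
    Scales h t (T.mass Xo i) (T.mass Xo j) (4 * A ^ 2) := by
  have hX0 := erase_isHermitian hX i j
  have h3 := mass_le hX0 hT i
  have h4 := mass_le hX0 hT j
  have hA := hT.one_le
  exact ⟨hh, h1, ht, hht, T.mass_nonneg _ _, T.mass_nonneg _ _, by nlinarith, by linarith⟩

end Family

instance matrixMeasurableSpace {m n : Type} : MeasurableSpace (Matrix m n ℂ) :=
  inferInstanceAs (MeasurableSpace (m → n → ℂ))

instance matrixBorelSpace {m n : Type} [Fintype m] [Fintype n] : BorelSpace (Matrix m n ℂ) :=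
  inferInstanceAs (BorelSpace (m → n → ℂ))

lemma measurable_entry (i j : n) : Measurable fun X : 𝕄 => X i j :=
  (measurable_pi_apply j).comp (measurable_pi_apply i)

lemma measurable_matrix {Ω : Type*} [MeasurableSpace Ω] {X : Ω → 𝕄}
    (h : ∀ i j, Measurable fun w => X w i j) : Measurable X :=
  measurable_pi_lambda _ fun i => measurable_pi_lambda _ fun j => h i j

lemma measurable_resolvent (z : ℂ) : Measurable fun X : 𝕄 => res z X := by
  unfold res
  simp only [Matrix.inv_def, Ring.inverse_eq_inv']
  refine measurable_matrix fun i j => ?_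
  simp only [Matrix.smul_apply, smul_eq_mul]
  refine Measurable.mul ?_ ?_
  · refine Measurable.inv (Continuous.measurable ?_)
    exact Continuous.matrix_det (by fun_prop)
  · refine (measurable_entry i j).comp (Continuous.measurable ?_)
    exact Continuous.matrix_adjugate (by fun_prop)

lemma measurable_resolvent_entry (z : ℂ) (i j : n) : Measurable fun X : 𝕄 => res z X i j :=
  (measurable_entry i j).comp (measurable_resolvent z)

lemma measurable_erase (i j : n) : Measurable fun X : 𝕄 => erase X i j := by
  refine measurable_matrix fun k l => ?_
  simp only [erase, Matrix.sub_apply, Matrix.single_apply]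
  have := fun a b => measurable_entry (n := n) a b
  refine ((this k l).sub ?_).sub ?_
  · split_ifs
    · exact this i j
    · exact measurable_const
  · split_ifs
    · exact this j i
    · exact measurable_const

/-- Functions of a matrix that are measurable, and bounded on Hermitian matrices. -/
@[fun_prop]
def Tame {𝕜 : Type*} [RCLike 𝕜] (F : 𝕄 → 𝕜) : Prop :=
  Measurable F ∧ ∃ C : ℝ, ∀ X : 𝕄, X.IsHermitian → ‖F X‖ ≤ C

namespace Tame

variable {𝕜 : Type*} [RCLike 𝕜] {F G : Matrix n n ℂ → 𝕜}

lemma const (c : 𝕜) : Tame fun _ : 𝕄 => c := ⟨measurable_const, ‖c‖, fun _ _ => le_rfl⟩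

lemma add (hF : Tame F) (hG : Tame G) : Tame fun X => F X + G X := by
  obtain ⟨C, hC⟩ := hF.2
  obtain ⟨D, hD⟩ := hG.2
  exact ⟨hF.1.add hG.1, C + D, fun X hX =>
    (norm_add_le _ _).trans (add_le_add (hC X hX) (hD X hX))⟩

lemma sub (hF : Tame F) (hG : Tame G) : Tame fun X => F X - G X := by
  obtain ⟨C, hC⟩ := hF.2
  obtain ⟨D, hD⟩ := hG.2
  exact ⟨hF.1.sub hG.1, C + D, fun X hX =>
    (norm_sub_le _ _).trans (add_le_add (hC X hX) (hD X hX))⟩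

lemma mul (hF : Tame F) (hG : Tame G) : Tame fun X => F X * G X := by
  obtain ⟨C, hC⟩ := hF.2
  obtain ⟨D, hD⟩ := hG.2
  refine ⟨hF.1.mul hG.1, C * D, fun X hX => ?_⟩
  rw [norm_mul]
  exact mul_le_mul (hC X hX) (hD X hX) (norm_nonneg _) ((norm_nonneg _).trans (hC X hX))

lemma sum {ι : Type*} {s : Finset ι} {F : ι → 𝕄 → 𝕜} (h : ∀ i, Tame (F i)) :
    Tame fun X => ∑ i ∈ s, F i X := by
  classical
  induction s using Finset.induction_on with
  | empty => simpa using const (n := n) (0 : 𝕜)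
  | insert a s ha ih =>
    simpa only [Finset.sum_insert ha] using (h a).add ih

lemma norm (hF : Tame F) : Tame fun X => ‖F X‖ := by
  obtain ⟨C, hC⟩ := hF.2
  exact ⟨hF.1.norm, C, fun X hX => by simpa using hC X hX⟩

lemma pow (hF : Tame F) (k : ℕ) : Tame fun X => F X ^ k := by
  induction k with
  | zero => simpa using const (n := n) (1 : 𝕜)
  | succ k ih => simpa only [pow_succ] using ih.mul hF

lemma star {F : 𝕄 → ℂ} (hF : Tame F) : Tame fun X => conj (F X) := by
  obtain ⟨C, hC⟩ := hF.2
  exact ⟨Complex.continuous_conj.measurable.comp hF.1, C, fun X hX => by simpa using hC X hX⟩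

attribute [fun_prop] const add sub mul sum norm pow Tame.star

end Tame

@[fun_prop]
lemma tame_res_entry {z : ℂ} (hz : z.im ≠ 0) (i j : n) : Tame fun X : 𝕄 => res z X i j :=
  ⟨measurable_resolvent_entry z i j, |z.im|⁻¹, fun X hX =>
    norm_res_entry_le hX (by rw [inv_mul_cancel₀ (abs_ne_zero.2 hz)]) i j⟩

@[fun_prop]
lemma tame_res_mulVec {z : ℂ} (hz : z.im ≠ 0) (y : n → ℂ) (i : n) :
    Tame fun X : 𝕄 => (res z X *ᵥ y) i := by
  simp only [Matrix.mulVec, dotProduct]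
  exact Tame.sum fun j => (tame_res_entry hz i j).mul (Tame.const _)

@[fun_prop]
lemma tame_form {z : ℂ} (hz : z.im ≠ 0) (u v : n → ℂ) : Tame fun X : 𝕄 => form z u v X := by
  unfold form
  exact Tame.sum fun j => (Tame.const _).mul (tame_res_mulVec hz v j)

namespace Family

variable {T : Family n β} {c : β → ℂ} {A : ℝ}

lemma Good.im_ne (hT : T.Good c A) (b : β) : (T.z b).im ≠ 0 := im_ne_of (hT.im b)

lemma Good.im_conj_ne (hT : T.Good c A) (b : β) : (conj (T.z b)).im ≠ 0 :=
  im_ne_of (abs_im_conj (hT.im b))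

@[fun_prop]
lemma tame_left (hT : T.Good c A) (b : β) (i : n) : Tame fun X => T.left b X i :=
  tame_res_mulVec (hT.im_conj_ne b) _ _

@[fun_prop]
lemma tame_right (hT : T.Good c A) (b : β) (i : n) : Tame fun X => T.right b X i :=
  tame_res_mulVec (hT.im_ne b) _ _

@[fun_prop]
lemma tame_mass (hT : T.Good c A) (i : n) : Tame fun X => T.mass X i :=
  Tame.sum fun b => (tame_left hT b i).norm.add (tame_right hT b i).norm

@[fun_prop]
lemma tame_lin (hT : T.Good c A) : Tame fun X => T.lin c X :=
  Tame.sum fun b => (Tame.const _).mul (tame_form (hT.im_ne b) _ _)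

@[fun_prop]
lemma tame_osc (hT : T.Good c A) (κ : ℝ) : Tame fun X => T.osc κ c X :=
  ⟨Complex.measurable_exp.comp (((tame_lin hT).1.const_mul _).const_mul _), 1,
    fun X hX => (norm_osc hX hT κ).le⟩

end Family

variable {Ω : Type*} [MeasurableSpace Ω]

/-- The average of a function of a random matrix. -/
def avg {𝕜 : Type*} [RCLike 𝕜] (P : Measure Ω) (X : Ω → 𝕄) (F : 𝕄 → 𝕜) : 𝕜 := ∫ w, F (X w) ∂P

variable {P : Measure Ω} {X : Ω → Matrix n n ℂ}

lemma avg_mul_left {𝕜 : Type*} [RCLike 𝕜] (a : 𝕜) (F : 𝕄 → 𝕜) :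
    avg P X (fun Y => a * F Y) = a * avg P X F := integral_const_mul _ _

lemma avg_mul_right {𝕜 : Type*} [RCLike 𝕜] (a : 𝕜) (F : 𝕄 → 𝕜) :
    avg P X (fun Y => F Y * a) = avg P X F * a := integral_mul_const _ _

/-- A random Hermitian matrix with independent centred entries of size `h = N ^ (-1/2)`. -/
structure Model (P : Measure Ω) (X : Ω → 𝕄) (h A σ ρ : ℝ) : Prop where
  h_pos : 0 < h
  h_le : h ≤ 1
  card_eq : (card n : ℝ) * h ^ 2 = 1
  one_le : 1 ≤ A
  sigma_le : σ ^ 2 ≤ A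
  rho_le : |ρ| ≤ 1
  isHermitian : ∀ w, (X w).IsHermitian
  diag : ∀ w i, X w i i = 0
  measurable : ∀ i j, Measurable fun w => X w i j
  bound : ∀ w i j, ‖X w i j‖ ^ 2 ≤ 4 * h
  indep : ∀ i j, i ≠ j → IndepFun (fun w => X w i j) (fun w => Xe) P
  mean : ∀ i j, ∫ w, X w i j ∂P = 0
  fourth : ∀ i j, ∫ w, ‖X w i j‖ ^ 4 ∂P ≤ A * h ^ 4
  second : ∀ i j, i ≠ j → |∫ w, ‖X w i j‖ ^ 2 ∂P - σ ^ 2 * h ^ 2| ≤ A * h ^ 3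
  square : ∀ i j, i ≠ j → ‖∫ w, X w i j ^ 2 ∂P - ρ * σ ^ 2 * h ^ 2‖ ≤ A * h ^ 3
  efronStein : ∀ F : 𝕄 → ℂ, Tame F → ∫ w, ‖F (X w) - avg P X F‖ ^ 2 ∂P ≤
    ∑ i, ∑ j, if i ≠ j then ∫ w, ‖F (X w) - F Xe‖ ^ 2 ∂P else 0

namespace Model

variable {P : Measure Ω} [IsProbabilityMeasure P] {X : Ω → Matrix n n ℂ} {h A σ ρ : ℝ}
variable (M : Model P X h A σ ρ)
include M

lemma measurable_matrix : Measurable X := WignerFluct.measurable_matrix M.measurable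

lemma erase_hermitian (w : Ω) (i j : n) : (Xe).IsHermitian :=
  erase_isHermitian (M.isHermitian w) i j

variable {𝕜 : Type*} [RCLike 𝕜] {F G : Matrix n n ℂ → 𝕜}

lemma integrable (hF : Tame F) : Integrable (fun w => F (X w)) P := by
  obtain ⟨C, hC⟩ := hF.2
  exact Integrable.of_bound (hF.1.comp M.measurable_matrix).aestronglyMeasurable C
    (ae_of_all _ fun w => hC _ (M.isHermitian w))

lemma avg_add (hF : Tame F) (hG : Tame G) : avg P X (fun Y => F Y + G Y) = avg P X F + avg P X G :=
  integral_add (M.integrable hF) (M.integrable hG)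

lemma avg_sub (hF : Tame F) (hG : Tame G) : avg P X (fun Y => F Y - G Y) = avg P X F - avg P X G :=
  integral_sub (M.integrable hF) (M.integrable hG)

lemma avg_sum {ι : Type*} {s : Finset ι} {F : ι → 𝕄 → 𝕜} (hF : ∀ i, Tame (F i)) :
    avg P X (fun Y => ∑ i ∈ s, F i Y) = ∑ i ∈ s, avg P X (F i) :=
  integral_finsetSum _ fun i _ => M.integrable (hF i)

lemma measurable_erased (i j : n) : Measurable fun w => Xe :=
  (measurable_erase i j).comp M.measurable_matrix

lemma integrable_erase (hF : Tame F) (i j : n) : Integrable (fun w => F Xe) P := by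
  obtain ⟨C, hC⟩ := hF.2
  exact Integrable.of_bound (hF.1.comp (M.measurable_erased i j)).aestronglyMeasurable C
    (ae_of_all _ fun w => hC _ (M.erase_hermitian w i j))

lemma norm_entry_le_two (w : Ω) (i j : n) : ‖X w i j‖ ≤ 2 := by
  have h1 := M.bound w i j
  have h2 := M.h_le
  nlinarith [norm_nonneg (X w i j)]

lemma integrable_entry_mul {φ : ℂ → 𝕜} (hφ : Continuous φ) (hF : Tame F) (i j : n) :
    Integrable (fun w => φ (X w i j) * F (X w)) P := by
  obtain ⟨C, hC⟩ := hF.2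
  obtain ⟨D, hD⟩ := (isCompact_closedBall (0 : ℂ) 2).exists_bound_of_continuousOn hφ.continuousOn
  refine Integrable.of_bound ((hφ.measurable.comp (M.measurable i j)).mul
    (hF.1.comp M.measurable_matrix)).aestronglyMeasurable (D * C)
    (ae_of_all _ fun w => ?_)
  have h1 := hD (X w i j) (by simpa using M.norm_entry_le_two w i j)
  rw [norm_mul]
  exact mul_le_mul h1 (hC _ (M.isHermitian w)) (norm_nonneg _) ((norm_nonneg _).trans h1)

lemma integrable_entry_erase {φ : ℂ → 𝕜} (hφ : Continuous φ) (hF : Tame F) (i j : n) :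
    Integrable (fun w => φ (X w i j) * F Xe) P := by
  obtain ⟨C, hC⟩ := hF.2
  obtain ⟨D, hD⟩ := (isCompact_closedBall (0 : ℂ) 2).exists_bound_of_continuousOn hφ.continuousOn
  refine Integrable.of_bound ((hφ.measurable.comp (M.measurable i j)).mul
    (hF.1.comp (M.measurable_erased i j))).aestronglyMeasurable (D * C)
    (ae_of_all _ fun w => ?_)
  have h1 := hD (X w i j) (by simpa using M.norm_entry_le_two w i j)
  rw [norm_mul]
  exact mul_le_mul h1 (hC _ (M.erase_hermitian w i j)) (norm_nonneg _) ((norm_nonneg _).trans h1)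

/-- The entry `(i, j)` is independent of the rest of the matrix. -/
lemma integral_entry_mul {φ : ℂ → 𝕜} (hφ : Continuous φ) (hF : Tame F) {i j : n} (hij : i ≠ j) :
    ∫ w, φ (X w i j) * F Xe ∂P = (∫ w, φ (X w i j) ∂P) * ∫ w, F Xe ∂P := by
  have h1 := (M.indep i j hij).comp hφ.measurable hF.1
  exact h1.integral_fun_mul_eq_mul_integral
    (hφ.measurable.comp (M.measurable i j)).aestronglyMeasurable
    (hF.1.comp (M.measurable_erased i j)).aestronglyMeasurable

lemma integrable_entry {φ : ℂ → 𝕜} (hφ : Continuous φ) (i j : n) :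
    Integrable (fun w => φ (X w i j)) P := by
  simpa using M.integrable_entry_mul hφ (Tame.const (n := n) (1 : 𝕜)) i j

/-- The modulus of an entry in units of `h`. -/
lemma exists_scale (w : Ω) (i j : n) : ‖X w i j‖ = h * Xt := by
  have := M.h_pos; field_simp

lemma scale_nonneg (w : Ω) (i j : n) : 0 ≤ Xt := div_nonneg (norm_nonneg _) M.h_pos.le

lemma scale_sq (w : Ω) (i j : n) : h * Xt ^ 2 ≤ 4 := by
  have h0 := M.h_pos
  have h1 := M.bound w i j
  rw [div_pow]
  calc h * (‖X w i j‖ ^ 2 / h ^ 2) ≤ h * (4 * h / h ^ 2) := by gcongr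
    _ = 4 := by field_simp

lemma continuous_scale : Continuous fun x : ℂ => 1 + (‖x‖ / h) ^ 4 := by fun_prop

lemma integral_scale_le (i j : n) : ∫ w, (1 + Xt ^ 4) ∂P ≤ 1 + A := by
  have h0 := M.h_pos
  have hi : Integrable (fun w => ‖X w i j‖ ^ 4) P :=
    M.integrable_entry (φ := fun x : ℂ => ‖x‖ ^ 4) (by fun_prop) i j
  have : ∀ w, 1 + Xt ^ 4 = 1 + ‖X w i j‖ ^ 4 / h ^ 4 := fun w => by rw [div_pow]
  simp only [this]
  rw [integral_add (integrable_const _) (hi.div_const _), integral_div]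
  have h2 : (∫ w, ‖X w i j‖ ^ 4 ∂P) / h ^ 4 ≤ A := by
    rw [div_le_iff₀ (by positivity)]; exact M.fourth i j
  simpa using h2

/-- If a quantity is bounded by the fourth power of an entry times a function of the rest, then
its average is bounded by the average of this function. -/
lemma integral_le_of_le_scale_mul {H : 𝕄 → ℝ} (hH : Tame H)
    (hH0 : ∀ Y : 𝕄, Y.IsHermitian → 0 ≤ H Y) {i j : n} (hij : i ≠ j) {g : Ω → ℝ}
    (hg0 : ∀ w, 0 ≤ g w)
    (hg : ∀ w, g w ≤ (1 + Xt ^ 4) * H Xe) :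
    ∫ w, g w ∂P ≤ (1 + A) * ∫ w, H Xe ∂P := by
  have hi := M.integrable_entry_erase (M.continuous_scale) hH i j
  refine (integral_mono_of_nonneg (ae_of_all _ hg0) hi (ae_of_all _ hg)).trans ?_
  rw [M.integral_entry_mul M.continuous_scale hH hij]
  exact mul_le_mul_of_nonneg_right (M.integral_scale_le i j)
    (integral_nonneg fun w => hH0 _ (M.erase_hermitian w i j))

lemma norm_integral_le_of_le_scale_mul {H : 𝕄 → ℝ} (hH : Tame H)
    (hH0 : ∀ Y : 𝕄, Y.IsHermitian → 0 ≤ H Y) {i j : n} (hij : i ≠ j) {g : Ω → ℂ}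
    (hg : ∀ w, ‖g w‖ ≤ (1 + Xt ^ 4) * H Xe) :
    ‖∫ w, g w ∂P‖ ≤ (1 + A) * ∫ w, H Xe ∂P :=
  (norm_integral_le_integral_norm _).trans
    (M.integral_le_of_le_scale_mul hH hH0 hij (fun _ => norm_nonneg _) hg)

end Model

namespace Family

variable (T : Family n β) (c : β → ℂ)

def cross (i j : n) (Y : 𝕄) : ℂ := ∑ b, c b * (conj (T.left b Y i) * T.right b Y j)

/-- The terms of second order which do not involve the derivative of the oscillating factor. -/
def term₂ (κ : ℝ) (b : β) (j a k : n) (Y : 𝕄) : ℂ := res (T.z b) Y j a * T.right b Y k * T.osc κ c Y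

/-- The terms of second order from the derivative of the oscillating factor. -/
def termOsc (κ : ℝ) (b : β) (i k j : n) (Y : 𝕄) : ℂ := T.cross c i k Y * T.right b Y j * T.osc κ c Y

/-- The terms of third order. -/
def term₃ (κ : ℝ) (b : β) (j a l m k : n) (Y : 𝕄) : ℂ :=
  res (T.z b) Y j a * res (T.z b) Y l m * T.right b Y k * T.osc κ c Y

variable {T c} {A : ℝ}

lemma linLin_eq (X : 𝕄) (i j : n) : T.linLin c X i j =
    X i j * T.cross c i j (erase X i j) + conj (X i j) * T.cross c j i (erase X i j) := by
  unfold linLin cross formLin left right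
  rw [mul_sum, mul_sum, ← sum_add_distrib]
  exact sum_congr rfl fun b _ => by ring

@[fun_prop]
lemma tame_cross (hT : T.Good c A) (i j : n) : Tame (T.cross c i j) :=
  Tame.sum fun b => (Tame.const _).mul ((tame_left hT b i).star.mul (tame_right hT b j))

@[fun_prop]
lemma tame_term₂ (hT : T.Good c A) (κ : ℝ) (b : β) (j a k : n) : Tame (T.term₂ c κ b j a k) :=
  ((tame_res_entry (hT.im_ne b) j a).mul (tame_right hT b k)).mul (tame_osc hT κ)

@[fun_prop]
lemma tame_termOsc (hT : T.Good c A) (κ : ℝ) (b : β) (i k j : n) : Tame (T.termOsc c κ b i k j) :=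
  ((tame_cross hT i k).mul (tame_right hT b j)).mul (tame_osc hT κ)

@[fun_prop]
lemma tame_term₃ (hT : T.Good c A) (κ : ℝ) (b : β) (j a l m k : n) :
    Tame (T.term₃ c κ b j a l m k) :=
  (((tame_res_entry (hT.im_ne b) j a).mul (tame_res_entry (hT.im_ne b) l m)).mul
    (tame_right hT b k)).mul (tame_osc hT κ)

@[fun_prop]
lemma tame_err (hT : T.Good c A) (h : ℝ) (i j : n) :
    Tame fun Y => err h (T.mass Y i) (T.mass Y j) := by
  have h1 := tame_mass hT i
  have h2 := tame_mass hT j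
  unfold err
  exact (((((Tame.const _).mul (h1.add h2))).add ((Tame.const _).mul ((h1.add h2).pow 2))).add
    ((Tame.const _).mul (((h1.add h2).mul (h1.mul h2)).add (h2.pow 3)))).add ((h1.mul h2).pow 2)

lemma err_mass_nonneg {h : ℝ} (hh : 0 ≤ h) (i j : n) (Y : 𝕄) :
    0 ≤ err h (T.mass Y i) (T.mass Y j) :=
  err_nonneg hh (T.mass_nonneg _ _) (T.mass_nonneg _ _)

end Family

open Family

variable {P : Measure Ω} [IsProbabilityMeasure P] {X : Ω → Matrix n n ℂ} {h A σ ρ : ℝ}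
  {T : Family n β} {c : β → ℂ}

namespace Model

/-- Twice the mass of the unperturbed vector bounds the two entries of a vector of the family. -/
lemma norm_add_norm_right_le (T : Family n β) (b : β) (Y : 𝕄) (i j : n) :
    ‖(res (T.z b) Y *ᵥ T.v b) i‖ + ‖(res (T.z b) Y *ᵥ T.v b) j‖ ≤ T.mass Y i + T.mass Y j :=
  add_le_add (T.norm_right_le Y b i) (T.norm_right_le Y b j)

lemma norm_add_norm_left_le (T : Family n β) (b : β) (Y : 𝕄) (i j : n) :
    ‖(res (conj (T.z b)) Y *ᵥ T.u b) i‖ + ‖(res (conj (T.z b)) Y *ᵥ T.u b) j‖ ≤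
      T.mass Y i + T.mass Y j :=
  add_le_add (T.norm_left_le Y b i) (T.norm_left_le Y b j)

lemma norm_right_le_add (T : Family n β) (b : β) (Y : 𝕄) {i j k : n} (hk : k = i ∨ k = j) :
    ‖T.right b Y k‖ ≤ T.mass Y i + T.mass Y j := by
  have := T.mass_nonneg Y i
  have := T.mass_nonneg Y j
  have := T.norm_right_le Y b k
  rcases hk with rfl | rfl <;> linarith

variable (M : Model P X h A σ ρ)
include M

lemma mul_scale_le (w : Ω) (i j : n) : h * Xt ≤ 2 := by
  rw [← M.exists_scale w i j]; exact M.norm_entry_le_two w i j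

lemma expBounds (hT : T.Good c A) (w : Ω) (i j : n) :
    ExpBounds h Xt (T.mass Xe i) (T.mass Xe j) (4 * A ^ 2) (T.osc h⁻¹ c (X w)) (T.osc h⁻¹ c Xe)
      (I * ((h⁻¹ : ℝ) * T.linLin c (X w) i j)) :=
  Family.expBounds (M.isHermitian w) hT i j M.h_pos (M.scale_nonneg w i j) (M.exists_scale w i j)

lemma scales (hT : T.Good c A) (w : Ω) (i j : n) : Scales h Xt (T.mass Xe i) (T.mass Xe j)
      (4 * A ^ 2) :=
  Family.scales (M.isHermitian w) hT i j M.h_pos M.h_le (M.scale_nonneg w i j) (M.scale_sq w i j)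

lemma le_four_sq : A ≤ 4 * A ^ 2 := by nlinarith [M.one_le]

lemma right_sub_le (hT : T.Good c A) (b : β) (w : Ω) (i j k : n) :
    ‖T.right b (X w) k - T.right b Xe k‖ ≤ A * (h * Xt * Xm) := by
  rw [← M.exists_scale w i j]
  have h1 := norm_res_mulVec_sub_le (M.isHermitian w) (hT.im b) i j (T.v b) k
  have h2 := norm_add_norm_right_le T b Xe i j
  have h3 := M.one_le
  exact h1.trans (by gcongr)

lemma left_sub_le (hT : T.Good c A) (b : β) (w : Ω) (i j k : n) :
    ‖T.left b (X w) k - T.left b Xe k‖ ≤ A * (h * Xt * Xm) := by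
  rw [← M.exists_scale w i j]
  have h1 := norm_res_mulVec_sub_le (M.isHermitian w) (abs_im_conj (hT.im b)) i j (T.u b) k
  have h2 := norm_add_norm_left_le T b Xe i j
  have h3 := M.one_le
  exact h1.trans (by gcongr)

lemma right_sub_sub_le (hT : T.Good c A) (b : β) (w : Ω) (i j k : n) :
    ‖T.right b (X w) k - T.right b Xe k - lin1 (T.z b) (X w) i j (T.v b) k‖ ≤
      2 * A ^ 2 * ((h * Xt) ^ 2 *
      Xm) := by
  rw [← M.exists_scale w i j]
  have h1 := norm_second_order_le (M.isHermitian w) (hT.im b) i j (T.v b) k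
  have h2 := norm_add_norm_right_le T b Xe i j
  have h3 := M.one_le
  exact h1.trans (by gcongr)

lemma sum_col_le {Y : 𝕄} (hY : Y.IsHermitian) {z : ℂ} (hz : 1 ≤ A * |z.im|) (a i j : n) :
    ‖(res z Y *ᵥ Pi.single a 1) i‖ + ‖(res z Y *ᵥ Pi.single a 1) j‖ ≤ 2 * A := by
  rw [← res_apply_eq, ← res_apply_eq]
  linarith [norm_res_entry_le hY hz i a, norm_res_entry_le hY hz j a]

lemma entry_sub_le {z : ℂ} (hz : 1 ≤ A * |z.im|) (w : Ω) (i j k a : n) :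
    ‖res z (X w) k a - res z Xe k a‖ ≤ 2 * A ^ 2 * (h * Xt) := by
  rw [← M.exists_scale w i j]
  have h1 := norm_res_mulVec_sub_le (M.isHermitian w) hz i j (Pi.single a 1) k
  have h2 := M.sum_col_le (M.erase_hermitian w i j) hz a i j
  rw [res_apply_eq, res_apply_eq]
  have h3 := M.one_le
  refine h1.trans ?_
  calc _ ≤ A * (‖X w i j‖ * (2 * A)) := by gcongr
    _ = _ := by ring

lemma entry_sub_sub_le {z : ℂ} (hz : 1 ≤ A * |z.im|) (w : Ω) (i j k a : n) :
    ‖res z (X w) k a - res z Xe k a - lin1 z (X w) i j (Pi.single a 1) k‖ ≤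
      4 * A ^ 3 * (h * Xt) ^ 2 := by
  rw [← M.exists_scale w i j]
  have h1 := norm_second_order_le (M.isHermitian w) hz i j (Pi.single a 1) k
  have h2 := M.sum_col_le (M.erase_hermitian w i j) hz a i j
  rw [res_apply_eq, res_apply_eq]
  have h3 := M.one_le
  refine h1.trans ?_
  calc _ ≤ 2 * A ^ 2 * (‖X w i j‖ ^ 2 * (2 * A)) := by gcongr
    _ = _ := by ring

/-- `∫ ξ U + conj ξ V = 0` for functions `U`, `V` of the erased matrix. -/
lemma integral_linear_eq_zero {U V : 𝕄 → ℂ} (hU : Tame U) (hV : Tame V) {i j : n}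
    (hij : i ≠ j) : ∫ w, (X w i j * U Xe + conj (X w i j) * V Xe) ∂P = 0 := by
  have c1 : Continuous fun x : ℂ => x := continuous_id
  have c2 : Continuous fun x : ℂ => conj x := Complex.continuous_conj
  rw [integral_add (M.integrable_entry_erase c1 hU i j)
    (M.integrable_entry_erase c2 hV i j), M.integral_entry_mul c1 hU hij,
    M.integral_entry_mul c2 hV hij, integral_conj, M.mean]
  simp

lemma avg_term₂_sub_le (hT : T.Good c A) (b : β) {i j : n} (hij : i ≠ j) (a k : n)
    (hk : k = i ∨ k = j) :
    h * ‖avg P X (T.term₂ c h⁻¹ b j a k) - ∫ w, T.term₂ c h⁻¹ b j a k Xe ∂P‖ ≤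
      (1 + A) * (500 * (4 * A ^ 2) ^ 8 * ∫ w, Xr ∂P) := by
  have hh := M.h_pos
  have hA := M.one_le
  have hz := hT.im b
  set F := T.term₂ c h⁻¹ b j a k with hF
  have hFt : Tame F := by fun_prop
  let U : 𝕄 → ℂ := fun Y => T.osc h⁻¹ c Y * (res (T.z b) Y j i *
    (res (T.z b) Y *ᵥ Pi.single a 1) j * T.right b Y k + res (T.z b) Y j a *
    (res (T.z b) Y k i * T.right b Y j) + res (T.z b) Y j a * T.right b Y k *
      (I * ((h⁻¹ : ℝ) * T.cross c i j Y)))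
  let V : 𝕄 → ℂ := fun Y => T.osc h⁻¹ c Y * (res (T.z b) Y j j *
    (res (T.z b) Y *ᵥ Pi.single a 1) i * T.right b Y k + res (T.z b) Y j a *
    (res (T.z b) Y k j * T.right b Y i) + res (T.z b) Y j a * T.right b Y k *
      (I * ((h⁻¹ : ℝ) * T.cross c j i Y)))
  have hR := fun x y : n => tame_res_entry (hT.im_ne b) x y
  have hRv := fun x y : n => tame_res_mulVec (hT.im_ne b) (Pi.single x 1) y
  have hr := fun x : n => tame_right hT b x
  have hU : Tame U := by fun_prop
  have hV : Tame V := by fun_prop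
  have hlin := M.integral_linear_eq_zero hU hV hij
  have c1 : Continuous fun x : ℂ => x := continuous_id
  have c2 : Continuous fun x : ℂ => conj x := Complex.continuous_conj
  have hi1 : Integrable (fun w => X w i j * U Xe + conj (X w i j) * V Xe) P :=
    (M.integrable_entry_erase c1 hU i j).add (M.integrable_entry_erase c2 hV i j)
  have hi2 : Integrable (fun w => F (X w) - F Xe) P :=
    (M.integrable hFt).sub (M.integrable_erase hFt i j)
  have hkey : avg P X F - ∫ w, F Xe ∂P = ∫ w, (F (X w) - F Xe -
      (X w i j * U Xe + conj (X w i j) * V Xe)) ∂P := by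
    rw [integral_sub hi2 hi1, hlin, sub_zero,
      integral_sub (M.integrable hFt) (M.integrable_erase hFt i j)]
    rfl
  rw [hkey]
  have hpt : ∀ w, ‖(h : ℂ) * (F (X w) - F Xe - (X w i j * U Xe + conj (X w i j) * V Xe))‖ ≤
      (1 + Xt ^ 4) * (500 * (4 * A ^ 2) ^ 8 * Xr) := fun w => by
    have hs := M.scales hT w i j
    have he := M.expBounds hT w i j
    have a1 := M.entry_sub_le hz w i j j a
    have a2 := M.entry_sub_sub_le hz w i j j a
    have a3 := norm_res_entry_le (M.erase_hermitian w i j) hz j a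
    have w1 := M.right_sub_le hT b w i j k
    have w2 := M.right_sub_sub_le hT b w i j k
    have w3 := norm_right_le_add T b Xe hk
    have hξ2 := M.mul_scale_le w i j
    have hd0 : 0 ≤ h * Xt := mul_nonneg hh.le hs.t0
    have hs0 : 0 ≤ Xm := add_nonneg hs.x0 hs.y0
    set s := Xm
    set d := h * Xt
    set r := res (T.z b) (X w) j a with hr
    set r₀ := res (T.z b) Xe j a with hr₀
    set v := T.right b (X w) k with hv
    set v₀ := T.right b Xe k with hv₀
    set l := lin1 (T.z b) (X w) i j (Pi.single a 1) j with hl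
    set l' := lin1 (T.z b) (X w) i j (T.v b) k with hl'
    have hA6 : A ^ 3 ≤ A ^ 6 := pow_le_pow_right₀ hA (by norm_num)
    have hA3 : 0 ≤ A ^ 3 := by positivity
    have hA23 : A ^ 2 ≤ A ^ 3 := pow_le_pow_right₀ hA (by norm_num)
    have f1 : ‖r * v - r₀ * v₀ - (l * v₀ + r₀ * l')‖ ≤ 6 * (4 * A ^ 2) ^ 3 * (d ^ 2 * s) := by
      rw [show r * v - r₀ * v₀ - (l * v₀ + r₀ * l') =
        (r - r₀ - l) * v₀ + r₀ * (v - v₀ - l') + (r - r₀) * (v - v₀) by ring]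
      refine norm_add₃_le.trans ?_
      simp only [norm_mul]
      calc _ ≤ 4 * A ^ 3 * d ^ 2 * s + A * (2 * A ^ 2 * (d ^ 2 * s)) +
            2 * A ^ 2 * d * (A * (d * s)) := by gcongr
        _ = 8 * A ^ 3 * (d ^ 2 * s) := by ring
        _ ≤ _ := by gcongr ?_ * _; linarith
    have f2 : ‖r * v - r₀ * v₀‖ ≤ 6 * (4 * A ^ 2) ^ 3 * (d * s) := by
      rw [show r * v - r₀ * v₀ = (r - r₀) * (v - v₀) + (r - r₀) * v₀ + r₀ * (v - v₀) by ring]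
      refine norm_add₃_le.trans ?_
      simp only [norm_mul]
      calc _ ≤ 2 * A ^ 2 * d * (A * (d * s)) + 2 * A ^ 2 * d * s + A * (A * (d * s)) := by gcongr
        _ = (2 * A ^ 3 * d + 3 * A ^ 2) * (d * s) := by ring
        _ ≤ (2 * A ^ 3 * 2 + 3 * A ^ 2) * (d * s) := by gcongr
        _ ≤ _ := by gcongr ?_ * _; linarith
    have f3 : ‖r₀ * v₀‖ ≤ 4 * A ^ 2 * s := by
      rw [norm_mul]
      exact mul_le_mul (a3.trans M.le_four_sq) w3 (norm_nonneg _) (by positivity)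
    have hfin := hs.second_order he f1 f2 f3
    rw [norm_mul, norm_real, norm_of_nonneg hh.le]
    refine le_trans (le_of_eq ?_) (hfin.trans (le_of_eq ?_))
    · congr 2
      simp only [hF, term₂, U, V, hr, hr₀, hv, hv₀, hl, hl', linLin_eq, lin1]
      simp only [right, ← res_apply_eq]
      ring
    · ring
  have hE : Tame fun Y => 500 * (4 * A ^ 2) ^ 8 * err h (T.mass Y i) (T.mass Y j) := by fun_prop
  have := M.norm_integral_le_of_le_scale_mul hE
    (fun Y _ => mul_nonneg (by positivity) (err_mass_nonneg hh.le i j Y)) hij hpt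
  rw [integral_const_mul, norm_mul, norm_real, norm_of_nonneg hh.le, integral_const_mul] at this
  exact this

end Model

namespace Model

variable (M : Model P X h A σ ρ)
include M

lemma norm_avg_sub_le {F : 𝕄 → ℂ} (hF : Tame F) (hT : T.Good c A) {i j : n}
    (hij : i ≠ j) {C κ : ℝ} (hC : 0 ≤ C) (hκ : 0 ≤ κ)
    (hpt : ∀ w, κ * ‖F (X w) - F Xe‖ ≤ C * ((1 + Xt ^ 4) * Xr)) :
    κ * ‖avg P X F - ∫ w, F Xe ∂P‖ ≤ (1 + A) * (C * ∫ w, Xr ∂P) := by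
  have hh := M.h_pos
  have hkey : avg P X F - ∫ w, F Xe ∂P = ∫ w, (F (X w) - F Xe) ∂P := by
    rw [integral_sub (M.integrable hF) (M.integrable_erase hF i j)]; rfl
  have hE : Tame fun Y => C * err h (T.mass Y i) (T.mass Y j) := by fun_prop
  have := M.norm_integral_le_of_le_scale_mul (g := fun w => (κ : ℂ) * (F (X w) - F Xe)) hE
    (fun Y _ => mul_nonneg hC (err_mass_nonneg hh.le i j Y)) hij (fun w => by
      rw [norm_mul, norm_real, norm_of_nonneg hκ]
      refine (hpt w).trans (le_of_eq (by ring)))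
  rw [hkey]
  rw [integral_const_mul, norm_mul, norm_real, norm_of_nonneg hκ, integral_const_mul] at this
  exact this

lemma avg_term₃_sub_le (hT : T.Good c A) (b : β) {i j : n} (hij : i ≠ j) (p q l m k : n)
    (hk : k = i ∨ k = j) :
    h ^ 2 * ‖avg P X (T.term₃ c h⁻¹ b p q l m k) - ∫ w, T.term₃ c h⁻¹ b p q l m k Xe ∂P‖ ≤
      (1 + A) * (100 * (4 * A ^ 2) ^ 5 * ∫ w, Xr ∂P) := by
  have hh := M.h_pos
  have hA := M.one_le
  have hz := hT.im b
  refine M.norm_avg_sub_le (tame_term₃ hT _ b p q l m k) hT hij (by positivity) (by positivity)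
    fun w => ?_
  have hs := M.scales hT w i j
  have he := M.expBounds hT w i j
  have w1 := M.right_sub_le hT b w i j k
  have w3 := norm_right_le_add T b Xe hk
  have hξ2 := M.mul_scale_le w i j
  have hd0 : 0 ≤ h * Xt := mul_nonneg hh.le hs.t0
  have a1 := M.entry_sub_le hz w i j p q
  have a2 := M.entry_sub_le hz w i j l m
  have a3 := norm_res_entry_le (M.erase_hermitian w i j) hz p q
  have a4 := norm_res_entry_le (M.erase_hermitian w i j) hz l m
  have a5 := norm_res_entry_le (M.isHermitian w) hz l m
  have hs0 : 0 ≤ Xm := add_nonneg hs.x0 hs.y0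
  have h1 := norm_sub_norm_le (T.right b (X w) k) (T.right b Xe k)
  unfold term₃
  set s := Xm
  set d := h * Xt
  set r := res (T.z b) (X w) p q
  set r₀ := res (T.z b) Xe p q
  set t := res (T.z b) (X w) l m
  set t₀ := res (T.z b) Xe l m
  set v := T.right b (X w) k
  set v₀ := T.right b Xe k
  have w4 : ‖v‖ ≤ 3 * A * s := by
    have h2 : A * (d * s) ≤ A * (2 * s) := by gcongr
    have h3 : s ≤ A * s := le_mul_of_one_le_left hs0 hA
    linarith
  have hA6 : 0 ≤ A ^ 6 := by positivity
  have hA46 : A ^ 4 ≤ A ^ 6 := pow_le_pow_right₀ hA (by norm_num)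
  have hA36 : A ^ 3 ≤ A ^ 6 := pow_le_pow_right₀ hA (by norm_num)
  have hA24 : A ^ 2 ≤ A ^ 4 := pow_le_pow_right₀ hA (by norm_num)
  have hA4 : 0 ≤ A ^ 4 := by positivity
  have f2 : ‖r * t * v - r₀ * t₀ * v₀‖ ≤ 10 * (4 * A ^ 2) ^ 3 * (d * s) := by
    rw [show r * t * v - r₀ * t₀ * v₀ =
      (r - r₀) * t * v + r₀ * (t - t₀) * v + r₀ * t₀ * (v - v₀) by ring]
    refine norm_add₃_le.trans ?_
    simp only [norm_mul]
    calc _ ≤ 2 * A ^ 2 * d * A * (3 * A * s) + A * (2 * A ^ 2 * d) * (3 * A * s) +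
          A * A * (A * (d * s)) := by gcongr
      _ = (12 * A ^ 4 + A ^ 3) * (d * s) := by ring
      _ ≤ _ := by gcongr ?_ * _; linarith
  have f3 : ‖r₀ * t₀ * v₀‖ ≤ (4 * A ^ 2) ^ 2 * s := by
    simp only [norm_mul]
    calc _ ≤ A * A * s := by gcongr
      _ ≤ _ := by gcongr ?_ * _; linarith
  exact hs.first_order he f2 f3

lemma avg_termOsc_sub_le (hT : T.Good c A) (b : β) {i j : n} (hij : i ≠ j) (p q : n)
    (hpq : (p = i ∧ q = j) ∨ (p = j ∧ q = i)) :
    ‖avg P X (T.termOsc c h⁻¹ b p q j) - ∫ w, T.termOsc c h⁻¹ b p q j Xe ∂P‖ ≤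
      (1 + A) * (100 * (4 * A ^ 2) ^ 7 * ∫ w, Xr ∂P) := by
  have hh := M.h_pos
  have hA := M.one_le
  rw [← one_mul ‖_‖]
  refine M.norm_avg_sub_le (tame_termOsc hT _ b p q j) hT hij (by positivity) zero_le_one
    fun w => ?_
  rw [one_mul]
  have hs := M.scales hT w i j
  have he := M.expBounds hT w i j
  have hB := M.le_four_sq
  have hs0 := add_nonneg hs.x0 hs.y0
  have hD : 0 ≤ h * Xt * Xm := mul_nonneg (mul_nonneg hh.le hs.t0) hs0
  have w1 := (M.right_sub_le hT b w i j j).trans (mul_le_mul_of_nonneg_right hB hD)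
  have hb : ∀ b', ‖c b' * (conj (T.left b' (X w) p) * T.right b' (X w) q * T.right b (X w) j *
      T.osc h⁻¹ c (X w) - conj (T.left b' Xe p) * T.right b' Xe q *
        T.right b Xe j * T.osc h⁻¹ c Xe)‖ ≤
      A * (100 * (4 * A ^ 2) ^ 6 * ((1 + Xt ^ 4) *
      Xr)) := fun b' => by
    rw [norm_mul]
    refine mul_le_mul (hT.c_le b') ?_ (norm_nonneg _) (by linarith)
    refine hs.triple he ?_ ((M.right_sub_le hT b' w i j q).trans
      (mul_le_mul_of_nonneg_right hB hD)) w1 ?_ (T.norm_right_le _ b j)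
    · rw [← map_sub, norm_conj]
      exact (M.left_sub_le hT b' w i j p).trans (mul_le_mul_of_nonneg_right hB hD)
    · rw [norm_conj]
      rcases hpq with ⟨rfl, rfl⟩ | ⟨rfl, rfl⟩
      · exact Or.inl ⟨T.norm_left_le _ _ _, T.norm_right_le _ _ _⟩
      · exact Or.inr ⟨T.norm_left_le _ _ _, T.norm_right_le _ _ _⟩
  have key : T.termOsc c h⁻¹ b p q j (X w) - T.termOsc c h⁻¹ b p q j Xe =
      ∑ b', c b' * (conj (T.left b' (X w) p) * T.right b' (X w) q * T.right b (X w) j *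
      T.osc h⁻¹ c (X w) - conj (T.left b' Xe p) * T.right b' Xe q *
        T.right b Xe j * T.osc h⁻¹ c Xe) := by
    unfold termOsc cross
    rw [sum_mul, sum_mul, sum_mul, sum_mul, ← sum_sub_distrib]
    exact sum_congr rfl fun b' _ => by ring
  rw [key]
  refine (norm_sum_le _ _).trans ((sum_le_sum fun b' _ => hb b').trans ?_)
  rw [sum_const, card_univ, nsmul_eq_mul]
  have hW : 0 ≤ (1 + Xt ^ 4) * Xr := mul_nonneg (by positivity) (err_mass_nonneg hh.le i j _)
  set W := (1 + Xt ^ 4) * Xr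
  calc (card β : ℝ) * (A * (100 * (4 * A ^ 2) ^ 6 * W))
      ≤ A * (A * (100 * (4 * A ^ 2) ^ 6 * W)) := by
        have := hT.card_le
        gcongr
    _ = 100 * (4 * A ^ 2) ^ 6 * A ^ 2 * W := by ring
    _ ≤ 100 * (4 * A ^ 2) ^ 6 * (4 * A ^ 2) * W := by
      have : A ^ 2 ≤ 4 * A ^ 2 := by nlinarith
      gcongr
    _ = _ := by ring

lemma integral_pow_le (k : ℕ) (hk : k = 1 ∨ k = 2 ∨ k = 3) (i j : n) :
    ∫ w, ‖X w i j‖ ^ k ∂P ≤ (1 + A) * h ^ k := by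
  have hh := M.h_pos
  have hi : Integrable (fun w => 1 + Xt ^ 4) P := M.integrable_entry (M.continuous_scale) i j
  have hpt : ∀ w, ‖X w i j‖ ^ k ≤ h ^ k * (1 + Xt ^ 4) := fun w => by
    have h1 := M.scale_nonneg w i j
    have h2 : Xt ^ k ≤ 1 + Xt ^ 4 := by
      rcases hk with rfl | rfl | rfl
      · simpa using le_one_add_pow_four _
      · exact sq_le_one_add_pow_four _
      · exact cube_le_one_add_pow_four h1
    calc ‖X w i j‖ ^ k = h ^ k * Xt ^ k := by rw [← mul_pow, ← M.exists_scale w i j]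
      _ ≤ _ := by gcongr
  refine (integral_mono_of_nonneg (ae_of_all _ fun w => by positivity) (hi.const_mul _)
    (ae_of_all _ hpt)).trans ?_
  rw [integral_const_mul, mul_comm]
  exact mul_le_mul_of_nonneg_right (M.integral_scale_le i j) (by positivity)

lemma norm_integral_entry_le (k : ℕ) (hk : k = 1 ∨ k = 2 ∨ k = 3) (i j : n) {φ : ℂ → ℂ}
    (hφ : ∀ x, ‖φ x‖ = ‖x‖ ^ k) : ‖∫ w, φ (X w i j) ∂P‖ ≤ (1 + A) * h ^ k := by
  refine (norm_integral_le_integral_norm _).trans ?_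
  simp only [hφ]
  exact M.integral_pow_le k hk i j

end Model

/-- The second and third moments of the entries. -/
def mom (P : Measure Ω) (X : Ω → 𝕄) (k l : ℕ) (i j : n) : ℂ :=
  ∫ w, X w i j ^ k * conj (X w i j) ^ l ∂P

/-- The expansion of `E[ξ w_j e]`, for functionals `E₂`, `Eₒ`, `E₃` applied to its terms. -/
def expansionTerm (P : Measure Ω) (X : Ω → 𝕄) (h : ℝ) (i j : n) (E₂ Eₒ : n → n → ℂ)
    (E₃ : n → n → n → n → n → ℂ) : ℂ :=
  mom P X 2 0 i j * E₂ i j + mom P X 1 1 i j * E₂ j i +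
    I * (h⁻¹ : ℝ) * (mom P X 2 0 i j * Eₒ i j + mom P X 1 1 i j * Eₒ j i) +
    (mom P X 3 0 i j * E₃ j i j i j + mom P X 2 1 i j * E₃ j i j j i +
      mom P X 2 1 i j * E₃ j j i i j + mom P X 1 2 i j * E₃ j j i j i)

namespace Model

variable (M : Model P X h A σ ρ)
include M

lemma norm_mom_le (k l : ℕ) (hk : k + l = 1 ∨ k + l = 2 ∨ k + l = 3) (i j : n) :
    ‖mom P X k l i j‖ ≤ (1 + A) * h ^ (k + l) :=
  M.norm_integral_entry_le (k + l) hk i j (φ := fun x => x ^ k * conj x ^ l) fun x => by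
    simp [pow_add]

lemma integral_mom_mul {F : 𝕄 → ℂ} (hF : Tame F) (k l : ℕ) {i j : n} (hij : i ≠ j) :
    ∫ w, X w i j ^ k * conj (X w i j) ^ l * F Xe ∂P = mom P X k l i j * ∫ w, F Xe ∂P :=
  M.integral_entry_mul (φ := fun x => x ^ k * conj x ^ l) (by fun_prop) hF hij

lemma integrable_mom_mul {F : 𝕄 → ℂ} (hF : Tame F) (k l : ℕ) (i j : n) :
    Integrable (fun w => X w i j ^ k * conj (X w i j) ^ l * F Xe) P :=
  M.integrable_entry_erase (φ := fun x => x ^ k * conj x ^ l) (by fun_prop) hF i j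

lemma norm_expansion_erase_le (hT : T.Good c A) (b : β) {i j : n} (hij : i ≠ j) :
    ‖∫ w, X w i j * (T.right b (X w) j * T.osc h⁻¹ c (X w)) ∂P -
      expansionTerm P X h i j (fun a k => ∫ w, T.term₂ c h⁻¹ b j a k Xe ∂P)
        (fun p q => ∫ w, T.termOsc c h⁻¹ b p q j Xe ∂P)
        (fun p q l m k => ∫ w, T.term₃ c h⁻¹ b p q l m k Xe ∂P)‖ ≤
      h * ((1 + A) * (500 * (4 * A ^ 2) ^ 6 * ∫ w, Xr ∂P)) := by
  have hh := M.h_pos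
  have hA := M.one_le
  have hz := hT.im b
  have t2 := fun a k => tame_term₂ hT h⁻¹ b j a k
  have tO := fun p q => tame_termOsc hT h⁻¹ b p q j
  have t3 := fun p q l m k => tame_term₃ hT h⁻¹ b p q l m k
  have hw : Tame fun Y => T.right b Y j * T.osc h⁻¹ c Y := by fun_prop
  have c1 : Continuous fun x : ℂ => x := continuous_id
  have hI : Integrable (fun w => X w i j * (T.right b (X w) j * T.osc h⁻¹ c (X w))) P :=
    M.integrable_entry_mul c1 hw i j
  let G : Ω → ℂ := fun w =>
    X w i j ^ 1 * conj (X w i j) ^ 0 * (T.right b Xe j * T.osc h⁻¹ c Xe) +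
    (X w i j ^ 2 * conj (X w i j) ^ 0 * T.term₂ c h⁻¹ b j i j Xe +
    X w i j ^ 1 * conj (X w i j) ^ 1 * T.term₂ c h⁻¹ b j j i Xe +
    I * (h⁻¹ : ℝ) * (X w i j ^ 2 * conj (X w i j) ^ 0 * T.termOsc c h⁻¹ b i j j Xe +
      X w i j ^ 1 * conj (X w i j) ^ 1 * T.termOsc c h⁻¹ b j i j Xe) +
    (X w i j ^ 3 * conj (X w i j) ^ 0 * T.term₃ c h⁻¹ b j i j i j Xe +
    X w i j ^ 2 * conj (X w i j) ^ 1 * T.term₃ c h⁻¹ b j i j j i Xe +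
    X w i j ^ 2 * conj (X w i j) ^ 1 * T.term₃ c h⁻¹ b j j i i j Xe +
    X w i j ^ 1 * conj (X w i j) ^ 2 * T.term₃ c h⁻¹ b j j i j i Xe))
  have i0 := M.integrable_mom_mul hw 1 0 i j
  have i1 := M.integrable_mom_mul (t2 i j) 2 0 i j
  have i2 := M.integrable_mom_mul (t2 j i) 1 1 i j
  have i3 := M.integrable_mom_mul (tO i j) 2 0 i j
  have i4 := M.integrable_mom_mul (tO j i) 1 1 i j
  have i5 := M.integrable_mom_mul (t3 j i j i j) 3 0 i j
  have i6 := M.integrable_mom_mul (t3 j i j j i) 2 1 i j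
  have i7 := M.integrable_mom_mul (t3 j j i i j) 2 1 i j
  have i8 := M.integrable_mom_mul (t3 j j i j i) 1 2 i j
  have hG : Integrable G P := by fun_prop
  have hGint : ∫ w, G w ∂P = expansionTerm P X h i j (fun a k => ∫ w, T.term₂ c h⁻¹ b j a k Xe ∂P)
        (fun p q => ∫ w, T.termOsc c h⁻¹ b p q j Xe ∂P)
        (fun p q l m k => ∫ w, T.term₃ c h⁻¹ b p q l m k Xe ∂P) := by
    have hmean : mom P X 1 0 i j = 0 := by simpa [mom] using M.mean i j
    simp (disch := fun_prop) only [G, integral_add, integral_const_mul,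
      M.integral_mom_mul (t2 _ _) _ _ hij, M.integral_mom_mul (tO _ _) _ _ hij,
      M.integral_mom_mul (t3 _ _ _ _ _) _ _ hij]
    rw [M.integral_mom_mul hw 1 0 hij, hmean, zero_mul, zero_add]
    rfl
  rw [← hGint, ← integral_sub hI hG]
  have hE : Tame fun Y => h * (500 * (4 * A ^ 2) ^ 6 * err h (T.mass Y i) (T.mass Y j)) := by fun_prop
  have := M.norm_integral_le_of_le_scale_mul (g := fun w =>
    X w i j * (T.right b (X w) j * T.osc h⁻¹ c (X w)) - G w) hE
    (fun Y _ => mul_nonneg hh.le (mul_nonneg (by positivity) (err_mass_nonneg hh.le i j Y)))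
    hij (fun w => ?_)
  · refine this.trans (le_of_eq ?_)
    rw [integral_const_mul, integral_const_mul]
    ring
  have hs := M.scales hT w i j
  have he := M.expBounds hT w i j
  have hB := M.le_four_sq
  have hB1 : (1:ℝ) ≤ 4 * A ^ 2 := hs.B1
  have hs0 := add_nonneg hs.x0 hs.y0
  have w1 := M.right_sub_le hT b w i j j
  have hD : 0 ≤ h * Xt * Xm := mul_nonneg (mul_nonneg hh.le hs.t0) hs0
  have w1' := w1.trans (mul_le_mul_of_nonneg_right hB hD)
  have w3 := norm_third_order_le (M.isHermitian w) hz i j (T.v b) j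
  have w4 : ‖T.right b (X w) j - T.right b Xe j - lin1 (T.z b) (X w) i j (T.v b) j
      - lin2 (T.z b) (X w) i j (T.v b) j‖ ≤ 4 * (4 * A ^ 2) ^ 3 * ((h * Xt) ^ 3 *
      Xm) := by
    refine w3.trans ?_
    have h2 := norm_add_norm_right_le T b Xe i j
    rw [← M.exists_scale w i j]
    gcongr
  have hfin := hs.third_order (l := lin1 (T.z b) (X w) i j (T.v b) j)
    (q := lin2 (T.z b) (X w) i j (T.v b) j) he w4 w1' (T.norm_right_le _ b j)
  rw [show X w i j * (T.right b (X w) j * T.osc h⁻¹ c (X w)) - G w =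
      X w i j * (T.right b (X w) j * T.osc h⁻¹ c (X w) - T.osc h⁻¹ c Xe *
      (T.right b Xe j + lin1 (T.z b) (X w) i j (T.v b) j +
        T.right b Xe j * (I * ((h⁻¹ : ℝ) * T.linLin c (X w) i j)) +
        lin2 (T.z b) (X w) i j (T.v b) j)) by
    simp only [G, linLin_eq, lin2, lin1, term₂, termOsc, term₃, right]
    ring, norm_mul, M.exists_scale w i j, mul_assoc]
  exact (mul_le_mul_of_nonneg_left hfin hh.le).trans_eq (by rw [← M.exists_scale w i j]; ring)

end Model

/-- The main terms of the expansion of `E[ξ w_j e]` for the entry `ξ = X i j`. -/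
def mainTerm (P : Measure Ω) (X : Ω → 𝕄) (h : ℝ) (T : Family n β) (c : β → ℂ)
    (b : β) (i j : n) : ℂ :=
  expansionTerm P X h i j (fun a k => avg P X (T.term₂ c h⁻¹ b j a k))
    (fun p q => avg P X (T.termOsc c h⁻¹ b p q j))
    (fun p q l m k => avg P X (T.term₃ c h⁻¹ b p q l m k))

namespace Model

variable (M : Model P X h A σ ρ)
include M

lemma norm_expansionTerm_sub_le {E : ℝ} (hE : 0 ≤ E) {E₂ E₂' Eₒ Eₒ' : n → n → ℂ}
    {E₃ E₃' : n → n → n → n → n → ℂ} {i j : n}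
    (h₂ : ∀ a k, k = i ∨ k = j → h * ‖E₂ a k - E₂' a k‖ ≤ (1 + A) * (500 * (4 * A ^ 2) ^ 8 * E))
    (hₒ : ∀ p q, p = i ∧ q = j ∨ p = j ∧ q = i →
      ‖Eₒ p q - Eₒ' p q‖ ≤ (1 + A) * (100 * (4 * A ^ 2) ^ 7 * E))
    (h₃ : ∀ p q l m k, k = i ∨ k = j →
      h ^ 2 * ‖E₃ p q l m k - E₃' p q l m k‖ ≤ (1 + A) * (100 * (4 * A ^ 2) ^ 5 * E)) :
    ‖expansionTerm P X h i j E₂ Eₒ E₃ - expansionTerm P X h i j E₂' Eₒ' E₃'‖ ≤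
      1600 * (4 * A ^ 2) ^ 8 * ((1 + A) ^ 2 * (h * E)) := by
  have hh := M.h_pos
  have hA := M.one_le
  have hB1 : 1 ≤ 4 * A ^ 2 := by nlinarith
  set B := 4 * A ^ 2
  have term : ∀ (q : ℕ) {p x : ℂ} {D : ℝ}, ‖p‖ ≤ (1 + A) * h * h ^ q →
      h ^ q * ‖x‖ ≤ (1 + A) * (D * E) → ‖p * x‖ ≤ D * ((1 + A) ^ 2 * (h * E)) :=
      fun q p x D h1 h2 => by
    rw [norm_mul]
    calc _ ≤ (1 + A) * h * h ^ q * ‖x‖ := by gcongr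
      _ = (1 + A) * h * (h ^ q * ‖x‖) := by ring
      _ ≤ (1 + A) * h * ((1 + A) * (D * E)) := by gcongr
      _ = _ := by ring
  have m : ∀ k l q, k + l = q + 1 → q ≤ 2 → ‖mom P X k l i j‖ ≤ (1 + A) * h * h ^ q :=
    fun k l q hk hq => (M.norm_mom_le k l (by omega) i j).trans_eq (by rw [hk]; ring)
  have o : ∀ k l, k + l = 2 → ‖I * (h⁻¹ : ℝ) * mom P X k l i j‖ ≤ (1 + A) * h * h ^ 0 :=
      fun k l hk => by
    have := m k l 1 hk (by norm_num)
    simp only [norm_mul, Complex.norm_I, norm_real, norm_of_nonneg (inv_nonneg.2 hh.le), one_mul]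
    calc _ ≤ h⁻¹ * ((1 + A) * h * h ^ 1) := by gcongr
      _ = _ := by field_simp
  have ho := fun p q hp => (by rw [pow_zero, one_mul]; exact hₒ p q hp :
    h ^ 0 * ‖Eₒ p q - Eₒ' p q‖ ≤ (1 + A) * (100 * B ^ 7 * E))
  rw [show expansionTerm P X h i j E₂ Eₒ E₃ - expansionTerm P X h i j E₂' Eₒ' E₃' =
    mom P X 2 0 i j * (E₂ i j - E₂' i j) + mom P X 1 1 i j * (E₂ j i - E₂' j i) +
    I * (h⁻¹ : ℝ) * mom P X 2 0 i j * (Eₒ i j - Eₒ' i j) +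
    I * (h⁻¹ : ℝ) * mom P X 1 1 i j * (Eₒ j i - Eₒ' j i) +
    mom P X 3 0 i j * (E₃ j i j i j - E₃' j i j i j) +
    mom P X 2 1 i j * (E₃ j i j j i - E₃' j i j j i) +
    mom P X 2 1 i j * (E₃ j j i i j - E₃' j j i i j) +
    mom P X 1 2 i j * (E₃ j j i j i - E₃' j j i j i) by unfold expansionTerm; ring]
  have two := fun k l hk a b hb => term 1 (m k l 1 hk (by norm_num)) (by rw [pow_one]; exact h₂ a b hb :
    h ^ 1 * ‖E₂ a b - E₂' a b‖ ≤ (1 + A) * (500 * B ^ 8 * E))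
  have thr := fun k l hk p q r s t ht => term 2 (m k l 2 hk le_rfl) (h₃ p q r s t ht)
  refine (norm_add_le_of_le (norm_add_le_of_le (norm_add_le_of_le (norm_add_le_of_le
    (norm_add_le_of_le (norm_add_le_of_le (norm_add_le_of_le
    (two 2 0 rfl i j (.inr rfl)) (two 1 1 rfl j i (.inl rfl)))
    (term 0 (o 2 0 rfl) (ho i j (.inl ⟨rfl, rfl⟩)))) (term 0 (o 1 1 rfl) (ho j i (.inr ⟨rfl, rfl⟩))))
    (thr 3 0 rfl j i j i j (.inr rfl))) (thr 2 1 rfl j i j j i (.inl rfl)))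
    (thr 2 1 rfl j j i i j (.inr rfl))) (thr 1 2 rfl j j i j i (.inl rfl))).trans ?_
  simp only [← add_mul]
  have p5 : B ^ 5 ≤ B ^ 8 := pow_le_pow_right₀ hB1 (by norm_num)
  have p7 : B ^ 7 ≤ B ^ 8 := pow_le_pow_right₀ hB1 (by norm_num)
  gcongr
  linarith

lemma norm_expansion_le_erase (hT : T.Good c A) (b : β) {i j : n} (hij : i ≠ j) :
    ‖∫ w, X w i j * (T.right b (X w) j * T.osc h⁻¹ c (X w)) ∂P - mainTerm P X h T c b i j‖ ≤
      2100 * (1 + A) ^ 2 * (4 * A ^ 2) ^ 8 * (h * ∫ w, Xr ∂P) := by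
  have hh := M.h_pos
  have hA := M.one_le
  have hE : 0 ≤ ∫ w, Xr ∂P := integral_nonneg fun w => err_mass_nonneg hh.le i j _
  have h1 := M.norm_expansionTerm_sub_le hE (fun a k => M.avg_term₂_sub_le hT b hij a k)
    (M.avg_termOsc_sub_le hT b hij) (M.avg_term₃_sub_le hT b hij)
  rw [norm_sub_rev] at h1
  refine (norm_sub_le_norm_sub_add_norm_sub _ _ _).trans
    ((add_le_add (M.norm_expansion_erase_le hT b hij) h1).trans ?_)
  generalize ∫ w, Xr ∂P = E at *
  calc _ ≤ h * ((1 + A) ^ 2 * (500 * (4 * A ^ 2) ^ 8 * E)) +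
        1600 * (4 * A ^ 2) ^ 8 * ((1 + A) ^ 2 * (h * E)) := by
        gcongr
        exacts [by nlinarith, by nlinarith, by norm_num]
    _ = _ := by ring

/-- Powers of an entry can be averaged out against functions that depend weakly on this entry. -/
lemma integral_scale_mul_le {S : 𝕄 → ℝ} (hS : Tame S) {K : ℝ} (hK : 0 ≤ K) {i j : n}
    (hij : i ≠ j) (hS0 : ∀ Y : 𝕄, Y.IsHermitian → 0 ≤ S Y)
    (h1 : ∀ w, S (X w) ≤ K * S Xe) (h2 : ∀ w, S Xe ≤ K * S (X w)) :
    ∫ w, (1 + Xt ^ 4) * S (X w) ∂P ≤ (1 + A) * K ^ 2 * ∫ w, S (X w) ∂P := by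
  have hA := M.one_le
  refine (M.integral_le_of_le_scale_mul (H := fun Y => K * S Y) ((Tame.const K).mul hS)
    (fun Y hY => mul_nonneg hK (hS0 Y hY)) hij (fun w => mul_nonneg (by positivity)
    (hS0 _ (M.isHermitian w))) (fun w => mul_le_mul_of_nonneg_left (h1 w) (by positivity))).trans ?_
  rw [mul_assoc]
  refine mul_le_mul_of_nonneg_left ?_ (by linarith)
  rw [← integral_const_mul]
  refine integral_mono ((M.integrable_erase hS i j).const_mul _) ((M.integrable hS).const_mul _)
    fun w => ?_
  calc K * S Xe ≤ K * (K * S (X w)) := mul_le_mul_of_nonneg_left (h2 w) hK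
    _ = K ^ 2 * S (X w) := by ring

lemma mass_add_le_erase (hT : T.Good c A) (w : Ω) (i j : n) : T.mass (X w) i + T.mass (X w) j ≤
      5 * A * Xm := by
  have h1 := mass_le_mass_erase (M.isHermitian w) hT i j i
  have h2 := mass_le_mass_erase (M.isHermitian w) hT i j j
  have h3 := M.norm_entry_le_two w i j
  have hA := M.one_le
  have hs := add_nonneg (T.mass_nonneg Xe i) (T.mass_nonneg Xe j)
  set s := Xm
  have h4 : A * (‖X w i j‖ * s) ≤ A * (2 * s) := by gcongr
  have h5 : s ≤ A * s := le_mul_of_one_le_left hs hA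
  linarith

lemma erase_mass_add_le (hT : T.Good c A) (w : Ω) (i j : n) : Xm ≤
      5 * A * (T.mass (X w) i + T.mass (X w) j) := by
  have h1 := mass_erase_le_mass (M.isHermitian w) hT i j i
  have h2 := mass_erase_le_mass (M.isHermitian w) hT i j j
  have h3 := M.norm_entry_le_two w i j
  have hA := M.one_le
  have hs := add_nonneg (T.mass_nonneg (X w) i) (T.mass_nonneg (X w) j)
  set s := T.mass (X w) i + T.mass (X w) j
  have h4 : A * (‖X w i j‖ * s) ≤ A * (2 * s) := by gcongr
  have h5 : s ≤ A * s := le_mul_of_one_le_left hs hA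
  linarith

lemma integral_err_erase_le (hT : T.Good c A) {i j : n} (hij : i ≠ j) : ∫ w, Xr ∂P ≤
      20000000 * (1 + A) * A ^ 12 * ∫ w, err h (T.mass (X w) i) (T.mass (X w) j) ∂P := by
  have hh := M.h_pos
  have hA := M.one_le
  have hs2 : Tame fun Y => (T.mass Y i + T.mass Y j) ^ 2 := by fun_prop
  have hw := M.integral_scale_mul_le hs2 (K := (5 * A) ^ 2) (by positivity) hij
    (fun Y _ => by positivity) (fun w => by
      rw [← mul_pow]
      exact pow_le_pow_left₀ (add_nonneg (T.mass_nonneg _ i) (T.mass_nonneg _ j))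
        (M.mass_add_le_erase hT w i j) 2)
    (fun w => by
      rw [← mul_pow]
      exact pow_le_pow_left₀ (add_nonneg (T.mass_nonneg _ i) (T.mass_nonneg _ j))
        (M.erase_mass_add_le hT w i j) 2)
  have hpt : ∀ w, Xr ≤
      1000 * A ^ 4 * (err h (T.mass (X w) i) (T.mass (X w) j) + 20 * A ^ 4 * h ^ 2 *
        ((1 + Xt ^ 4) * (T.mass (X w) i + T.mass (X w) j) ^ 2)) := fun w => by
    have h1 := mass_erase_le_mass (M.isHermitian w) hT i j i
    have h2 := mass_erase_le_mass (M.isHermitian w) hT i j j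
    refine (err_le_of_near hh.le M.h_le (T.mass_nonneg (X w) i) (T.mass_nonneg (X w) j)
      (T.mass_nonneg _ _) (T.mass_nonneg _ _) hA (norm_nonneg (X w i j))
      (M.norm_entry_le_two w i j) h1 h2).trans ?_
    have hs0 := add_nonneg (T.mass_nonneg (X w) i) (T.mass_nonneg (X w) j)
    have hs4 : T.mass (X w) i + T.mass (X w) j ≤ 4 * A ^ 2 := by
      linarith [mass_le (M.isHermitian w) hT i, mass_le (M.isHermitian w) hT j]
    have hξ := M.exists_scale w i j
    have ht := M.scale_nonneg w i j
    set s := T.mass (X w) i + T.mass (X w) j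
    set t := Xt
    rw [hξ, add_assoc]
    refine mul_le_mul_of_nonneg_left (add_le_add le_rfl ?_) (by positivity)
    have b1 : t ≤ 1 + t ^ 4 := le_one_add_pow_four t
    have b2 : t ^ 2 ≤ 1 + t ^ 4 := sq_le_one_add_pow_four t
    have hA24 : A ^ 2 ≤ A ^ 4 := pow_le_pow_right₀ hA (by norm_num)
    calc h * (h * t * s ^ 3) + (h * t) ^ 2 * s ^ 4
        = h ^ 2 * s ^ 2 * (t * s) + h ^ 2 * s ^ 2 * (t ^ 2 * s ^ 2) := by ring
      _ ≤ h ^ 2 * s ^ 2 * ((1 + t ^ 4) * (4 * A ^ 4)) +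
          h ^ 2 * s ^ 2 * ((1 + t ^ 4) * (4 * A ^ 2) ^ 2) := by
        have : s ≤ 4 * A ^ 4 := by linarith
        gcongr
      _ = _ := by ring
  have i1 : Integrable (fun w => err h (T.mass (X w) i) (T.mass (X w) j)) P :=
    M.integrable (tame_err hT h i j)
  have i2 : Integrable (fun w => (1 + Xt ^ 4) * (T.mass (X w) i + T.mass (X w) j) ^ 2) P :=
    M.integrable_entry_mul M.continuous_scale hs2 i j
  have hmono := integral_mono (M.integrable_erase (tame_err hT h i j) i j)
    ((i1.add (i2.const_mul (20 * A ^ 4 * h ^ 2))).const_mul (1000 * A ^ 4)) hpt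
  simp only [Pi.add_apply] at hmono
  rw [integral_const_mul, integral_add i1 (i2.const_mul _), integral_const_mul] at hmono
  have hE2 : h ^ 2 * ∫ w, (T.mass (X w) i + T.mass (X w) j) ^ 2 ∂P ≤
      ∫ w, err h (T.mass (X w) i) (T.mass (X w) j) ∂P := by
    rw [← integral_const_mul]
    exact integral_mono ((M.integrable hs2).const_mul _) i1 fun w =>
      err_ge2 hh.le (T.mass_nonneg _ _) (T.mass_nonneg _ _)
  have hE0 : 0 ≤ ∫ w, err h (T.mass (X w) i) (T.mass (X w) j) ∂P :=
    integral_nonneg fun w => err_mass_nonneg hh.le i j _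
  set E := ∫ w, err h (T.mass (X w) i) (T.mass (X w) j) ∂P
  set V := ∫ w, (T.mass (X w) i + T.mass (X w) j) ^ 2 ∂P
  refine hmono.trans ?_
  calc _ ≤ 1000 * A ^ 4 * (E + 20 * A ^ 4 * h ^ 2 * ((1 + A) * ((5 * A) ^ 2) ^ 2 * V)) := by gcongr
    _ = 1000 * A ^ 4 * (E + 12500 * A ^ 8 * (1 + A) * (h ^ 2 * V)) := by ring
    _ ≤ 1000 * A ^ 4 * (A ^ 8 * (1 + A) * E + 12500 * A ^ 8 * (1 + A) * E) := by
      have h8 : 1 ≤ A ^ 8 * (1 + A) := one_le_mul_of_one_le_of_one_le (one_le_pow₀ hA) (by linarith)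
      have : E ≤ A ^ 8 * (1 + A) * E := le_mul_of_one_le_left hE0 h8
      gcongr
    _ = 12501000 * ((1 + A) * A ^ 12 * E) := by ring
    _ ≤ 20000000 * ((1 + A) * A ^ 12 * E) := by
      have : 0 ≤ (1 + A) * A ^ 12 * E := by positivity
      linarith
    _ = _ := by ring

end Model

/-- The constant in the expansion of `E[ξ w_j e]`. -/
def expConst (A : ℝ) : ℝ := 2100 * (1 + A) ^ 2 * (4 * A ^ 2) ^ 8 * (20000000 * (1 + A) * A ^ 12)

lemma expConst_nonneg {A : ℝ} (hA : 1 ≤ A) : 0 ≤ expConst A := by unfold expConst; positivity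

namespace Model

variable (M : Model P X h A σ ρ)
include M

/-- The expansion of `E[ξ w_j e]` in terms of the moments of `ξ`. -/
theorem norm_expansion_le (hT : T.Good c A) (b : β) {i j : n} (hij : i ≠ j) :
    ‖∫ w, X w i j * (T.right b (X w) j * T.osc h⁻¹ c (X w)) ∂P - mainTerm P X h T c b i j‖ ≤
      expConst A * (h * ∫ w, err h (T.mass (X w) i) (T.mass (X w) j) ∂P) := by
  have hh := M.h_pos
  have hA := M.one_le
  refine (M.norm_expansion_le_erase hT b hij).trans ?_
  have := M.integral_err_erase_le hT hij
  unfold expConst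
  calc _ ≤ 2100 * (1 + A) ^ 2 * (4 * A ^ 2) ^ 8 * (h * (20000000 * (1 + A) * A ^ 12 *
        ∫ w, err h (T.mass (X w) i) (T.mass (X w) j) ∂P)) := by gcongr
    _ = _ := by ring

end Model

/-- The total size of the error terms. -/
lemma sum_err_le {h η K : ℝ} (hh : 0 < h) (h1 : h ≤ 1) (hcard : (card n : ℝ) * h ^ 2 = 1)
    (hK : 1 ≤ K) (hη : 0 ≤ η) {q r : n → ℝ} (hq0 : ∀ i, 0 ≤ q i) (hr0 : ∀ i, 0 ≤ r i)
    (hqη : ∀ i, q i ≤ η) (hq : ∑ i, q i ^ 2 ≤ 1) (hr : ∑ i, r i ^ 2 ≤ K) :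
    ∑ i, ∑ j, q i * err h (r i) (r j) ≤ 5 * K ^ 2 * (h + η + ∑ j, r j ^ 3) := by
  have hl1 : ∀ x : n → ℝ, (∀ i, 0 ≤ x i) → ∀ L : ℝ, 1 ≤ L → ∑ i, x i ^ 2 ≤ L →
      h * ∑ i, x i ≤ L := fun x hx L hL hxL => by
    have := sq_sum_le_card_mul_sum_sq (s := univ) (f := x)
    rw [card_univ] at this
    refine le_of_sq_le_sq ?_ (by linarith)
    calc _ = h ^ 2 * (∑ i, x i) ^ 2 := mul_pow _ _ _
      _ ≤ h ^ 2 * (card n * ∑ i, x i ^ 2) := by gcongr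
      _ = (card n * h ^ 2) * ∑ i, x i ^ 2 := by ring
      _ ≤ L := by rwa [hcard, one_mul]
      _ ≤ L ^ 2 := by nlinarith
  have a1 : h * ∑ i, q i ≤ 1 := hl1 q hq0 1 le_rfl hq
  have a2 : h * ∑ i, r i ≤ K := hl1 r hr0 K hK hr
  have a3 : ∑ i, q i * r i ≤ K := by
    have : ∑ i, q i * r i ≤ ∑ i, (q i ^ 2 + r i ^ 2) / 2 :=
      sum_le_sum fun i _ => by nlinarith [sq_nonneg (q i - r i)]
    rw [← Finset.sum_div, sum_add_distrib] at this
    linarith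
  have a4 : ∑ i, q i * r i ^ 2 ≤ η * K := by
    calc ∑ i, q i * r i ^ 2 ≤ ∑ i, η * r i ^ 2 :=
          sum_le_sum fun i _ => mul_le_mul_of_nonneg_right (hqη i) (sq_nonneg _)
      _ ≤ η * K := by rw [← mul_sum]; gcongr
  have s0 : 0 ≤ ∑ i, q i := sum_nonneg fun i _ => hq0 i
  have s1 : 0 ≤ ∑ i, r i := sum_nonneg fun i _ => hr0 i
  have s2 : 0 ≤ ∑ i, r i ^ 2 := sum_nonneg fun i _ => sq_nonneg _
  have s3 : 0 ≤ ∑ i, r i ^ 3 := sum_nonneg fun i _ => pow_nonneg (hr0 i) _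
  have s4 : 0 ≤ ∑ i, q i * r i := sum_nonneg fun i _ => mul_nonneg (hq0 i) (hr0 i)
  have s5 : 0 ≤ ∑ i, q i * r i ^ 2 := sum_nonneg fun i _ => mul_nonneg (hq0 i) (sq_nonneg _)
  have hpt : ∀ i j, q i * err h (r i) (r j) ≤ h ^ 3 * (q i * r i) + h ^ 3 * (q i * r j) +
      2 * h ^ 2 * (q i * r i ^ 2) + 2 * h ^ 2 * (q i * r j ^ 2) +
      h * (q i * r i ^ 2 * r j) + h * (q i * r i * r j ^ 2) + h * (q i * r j ^ 3) +
      q i * r i ^ 2 * r j ^ 2 := fun i j => by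
    have := mul_nonneg (hq0 i) (mul_nonneg (sq_nonneg h) (sq_nonneg (r i - r j)))
    unfold err
    nlinarith
  refine (sum_le_sum fun i _ => sum_le_sum fun j _ => hpt i j).trans ?_
  have hsum : ∑ i, ∑ j, (h ^ 3 * (q i * r i) + h ^ 3 * (q i * r j) +
      2 * h ^ 2 * (q i * r i ^ 2) + 2 * h ^ 2 * (q i * r j ^ 2) +
      h * (q i * r i ^ 2 * r j) + h * (q i * r i * r j ^ 2) + h * (q i * r j ^ 3) +
      q i * r i ^ 2 * r j ^ 2) =
      h * (card n * h ^ 2) * (∑ i, q i * r i) + h * ((h * ∑ i, q i) * (h * ∑ i, r i)) +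
      2 * (card n * h ^ 2) * (∑ i, q i * r i ^ 2) + 2 * h * ((h * ∑ i, q i) * ∑ i, r i ^ 2)
      + (∑ i, q i * r i ^ 2) * (h * ∑ i, r i) + h * ((∑ i, q i * r i) * (∑ i, r i ^ 2)) +
      (h * ∑ i, q i) * (∑ i, r i ^ 3) + (∑ i, q i * r i ^ 2) * ∑ i, r i ^ 2 := by
    have e1 : ∀ x : n → ℝ, ∑ i, ∑ j : n, x i = card n * ∑ i, x i := fun x => by simp [mul_sum]
    simp only [sum_add_distrib, ← mul_sum, ← sum_mul]
    have e2 : ∑ i, q i * ∑ j : n, r i = card n * ∑ i, q i * r i := by simp only [mul_sum, ← e1]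
    have e3 : ∑ i, q i * ∑ j : n, r i ^ 2 = card n * ∑ i, q i * r i ^ 2 := by
      simp only [mul_sum, ← e1]
    rw [e2, e3]
    ring
  rw [hsum, hcard]
  have n1 := mul_nonneg hh.le s1
  have p1 : (h * ∑ i, q i) * (h * ∑ i, r i) ≤ 1 * K := by gcongr
  have p2 : (h * ∑ i, q i) * ∑ i, r i ^ 2 ≤ 1 * K := by gcongr
  have p3 : (∑ i, q i * r i ^ 2) * (h * ∑ i, r i) ≤ η * K * K := by gcongr
  have p4 : (∑ i, q i * r i) * (∑ i, r i ^ 2) ≤ K * K := by gcongr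
  have p5 : (h * ∑ i, q i) * (∑ i, r i ^ 3) ≤ 1 * ∑ i, r i ^ 3 := by gcongr
  have p6 : (∑ i, q i * r i ^ 2) * ∑ i, r i ^ 2 ≤ η * K * K := by gcongr
  have q1 := mul_le_mul_of_nonneg_left a3 hh.le
  have q2 := mul_le_mul_of_nonneg_left p1 hh.le
  have q3 := mul_le_mul_of_nonneg_left p2 hh.le
  have q4 := mul_le_mul_of_nonneg_left p4 hh.le
  have hK2 : K ≤ K ^ 2 := by nlinarith
  have r1 : h * K ≤ h * K ^ 2 := by gcongr
  have r2 : η * K ≤ η * K ^ 2 := by gcongr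
  have r3 : (∑ i, r i ^ 3) ≤ 5 * K ^ 2 * ∑ i, r i ^ 3 := le_mul_of_one_le_left s3 (by nlinarith)
  linarith

/-- The variance of a complex function of a random matrix. -/
def spread (P : Measure Ω) (X : Ω → 𝕄) (F : 𝕄 → ℂ) : ℝ := ∫ w, ‖F (X w) - avg P X F‖ ^ 2 ∂P

namespace Model

variable (M : Model P X h A σ ρ)
include M

lemma avg_mono {F G : 𝕄 → ℝ} (hF : Tame F) (hG : Tame G)
    (h : ∀ Y : 𝕄, Y.IsHermitian → F Y ≤ G Y) : avg P X F ≤ avg P X G :=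
  integral_mono (M.integrable hF) (M.integrable hG) fun w => h _ (M.isHermitian w)

lemma integral_pow_four_le (i j : n) : ∫ w, ‖X w i j‖ ^ 4 ∂P ≤ (1 + A) * h ^ 4 := by
  have := M.fourth i j
  have : 0 ≤ h ^ 4 := by positivity
  linarith

lemma integral_sq_sub_erase_le {F : 𝕄 → ℂ} (hF : Tame F) {p S : 𝕄 → ℝ}
    (hp : Tame p) (hS : Tame S) {i j : n} (hij : i ≠ j) {K : ℝ} (hK : 1 ≤ K)
    (hS0 : ∀ Y, 0 ≤ S Y) (hp0 : ∀ Y, 0 ≤ p Y)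
    (h1 : ∀ w, ‖F (X w) - F Xe‖ ≤ ‖X w i j‖ * p Xe + ‖X w i j‖ ^ 2 * S Xe)
    (h2 : ∀ w, p Xe ≤ p (X w) + ‖X w i j‖ * S Xe)
    (h3 : ∀ w, S Xe ≤ K * S (X w)) :
    ∫ w, ‖F (X w) - F Xe‖ ^ 2 ∂P ≤ 6 * (1 + A) ^ 2 * K ^ 2 *
      avg P X (fun Y => h ^ 2 * p Y ^ 2 + h ^ 4 * S Y ^ 2) := by
  have hA := M.one_le
  have hh := M.h_pos
  have ip := M.integrable (hp.pow 2)
  have iS := M.integrable (hS.pow 2)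
  have ip0 := M.integrable_erase (hp.pow 2) i j
  have iS0 := M.integrable_erase (hS.pow 2) i j
  have c2 : Continuous fun x : ℂ => ‖x‖ ^ 2 := by fun_prop
  have c4 : Continuous fun x : ℂ => ‖x‖ ^ 4 := by fun_prop
  have j1 := M.integrable_entry_erase c2 (hp.pow 2) i j
  have j2 := M.integrable_entry_erase c4 (hS.pow 2) i j
  have j3 := M.integrable_entry_erase c2 (hS.pow 2) i j
  have b1 : ∫ w, ‖F (X w) - F Xe‖ ^ 2 ∂P ≤ 2 * ((∫ w, ‖X w i j‖ ^ 2 ∂P) * ∫ w, p Xe ^ 2 ∂P) +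
      2 * ((∫ w, ‖X w i j‖ ^ 4 ∂P) * ∫ w, S Xe ^ 2 ∂P) := by
    rw [← M.integral_entry_mul c2 (hp.pow 2) hij, ← M.integral_entry_mul c4 (hS.pow 2) hij,
      ← integral_const_mul, ← integral_const_mul, ← integral_add (j1.const_mul 2) (j2.const_mul 2)]
    refine integral_mono_of_nonneg (ae_of_all _ fun w => by positivity)
      ((j1.const_mul 2).add (j2.const_mul 2)) (ae_of_all _ fun w => ?_)
    have := pow_le_pow_left₀ (norm_nonneg _) (h1 w) 2
    simp only
    nlinarith [sq_nonneg (‖X w i j‖ * p Xe - ‖X w i j‖ ^ 2 * S Xe)]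
  have b2 : ∫ w, p Xe ^ 2 ∂P ≤ 2 * (∫ w, p (X w) ^ 2 ∂P) +
      2 * ((∫ w, ‖X w i j‖ ^ 2 ∂P) * ∫ w, S Xe ^ 2 ∂P) := by
    rw [← M.integral_entry_mul c2 (hS.pow 2) hij, ← integral_const_mul, ← integral_const_mul,
      ← integral_add (ip.const_mul 2) (j3.const_mul 2)]
    refine integral_mono ip0 ((ip.const_mul 2).add (j3.const_mul 2)) fun w => ?_
    have := pow_le_pow_left₀ (hp0 _) (h2 w) 2
    simp only
    nlinarith [sq_nonneg (p (X w) - ‖X w i j‖ * S Xe)]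
  have b3 : ∫ w, S Xe ^ 2 ∂P ≤ K ^ 2 * ∫ w, S (X w) ^ 2 ∂P := by
    rw [← integral_const_mul]
    refine integral_mono iS0 (iS.const_mul _) fun w => ?_
    have := pow_le_pow_left₀ (hS0 _) (h3 w) 2
    rwa [mul_pow] at this
  have m2 := M.integral_pow_le 2 (by norm_num) i j
  have m4 := M.integral_pow_four_le i j
  have hav : avg P X (fun Y => h ^ 2 * p Y ^ 2 + h ^ 4 * S Y ^ 2) =
      h ^ 2 * (∫ w, p (X w) ^ 2 ∂P) + h ^ 4 * ∫ w, S (X w) ^ 2 ∂P := by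
    simp (disch := fun_prop) only [M.avg_add, avg_mul_left]
    rfl
  rw [hav]
  have n1 : 0 ≤ ∫ w, p (X w) ^ 2 ∂P := integral_nonneg fun w => sq_nonneg _
  have n2 : 0 ≤ ∫ w, S (X w) ^ 2 ∂P := integral_nonneg fun w => sq_nonneg _
  have n3 : 0 ≤ ∫ w, p Xe ^ 2 ∂P := integral_nonneg fun w => sq_nonneg _
  have n4 : 0 ≤ ∫ w, S Xe ^ 2 ∂P := integral_nonneg fun w => sq_nonneg _
  have n5 : 0 ≤ ∫ w, ‖X w i j‖ ^ 2 ∂P := integral_nonneg fun w => sq_nonneg _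
  set x := ∫ w, p (X w) ^ 2 ∂P
  set y := ∫ w, S (X w) ^ 2 ∂P
  set x0 := ∫ w, p Xe ^ 2 ∂P
  set y0 := ∫ w, S Xe ^ 2 ∂P
  set τ := ∫ w, ‖X w i j‖ ^ 2 ∂P
  set φ := ∫ w, ‖X w i j‖ ^ 4 ∂P
  have hK2 : 1 ≤ K ^ 2 := one_le_pow₀ hK
  calc _ ≤ 2 * (τ * x0) + 2 * (φ * y0) := b1
    _ ≤ 2 * (((1 + A) * h ^ 2) * (2 * x + 2 * (((1 + A) * h ^ 2) * (K ^ 2 * y)))) +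
        2 * (((1 + A) * h ^ 4) * (K ^ 2 * y)) := by
      have : x0 ≤ 2 * x + 2 * (((1 + A) * h ^ 2) * (K ^ 2 * y)) := b2.trans (by gcongr)
      gcongr
    _ = 4 * ((1 + A) * (h ^ 2 * x)) + (4 * (1 + A) ^ 2 + 2 * (1 + A)) * (K ^ 2 * (h ^ 4 * y)) := by
      ring
    _ ≤ 6 * ((1 + A) ^ 2 * K ^ 2 * (h ^ 2 * x)) + 6 * (1 + A) ^ 2 * (K ^ 2 * (h ^ 4 * y)) := by
      have q1 : (1 + A) * (h ^ 2 * x) ≤ (1 + A) ^ 2 * K ^ 2 * (h ^ 2 * x) := by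
        refine mul_le_mul_of_nonneg_right ?_ (by positivity)
        calc 1 + A ≤ (1 + A) ^ 2 := by nlinarith
          _ ≤ _ := le_mul_of_one_le_right (by positivity) hK2
      have q2 : 0 ≤ (1 + A) ^ 2 * K ^ 2 * (h ^ 2 * x) := by positivity
      have q3 : 4 * (1 + A) ^ 2 + 2 * (1 + A) ≤ 6 * (1 + A) ^ 2 := by nlinarith
      have q4 := mul_le_mul_of_nonneg_right q3 (show 0 ≤ K ^ 2 * (h ^ 4 * y) by positivity)
      linarith
    _ = _ := by ring

/-- A variance bound from bounds on the influence of the entries. -/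
lemma spread_le {F : 𝕄 → ℂ} (hF : Tame F) {p S : n → n → 𝕄 → ℝ}
    (hp : ∀ i j, Tame (p i j)) (hS : ∀ i j, Tame (S i j)) {K : ℝ} (hK : 1 ≤ K)
    (hS0 : ∀ i j Y, 0 ≤ S i j Y) (hp0 : ∀ i j Y, 0 ≤ p i j Y)
    (h1 : ∀ w i j, ‖F (X w) - F Xe‖ ≤ ‖X w i j‖ * p i j Xe + ‖X w i j‖ ^ 2 * S i j Xe)
    (h2 : ∀ w i j, p i j Xe ≤ p i j (X w) + ‖X w i j‖ * S i j Xe)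
    (h3 : ∀ w i j, S i j Xe ≤ K * S i j (X w)) :
    spread P X F ≤ 6 * (1 + A) ^ 2 * K ^ 2 *
      avg P X (fun Y => ∑ i, ∑ j, (h ^ 2 * p i j Y ^ 2 + h ^ 4 * S i j Y ^ 2)) := by
  have hA := M.one_le
  have hh := M.h_pos
  simp (disch := fun_prop) only [M.avg_sum, mul_sum]
  refine (M.efronStein F hF).trans (sum_le_sum fun i _ => sum_le_sum fun j _ => ?_)
  split_ifs with hij
  · exact M.integral_sq_sub_erase_le hF (hp i j) (hS i j) hij hK (hS0 i j) (hp0 i j)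
      (fun w => h1 w i j) (fun w => h2 w i j) (fun w => h3 w i j)
  · refine mul_nonneg (by positivity) (integral_nonneg fun w => ?_)
    simp only
    positivity

end Model

/-- The influence of the entry `(i, j)` on `⟨u, (z - X)⁻¹ v⟩`. -/
def crossMass (z : ℂ) (u v : n → ℂ) (i j : n) (Y : 𝕄) : ℝ :=
  ‖(res (conj z) Y *ᵥ u) i‖ * ‖(res z Y *ᵥ v) j‖ + ‖(res (conj z) Y *ᵥ u) j‖ * ‖(res z Y *ᵥ v) i‖

def pairMass (z : ℂ) (u v : n → ℂ) (i j : n) (Y : 𝕄) : ℝ :=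
  (‖(res (conj z) Y *ᵥ u) i‖ + ‖(res (conj z) Y *ᵥ u) j‖) *
    (‖(res z Y *ᵥ v) i‖ + ‖(res z Y *ᵥ v) j‖)

lemma crossMass_nonneg (z : ℂ) (u v : n → ℂ) (i j : n) (Y : 𝕄) :
    0 ≤ crossMass z u v i j Y := by unfold crossMass; positivity

lemma pairMass_nonneg (z : ℂ) (u v : n → ℂ) (i j : n) (Y : 𝕄) :
    0 ≤ pairMass z u v i j Y := by unfold pairMass; positivity

@[fun_prop]
lemma tame_crossMass {z : ℂ} (hz : z.im ≠ 0) (u v : n → ℂ) (i j : n) :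
    Tame (crossMass z u v i j) := by
  have hz' : (conj z).im ≠ 0 := by simpa using hz
  unfold crossMass
  fun_prop

@[fun_prop]
lemma tame_pairMass {z : ℂ} (hz : z.im ≠ 0) (u v : n → ℂ) (i j : n) :
    Tame (pairMass z u v i j) := by
  have hz' : (conj z).im ≠ 0 := by simpa using hz
  unfold pairMass
  fun_prop

lemma l2_res_le {X : 𝕄} (hX : X.IsHermitian) {z : ℂ} (hz : 1 ≤ A * |z.im|)
    (u : n → ℂ) : l2 (res z X *ᵥ u) ≤ A * l2 u :=
  (l2_mulVec_le _ _).trans (by gcongr; exacts [l2_nonneg _, norm_res_le hX hz])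

lemma sum_crossMass_sq_le {Y : 𝕄} (z : ℂ) (u v : n → ℂ) : ∑ i, ∑ j, crossMass z u v i j Y ^ 2 ≤
      4 * (l2 (res (conj z) Y *ᵥ u) * l2 (res z Y *ᵥ v)) ^ 2 := by
  unfold crossMass
  set a := res (conj z) Y *ᵥ u
  set w := res z Y *ᵥ v
  calc _ ≤ ∑ i, ∑ j, (2 * (‖a i‖ ^ 2 * ‖w j‖ ^ 2) + 2 * (‖w i‖ ^ 2 * ‖a j‖ ^ 2)) := by
        refine sum_le_sum fun i _ => sum_le_sum fun j _ => ?_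
        nlinarith [sq_nonneg (‖a i‖ * ‖w j‖ - ‖a j‖ * ‖w i‖)]
    _ = _ := by
      simp only [sum_add_distrib, ← mul_sum, ← sum_mul, ← l2_sq]
      ring

lemma sum_pairMass_sq_le [Nonempty n] {Y : 𝕄} (z : ℂ) (u v : n → ℂ) :
    ∑ i, ∑ j, pairMass z u v i j Y ^ 2 ≤
      16 * card n * (l2 (res (conj z) Y *ᵥ u) * l2 (res z Y *ᵥ v)) ^ 2 := by
  unfold pairMass
  set a := res (conj z) Y *ᵥ u
  set w := res z Y *ᵥ v
  have h1 : ∑ i, ‖a i‖ ^ 2 * ‖w i‖ ^ 2 ≤ l2 a ^ 2 * l2 w ^ 2 := by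
    rw [l2_sq, l2_sq, sum_mul]
    gcongr with i
    exact single_le_sum (f := fun i => ‖w i‖ ^ 2) (fun j _ => by positivity) (mem_univ i)
  have hN : (1 : ℝ) ≤ card n := by exact_mod_cast Fintype.card_pos
  have h2 : l2 a ^ 2 * l2 w ^ 2 ≤ card n * (l2 a ^ 2 * l2 w ^ 2) :=
    le_mul_of_one_le_left (by positivity) hN
  calc _ ≤ ∑ i, ∑ j, (4 * (‖a i‖ ^ 2 * ‖w i‖ ^ 2) + 4 * (‖a i‖ ^ 2 * ‖w j‖ ^ 2) +
          4 * (‖w i‖ ^ 2 * ‖a j‖ ^ 2) + 4 * (‖a j‖ ^ 2 * ‖w j‖ ^ 2)) := by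
        refine sum_le_sum fun i _ => sum_le_sum fun j _ => ?_
        rw [mul_pow]
        calc _ ≤ (2 * (‖a i‖ ^ 2 + ‖a j‖ ^ 2)) * (2 * (‖w i‖ ^ 2 + ‖w j‖ ^ 2)) := by
              gcongr <;> exact add_sq_le
          _ = _ := by ring
    _ = 8 * (l2 a ^ 2 * l2 w ^ 2) + 8 * (card n * ∑ i, ‖a i‖ ^ 2 * ‖w i‖ ^ 2) := by
      simp only [sum_add_distrib, ← mul_sum, ← sum_mul, ← l2_sq, sum_const, card_univ, nsmul_eq_mul]
      have e : ∑ i, ‖a i‖ ^ 2 * (card n * ‖w i‖ ^ 2) = card n * ∑ i, ‖a i‖ ^ 2 * ‖w i‖ ^ 2 := by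
        simp only [mul_sum, mul_left_comm]
      rw [e]
      ring
    _ ≤ 8 * (card n * (l2 a ^ 2 * l2 w ^ 2)) + 8 * (card n * (l2 a ^ 2 * l2 w ^ 2)) := by gcongr
    _ = _ := by ring

section Pointwise

variable {Y : Matrix n n ℂ} {z : ℂ} (u v : n → ℂ) (i j : n)

lemma res_mulVec_erase_add_le (hY : Y.IsHermitian) (hA : 1 ≤ A) (hz : 1 ≤ A * |z.im|)
    (h2 : ‖Y i j‖ ≤ 2) : ‖(res z Y *ᵥ v) i‖ + ‖(res z Y *ᵥ v) j‖ ≤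
      5 * A * (‖(res z (erase Y i j) *ᵥ v) i‖ + ‖(res z (erase Y i j) *ᵥ v) j‖) := by
  have h3 := norm_res_mulVec_sub_le hY hz i j v i
  have h4 := norm_res_mulVec_sub_le hY hz i j v j
  have h5 := norm_sub_norm_le ((res z Y *ᵥ v) i) ((res z (erase Y i j) *ᵥ v) i)
  have h6 := norm_sub_norm_le ((res z Y *ᵥ v) j) ((res z (erase Y i j) *ᵥ v) j)
  have hs : 0 ≤ ‖(res z (erase Y i j) *ᵥ v) i‖ + ‖(res z (erase Y i j) *ᵥ v) j‖ := by positivity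
  set s := ‖(res z (erase Y i j) *ᵥ v) i‖ + ‖(res z (erase Y i j) *ᵥ v) j‖
  have h7 : A * (‖Y i j‖ * s) ≤ A * (2 * s) := by gcongr
  have h8 : s ≤ A * s := le_mul_of_one_le_left hs hA
  linarith

lemma erase_res_mulVec_add_le (hY : Y.IsHermitian) (hA : 1 ≤ A) (hz : 1 ≤ A * |z.im|)
    (h2 : ‖Y i j‖ ≤ 2) : ‖(res z (erase Y i j) *ᵥ v) i‖ + ‖(res z (erase Y i j) *ᵥ v) j‖ ≤
      5 * A * (‖(res z Y *ᵥ v) i‖ + ‖(res z Y *ᵥ v) j‖) := by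
  have h3 := norm_res_mulVec_sub_le' hY hz i j v i
  have h4 := norm_res_mulVec_sub_le' hY hz i j v j
  have h5 := norm_sub_norm_le ((res z (erase Y i j) *ᵥ v) i) ((res z Y *ᵥ v) i)
  have h6 := norm_sub_norm_le ((res z (erase Y i j) *ᵥ v) j) ((res z Y *ᵥ v) j)
  have hs : 0 ≤ ‖(res z Y *ᵥ v) i‖ + ‖(res z Y *ᵥ v) j‖ := by positivity
  set s := ‖(res z Y *ᵥ v) i‖ + ‖(res z Y *ᵥ v) j‖
  have h7 : A * (‖Y i j‖ * s) ≤ A * (2 * s) := by gcongr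
  have h8 : s ≤ A * s := le_mul_of_one_le_left hs hA
  linarith

lemma pairMass_erase_le (hY : Y.IsHermitian) (hA : 1 ≤ A) (hz : 1 ≤ A * |z.im|)
    (h2 : ‖Y i j‖ ≤ 2) : pairMass z u v i j (erase Y i j) ≤ 25 * A ^ 2 * pairMass z u v i j Y := by
  have h3 := erase_res_mulVec_add_le v i j hY hA hz h2
  have h4 := erase_res_mulVec_add_le u i j hY hA (abs_im_conj hz) h2
  unfold pairMass
  calc _ ≤ _ := mul_le_mul h4 h3 (by positivity) (by positivity)
    _ = _ := by ring

lemma pairMass_le_erase (hY : Y.IsHermitian) (hA : 1 ≤ A) (hz : 1 ≤ A * |z.im|)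
    (h2 : ‖Y i j‖ ≤ 2) : pairMass z u v i j Y ≤ 25 * A ^ 2 * pairMass z u v i j (erase Y i j) := by
  have h3 := res_mulVec_erase_add_le v i j hY hA hz h2
  have h4 := res_mulVec_erase_add_le u i j hY hA (abs_im_conj hz) h2
  unfold pairMass
  calc _ ≤ _ := mul_le_mul h4 h3 (by positivity) (by positivity)
    _ = _ := by ring

lemma crossMass_erase_le (hY : Y.IsHermitian) (hA : 1 ≤ A) (hz : 1 ≤ A * |z.im|)
    (h2 : ‖Y i j‖ ≤ 2) : crossMass z u v i j (erase Y i j) ≤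
      crossMass z u v i j Y + ‖Y i j‖ * (14 * A ^ 2 * pairMass z u v i j (erase Y i j)) := by
  have hA0 : 0 ≤ A := by linarith
  have w2 := res_mulVec_erase_add_le v i j hY hA hz h2
  have a2 := res_mulVec_erase_add_le u i j hY hA (abs_im_conj hz) h2
  have tri : ∀ {x y : ℂ} {t : ℝ}, ‖x - y‖ ≤ t → ‖y‖ ≤ ‖x‖ + t := fun h => by
    rw [norm_sub_rev] at h
    exact (norm_le_norm_add_norm_sub' _ _).trans (by gcongr)
  have w' := fun k => tri (norm_res_mulVec_sub_le hY hz i j v k)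
  have a' := fun k => tri (norm_res_mulVec_sub_le hY (abs_im_conj hz) i j u k)
  unfold crossMass pairMass
  generalize hsw : ‖(res z (erase Y i j) *ᵥ v) i‖ + ‖(res z (erase Y i j) *ᵥ v) j‖ = sw at *
  generalize hsa : ‖(res (conj z) (erase Y i j) *ᵥ u) i‖ +
    ‖(res (conj z) (erase Y i j) *ᵥ u) j‖ = sa at *
  have hsw0 : 0 ≤ sw := by rw [← hsw]; positivity
  have hsa0 : 0 ≤ sa := by rw [← hsa]; positivity
  have k1 := mul_le_mul (a' i) (w' j) (norm_nonneg _) (by positivity)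
  have k2 := mul_le_mul (a' j) (w' i) (norm_nonneg _) (by positivity)
  have hx := norm_nonneg (Y i j)
  generalize ‖Y i j‖ = x at *
  have k3 := mul_le_mul_of_nonneg_right w2 (show 0 ≤ A * x * sa by positivity)
  have k4 := mul_le_mul_of_nonneg_right a2 (show 0 ≤ A * x * sw by positivity)
  have k5 := mul_le_mul_of_nonneg_right h2 (show 0 ≤ A ^ 2 * x * (sa * sw) by positivity)
  linarith

lemma norm_form_erase_sub_le (hY : Y.IsHermitian) (hA : 1 ≤ A) (hz : 1 ≤ A * |z.im|) :
    ‖form z u v Y - form z u v (erase Y i j)‖ ≤ ‖Y i j‖ * crossMass z u v i j (erase Y i j) +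
      ‖Y i j‖ ^ 2 * (14 * A ^ 2 * pairMass z u v i j (erase Y i j)) := by
  have h1 := norm_form_sub_sub_le u v i j hY hz
  have h2 := norm_formLin_le (z := z) (X := Y) u v i j
  have h3 := norm_add_le (form z u v Y - form z u v (erase Y i j) - formLin z u v Y i j)
    (formLin z u v Y i j)
  rw [sub_add_cancel] at h3
  have h4 : A * (‖Y i j‖ ^ 2 * pairMass z u v i j (erase Y i j)) ≤
      ‖Y i j‖ ^ 2 * (14 * A ^ 2 * pairMass z u v i j (erase Y i j)) := by
    have h5 := pairMass_nonneg z u v i j (erase Y i j)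
    calc _ ≤ 14 * A ^ 2 * (‖Y i j‖ ^ 2 * pairMass z u v i j (erase Y i j)) := by
          gcongr
          nlinarith
      _ = _ := by ring
  unfold crossMass pairMass at *
  linarith

end Pointwise

/-- The constant in the variance bounds. -/
def varConst (A : ℝ) : ℝ := 6 * (1 + A) ^ 2 * (25 * A ^ 2) ^ 2 * (3200 * A ^ 8)

lemma varConst_nonneg {A : ℝ} (hA : 1 ≤ A) : 0 ≤ varConst A := by unfold varConst; positivity

namespace Model

variable (M : Model P X h A σ ρ)
include M

lemma nonempty : Nonempty n := by
  by_contra hn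
  have := not_nonempty_iff.1 hn
  simpa using M.card_eq

/-- The variance of `⟨u, (z - X)⁻¹ v⟩`. -/
theorem spread_form_le {z : ℂ} (hz : 1 ≤ A * |z.im|) (u v : n → ℂ) :
    spread P X (form z u v) ≤ varConst A * (h ^ 2 * (l2 u * l2 v) ^ 2) := by
  have hA := M.one_le
  have hh := M.h_pos
  have hz0 := im_ne_of hz
  have := M.nonempty
  refine (M.spread_le (tame_form hz0 u v) (S := fun i j Y => 14 * A ^ 2 * pairMass z u v i j Y)
    (fun i j => tame_crossMass hz0 u v i j) (by fun_prop) (K := 25 * A ^ 2) (by nlinarith)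
    (fun i j Y => mul_nonneg (by positivity) (pairMass_nonneg _ _ _ _ _ _))
    (fun i j Y => crossMass_nonneg _ _ _ _ _ _)
    (fun w i j => norm_form_erase_sub_le u v i j (M.isHermitian w) hA hz)
    (fun w i j => crossMass_erase_le u v i j (M.isHermitian w) hA hz (M.norm_entry_le_two w i j))
    (fun w i j => ?_)).trans ?_
  · have := pairMass_erase_le u v i j (M.isHermitian w) hA hz (M.norm_entry_le_two w i j)
    calc _ ≤ 14 * A ^ 2 * (25 * A ^ 2 * pairMass z u v i j (X w)) := by gcongr
      _ = _ := by ring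
  have hav : avg P X (fun Y => ∑ i, ∑ j, (h ^ 2 * crossMass z u v i j Y ^ 2 +
      h ^ 4 * (14 * A ^ 2 * pairMass z u v i j Y) ^ 2)) ≤
      3200 * A ^ 8 * (h ^ 2 * (l2 u * l2 v) ^ 2) := by
    refine (M.avg_mono (by fun_prop) (Tame.const (3200 * A ^ 8 * (h ^ 2 * (l2 u * l2 v) ^ 2)))
      fun Y hY => ?_).trans (by simp [avg])
    have e : ∑ i, ∑ j, (h ^ 2 * crossMass z u v i j Y ^ 2 +
        h ^ 4 * (14 * A ^ 2 * pairMass z u v i j Y) ^ 2) =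
        h ^ 2 * (∑ i, ∑ j, crossMass z u v i j Y ^ 2) +
        196 * A ^ 4 * h ^ 4 * ∑ i, ∑ j, pairMass z u v i j Y ^ 2 := by
      simp only [mul_sum, ← sum_add_distrib]
      exact sum_congr rfl fun i _ => sum_congr rfl fun j _ => by ring
    rw [e]
    have b1 := sum_crossMass_sq_le (Y := Y) z u v
    have b2 := sum_pairMass_sq_le (Y := Y) z u v
    have l1 := l2_res_le hY hz v
    have l3 := l2_res_le hY (abs_im_conj hz) u
    have := l2_nonneg u
    have := l2_nonneg (res z Y *ᵥ v)
    have := l2_nonneg (res (conj z) Y *ᵥ u)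
    have l4 : (l2 (res (conj z) Y *ᵥ u) * l2 (res z Y *ᵥ v)) ^ 2 ≤ A ^ 4 * (l2 u * l2 v) ^ 2 := by
      calc _ ≤ ((A * l2 u) * (A * l2 v)) ^ 2 := by gcongr
        _ = _ := by ring
    set L := (l2 (res (conj z) Y *ᵥ u) * l2 (res z Y *ᵥ v)) ^ 2
    set L0 := (l2 u * l2 v) ^ 2
    have hL0 : 0 ≤ L0 := sq_nonneg _
    calc _ ≤ h ^ 2 * (4 * (A ^ 4 * L0)) +
          196 * A ^ 4 * h ^ 4 * (16 * card n * (A ^ 4 * L0)) := by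
          gcongr
          exacts [b1.trans (by gcongr), b2.trans (by gcongr)]
      _ = 4 * A ^ 4 * (h ^ 2 * L0) + 3136 * A ^ 8 * ((card n * h ^ 2) * (h ^ 2 * L0)) := by ring
      _ ≤ 4 * A ^ 8 * (h ^ 2 * L0) + 3136 * A ^ 8 * (h ^ 2 * L0) := by
        rw [M.card_eq, one_mul]
        gcongr <;> norm_num [hA]
      _ ≤ _ := by
        have : 0 ≤ A ^ 8 * (h ^ 2 * L0) := by positivity
        linarith
  calc _ ≤ 6 * (1 + A) ^ 2 * (25 * A ^ 2) ^ 2 * (3200 * A ^ 8 * (h ^ 2 * (l2 u * l2 v) ^ 2)) := by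
        gcongr
    _ = _ := by unfold varConst; ring

end Model

lemma l2_add_le (x y : n → ℂ) : l2 (x + y) ≤ l2 x + l2 y := by
  unfold l2; rw [WithLp.toLp_add]; exact norm_add_le _ _

lemma l2_single_eq (i : n) (x : ℂ) : l2 (Pi.single i x) = ‖x‖ := by
  refine (sq_eq_sq₀ (l2_nonneg _) (norm_nonneg _)).1 ?_
  rw [l2_sq, sum_eq_single i] <;> simp +contextual

lemma norm_res_sub_erase_le {X : 𝕄} {z : ℂ} {A : ℝ} (hX : X.IsHermitian)
    (hz : 1 ≤ A * |z.im|) (i j : n) :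
    ‖res z X - res z (erase X i j)‖ ≤ 2 * A ^ 2 * ‖X i j‖ := by
  have hz0 := im_ne_of hz
  rw [resolvent_erase hX hz0 i j, add_sub_cancel_left]
  have h1 := norm_res_le hX hz
  have h2 := norm_res_le (erase_isHermitian hX i j) hz
  have hA : 0 ≤ A := (norm_nonneg _).trans h1
  have h3 : ‖(Matrix.single i j (X i j) + Matrix.single j i (conj (X i j)) : 𝕄)‖ ≤ 2 * ‖X i j‖ := by
    refine opNorm_le_of_forall_l2 _ (by positivity) fun y => ?_
    rw [pair_mulVec]
    refine (l2_add_le _ _).trans ?_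
    rw [l2_single_eq, l2_single_eq, norm_mul, norm_mul, norm_conj]
    have := norm_apply_le_l2 y
    calc _ ≤ ‖X i j‖ * l2 y + ‖X i j‖ * l2 y := by gcongr <;> apply this
      _ = _ := by ring
  calc _ ≤ ‖res z (erase X i j)‖ * ‖(Matrix.single i j (X i j) +
        Matrix.single j i (conj (X i j)) : 𝕄)‖ * ‖res z X‖ :=
        norm_mul₃_le
    _ ≤ A * (2 * ‖X i j‖) * A := by gcongr
    _ = _ := by ring

/-- The normalized trace of the resolvent. -/
def meanTrace (h : ℝ) (z : ℂ) (Y : 𝕄) : ℂ := (h : ℂ) ^ 2 * ∑ k, res z Y k k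

@[fun_prop]
lemma tame_meanTrace (h : ℝ) {z : ℂ} (hz : z.im ≠ 0) : Tame fun Y : 𝕄 => meanTrace h z Y :=
  (Tame.const _).mul (Tame.sum fun k => tame_res_entry hz k k)

lemma sum_norm_sq_entry_le (B : 𝕄) : ∑ i, ∑ j, ‖B i j‖ ^ 2 ≤ card n * ‖B‖ ^ 2 := by
  calc _ ≤ ∑ i : n, ‖B‖ ^ 2 := sum_le_sum fun i _ => by
        rw [← l2_sq (fun j => B i j)]
        exact pow_le_pow_left₀ (l2_nonneg _) (l2_row_le B i) 2
    _ = _ := by simp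

lemma trace_pair_mul (A B : 𝕄) (i j : n) (x : ℂ) :
    ∑ k, (A * (Matrix.single i j x + Matrix.single j i (conj x)) * B) k k =
      x * (B * A) j i + conj x * (B * A) i j := by
  have h1 := Matrix.trace_mul_cycle A (Matrix.single i j x) B
  have h2 := Matrix.trace_mul_cycle A (Matrix.single j i (conj x)) B
  have e1 : Matrix.trace (B * A * Matrix.single i j x) = x * (B * A) j i := by
    rw [Matrix.trace_mul_single]; simp [mul_comm]
  have e2 : Matrix.trace (B * A * Matrix.single j i (conj x)) = conj x * (B * A) i j := by
    rw [Matrix.trace_mul_single]; simp [mul_comm]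
  change Matrix.trace _ = _
  rw [mul_add, add_mul, Matrix.trace_add, h1, h2, e1, e2]

namespace Model

variable (M : Model P X h A σ ρ)
include M

/-- The variance of the normalized trace of the resolvent. -/
theorem spread_meanTrace_le {z : ℂ} (hz : 1 ≤ A * |z.im|) :
    spread P X (meanTrace h z) ≤ varConst A * h ^ 4 := by
  have hA := M.one_le
  have hh := M.h_pos
  have hz0 := im_ne_of hz
  obtain ⟨G, hG⟩ : ∃ G : 𝕄 → 𝕄 → 𝕄, ∀ Y Y', res z Y * res z Y' = G Y Y' := ⟨_, fun _ _ => rfl⟩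
  obtain ⟨H, hH⟩ : ∃ H : n → n → 𝕄 → ℂ, ∀ Y i j, G Y Y i j = H i j Y := ⟨_, fun _ _ _ => rfl⟩
  have tH : ∀ i j, Tame (H i j) := fun i j => by
    have : H i j = fun Y => ∑ k, res z Y i k * res z Y k j := funext fun Y => by
      rw [← hH, ← hG, Matrix.mul_apply]
    rw [this]
    fun_prop
  have hb : ∀ (B B' : 𝕄) t, ‖B - B'‖ ≤ t → ∀ k l, ‖B k l‖ ≤ ‖B' k l‖ + t := fun B B' t h k l => by
    have := norm_entry_le (B - B') k l
    rw [Matrix.sub_apply] at this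
    linarith [norm_sub_norm_le (B k l) (B' k l)]
  have hd : ∀ w i j k l, ‖G (X w) Xe k l‖ ≤
      ‖H k l Xe‖ + 2 * A ^ 3 * ‖X w i j‖ := fun w i j k l => by
    rw [← hH]
    refine hb _ _ _ ?_ k l
    have h1 := norm_res_le (M.erase_hermitian w i j) hz
    have h3 := norm_res_sub_erase_le (M.isHermitian w) hz i j
    rw [← hG, ← hG, ← sub_mul]
    refine (norm_mul_le _ _).trans ?_
    calc _ ≤ 2 * A ^ 2 * ‖X w i j‖ * A := by gcongr
      _ = _ := by ring
  have hd2 : ∀ w i j k l, ‖H k l Xe‖ ≤ ‖H k l (X w)‖ + 4 * A ^ 3 * ‖X w i j‖ := fun w i j k l => by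
    rw [← hH, ← hH]
    refine hb _ _ _ ?_ k l
    have h1 := norm_res_le (M.isHermitian w) hz
    have h2 := norm_res_le (M.erase_hermitian w i j) hz
    have h3 := norm_res_sub_erase_le (M.isHermitian w) hz i j
    have e : ∀ U V : 𝕄, V * V - U * U = (V - U) * V + U * (V - U) := fun U V => by noncomm_ring
    rw [norm_sub_rev] at h3
    rw [← hG, ← hG, e]
    refine (norm_add_le _ _).trans ((add_le_add (norm_mul_le _ _) (norm_mul_le _ _)).trans ?_)
    calc _ ≤ 2 * A ^ 2 * ‖X w i j‖ * A + A * (2 * A ^ 2 * ‖X w i j‖) := by gcongr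
      _ = _ := by ring
  refine (M.spread_le (by fun_prop) (p := fun i j Y => h ^ 2 * (‖H i j Y‖ + ‖H j i Y‖))
    (S := fun _ _ _ => 8 * A ^ 3 * h ^ 2) (by fun_prop) (by fun_prop) (K := 1) le_rfl
    (fun i j Y => by positivity) (fun i j Y => by positivity) (fun w i j => ?_) (fun w i j => ?_)
    (fun w i j => by simp)).trans ?_
  · have e : meanTrace h z (X w) - meanTrace h z Xe = (h : ℂ) ^ 2 *
        (X w i j * G (X w) Xe j i + conj (X w i j) * G (X w) Xe i j) := by
      unfold meanTrace
      rw [← mul_sub, ← sum_sub_distrib, ← hG, ← trace_pair_mul]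
      congr 1
      refine sum_congr rfl fun k _ => ?_
      conv_lhs => rw [resolvent_erase (M.isHermitian w) hz0 i j]
      rw [Matrix.add_apply, add_sub_cancel_left]
    rw [e, norm_mul, norm_pow, norm_real, norm_of_nonneg hh.le]
    calc _ ≤ h ^ 2 * (‖X w i j‖ * ‖G (X w) Xe j i‖ +
          ‖X w i j‖ * ‖G (X w) Xe i j‖) := by
          gcongr
          exact (norm_add_le _ _).trans (by rw [norm_mul, norm_mul, norm_conj])
      _ ≤ h ^ 2 * (‖X w i j‖ * (‖H j i Xe‖ + 2 * A ^ 3 * ‖X w i j‖) +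
          ‖X w i j‖ * (‖H i j Xe‖ + 2 * A ^ 3 * ‖X w i j‖)) := by
          gcongr
          exacts [hd w i j j i, hd w i j i j]
      _ ≤ _ := by
        have : 0 ≤ h ^ 2 * A ^ 3 * ‖X w i j‖ ^ 2 := by positivity
        linarith
  · have := add_le_add (hd2 w i j i j) (hd2 w i j j i)
    linear_combination h ^ 2 * this
  have hav : avg P X (fun Y => ∑ i, ∑ j, (h ^ 2 * (h ^ 2 * (‖H i j Y‖ + ‖H j i Y‖)) ^ 2 +
      h ^ 4 * (8 * A ^ 3 * h ^ 2) ^ 2)) ≤ 68 * A ^ 8 * h ^ 4 := by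
    refine (M.avg_mono (by fun_prop) (Tame.const (68 * A ^ 8 * h ^ 4)) fun Y hY => ?_).trans
      (by simp [avg])
    have b2 : ‖G Y Y‖ ≤ A ^ 2 := by
      have := norm_res_le hY hz
      rw [← hG, pow_two]
      exact (norm_mul_le _ _).trans (by gcongr)
    have b3 : ∑ i, ∑ j, ‖H i j Y‖ ^ 2 ≤ card n * A ^ 4 := by
      simp only [← hH]
      refine (sum_norm_sq_entry_le _).trans ?_
      calc _ ≤ (card n : ℝ) * (A ^ 2) ^ 2 := by gcongr
        _ = _ := by ring
    calc _ ≤ ∑ i, ∑ j, (h ^ 6 * (2 * (‖H i j Y‖ ^ 2 + ‖H j i Y‖ ^ 2)) +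
          64 * A ^ 6 * h ^ 8) := by
          refine sum_le_sum fun i _ => sum_le_sum fun j _ => ?_
          have := mul_le_mul_of_nonneg_left (add_sq_le (a := ‖H i j Y‖) (b := ‖H j i Y‖))
            (show 0 ≤ h ^ 6 by positivity)
          linarith
      _ = 4 * h ^ 6 * (∑ i, ∑ j, ‖H i j Y‖ ^ 2) +
          64 * A ^ 6 * h ^ 4 * ((card n * h ^ 2) * (card n * h ^ 2)) := by
        simp only [sum_add_distrib, ← mul_sum]
        rw [sum_comm (f := fun i j => ‖H j i Y‖ ^ 2)]
        simp only [sum_const, card_univ, nsmul_eq_mul]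
        ring
      _ ≤ 4 * h ^ 6 * (card n * A ^ 4) + 64 * A ^ 6 * h ^ 4 := by
        rw [M.card_eq, mul_one, mul_one]
        gcongr
      _ = 4 * A ^ 4 * h ^ 4 * (card n * h ^ 2) + 64 * A ^ 6 * h ^ 4 := by ring
      _ ≤ 4 * A ^ 8 * h ^ 4 + 64 * A ^ 8 * h ^ 4 := by
        rw [M.card_eq, mul_one]
        gcongr <;> norm_num [hA]
      _ = _ := by ring
  calc _ ≤ 6 * (1 + A) ^ 2 * 1 ^ 2 * (68 * A ^ 8 * h ^ 4) := by gcongr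
    _ ≤ 6 * (1 + A) ^ 2 * (25 * A ^ 2) ^ 2 * (3200 * A ^ 8 * h ^ 4) := by
      have : (1 : ℝ) ≤ 25 * A ^ 2 := by nlinarith
      gcongr
      norm_num
    _ = _ := by unfold varConst; ring

end Model

lemma form_single (z : ℂ) (k : n) (v : n → ℂ) (Y : 𝕄) :
    form z (Pi.single k 1) v Y = (res z Y *ᵥ v) k := by
  unfold form
  rw [sum_eq_single k] <;> simp +contextual

lemma crossMass_le_pairMass (z : ℂ) (u v : n → ℂ) (i j : n) (Y : 𝕄) :
    crossMass z u v i j Y ≤ pairMass z u v i j Y := by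
  unfold crossMass pairMass
  have : 0 ≤ ‖(res (conj z) Y *ᵥ u) i‖ * ‖(res z Y *ᵥ v) i‖ := by positivity
  have : 0 ≤ ‖(res (conj z) Y *ᵥ u) j‖ * ‖(res z Y *ᵥ v) j‖ := by positivity
  linarith

/-- `∑ ‖(Y - z)⁻¹ e_k‖` over the columns `k`. -/
lemma sum_pairMass_single_sq_le {Y : 𝕄} (hY : Y.IsHermitian) {z : ℂ}
    (hz : 1 ≤ A * |z.im|) (v : n → ℂ) :
    ∑ k, ∑ i, ∑ j, pairMass z (Pi.single k 1) v i j Y ^ 2 ≤ 16 * A ^ 4 * (card n * l2 v ^ 2) := by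
  have hrow : ∀ i, ∑ k, ‖res (conj z) Y i k‖ ^ 2 ≤ A ^ 2 := fun i => by
    rw [← l2_sq (fun k => res (conj z) Y i k)]
    exact pow_le_pow_left₀ (l2_nonneg _) ((l2_row_le _ i).trans (norm_res_le hY (abs_im_conj hz))) 2
  have hw : ∑ i, ‖(res z Y *ᵥ v) i‖ ^ 2 ≤ A ^ 2 * l2 v ^ 2 := by
    rw [← l2_sq, ← mul_pow]
    exact pow_le_pow_left₀ (l2_nonneg _) (l2_res_le hY hz v) 2
  calc _ ≤ ∑ k, ∑ i, ∑ j, (2 * (‖res (conj z) Y i k‖ ^ 2 + ‖res (conj z) Y j k‖ ^ 2)) *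
        (2 * (‖(res z Y *ᵥ v) i‖ ^ 2 + ‖(res z Y *ᵥ v) j‖ ^ 2)) := by
        gcongr with k _ i _ j
        rw [pairMass, mul_pow, ← res_apply_eq, ← res_apply_eq]
        gcongr <;> exact add_sq_le
    _ = ∑ i, ∑ j, (2 * ((∑ k, ‖res (conj z) Y i k‖ ^ 2) + ∑ k, ‖res (conj z) Y j k‖ ^ 2)) *
        (2 * (‖(res z Y *ᵥ v) i‖ ^ 2 + ‖(res z Y *ᵥ v) j‖ ^ 2)) := by
      rw [sum_comm]
      refine sum_congr rfl fun i _ => ?_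
      rw [sum_comm]
      refine sum_congr rfl fun j _ => ?_
      rw [← sum_mul, ← mul_sum, sum_add_distrib]
    _ ≤ ∑ i, ∑ j, (2 * (A ^ 2 + A ^ 2)) *
        (2 * (‖(res z Y *ᵥ v) i‖ ^ 2 + ‖(res z Y *ᵥ v) j‖ ^ 2)) := by
      gcongr <;> apply hrow
    _ = 16 * A ^ 2 * (card n * ∑ i, ‖(res z Y *ᵥ v) i‖ ^ 2) := by
      simp only [← mul_sum, sum_add_distrib, sum_const, card_univ, nsmul_eq_mul]
      ring
    _ ≤ 16 * A ^ 2 * (card n * (A ^ 2 * l2 v ^ 2)) := by gcongr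
    _ = _ := by ring

/-- The constant in the bound for the variances of the squared entries. -/
def squareConst (A : ℝ) : ℝ := 6 * (1 + A) ^ 2 * (1250 * A ^ 4) ^ 2 * (3000000000 * A ^ 16)

lemma squareConst_nonneg {A : ℝ} (hA : 1 ≤ A) : 0 ≤ squareConst A := by
  unfold squareConst; positivity

namespace Model

variable (M : Model P X h A σ ρ)
include M

/-- The variances of the squared moduli of the entries of `(z - X)⁻¹ v`. -/
theorem sum_spread_normSq_le {z : ℂ} (hz : 1 ≤ A * |z.im|) {v : n → ℂ} (hv : l2 v ≤ 1) :
    ∑ k, spread P X (fun Y => (((‖(res z Y *ᵥ v) k‖ ^ 2 : ℝ)) : ℂ)) ≤ squareConst A * h ^ 2 := by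
  have hA := M.one_le
  have hh := M.h_pos
  have hz0 := im_ne_of hz
  have := M.nonempty
  obtain ⟨f, hf⟩ : ∃ f : n → 𝕄 → ℂ, ∀ k Y, (res z Y *ᵥ v) k = f k Y := ⟨_, fun _ _ => rfl⟩
  obtain ⟨C, hC⟩ : ∃ C : n → n → n → 𝕄 → ℝ, ∀ k i j Y,
    crossMass z (Pi.single k 1) v i j Y = C k i j Y := ⟨_, fun _ _ _ _ => rfl⟩
  obtain ⟨Q, hQ⟩ : ∃ Q : n → n → n → 𝕄 → ℝ, ∀ k i j Y,
    pairMass z (Pi.single k 1) v i j Y = Q k i j Y := ⟨_, fun _ _ _ _ => rfl⟩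
  set S : n → n → n → 𝕄 → ℝ := fun k i j Y => 14 * A ^ 2 * Q k i j Y with hS
  set p : n → n → n → 𝕄 → ℝ := fun k i j Y => 2 * C k i j Y * ‖f k Y‖ with hp
  set S' : n → n → n → 𝕄 → ℝ := fun k i j Y => 2 * S k i j Y * ‖f k Y‖ + 12 * S k i j Y ^ 2 with hS'
  have tf : ∀ k, Tame (f k) := fun k => by simpa only [hf] using tame_res_mulVec hz0 v k
  have tC : ∀ k i j, Tame (C k i j) := fun k i j =>
    (funext (hC k i j)) ▸ tame_crossMass hz0 (Pi.single k 1) v i j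
  have tQ : ∀ k i j, Tame (Q k i j) := fun k i j =>
    (funext (hQ k i j)) ▸ tame_pairMass hz0 (Pi.single k 1) v i j
  have tF : ∀ k, Tame fun Y => ((‖f k Y‖ ^ 2 : ℝ) : ℂ) := fun k => by
    obtain ⟨m, C, hC⟩ := (tf k).norm.pow 2
    exact ⟨Complex.measurable_ofReal.comp m, C, fun Y hY => by rw [norm_real]; exact hC Y hY⟩
  have C0 : ∀ k i j Y, 0 ≤ C k i j Y := fun k i j Y => hC k i j Y ▸ crossMass_nonneg _ _ _ _ _ _
  have Q0 : ∀ k i j Y, 0 ≤ Q k i j Y := fun k i j Y => hQ k i j Y ▸ pairMass_nonneg _ _ _ _ _ _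
  have S0 : ∀ k i j Y, 0 ≤ S k i j Y := fun k i j Y => mul_nonneg (by positivity) (Q0 k i j Y)
  have cQ : ∀ k i j Y, C k i j Y ≤ Q k i j Y := fun k i j Y => by
    simpa only [hC, hQ] using crossMass_le_pairMass z (Pi.single k 1) v i j Y
  have e0 := fun w i j => M.norm_entry_le_two w i j
  have e1 : ∀ w k i j, ‖f k (X w) - f k Xe‖ ≤ ‖X w i j‖ * C k i j Xe +
      ‖X w i j‖ ^ 2 * S k i j Xe := fun w k i j => by
    simpa only [form_single, hf, hC, hQ] using
      norm_form_erase_sub_le (Pi.single k 1) v i j (M.isHermitian w) hA hz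
  have e2 : ∀ w k i j, ‖f k (X w) - f k Xe‖ ≤ 3 * ‖X w i j‖ * S k i j Xe := fun w k i j => by
    have h2 := S0 k i j Xe
    have h1 : C k i j Xe ≤ S k i j Xe :=
      (cQ k i j _).trans (le_mul_of_one_le_left (Q0 k i j _) (by nlinarith))
    have h4 := norm_nonneg (X w i j)
    have h5 := mul_le_mul_of_nonneg_left h1 h4
    have h6 := mul_le_mul_of_nonneg_right (e0 w i j) (mul_nonneg h4 h2)
    linarith [e1 w k i j]
  have e3 : ∀ w k i j, S k i j Xe ≤ 25 * A ^ 2 * S k i j (X w) := fun w k i j => by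
    have := pairMass_erase_le (Pi.single k 1) v i j (M.isHermitian w) hA hz (e0 w i j)
    simp only [hQ] at this
    calc _ ≤ 14 * A ^ 2 * (25 * A ^ 2 * Q k i j (X w)) := by simp only [hS]; gcongr
      _ = _ := by rw [hS]; ring
  have e4 : ∀ w k i j, C k i j (X w) ≤ 2 * S k i j Xe := fun w k i j => by
    have h1 := pairMass_le_erase (Pi.single k 1) v i j (M.isHermitian w) hA hz (e0 w i j)
    have h3 := mul_nonneg (sq_nonneg A) (Q0 k i j Xe)
    simp only [hQ] at h1
    simp only [hS]
    linarith [cQ k i j (X w)]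
  have e5 : ∀ w k i j, C k i j Xe ≤ C k i j (X w) + ‖X w i j‖ * S k i j Xe := fun w k i j => by
    simpa only [hC, hQ] using
      crossMass_erase_le (Pi.single k 1) v i j (M.isHermitian w) hA hz (e0 w i j)
  have e6 : ∀ w k i j, ‖f k Xe‖ ≤ ‖f k (X w)‖ + ‖f k (X w) - f k Xe‖ := fun w k i j => by
    rw [norm_sub_rev]
    exact norm_le_norm_add_norm_sub' _ _
  have hk : ∀ k, spread P X (fun Y => ((‖f k Y‖ ^ 2 : ℝ) : ℂ)) ≤
      6 * (1 + A) ^ 2 * (1250 * A ^ 4) ^ 2 *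
        avg P X (fun Y => ∑ i, ∑ j, (h ^ 2 * p k i j Y ^ 2 + h ^ 4 * S' k i j Y ^ 2)) := fun k => by
    refine M.spread_le (tF k) (by fun_prop) (by fun_prop) ?_ (fun i j Y => ?_) (fun i j Y => ?_)
      (fun w i j => ?_) (fun w i j => ?_) (fun w i j => ?_)
    · linarith [one_le_pow₀ hA (n := 4)]
    · have := S0 k i j Y
      positivity
    · have := C0 k i j Y
      positivity
    all_goals
      have h1 := e1 w k i j
      have h2 := e2 w k i j
      have h3 := S0 k i j Xe
      have h4 := norm_nonneg (X w i j)
      have h5 := norm_nonneg (f k Xe)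
      have h9 := e6 w k i j
    · rw [← Complex.ofReal_sub, norm_real, Real.norm_eq_abs, sq_sub_sq, abs_mul,
        abs_of_nonneg (by positivity)]
      simp only [hp, hS']
      have h6 := abs_norm_sub_norm_le (f k (X w)) (f k Xe)
      have h7 := norm_sub_norm_le (f k (X w)) (f k Xe)
      have h8 := norm_nonneg (f k (X w) - f k Xe)
      generalize ‖f k (X w) - f k Xe‖ = d at *
      generalize ‖f k Xe‖ = y at *
      generalize S k i j Xe = s at *
      generalize C k i j Xe = q at *
      generalize ‖X w i j‖ = x at *
      have k0 : (‖f k (X w)‖ + y) * |‖f k (X w)‖ - y| ≤ (2 * y + d) * d :=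
        mul_le_mul (by linarith) h6 (abs_nonneg _) (by linarith)
      have k1 := mul_le_mul_of_nonneg_right h1 (show 0 ≤ 2 * y by positivity)
      have k2 : d * d ≤ (3 * x * s) * (3 * x * s) := by gcongr
      have : 0 ≤ x ^ 2 * s ^ 2 := by positivity
      linarith
    · have h6 := C0 k i j (X w)
      have h7 := e4 w k i j
      have h8 := e5 w k i j
      simp only [hp, hS']
      generalize ‖f k (X w) - f k Xe‖ = d at *
      generalize ‖f k Xe‖ = y at *
      generalize ‖f k (X w)‖ = f1 at *
      generalize S k i j Xe = s at *
      generalize C k i j Xe = q at *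
      generalize C k i j (X w) = q1 at *
      generalize ‖X w i j‖ = x at *
      have k1 := mul_le_mul_of_nonneg_right h8 h5
      have k2 := mul_le_mul_of_nonneg_left (show y ≤ f1 + 3 * x * s by linarith) h6
      have k3 := mul_le_mul_of_nonneg_right h7 (show 0 ≤ x * s by positivity)
      linarith
    · have h3' := S0 k i j (X w)
      have h6 := mul_le_mul_of_nonneg_right (e0 w i j) h3
      have h7 := e3 w k i j
      have h8 := norm_nonneg (f k (X w))
      simp only [hS']
      generalize S k i j Xe = s at *
      generalize S k i j (X w) = s1 at *
      have hL : (1 : ℝ) ≤ 25 * A ^ 2 := by nlinarith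
      have hKL : 1250 * A ^ 4 = 2 * (25 * A ^ 2) ^ 2 := by ring
      rw [hKL]
      generalize 25 * A ^ 2 = L at *
      calc _ ≤ 2 * (L * s1) * (‖f k (X w)‖ + 6 * (L * s1)) + 12 * (L * s1) ^ 2 := by
            gcongr
            linarith
        _ = 2 * s1 * ‖f k (X w)‖ * L + 24 * (L ^ 2 * s1 ^ 2) := by ring
        _ ≤ 2 * s1 * ‖f k (X w)‖ * (2 * L ^ 2) + 24 * (L ^ 2 * s1 ^ 2) := by
          have : L ≤ 2 * L ^ 2 := by nlinarith
          gcongr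
        _ = _ := by ring
  have hav : ∑ k, avg P X (fun Y => ∑ i, ∑ j, (h ^ 2 * p k i j Y ^ 2 + h ^ 4 * S' k i j Y ^ 2)) ≤
      3000000000 * A ^ 16 * h ^ 2 := by
    rw [← M.avg_sum (by fun_prop)]
    refine (M.avg_mono (by fun_prop) (Tame.const (3000000000 * A ^ 16 * h ^ 2))
      fun Y hY => ?_).trans (by simp [avg])
    have hl1 : l2 (res z Y *ᵥ v) ≤ A := (l2_res_le hY hz v).trans (by nlinarith)
    have hw2 : ∑ k, ‖f k Y‖ ^ 2 ≤ A ^ 2 := by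
      simp only [← hf]
      rw [← l2_sq]
      exact pow_le_pow_left₀ (l2_nonneg _) hl1 2
    have hak : ∀ k, (l2 (res (conj z) Y *ᵥ Pi.single k 1) * l2 (res z Y *ᵥ v)) ^ 2 ≤ A ^ 4 :=
        fun k => by
      have := l2_res_le hY (abs_im_conj hz) (Pi.single k 1)
      rw [l2_single, mul_one] at this
      have := l2_nonneg (res (conj z) Y *ᵥ Pi.single k 1)
      have := l2_nonneg (res z Y *ᵥ v)
      calc _ ≤ (A * A) ^ 2 := by gcongr
        _ = _ := by ring
    have b1 : ∀ k, ∑ i, ∑ j, C k i j Y ^ 2 ≤ 4 * A ^ 4 := fun k => by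
      simp only [← hC]
      exact (sum_crossMass_sq_le z _ v).trans (by have := hak k; gcongr)
    have b2 : ∀ k, ∑ i, ∑ j, Q k i j Y ^ 2 ≤ 16 * card n * A ^ 4 := fun k => by
      simp only [← hQ]
      exact (sum_pairMass_sq_le z _ v).trans (by have := hak k; gcongr)
    have b3 : ∑ k, ∑ i, ∑ j, Q k i j Y ^ 2 ≤ 16 * A ^ 4 * (card n * 1 ^ 2) := by
      simp only [← hQ]
      exact (sum_pairMass_single_sq_le hY hz v).trans (by have := l2_nonneg v; gcongr)
    have b4 : ∀ k i j, Q k i j Y ^ 2 ≤ 16 * A ^ 4 := fun k i j => by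
      have c1 := norm_res_entry_le hY (abs_im_conj hz) i k
      have c2 := norm_res_entry_le hY (abs_im_conj hz) j k
      have c3 := (norm_apply_le_l2 _ i).trans hl1
      have c4 := (norm_apply_le_l2 _ j).trans hl1
      rw [← hQ, pairMass, ← res_apply_eq, ← res_apply_eq]
      calc _ ≤ ((A + A) * (A + A)) ^ 2 := by gcongr
        _ = _ := by ring
    calc _ ≤ ∑ k, ∑ i, ∑ j, (4 * h ^ 2 * (‖f k Y‖ ^ 2 * C k i j Y ^ 2) +
          1568 * A ^ 4 * h ^ 4 * (‖f k Y‖ ^ 2 * Q k i j Y ^ 2) +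
          11063808 * A ^ 8 * h ^ 4 * (16 * A ^ 4 * Q k i j Y ^ 2)) := by
          refine sum_le_sum fun k _ => sum_le_sum fun i _ => sum_le_sum fun j _ => ?_
          have c1 : S' k i j Y ^ 2 ≤ 2 * ((2 * S k i j Y * ‖f k Y‖) ^ 2 +
            (12 * S k i j Y ^ 2) ^ 2) := add_sq_le
          have c2 := mul_le_mul_of_nonneg_left c1 (show 0 ≤ h ^ 4 by positivity)
          have c3 := mul_le_mul_of_nonneg_right (b4 k i j)
            (show 0 ≤ A ^ 8 * h ^ 4 * Q k i j Y ^ 2 by positivity)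
          simp only [hp, hS] at c2 ⊢
          linarith
      _ = 4 * h ^ 2 * (∑ k, ‖f k Y‖ ^ 2 * ∑ i, ∑ j, C k i j Y ^ 2) +
        1568 * A ^ 4 * h ^ 4 * (∑ k, ‖f k Y‖ ^ 2 * ∑ i, ∑ j, Q k i j Y ^ 2) +
        11063808 * A ^ 8 * h ^ 4 * (16 * A ^ 4 * ∑ k, ∑ i, ∑ j, Q k i j Y ^ 2) := by
        simp only [sum_add_distrib, ← mul_sum]
      _ ≤ 4 * h ^ 2 * (∑ k, ‖f k Y‖ ^ 2 * (4 * A ^ 4)) +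
        1568 * A ^ 4 * h ^ 4 * (∑ k, ‖f k Y‖ ^ 2 * (16 * card n * A ^ 4)) +
        11063808 * A ^ 8 * h ^ 4 * (16 * A ^ 4 * (16 * A ^ 4 * (card n * 1 ^ 2))) := by
        gcongr with k _ k _
        exacts [b1 k, b2 k]
      _ ≤ 4 * h ^ 2 * (A ^ 2 * (4 * A ^ 4)) +
        1568 * A ^ 4 * h ^ 4 * (A ^ 2 * (16 * card n * A ^ 4)) +
        11063808 * A ^ 8 * h ^ 4 * (16 * A ^ 4 * (16 * A ^ 4 * (card n * 1 ^ 2))) := by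
        rw [← sum_mul, ← sum_mul]
        gcongr
      _ = 16 * A ^ 6 * h ^ 2 + 25088 * A ^ 10 * h ^ 2 * (card n * h ^ 2) +
          2832334848 * A ^ 16 * h ^ 2 * (card n * h ^ 2) := by ring
      _ ≤ 16 * A ^ 16 * h ^ 2 + 25088 * A ^ 16 * h ^ 2 + 2832334848 * A ^ 16 * h ^ 2 := by
        rw [M.card_eq, mul_one, mul_one]
        gcongr <;> norm_num [hA]
      _ ≤ _ := by
        have : 0 ≤ A ^ 16 * h ^ 2 := by positivity
        linarith
  simp only [hf]
  calc _ ≤ ∑ k, 6 * (1 + A) ^ 2 * (1250 * A ^ 4) ^ 2 *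
        avg P X (fun Y => ∑ i, ∑ j, (h ^ 2 * p k i j Y ^ 2 + h ^ 4 * S' k i j Y ^ 2)) :=
        sum_le_sum fun k _ => hk k
    _ ≤ 6 * (1 + A) ^ 2 * (1250 * A ^ 4) ^ 2 * (3000000000 * A ^ 16 * h ^ 2) := by
      rw [← mul_sum]
      gcongr
    _ = _ := by unfold squareConst; ring

end Model

lemma smul_form {Y : 𝕄} (hY : Y.IsHermitian) {z : ℂ} (hz : z.im ≠ 0) (u v : n → ℂ) :
    z * form z u v Y = ∑ i, conj (u i) * v i +
      ∑ i, ∑ j, conj (u i) * (Y i j * (res z Y *ᵥ v) j) := by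
  have h := congrArg (fun B => B *ᵥ v) (smul_resolvent hY hz)
  simp only [Matrix.smul_mulVec, Matrix.add_mulVec, Matrix.one_mulVec, ← Matrix.mulVec_mulVec] at h
  unfold form
  rw [mul_sum, ← sum_add_distrib]
  refine sum_congr rfl fun i _ => ?_
  have hi := congrFun h i
  simp only [Pi.smul_apply, Pi.add_apply, smul_eq_mul] at hi
  rw [← mul_sum, ← mul_add, mul_left_comm, hi]
  rfl

/-- A weighted sum over the off-diagonal index pairs. -/
def offSum (u : n → ℂ) (m f : n → n → ℂ) : ℂ :=
  ∑ i, ∑ j, if i ≠ j then conj (u i) * (m i j * f i j) else 0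

/-- The error terms in the expansions. -/
def errTotal (P : Measure Ω) (X : Ω → 𝕄) (T : Family n β) (h η : ℝ) : ℝ :=
  h + η + avg P X fun Y => ∑ j, T.mass Y j ^ 3

lemma avg_const {𝕜 : Type*} [RCLike 𝕜] (a : 𝕜) : avg P X (fun _ => a) = a := by simp [avg]

namespace Model

variable (M : Model P X h A σ ρ)
include M

lemma norm_avg_le_avg {F : 𝕄 → ℂ} {G : 𝕄 → ℝ} (hF : Tame F) (hG : Tame G)
    (h : ∀ Y : 𝕄, Y.IsHermitian → ‖F Y‖ ≤ G Y) : ‖avg P X F‖ ≤ avg P X G :=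
  (norm_integral_le_integral_norm _).trans (M.avg_mono hF.norm hG h)

lemma norm_avg_le {F : 𝕄 → ℂ} (hF : Tame F) {C : ℝ}
    (h : ∀ Y : 𝕄, Y.IsHermitian → ‖F Y‖ ≤ C) : ‖avg P X F‖ ≤ C :=
  (M.norm_avg_le_avg hF (Tame.const C) h).trans_eq (avg_const C)

@[fun_prop]
lemma tame_formAt (hT : T.Good c A) (b : β) : Tame (T.formAt b) := tame_form (hT.im_ne b) _ _

lemma smul_avg_formAt (hT : T.Good c A) (b : β) :
    T.z b * avg P X (fun Y => T.formAt b Y * T.osc h⁻¹ c Y) =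
      (∑ i, conj (T.u b i) * T.v b i) * avg P X (T.osc h⁻¹ c) +
      ∑ i, ∑ j, conj (T.u b i) * ∫ w, X w i j * (T.right b (X w) j * T.osc h⁻¹ c (X w)) ∂P := by
  have c1 : Continuous fun x : ℂ => x := continuous_id
  have hw : ∀ j, Tame fun Y => T.right b Y j * T.osc h⁻¹ c Y := fun j => by fun_prop
  have hi : ∀ i j, Integrable (fun w => conj (T.u b i) *
      (X w i j * (T.right b (X w) j * T.osc h⁻¹ c (X w)))) P := fun i j =>
    (M.integrable_entry_mul c1 (hw j) i j).const_mul _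
  have e : ∀ w, T.z b * (T.formAt b (X w) * T.osc h⁻¹ c (X w)) =
      (∑ i, conj (T.u b i) * T.v b i) * T.osc h⁻¹ c (X w) + ∑ i, ∑ j, conj (T.u b i) *
        (X w i j * (T.right b (X w) j * T.osc h⁻¹ c (X w))) := fun w => by
    rw [← mul_assoc, formAt, smul_form (M.isHermitian w) (hT.im_ne b), add_mul, sum_mul univ]
    simp only [sum_mul, right, mul_assoc]
  have hs := fun i => integrable_finsetSum univ fun j _ => hi i j
  simp only [avg, ← integral_const_mul, e]
  rw [integral_add ((M.integrable (tame_osc hT _)).const_mul _)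
    (integrable_finsetSum univ fun i _ => hs i), integral_finsetSum univ fun i _ => hs i]
  simp only [integral_finsetSum _ fun j _ => hi _ j]

/-- The approximate identity satisfied by `E[⟨u, (z - X)⁻¹ v⟩ e]`. -/
theorem norm_main_identity_le (hT : T.Good c A) (b : β) {η : ℝ} (hη : 0 ≤ η)
    (huη : ∀ i, ‖T.u b i‖ ≤ η) :
    ‖T.z b * avg P X (fun Y => T.formAt b Y * T.osc h⁻¹ c Y) -
      (∑ i, conj (T.u b i) * T.v b i) * avg P X (T.osc h⁻¹ c) -
      offSum (T.u b) 1 (mainTerm P X h T c b)‖ ≤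
      expConst A * (80 * A ^ 8) * (h * errTotal P X T h η) := by
  have hh := M.h_pos
  have hA := M.one_le
  have hcE := expConst_nonneg hA
  rw [M.smul_avg_formAt hT b, add_sub_cancel_left]
  simp only [offSum, ← sum_sub_distrib]
  have hij : ∀ i j, ‖conj (T.u b i) * (∫ w, X w i j * (T.right b (X w) j * T.osc h⁻¹ c (X w)) ∂P) -
      (if i ≠ j then conj (T.u b i) * ((1 : n → n → ℂ) i j * mainTerm P X h T c b i j) else 0)‖ ≤
      expConst A * h * avg P X (fun Y => ‖T.u b i‖ *
        err h (T.mass Y i) (T.mass Y j)) := fun i j => by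
    have hE0 : 0 ≤ ∫ w, err h (T.mass (X w) i) (T.mass (X w) j) ∂P :=
      integral_nonneg fun w => err_mass_nonneg hh.le i j _
    rw [avg_mul_left, avg]
    split_ifs with hij
    · rw [Pi.one_apply, Pi.one_apply, one_mul, ← mul_sub, norm_mul, norm_conj]
      have := mul_le_mul_of_nonneg_left (M.norm_expansion_le hT b hij) (norm_nonneg (T.u b i))
      linarith
    · rw [not_not] at hij
      subst hij
      simp only [M.diag, zero_mul, integral_zero, mul_zero, sub_zero, norm_zero]
      positivity
  refine (norm_sum_le_of_le _ fun i _ => norm_sum_le_of_le _ fun j _ => hij i j).trans ?_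
  simp (disch := fun_prop) only [← mul_sum, ← M.avg_sum]
  have h3 : avg P X (fun Y => ∑ i, ‖T.u b i‖ * ∑ j, err h (T.mass Y i) (T.mass Y j)) ≤
      80 * A ^ 8 * errTotal P X T h η := by
    have e3 : 80 * A ^ 8 * errTotal P X T h η =
        avg P X (fun Y => 80 * A ^ 8 * (h + η + ∑ j, T.mass Y j ^ 3)) := by
      simp (disch := fun_prop) only [errTotal, avg_mul_left, M.avg_add, avg_const]
    rw [e3]
    refine M.avg_mono (by fun_prop) (by fun_prop) fun Y hY => ?_
    rw [sum_congr rfl fun i _ => mul_sum _ _ _]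
    have hA4 : (1 : ℝ) ≤ 4 * A ^ 4 := by
      have := one_le_pow₀ (n := 4) hA
      linarith
    refine (sum_err_le (K := 4 * A ^ 4) hh M.h_le M.card_eq hA4 hη (fun i => norm_nonneg _)
      (fun i => T.mass_nonneg Y i) huη ?_ (sum_mass_sq_le hY hT)).trans (le_of_eq (by ring))
    rw [← l2_sq]
    exact pow_le_one₀ (l2_nonneg _) (hT.u_le b)
  calc _ ≤ expConst A * h * (80 * A ^ 8 * errTotal P X T h η) := by gcongr
    _ = _ := by ring

/-- Absolute bounds for weighted sums. -/
lemma norm_offSum_le {u : n → ℂ} {m : n → n → ℂ} {F : n → n → 𝕄 → ℂ}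
    (hF : ∀ i j, Tame (F i j)) {μ D : ℝ} (hm : ∀ i j, i ≠ j → ‖m i j‖ ≤ μ) (hμ : 0 ≤ μ)
    (hD : ∀ Y : 𝕄, Y.IsHermitian → ∑ i, ∑ j, ‖u i‖ * ‖F i j Y‖ ≤ D) :
    ‖offSum u m fun i j => avg P X (F i j)‖ ≤ μ * D := by
  have h1 := (M.avg_mono (by fun_prop) (Tame.const D) hD).trans_eq (avg_const D)
  simp (disch := fun_prop) only [M.avg_sum, avg_mul_left] at h1
  refine (norm_sum_le_of_le _ fun i _ => norm_sum_le _ _).trans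
    (le_trans ?_ (mul_le_mul_of_nonneg_left h1 hμ))
  simp only [mul_sum]
  refine sum_le_sum fun i _ => sum_le_sum fun j _ => ?_
  have h2 : 0 ≤ avg P X (fun Y => ‖F i j Y‖) := integral_nonneg fun w => norm_nonneg _
  split_ifs with hij
  · rw [norm_mul, norm_mul, norm_conj]
    have h3 : ‖avg P X (F i j)‖ ≤ avg P X (fun Y => ‖F i j Y‖) := norm_integral_le_integral_norm _
    rw [mul_left_comm μ]
    gcongr
    exact hm i j hij
  · rw [norm_zero]; positivity

/-- Weighted sums with almost constant weights. -/
lemma norm_offSum_sub_le {u : n → ℂ} {m : n → n → ℂ} {F : n → n → 𝕄 → ℂ}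
    (hF : ∀ i j, Tame (F i j)) {μ : ℂ} {δ D D' : ℝ} (hm : ∀ i j, i ≠ j → ‖m i j - μ‖ ≤ δ)
    (hδ : 0 ≤ δ)
    (hD : ∀ Y : 𝕄, Y.IsHermitian → ∑ i, ∑ j, ‖u i‖ * ‖F i j Y‖ ≤ D)
    (hD' : ∀ Y : 𝕄, Y.IsHermitian → ∑ i, ‖u i‖ * ‖F i i Y‖ ≤ D') :
    ‖(offSum u m fun i j => avg P X (F i j)) -
      μ * avg P X (fun Y => ∑ i, ∑ j, conj (u i) * F i j Y)‖ ≤ δ * D + ‖μ‖ * D' := by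
  have h1 := M.norm_offSum_le (m := fun i j => m i j - μ) hF hm hδ hD
  have h2 : ‖avg P X (fun Y => ∑ i, conj (u i) * F i i Y)‖ ≤ D' :=
    M.norm_avg_le (by fun_prop) fun Y hY => (norm_sum_le _ _).trans (by simpa using hD' Y hY)
  have key : (offSum u m fun i j => avg P X (F i j)) -
      μ * avg P X (fun Y => ∑ i, ∑ j, conj (u i) * F i j Y) =
      offSum u (fun i j => m i j - μ) (fun i j => avg P X (F i j)) -
        μ * avg P X (fun Y => ∑ i, conj (u i) * F i i Y) := by
    simp (disch := fun_prop) only [M.avg_sum, avg_mul_left, offSum, mul_sum, ← sum_sub_distrib]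
    refine sum_congr rfl fun i _ => ?_
    have e : μ * (conj (u i) * avg P X (F i i)) =
        ∑ j, if i = j then μ * (conj (u i) * avg P X (F i j)) else 0 := by simp
    rw [e, ← sum_sub_distrib]
    exact sum_congr rfl fun j _ => by grind
  rw [key]
  refine (norm_sub_le _ _).trans (add_le_add h1 ?_)
  rw [norm_mul]
  exact mul_le_mul_of_nonneg_left h2 (norm_nonneg _)

lemma norm_mom_two_sub_le {i j : n} (hij : i ≠ j) :
    ‖mom P X 2 0 i j - (ρ * σ ^ 2 * h ^ 2 : ℝ)‖ ≤ A * h ^ 3 := by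
  have := M.square i j hij
  simpa [mom] using this

lemma norm_mom_abs_sub_le {i j : n} (hij : i ≠ j) :
    ‖mom P X 1 1 i j - (σ ^ 2 * h ^ 2 : ℝ)‖ ≤ A * h ^ 3 := by
  have h1 := M.second i j hij
  have e : mom P X 1 1 i j = ((∫ w, ‖X w i j‖ ^ 2 ∂P : ℝ) : ℂ) := by
    unfold mom
    rw [← integral_complex_ofReal]
    refine integral_congr_ae (ae_of_all _ fun w => ?_)
    simp only [pow_one, Complex.mul_conj, Complex.normSq_eq_norm_sq]
  rw [e, ← Complex.ofReal_sub, norm_real]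
  exact h1

lemma sum_norm_le {x : n → ℂ} {L : ℝ} (hx : l2 x ≤ L) : h * ∑ i, ‖x i‖ ≤ L := by
  have hh := M.h_pos
  have h1 := sum_norm_le_l2 x
  have h2 : √(card n) * h = 1 := by
    rw [← Real.sqrt_sq hh.le, ← Real.sqrt_mul (Nat.cast_nonneg _), M.card_eq, Real.sqrt_one]
  calc h * ∑ i, ‖x i‖ ≤ h * (√(card n) * l2 x) := by gcongr
    _ = (√(card n) * h) * l2 x := by ring
    _ ≤ L := by rw [h2, one_mul]; exact hx

end Model

section PointwiseSums

variable {Y : Matrix n n ℂ}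

lemma l2_right_le (hT : T.Good c A) (hY : Y.IsHermitian) (b : β) : l2 (T.right b Y) ≤ A := by
  refine (l2_res_le hY (hT.im b) (T.v b)).trans ?_
  have := hT.one_le
  exact mul_le_of_le_one_right (by linarith) (hT.v_le b)

lemma l2_left_le (hT : T.Good c A) (hY : Y.IsHermitian) (b : β) : l2 (T.left b Y) ≤ A := by
  refine (l2_res_le hY (abs_im_conj (hT.im b)) (T.u b)).trans ?_
  have := hT.one_le
  exact mul_le_of_le_one_right (by linarith) (hT.u_le b)

lemma sum_norm_mul_le_l2 {x y : n → ℂ} {a b : ℝ} (hx : l2 x ≤ a) (hy : l2 y ≤ b) :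
    ∑ i, ‖x i‖ * ‖y i‖ ≤ a * b :=
  (sum_norm_mul_norm_le x y).trans (mul_le_mul hx hy (l2_nonneg _) ((l2_nonneg _).trans hx))

lemma norm_term₂ (hT : T.Good c A) (hY : Y.IsHermitian) (b : β) (j a k : n) :
    ‖T.term₂ c h⁻¹ b j a k Y‖ = ‖res (T.z b) Y j a‖ * ‖T.right b Y k‖ := by
  rw [term₂, norm_mul, norm_mul, norm_osc hY hT, mul_one]

lemma norm_term₃ (hT : T.Good c A) (hY : Y.IsHermitian) (b : β) (j a l m k : n) :
    ‖T.term₃ c h⁻¹ b j a l m k Y‖ =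
      ‖res (T.z b) Y j a‖ * ‖res (T.z b) Y l m‖ * ‖T.right b Y k‖ := by
  rw [term₃, norm_mul, norm_mul, norm_mul, norm_osc hY hT, mul_one]

lemma norm_termOsc_le (hT : T.Good c A) (hY : Y.IsHermitian) (b : β) (p q k : n) :
    ‖T.termOsc c h⁻¹ b p q k Y‖ ≤ A * ∑ b', ‖T.left b' Y p‖ * ‖T.right b' Y q‖ * ‖T.right b Y k‖ := by
  rw [termOsc, norm_mul, norm_mul, norm_osc hY hT, mul_one, ← sum_mul, ← mul_assoc]
  refine mul_le_mul_of_nonneg_right ?_ (norm_nonneg _)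
  unfold cross
  refine (norm_sum_le _ _).trans ?_
  rw [mul_sum]
  refine sum_le_sum fun b' _ => ?_
  rw [norm_mul, norm_mul, norm_conj]
  exact mul_le_mul_of_nonneg_right (hT.c_le b') (by positivity)

end PointwiseSums

section PointwiseSums

variable {Y : Matrix n n ℂ}

lemma sum_sum_mul_sum (a : ℝ) (q : n → ℝ) (x y : β → n → ℝ) (w : n → ℝ) :
    ∑ i, ∑ j, q i * (a * ∑ b, x b i * y b j * w j) =
      a * ∑ b, (∑ i, q i * x b i) * ∑ j, y b j * w j := by
  simp only [sum_mul_sum]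
  simp only [mul_sum]
  rw [sum_comm (γ := β)]
  refine sum_congr rfl fun i _ => ?_
  rw [sum_comm (γ := β)]
  exact sum_congr rfl fun j _ => sum_congr rfl fun b' _ => by ring

lemma l2_res_row_le (hT : T.Good c A) (hY : Y.IsHermitian) (b : β) (i : n) :
    l2 (fun j => res (T.z b) Y i j) ≤ A :=
  (l2_row_le _ i).trans (norm_res_le hY (hT.im b))

lemma l2_res_col_le (hT : T.Good c A) (hY : Y.IsHermitian) (b : β) (i : n) :
    l2 (fun j => res (T.z b) Y j i) ≤ A :=
  (l2_col_le _ i).trans (norm_res_le hY (hT.im b))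

end PointwiseSums

namespace Model

variable (M : Model P X h A σ ρ)
include M

lemma sum_le_of_scaled {S D : ℝ} (hS : h * S ≤ D) : S ≤ h⁻¹ * D := by
  have := M.h_pos
  rw [inv_mul_eq_div, le_div_iff₀ this]
  linarith

lemma sum_term₂_le (hT : T.Good c A) (b : β) {Y : 𝕄} (hY : Y.IsHermitian) :
    ∑ i, ∑ j, ‖T.u b i‖ * ‖T.term₂ c h⁻¹ b j i j Y‖ ≤ h⁻¹ * A ^ 2 := by
  have hA := M.one_le
  have hh := M.h_pos
  refine M.sum_le_of_scaled ?_
  calc _ ≤ h * ∑ i, ‖T.u b i‖ * A ^ 2 := by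
        refine mul_le_mul_of_nonneg_left (sum_le_sum fun i _ => ?_) hh.le
        rw [← mul_sum]
        refine mul_le_mul_of_nonneg_left ?_ (norm_nonneg _)
        simp only [norm_term₂ hT hY]
        exact (sum_norm_mul_le_l2 (l2_res_col_le hT hY b i) (l2_right_le hT hY b)).trans
          (le_of_eq (by ring))
    _ = (h * ∑ i, ‖T.u b i‖) * A ^ 2 := by rw [← sum_mul]; ring
    _ ≤ 1 * A ^ 2 := by gcongr; exact M.sum_norm_le (hT.u_le b)
    _ = _ := one_mul _

lemma sum_term₂_diag_le (hT : T.Good c A) (b : β) {Y : 𝕄} (hY : Y.IsHermitian) :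
    ∑ i, ‖T.u b i‖ * ‖T.term₂ c h⁻¹ b i i i Y‖ ≤ A ^ 2 := by
  have hA := M.one_le
  simp only [norm_term₂ hT hY]
  calc _ ≤ ∑ i, A * (‖T.u b i‖ * ‖T.right b Y i‖) := by
        refine sum_le_sum fun i _ => ?_
        rw [mul_left_comm]
        gcongr
        exact norm_res_entry_le hY (hT.im b) i i
    _ ≤ A * (1 * A) := by
      rw [← mul_sum]
      gcongr
      exact sum_norm_mul_le_l2 (hT.u_le b) (l2_right_le hT hY b)
    _ = _ := by ring

lemma norm_sum_term₂_le (hT : T.Good c A) (b : β) {Y : 𝕄} (hY : Y.IsHermitian) :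
    ‖∑ i, ∑ j, conj (T.u b i) * T.term₂ c h⁻¹ b j i j Y‖ ≤ A ^ 2 := by
  have hA := M.one_le
  have e : ∑ i, ∑ j, conj (T.u b i) * T.term₂ c h⁻¹ b j i j Y =
      (∑ j, (res (T.z b) Y *ᵥ star (T.u b)) j * T.right b Y j) * T.osc h⁻¹ c Y := by
    rw [sum_comm, sum_mul]
    refine sum_congr rfl fun j _ => ?_
    simp only [Matrix.mulVec, dotProduct, sum_mul, Pi.star_apply, term₂]
    exact sum_congr rfl fun i _ => by simp only [RCLike.star_def]; ring
  have hs : l2 (star (T.u b)) = l2 (T.u b) := by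
    refine (sq_eq_sq₀ (l2_nonneg _) (l2_nonneg _)).1 ?_
    simp [l2_sq]
  have h1 : l2 (res (T.z b) Y *ᵥ star (T.u b)) ≤ A := by
    refine (l2_res_le hY (hT.im b) _).trans ?_
    rw [hs]
    exact mul_le_of_le_one_right (by linarith) (hT.u_le b)
  rw [e, norm_mul, norm_osc hY hT, mul_one]
  refine (norm_sum_le _ _).trans ?_
  simp only [norm_mul]
  exact (sum_norm_mul_le_l2 h1 (l2_right_le hT hY b)).trans (le_of_eq (by ring))

lemma sum_trace_le (hT : T.Good c A) (b : β) {Y : 𝕄} (hY : Y.IsHermitian) :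
    ∑ i, ∑ j, ‖T.u b i‖ * ‖T.term₂ c h⁻¹ b j j i Y‖ ≤ card n * A ^ 2 := by
  have hA := M.one_le
  simp only [norm_term₂ hT hY]
  calc _ ≤ ∑ i, ∑ j : n, A * (‖T.u b i‖ * ‖T.right b Y i‖) := by
        refine sum_le_sum fun i _ => sum_le_sum fun j _ => ?_
        rw [mul_left_comm]
        gcongr
        exact norm_res_entry_le hY (hT.im b) j j
    _ = card n * (A * ∑ i, (‖T.u b i‖ * ‖T.right b Y i‖)) := by simp [mul_sum]
    _ ≤ card n * (A * (1 * A)) := by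
      gcongr
      exact sum_norm_mul_le_l2 (hT.u_le b) (l2_right_le hT hY b)
    _ = _ := by ring

lemma sum_term₃_sq_le (hT : T.Good c A) (b : β) {Y : 𝕄} (hY : Y.IsHermitian) :
    ∑ i, ∑ j, ‖T.u b i‖ * ‖T.term₃ c h⁻¹ b j i j i j Y‖ ≤ h⁻¹ * A ^ 3 := by
  have hA := M.one_le
  have hh := M.h_pos
  have := M.sum_term₂_le hT b hY
  calc _ ≤ ∑ i, ∑ j, A * (‖T.u b i‖ * ‖T.term₂ c h⁻¹ b j i j Y‖) := by
        refine sum_le_sum fun i _ => sum_le_sum fun j _ => ?_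
        rw [norm_term₃ hT hY, norm_term₂ hT hY, mul_assoc ‖_‖, mul_left_comm]
        gcongr
        exact norm_res_entry_le hY (hT.im b) j i
    _ = A * ∑ i, ∑ j, ‖T.u b i‖ * ‖T.term₂ c h⁻¹ b j i j Y‖ := by simp only [mul_sum]
    _ ≤ A * (h⁻¹ * A ^ 2) := by gcongr
    _ = _ := by ring

lemma sum_mixed_le (hT : T.Good c A) (b : β) {Y : 𝕄} (hY : Y.IsHermitian)
    {x : n → n → ℂ} (hx : ∀ i, l2 (x i) ≤ A) :
    ∑ i, ∑ j, ‖T.u b i‖ * (‖x i j‖ * ‖res (T.z b) Y j j‖ * ‖T.right b Y i‖) ≤ h⁻¹ * A ^ 3 := by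
  have hA := M.one_le
  have hh := M.h_pos
  refine M.sum_le_of_scaled ?_
  calc _ ≤ h * ∑ i, ∑ j, A * (‖T.u b i‖ * ‖T.right b Y i‖ * ‖x i j‖) := by
        refine mul_le_mul_of_nonneg_left (sum_le_sum fun i _ =>
          sum_le_sum fun j _ => ?_) hh.le
        rw [mul_assoc ‖T.u b i‖, mul_left_comm A, mul_rotate ‖x i j‖, mul_assoc ‖res _ _ _ _‖]
        gcongr
        exact norm_res_entry_le hY (hT.im b) j j
    _ = A * ∑ i, (‖T.u b i‖ * ‖T.right b Y i‖) * (h * ∑ j, ‖x i j‖) := by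
      simp only [mul_sum]
      exact sum_congr rfl fun i _ => sum_congr rfl fun j _ => by ring
    _ ≤ A * ∑ i, (‖T.u b i‖ * ‖T.right b Y i‖) * A := by
      gcongr with i
      exact M.sum_norm_le (hx i)
    _ = A ^ 2 * ∑ i, (‖T.u b i‖ * ‖T.right b Y i‖) := by rw [← sum_mul]; ring
    _ ≤ A ^ 2 * (1 * A) := by
      gcongr
      exact sum_norm_mul_le_l2 (hT.u_le b) (l2_right_le hT hY b)
    _ = _ := by ring

lemma sum_diag_le (hT : T.Good c A) (b : β) {Y : 𝕄} (hY : Y.IsHermitian) :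
    ∑ i, ∑ j, ‖T.u b i‖ * ‖T.term₃ c h⁻¹ b j j i i j Y‖ ≤ h⁻¹ * (h⁻¹ * A ^ 3) := by
  have hA := M.one_le
  have hh := M.h_pos
  refine M.sum_le_of_scaled (M.sum_le_of_scaled ?_)
  simp only [norm_term₃ hT hY]
  calc _ ≤ h * (h * ∑ i, ∑ j, A ^ 2 * (‖T.u b i‖ * ‖T.right b Y j‖)) := by
        refine mul_le_mul_of_nonneg_left (mul_le_mul_of_nonneg_left (sum_le_sum fun i _ =>
          sum_le_sum fun j _ => ?_) hh.le) hh.le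
        rw [mul_left_comm, sq]
        gcongr <;> exact norm_res_entry_le hY (hT.im b) _ _
    _ = A ^ 2 * ((h * ∑ i, ‖T.u b i‖) * (h * ∑ j, ‖T.right b Y j‖)) := by
      simp only [← mul_sum, ← sum_mul]; ring
    _ ≤ A ^ 2 * (1 * A) := by
      have := M.sum_norm_le (hT.u_le b)
      have := M.sum_norm_le (l2_right_le hT hY b)
      have : 0 ≤ h * ∑ j, ‖T.right b Y j‖ := mul_nonneg hh.le (sum_nonneg fun _ _ => norm_nonneg _)
      gcongr
    _ = _ := by ring

lemma sum_cross_le (hT : T.Good c A) (b : β) {Y : 𝕄} (hY : Y.IsHermitian) {x y : β → n → ℂ}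
    (hx : ∀ b, l2 (x b) ≤ A) (hy : ∀ b, l2 (y b) ≤ A) :
    ∑ i, ∑ j, ‖T.u b i‖ * (A * ∑ b', ‖x b' i‖ * ‖y b' j‖ * ‖T.right b Y j‖) ≤ A ^ 5 := by
  have hA := M.one_le
  rw [sum_sum_mul_sum A (fun i => ‖T.u b i‖) (fun b' i => ‖x b' i‖) (fun b' i => ‖y b' i‖)]
  calc _ ≤ A * ∑ b' : β, (1 * A) * (A * A) := by
        gcongr with b'
        · exact sum_norm_mul_le_l2 (hT.u_le b) (hx b')
        · exact sum_norm_mul_le_l2 (hy b') (l2_right_le hT hY b)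
    _ = card β * A ^ 4 := by simp; ring
    _ ≤ A * A ^ 4 := by gcongr; exact hT.card_le
    _ = _ := by ring

lemma sum_termOsc_le (hT : T.Good c A) (b : β) {Y : 𝕄} (hY : Y.IsHermitian) :
    ∑ i, ∑ j, ‖T.u b i‖ * ‖T.termOsc c h⁻¹ b i j j Y‖ ≤ A ^ 5 :=
  (sum_le_sum fun i _ => sum_le_sum fun j _ => by gcongr; exact norm_termOsc_le hT hY b i j j).trans
    (M.sum_cross_le hT b hY (l2_left_le hT hY) (l2_right_le hT hY))

lemma sum_termOsc_swap_le (hT : T.Good c A) (b : β) {Y : 𝕄} (hY : Y.IsHermitian) :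
    ∑ i, ∑ j, ‖T.u b i‖ * ‖T.termOsc c h⁻¹ b j i j Y‖ ≤ A ^ 5 :=
  (sum_le_sum fun i _ => sum_le_sum fun j _ => by
    gcongr
    simpa only [mul_comm ‖T.left _ Y _‖] using norm_termOsc_le hT hY b j i j).trans
    (M.sum_cross_le hT b hY (l2_right_le hT hY) (l2_left_le hT hY))

lemma sum_termOsc_diag_le (hT : T.Good c A) (b : β) {η : ℝ} (hη : 0 ≤ η)
    (huη : ∀ i, ‖T.u b i‖ ≤ η) {Y : 𝕄} (hY : Y.IsHermitian) :
    ∑ i, ‖T.u b i‖ * ‖T.termOsc c h⁻¹ b i i i Y‖ ≤ η * A ^ 5 := by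
  have hA := M.one_le
  calc _ ≤ ∑ i, η * (A * ∑ b', A * (‖T.right b' Y i‖ * ‖T.right b Y i‖)) := by
        gcongr with i _
        · exact huη i
        · refine (norm_termOsc_le hT hY b i i i).trans ?_
          refine mul_le_mul_of_nonneg_left (sum_le_sum fun b' _ => ?_) (by linarith)
          rw [mul_assoc]
          exact mul_le_mul_of_nonneg_right ((norm_apply_le_l2 _ i).trans (l2_left_le hT hY b'))
            (by positivity)
    _ = η * (A * ∑ b', A * ∑ i, ‖T.right b' Y i‖ * ‖T.right b Y i‖) := by
      simp only [mul_sum]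
      rw [sum_comm]
    _ ≤ η * (A * ∑ b' : β, A * (A * A)) := by
      gcongr with b' _
      exact sum_norm_mul_le_l2 (l2_right_le hT hY b') (l2_right_le hT hY b)
    _ = η * (card β * A ^ 4) := by rw [sum_const, card_univ, nsmul_eq_mul]; ring
    _ ≤ η * (A * A ^ 4) := by gcongr; exact hT.card_le
    _ = _ := by ring

/-- The two main terms which do not come from the oscillating factor, and the two which do. -/
theorem norm_offSum_mainTerm_sub_le (hT : T.Good c A) (b : β) {η : ℝ} (hη : 0 ≤ η)
    (huη : ∀ i, ‖T.u b i‖ ≤ η) :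
    ‖offSum (T.u b) 1 (mainTerm P X h T c b) -
      offSum (T.u b) (mom P X 1 1) (fun i j => avg P X (T.term₂ c h⁻¹ b j j i)) -
      offSum (T.u b) (mom P X 2 1) (fun i j => avg P X (T.term₃ c h⁻¹ b j j i i j)) -
      I * h * (σ ^ 2 : ℝ) *
        (ρ * avg P X (fun Y => ∑ i, ∑ j, conj (T.u b i) * T.termOsc c h⁻¹ b i j j Y) +
        avg P X (fun Y => ∑ i, ∑ j, conj (T.u b i) * T.termOsc c h⁻¹ b j i j Y))‖ ≤
      12 * A ^ 6 * (h * (h + η)) := by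
  have hh := M.h_pos
  have hA := M.one_le
  have hσ := M.sigma_le
  have hρ := M.rho_le
  have t2 := fun a p k => tame_term₂ hT h⁻¹ b a p k
  have t3 := fun p q l m k => tame_term₃ hT h⁻¹ b p q l m k
  have tO := fun p q k => tame_termOsc hT h⁻¹ b p q k
  have hμ : ‖((ρ * σ ^ 2 * h ^ 2 : ℝ) : ℂ)‖ ≤ A * h ^ 2 := by
    rw [norm_real, Real.norm_eq_abs, abs_mul, abs_mul, abs_of_nonneg (sq_nonneg σ),
      abs_of_nonneg (sq_nonneg h)]
    calc |ρ| * σ ^ 2 * h ^ 2 ≤ 1 * A * h ^ 2 := by gcongr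
      _ = _ := by ring
  have hμ' : ‖((σ ^ 2 * h ^ 2 : ℝ) : ℂ)‖ ≤ A * h ^ 2 := by
    rw [norm_real, norm_of_nonneg (by positivity)]
    gcongr
  have b1 := M.norm_offSum_sub_le (u := T.u b) (m := mom P X 2 0)
    (F := fun i j => T.term₂ c h⁻¹ b j i j) (fun i j => t2 j i j)
    (fun i j hij => M.norm_mom_two_sub_le hij) (by positivity) (fun Y hY => M.sum_term₂_le hT b hY)
    (fun Y hY => M.sum_term₂_diag_le hT b hY)
  have b1' : ‖avg P X (fun Y => ∑ i, ∑ j, conj (T.u b i) * T.term₂ c h⁻¹ b j i j Y)‖ ≤ A ^ 2 :=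
    M.norm_avg_le (by fun_prop) fun Y hY => M.norm_sum_term₂_le hT b hY
  have b2 := M.norm_offSum_sub_le (u := T.u b) (m := mom P X 2 0)
    (F := fun i j => T.termOsc c h⁻¹ b i j j) (fun i j => tO i j j)
    (fun i j hij => M.norm_mom_two_sub_le hij) (by positivity)
    (fun Y hY => M.sum_termOsc_le hT b hY) (fun Y hY => M.sum_termOsc_diag_le hT b hη huη hY)
  have b3 := M.norm_offSum_sub_le (u := T.u b) (m := mom P X 1 1)
    (F := fun i j => T.termOsc c h⁻¹ b j i j) (fun i j => tO j i j)
    (fun i j hij => M.norm_mom_abs_sub_le hij) (by positivity)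
    (fun Y hY => M.sum_termOsc_swap_le hT b hY) (fun Y hY => M.sum_termOsc_diag_le hT b hη huη hY)
  have m3 : 0 ≤ (1 + A) * h ^ 3 := by positivity
  have b4 := M.norm_offSum_le (u := T.u b) (m := mom P X 3 0)
    (F := fun i j => T.term₃ c h⁻¹ b j i j i j) (fun i j => t3 j i j i j)
    (fun i j hij => M.norm_mom_le 3 0 (by norm_num) i j) m3 (fun Y hY => M.sum_term₃_sq_le hT b hY)
  have b5 := M.norm_offSum_le (u := T.u b) (m := mom P X 2 1)
    (F := fun i j => T.term₃ c h⁻¹ b j i j j i) (fun i j => t3 j i j j i)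
    (fun i j hij => M.norm_mom_le 2 1 (by norm_num) i j) m3 (fun Y hY => by
      simp only [norm_term₃ hT hY]
      exact M.sum_mixed_le hT b hY (x := fun i j => res (T.z b) Y j i)
        (fun i => l2_res_col_le hT hY b i))
  have b6 := M.norm_offSum_le (u := T.u b) (m := mom P X 1 2)
    (F := fun i j => T.term₃ c h⁻¹ b j j i j i) (fun i j => t3 j j i j i)
    (fun i j hij => M.norm_mom_le 1 2 (by norm_num) i j) m3 (fun Y hY => by
      simp only [norm_term₃ hT hY]
      refine le_trans (le_of_eq ?_) (M.sum_mixed_le hT b hY (x := fun i j => res (T.z b) Y i j)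
        (fun i => l2_res_row_le hT hY b i))
      exact sum_congr rfl fun i _ => sum_congr rfl fun j _ => by ring)
  set s1 := offSum (T.u b) (mom P X 2 0) (fun i j => avg P X (T.term₂ c h⁻¹ b j i j)) with h1
  set s2 := offSum (T.u b) (mom P X 1 1) (fun i j => avg P X (T.term₂ c h⁻¹ b j j i)) with h2
  set s3 := offSum (T.u b) (mom P X 2 0) (fun i j => avg P X (T.termOsc c h⁻¹ b i j j)) with h3
  set s4 := offSum (T.u b) (mom P X 1 1) (fun i j => avg P X (T.termOsc c h⁻¹ b j i j)) with h4
  set s5 := offSum (T.u b) (mom P X 3 0) (fun i j => avg P X (T.term₃ c h⁻¹ b j i j i j)) with h5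
  set s6 := offSum (T.u b) (mom P X 2 1) (fun i j => avg P X (T.term₃ c h⁻¹ b j i j j i)) with h6
  set s7 := offSum (T.u b) (mom P X 2 1) (fun i j => avg P X (T.term₃ c h⁻¹ b j j i i j)) with h7
  set s8 := offSum (T.u b) (mom P X 1 2) (fun i j => avg P X (T.term₃ c h⁻¹ b j j i j i)) with h8
  have split : offSum (T.u b) 1 (mainTerm P X h T c b) =
      s1 + s2 + I * (h⁻¹ : ℝ) * (s3 + s4) + (s5 + s6 + s7 + s8) := by
    simp only [h1, h2, h3, h4, h5, h6, h7, h8, offSum, mul_add, mul_sum, ← sum_add_distrib]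
    refine sum_congr rfl fun i _ => sum_congr rfl fun j _ => ?_
    by_cases hij : i = j
    · simp [hij]
    · simp only [hij, ne_eq, not_false_eq_true, if_true, mainTerm, expansionTerm, Pi.one_apply]
      ring
  rw [split]
  clear_value s1 s2 s3 s4 s5 s6 s7 s8
  generalize avg P X (fun Y => ∑ i, ∑ j, conj (T.u b i) * T.term₂ c h⁻¹ b j i j Y) = x1 at *
  generalize avg P X (fun Y => ∑ i, ∑ j, conj (T.u b i) * T.termOsc c h⁻¹ b i j j Y) = x3 at *
  generalize avg P X (fun Y => ∑ i, ∑ j, conj (T.u b i) * T.termOsc c h⁻¹ b j i j Y) = x4 at *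
  generalize hμd : ((ρ * σ ^ 2 * h ^ 2 : ℝ) : ℂ) = μ at *
  generalize hνd : ((σ ^ 2 * h ^ 2 : ℝ) : ℂ) = ν at *
  have c1 : ‖s1‖ ≤ 3 * A ^ 6 * h ^ 2 := by
    have e := norm_add_le (s1 - μ * x1) (μ * x1)
    rw [sub_add_cancel, norm_mul] at e
    have k1 : A * h ^ 3 * (h⁻¹ * A ^ 2) = A ^ 3 * h ^ 2 := by field_simp
    have k2 : ‖μ‖ * A ^ 2 ≤ A * h ^ 2 * A ^ 2 := by gcongr
    have k3 : ‖μ‖ * ‖x1‖ ≤ A * h ^ 2 * A ^ 2 := by gcongr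
    have k4 : A ^ 3 * h ^ 2 ≤ A ^ 6 * h ^ 2 := by
      have := pow_le_pow_right₀ hA (show 3 ≤ 6 by norm_num)
      gcongr
    rw [k1] at b1
    linarith
  have c2 : ‖I * (h⁻¹ : ℝ) * (s3 + s4) -
      I * h * (σ ^ 2 : ℝ) * (ρ * x3 + x4)‖ ≤ 2 * A ^ 6 * (h * (h + η)) := by
    have e : I * (h⁻¹ : ℝ) * (s3 + s4) - I * h * (σ ^ 2 : ℝ) * (ρ * x3 + x4) =
        I * (h⁻¹ : ℝ) * ((s3 - μ * x3) + (s4 - ν * x4)) := by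
      have hh0 : (h : ℂ) ≠ 0 := by exact_mod_cast hh.ne'
      rw [← hμd, ← hνd]
      push_cast
      field_simp
      ring
    rw [e, norm_mul, norm_mul, Complex.norm_I, one_mul, norm_real, norm_of_nonneg (by positivity)]
    have k := norm_add_le (s3 - μ * x3) (s4 - ν * x4)
    have k1 : ‖μ‖ * (η * A ^ 5) ≤ A * h ^ 2 * (η * A ^ 5) := by gcongr
    have k2 : ‖ν‖ * (η * A ^ 5) ≤ A * h ^ 2 * (η * A ^ 5) := by gcongr
    calc _ ≤ h⁻¹ * (2 * (A * h ^ 3 * A ^ 5 + A * h ^ 2 * (η * A ^ 5))) := by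
          gcongr
          linarith
      _ = _ := by field_simp
  have c3 : ∀ s : ℂ, ‖s‖ ≤ (1 + A) * h ^ 3 * (h⁻¹ * A ^ 3) → ‖s‖ ≤ 2 * A ^ 6 * h ^ 2 :=
      fun s hs => by
    refine hs.trans ?_
    have k1 : (1 + A) * h ^ 3 * (h⁻¹ * A ^ 3) = (A ^ 3 + A ^ 4) * h ^ 2 := by field_simp
    rw [k1]
    have := pow_le_pow_right₀ hA (show 3 ≤ 6 by norm_num)
    have := pow_le_pow_right₀ hA (show 4 ≤ 6 by norm_num)
    gcongr
    linarith
  have c5 := c3 s5 b4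
  have c6 := c3 s6 b5
  have c8 := c3 s8 b6
  have key : s1 + s2 + I * (h⁻¹ : ℝ) * (s3 + s4) + (s5 + s6 + s7 + s8) - s2 - s7 -
      I * h * (σ ^ 2 : ℝ) * (ρ * x3 + x4) = s1 + (I * (h⁻¹ : ℝ) * (s3 + s4) -
      I * h * (σ ^ 2 : ℝ) * (ρ * x3 + x4)) + (s5 + s6 + s8) := by ring
  rw [key]
  have k1 := norm_add₃_le (a := s1) (b := (I * (h⁻¹ : ℝ) * (s3 + s4) -
      I * h * (σ ^ 2 : ℝ) * (ρ * x3 + x4))) (c := s5 + s6 + s8)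
  have k2 := norm_add₃_le (a := s5) (b := s6) (c := s8)
  have k3 : 0 ≤ A ^ 6 * (h * η) := by positivity
  have k4 : 0 ≤ A ^ 6 * h ^ 2 := by positivity
  linarith

end Model

/-- The self-consistent equation satisfied by the Stieltjes transform of the semicircle law. -/
structure SelfCons (σ : ℝ) (z g : ℂ) : Prop where
  eq : z * g = 1 + (σ : ℂ) ^ 2 * g ^ 2
  sign : g.im * z.im ≤ 0

namespace SelfCons

variable {σ A : ℝ} {z g : ℂ}

lemma conjugate (hg : SelfCons σ z g) : SelfCons σ (conj z) (conj g) where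
  eq := by simpa using congrArg (starRingEnd ℂ) hg.eq
  sign := by simpa using hg.sign

lemma one_le_mul_norm_sub {z s : ℂ} {A τ : ℝ} (hz : 1 ≤ A * |z.im|) (hA : 0 ≤ A) (hτ : 0 ≤ τ)
    (hs : s.im * z.im ≤ 0) : 1 ≤ A * ‖z - τ * s‖ := by
  refine hz.trans ?_
  gcongr
  refine le_trans ?_ (Complex.abs_im_le_norm _)
  have e : (z - τ * s).im = z.im - τ * s.im := by simp
  rw [e, ← sq_le_sq]
  nlinarith [mul_nonneg hτ (neg_nonneg.2 hs), sq_nonneg (τ * s.im)]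

lemma mul_sub_eq_one (hg : SelfCons σ z g) : g * (z - (σ ^ 2 : ℝ) * g) = 1 := by
  have := hg.eq
  push_cast
  linear_combination this

lemma norm_le (hg : SelfCons σ z g) (hz : 1 ≤ A * |z.im|) (hA : 0 ≤ A) : ‖g‖ ≤ A := by
  have h1 := one_le_mul_norm_sub hz hA (sq_nonneg σ) hg.sign
  have h2 := congrArg norm hg.mul_sub_eq_one
  rw [norm_mul, norm_one] at h2
  calc ‖g‖ = ‖g‖ * 1 := (mul_one _).symm
    _ ≤ ‖g‖ * (A * ‖z - (σ ^ 2 : ℝ) * g‖) := by gcongr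
    _ = A * (‖g‖ * ‖z - (σ ^ 2 : ℝ) * g‖) := by ring
    _ = A := by rw [h2, mul_one]

end SelfCons

lemma form_self_im_mul_le {Y : 𝕄} (hY : Y.IsHermitian) {z : ℂ} (hz : z.im ≠ 0)
    (u : n → ℂ) : (form z u u Y).im * z.im ≤ 0 := by
  set w := res z Y *ᵥ u with hw
  have hu : u = (z • (1 : 𝕄) - Y) *ᵥ w := by
    rw [hw, Matrix.mulVec_mulVec, resolvent_mul hY hz, Matrix.one_mulVec]
  have h1 : form z u u Y = conj (star w ⬝ᵥ u) := by
    unfold form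
    simp only [dotProduct, map_sum, map_mul, Pi.star_apply, RCLike.star_def, Complex.conj_conj]
    exact sum_congr rfl fun i _ => by rw [mul_comm]
  have h2 : star w ⬝ᵥ u = z * ((l2 w ^ 2 : ℝ) : ℂ) - star w ⬝ᵥ (Y *ᵥ w) := by
    conv_lhs => rw [hu]
    rw [Matrix.sub_mulVec, Matrix.smul_mulVec, Matrix.one_mulVec, dotProduct_sub, dotProduct_smul,
      smul_eq_mul]
    congr 2
    rw [l2_sq]
    push_cast
    simp only [dotProduct, Pi.star_apply, RCLike.star_def]
    exact sum_congr rfl fun i _ => by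
      rw [mul_comm, Complex.mul_conj, Complex.normSq_eq_norm_sq]; push_cast; rfl
  rw [h1, h2, Complex.conj_im, Complex.sub_im, im_star_dotProduct_mulVec hY]
  have h3 : (z * ((l2 w ^ 2 : ℝ) : ℂ)).im = z.im * l2 w ^ 2 := by
    rw [mul_comm, Complex.re_ofReal_mul |> fun _ => Complex.im_ofReal_mul, mul_comm]
  rw [h3]
  nlinarith [mul_nonneg (sq_nonneg (l2 w)) (sq_nonneg z.im)]

namespace Family

lemma Good.zero (hT : T.Good c A) : T.Good 0 A where
  one_le := hT.one_le
  im := hT.im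
  u_le := hT.u_le
  v_le := hT.v_le
  card_le := hT.card_le
  c_le := fun b => by
    have := hT.one_le
    simp only [Pi.zero_apply, norm_zero]; linarith
  real := fun X _ => by simp [lin]

lemma osc_zero (κ : ℝ) (Y : 𝕄) : T.osc κ 0 Y = 1 := by simp [osc, lin]

lemma termOsc_zero (κ : ℝ) (b : β) (i k j : n) (Y : 𝕄) :
    T.termOsc 0 κ b i k j Y = 0 := by simp [termOsc, cross]

end Family

/-- The constant in the first order identity for `E⟨u, (z - X)⁻¹ v⟩`. -/
def meanConst (A : ℝ) : ℝ := expConst A * (800 * A ^ 14) + 28 * A ^ 6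

lemma meanConst_nonneg {A : ℝ} (hA : 1 ≤ A) : 0 ≤ meanConst A := by
  have := expConst_nonneg hA
  unfold meanConst; positivity

namespace Model

variable (M : Model P X h A σ ρ)
include M

lemma errTotal_one_le (hT : T.Good c A) : errTotal P X T h 1 ≤ 10 * A ^ 6 := by
  have hA := M.one_le
  have hh := M.h_le
  have t3 : Tame fun Y => ∑ j, T.mass Y j ^ 3 := by fun_prop
  have h1 : avg P X (fun Y => ∑ j, T.mass Y j ^ 3) ≤ 8 * A ^ 6 := by
    refine (M.avg_mono t3 (Tame.const (8 * A ^ 6)) fun Y hY => ?_).trans (avg_const _).le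
    calc _ ≤ ∑ j, 2 * A ^ 2 * T.mass Y j ^ 2 := by
          gcongr with j
          rw [pow_succ']
          gcongr
          exact mass_le hY hT j
      _ ≤ 2 * A ^ 2 * (4 * A ^ 4) := by
        rw [← mul_sum]
        gcongr
        exact sum_mass_sq_le hY hT
      _ = _ := by ring
  have h2 : 1 ≤ A ^ 6 := one_le_pow₀ hA
  unfold errTotal
  linarith

lemma norm_mean_identity_family_le (hT : T.Good 0 A) (b : β) :
    ‖T.z b * avg P X (T.formAt b) - (∑ i, conj (T.u b i) * T.v b i) -
      (σ ^ 2 : ℝ) * avg P X (fun Y => meanTrace h (T.z b) Y * T.formAt b Y)‖ ≤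
      meanConst A * h := by
  have hh := M.h_pos
  have hh1 := M.h_le
  have hA := M.one_le
  have hσ := M.sigma_le
  have hu1 : ∀ i, ‖T.u b i‖ ≤ 1 := fun i => (norm_apply_le_l2 _ i).trans (hT.u_le b)
  have e1 := M.norm_main_identity_le hT b zero_le_one hu1
  have e2 := M.norm_offSum_mainTerm_sub_le hT b zero_le_one hu1
  have e3 := M.norm_offSum_sub_le (u := T.u b) (m := mom P X 1 1)
    (F := fun i j => T.term₂ 0 h⁻¹ b j j i) (fun i j => tame_term₂ hT h⁻¹ b j j i)
    (fun i j hij => M.norm_mom_abs_sub_le hij) (by positivity)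
    (fun Y hY => M.sum_trace_le hT b hY) (fun Y hY => M.sum_term₂_diag_le hT b hY)
  have e4 := M.norm_offSum_le (u := T.u b) (m := mom P X 2 1)
    (F := fun i j => T.term₃ 0 h⁻¹ b j j i i j) (fun i j => tame_term₃ hT h⁻¹ b j j i i j)
    (fun i j hij => M.norm_mom_le 2 1 (by norm_num) i j) (by positivity)
    (fun Y hY => M.sum_diag_le hT b hY)
  have e5 := M.errTotal_one_le hT
  have hcE := expConst_nonneg hA
  have hosc : T.osc h⁻¹ 0 = fun _ => 1 := funext (osc_zero _)
  simp only [hosc, termOsc_zero, mul_one, mul_zero, Finset.sum_const_zero, avg_const, add_zero,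
    sub_zero] at e1 e2
  have e6 : ((σ ^ 2 * h ^ 2 : ℝ) : ℂ) * avg P X (fun Y => ∑ i, ∑ j, conj (T.u b i) *
      T.term₂ 0 h⁻¹ b j j i Y) = (σ ^ 2 : ℝ) *
      avg P X (fun Y => meanTrace h (T.z b) Y * T.formAt b Y) := by
    rw [← avg_mul_left, ← avg_mul_left]
    congr 1
    funext Y
    simp only [term₂, osc_zero, mul_one, meanTrace, formAt, form, right]
    rw [sum_comm, mul_assoc, sum_mul_sum]
    simp only [mul_sum]
    exact sum_congr rfl fun j _ => sum_congr rfl fun i _ => by push_cast; ring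
  rw [e6] at e3
  generalize (σ ^ 2 : ℝ) * avg P X (fun Y => meanTrace h (T.z b) Y * T.formAt b Y) = x at *
  generalize offSum (T.u b) (mom P X 1 1) (fun i j => avg P X (T.term₂ 0 h⁻¹ b j j i)) = s2 at *
  generalize offSum (T.u b) (mom P X 2 1) (fun i j => avg P X (T.term₃ 0 h⁻¹ b j j i i j)) = s3 at *
  generalize offSum (T.u b) 1 (mainTerm P X h T 0 b) = s at *
  change ‖T.z b * avg P X (T.formAt b) - _ - s‖ ≤ _ at e1
  generalize T.z b * avg P X (T.formAt b) - (∑ i, conj (T.u b i) * T.v b i) = y at *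
  have key : y - x = (y - s) + (s - s2 - s3) + (s2 - x) + s3 := by ring
  rw [key]
  have k1 := norm_add_le ((y - s) + (s - s2 - s3) + (s2 - x)) s3
  have k2 := norm_add₃_le (a := y - s) (b := s - s2 - s3) (c := s2 - x)
  have q1 : expConst A * (80 * A ^ 8) * (h * errTotal P X T h 1) ≤
      expConst A * (800 * A ^ 14) * h := by
    calc _ ≤ expConst A * (80 * A ^ 8) * (h * (10 * A ^ 6)) := by gcongr
      _ = _ := by ring
  have q2 : 12 * A ^ 6 * (h * (h + 1)) ≤ 24 * A ^ 6 * h := by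
    have : h * (h + 1) ≤ h * 2 := by gcongr; linarith
    have := mul_le_mul_of_nonneg_left this (show 0 ≤ 12 * A ^ 6 by positivity)
    linarith
  have p36 : A ^ 3 * h ≤ A ^ 6 * h := by gcongr <;> norm_num [hA]
  have p46 : A ^ 4 * h ≤ A ^ 6 * h := by gcongr <;> norm_num [hA]
  have q3 : A * h ^ 3 * (card n * A ^ 2) + ‖((σ ^ 2 * h ^ 2 : ℝ) : ℂ)‖ * A ^ 2 ≤ 2 * A ^ 6 * h := by
    rw [norm_real, norm_of_nonneg (by positivity)]
    have c2 : σ ^ 2 * h ^ 2 * A ^ 2 ≤ A * h * A ^ 2 := by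
      have : h ^ 2 ≤ h := by nlinarith
      gcongr
    linear_combination c2 + 2 * p36 + A ^ 3 * h * M.card_eq
  have q4 : (1 + A) * h ^ (2 + 1) * (h⁻¹ * (h⁻¹ * A ^ 3)) ≤ 2 * A ^ 6 * h := by
    have c1 : (1 + A) * h ^ (2 + 1) * (h⁻¹ * (h⁻¹ * A ^ 3)) = A ^ 3 * h + A ^ 4 * h := by field_simp
    linarith
  unfold meanConst
  linarith

end Model

/-- The test family consisting of a single pair of vectors. -/
def singleFamily (z : ℂ) (u v : n → ℂ) : Family n Unit := ⟨fun _ => z, fun _ => u, fun _ => v⟩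

lemma singleFamily_good {z : ℂ} {u v : n → ℂ} (hA : 1 ≤ A) (hz : 1 ≤ A * |z.im|)
    (hu : l2 u ≤ 1) (hv : l2 v ≤ 1) : (singleFamily z u v).Good 0 A where
  one_le := hA
  im := fun _ => hz
  u_le := fun _ => hu
  v_le := fun _ => hv
  card_le := by simpa using hA
  c_le := fun _ => by simp only [Pi.zero_apply, norm_zero]; linarith
  real := fun X _ => by simp [Family.lin]

/-- The constant in the bound for the mean of the resolvent. -/
def lawConst (A : ℝ) : ℝ := meanConst A + A ^ 2 * (varConst A + 1)

lemma lawConst_nonneg {A : ℝ} (hA : 1 ≤ A) : 0 ≤ lawConst A := by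
  have := meanConst_nonneg hA
  have := varConst_nonneg hA
  unfold lawConst; positivity

lemma form_single_eq (z : ℂ) (j : n) :
    (form z (Pi.single j 1) (Pi.single j 1) : 𝕄 → ℂ) = fun Y => res z Y j j := by
  funext Y
  rw [form_single, ← res_apply_eq]

namespace Model

variable (M : Model P X h A σ ρ)
include M

/-- Mean absolute deviations from variances. -/
lemma integral_norm_sub_avg_le {F : 𝕄 → ℂ} (hF : Tame F) {V t : ℝ} (ht : 0 < t)
    (hV : spread P X F ≤ V * t ^ 2) : ∫ w, ‖F (X w) - avg P X F‖ ∂P ≤ (V + 1) * t := by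
  have h1 : avg P X (fun Y => ‖F Y - avg P X F‖) ≤
      avg P X fun Y => t⁻¹ * ‖F Y - avg P X F‖ ^ 2 + t := by
    refine M.avg_mono (by fun_prop) (by fun_prop) fun Y _ => ?_
    have h2 := sq_nonneg (‖F Y - avg P X F‖ - t)
    have h3 := norm_nonneg (F Y - avg P X F)
    rw [inv_mul_eq_div, ← sub_le_iff_le_add, le_div_iff₀ ht]
    nlinarith
  refine h1.trans ?_
  simp (disch := fun_prop) only [M.avg_add, avg_mul_left, avg_const]
  calc _ ≤ t⁻¹ * (V * t ^ 2) + t := by gcongr; exact hV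
    _ = _ := by field_simp

lemma norm_avg_mul_sub_le {F G : 𝕄 → ℂ} (hF : Tame F) (hG : Tame G) {V t D : ℝ}
    (ht : 0 < t) (hV : spread P X F ≤ V * t ^ 2)
    (hD : ∀ Y : 𝕄, Y.IsHermitian → ‖G Y‖ ≤ D) :
    ‖avg P X (fun Y => F Y * G Y) - avg P X F * avg P X G‖ ≤ D * ((V + 1) * t) := by
  have e : avg P X (fun Y => F Y * G Y) - avg P X F * avg P X G =
      avg P X fun Y => (F Y - avg P X F) * G Y := by
    simp (disch := fun_prop) only [sub_mul, M.avg_sub, avg_mul_left]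
  obtain ⟨w⟩ : Nonempty Ω := nonempty_of_isProbabilityMeasure P
  have hD0 : 0 ≤ D := (norm_nonneg _).trans (hD _ (M.isHermitian w))
  rw [e]
  calc _ ≤ avg P X fun Y => D * ‖F Y - avg P X F‖ :=
        M.norm_avg_le_avg (by fun_prop) (by fun_prop) fun Y hY => by
          rw [norm_mul, mul_comm]
          gcongr
          exact hD Y hY
    _ ≤ _ := by
      rw [avg_mul_left]
      gcongr
      exact M.integral_norm_sub_avg_le hF ht hV

lemma norm_form_le_of_le_one {z : ℂ} (hz : 1 ≤ A * |z.im|) {u v : n → ℂ} (hu : l2 u ≤ 1)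
    (hv : l2 v ≤ 1) {Y : 𝕄} (hY : Y.IsHermitian) : ‖form z u v Y‖ ≤ A := by
  refine (norm_form_le hY hz u v).trans (mul_le_of_le_one_right (by linarith [M.one_le]) ?_)
  exact mul_le_one₀ hu (l2_nonneg _) hv

lemma norm_mean_identity_le {z : ℂ} (hz : 1 ≤ A * |z.im|) {u v : n → ℂ} (hu : l2 u ≤ 1)
    (hv : l2 v ≤ 1) :
    ‖(z - (σ ^ 2 : ℝ) * avg P X (meanTrace h z)) * avg P X (form z u v) -
      ∑ i, conj (u i) * v i‖ ≤ lawConst A * h := by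
  have hA := M.one_le
  have hh := M.h_pos
  have hh1 := M.h_le
  have hσ := M.sigma_le
  have hz0 := im_ne_of hz
  have h1 := M.norm_mean_identity_family_le (singleFamily_good hA hz hu hv) ()
  have h2 := M.norm_avg_mul_sub_le (tame_meanTrace h hz0) (tame_form hz0 u v) (t := h ^ 2)
    (V := varConst A) (by positivity) ((M.spread_meanTrace_le hz).trans (le_of_eq (by ring)))
    (fun Y hY => M.norm_form_le_of_le_one hz hu hv hY)
  change ‖z * avg P X (form z u v) - (∑ i, conj (u i) * v i) - (σ ^ 2 : ℝ) *
    avg P X (fun Y => meanTrace h z Y * form z u v Y)‖ ≤ _ at h1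
  have hv0 := varConst_nonneg hA
  have key : (z - (σ ^ 2 : ℝ) * avg P X (meanTrace h z)) * avg P X (form z u v) -
      ∑ i, conj (u i) * v i = (z * avg P X (form z u v) - (∑ i, conj (u i) * v i) - (σ ^ 2 : ℝ) *
    avg P X (fun Y => meanTrace h z Y * form z u v Y)) + (σ ^ 2 : ℝ) *
    (avg P X (fun Y => meanTrace h z Y * form z u v Y) -
      avg P X (meanTrace h z) * avg P X (form z u v)) := by ring
  rw [key]
  refine (norm_add_le _ _).trans ?_
  rw [norm_mul, norm_real, norm_of_nonneg (sq_nonneg σ)]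
  calc _ ≤ meanConst A * h + A * (A * ((varConst A + 1) * h)) := by
        have : h ^ 2 ≤ h := by nlinarith
        have h3 := h2.trans (show _ ≤ A * ((varConst A + 1) * h) by gcongr)
        gcongr
    _ = _ := by unfold lawConst; ring

lemma avg_meanTrace_sign {z : ℂ} (hz : 1 ≤ A * |z.im|) :
    (avg P X (meanTrace h z)).im * z.im ≤ 0 := by
  have hz0 := im_ne_of hz
  have hpt : ∀ Y : 𝕄, Y.IsHermitian → (meanTrace h z Y).im * z.im ≤ 0 := fun Y hY => by
    unfold meanTrace
    rw [← Complex.ofReal_pow, Complex.im_ofReal_mul, Complex.im_sum, mul_assoc, sum_mul]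
    refine mul_nonpos_of_nonneg_of_nonpos (sq_nonneg h) (Finset.sum_nonpos fun k _ => ?_)
    have := form_self_im_mul_le hY hz0 (Pi.single k 1)
    rwa [form_single, ← res_apply_eq] at this
  have hi := M.integrable (tame_meanTrace h hz0 (n := n))
  have e : (avg P X (meanTrace h z)).im = ∫ w, (meanTrace h z (X w)).im ∂P := (integral_im hi).symm
  rw [e, ← integral_mul_const]
  exact integral_nonpos fun w => hpt _ (M.isHermitian w)

/-- The normalized trace of the resolvent is close to the Stieltjes transform. -/
theorem norm_avg_meanTrace_sub_le {z g : ℂ} (hz : 1 ≤ A * |z.im|) (hg : SelfCons σ z g) :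
    ‖avg P X (meanTrace h z) - g‖ ≤ A * lawConst A * h := by
  have hA := M.one_le
  have hh := M.h_pos
  have hz0 := im_ne_of hz
  set s := avg P X (meanTrace h z) with hs
  have h1 : ∀ k : n, ‖(z - (σ ^ 2 : ℝ) * s) * avg P X (fun Y => res z Y k k) - 1‖ ≤
      lawConst A * h := fun k => by
    have := M.norm_mean_identity_le hz (l2_single k).le (l2_single k).le
    have e1 : ∑ i, conj ((Pi.single k 1 : n → ℂ) i) * (Pi.single k 1 : n → ℂ) i = 1 := by
      rw [sum_eq_single k] <;> simp +contextual
    rwa [e1, form_single_eq] at this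
  have h2 : s = (h : ℂ) ^ 2 * ∑ k, avg P X (fun Y => res z Y k k) := by
    simp (disch := fun_prop) only [hs, ← M.avg_sum, ← avg_mul_left]
    rfl
  have h3 : (z - (σ ^ 2 : ℝ) * s) * s - 1 = (h : ℂ) ^ 2 * ∑ k, ((z - (σ ^ 2 : ℝ) * s) *
      avg P X (fun Y => res z Y k k) - 1) := by
    have hc : (card n : ℂ) * (h : ℂ) ^ 2 = 1 := by exact_mod_cast M.card_eq
    rw [sum_sub_distrib, ← mul_sum]
    simp only [sum_const, card_univ, nsmul_eq_mul, mul_one]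
    linear_combination (z - (σ ^ 2 : ℝ) * s) * h2 + hc
  have h4 : ‖(z - (σ ^ 2 : ℝ) * s) * s - 1‖ ≤ lawConst A * h := by
    rw [h3, norm_mul, norm_pow, norm_real, norm_of_nonneg hh.le]
    calc _ ≤ h ^ 2 * ∑ k : n, lawConst A * h := by
          gcongr
          exact norm_sum_le_of_le _ fun k _ => h1 k
      _ = (card n * h ^ 2) * (lawConst A * h) := by simp; ring
      _ = _ := by rw [M.card_eq, one_mul]
  have h5 : (s - g) * (z - (σ ^ 2 : ℝ) * (s + g)) = (z - (σ ^ 2 : ℝ) * s) * s - 1 := by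
    have := hg.eq
    push_cast
    linear_combination -this
  have hs1 := M.avg_meanTrace_sign hz
  have h6 : 1 ≤ A * ‖z - (σ ^ 2 : ℝ) * (s + g)‖ :=
    SelfCons.one_le_mul_norm_sub hz (by linarith) (sq_nonneg σ) (by
      rw [Complex.add_im, add_mul]; linarith [hg.sign])
  calc ‖s - g‖ ≤ ‖s - g‖ * (A * ‖z - (σ ^ 2 : ℝ) * (s + g)‖) :=
        le_mul_of_one_le_right (norm_nonneg _) h6
    _ = A * ‖(s - g) * (z - (σ ^ 2 : ℝ) * (s + g))‖ := by rw [norm_mul]; ring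
    _ ≤ A * (lawConst A * h) := by rw [h5]; gcongr
    _ = _ := by ring

/-- The mean of the resolvent is close to a multiple of the identity. -/
theorem norm_avg_form_sub_le {z g : ℂ} (hz : 1 ≤ A * |z.im|) (hg : SelfCons σ z g)
    {u v : n → ℂ} (hu : l2 u ≤ 1) (hv : l2 v ≤ 1) :
    ‖avg P X (form z u v) - g * ∑ i, conj (u i) * v i‖ ≤ 2 * A ^ 4 * lawConst A * h := by
  have hA := M.one_le
  have hh := M.h_pos
  have hz0 := im_ne_of hz
  have hL := lawConst_nonneg hA
  have h1 := M.norm_mean_identity_le hz hu hv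
  have h2 := M.norm_avg_meanTrace_sub_le hz hg
  have h3 := hg.norm_le hz (by linarith)
  have h4 : ‖avg P X (form z u v)‖ ≤ A :=
    M.norm_avg_le (tame_form hz0 u v) fun Y hY => M.norm_form_le_of_le_one hz hu hv hY
  have h5 := hg.mul_sub_eq_one
  set s := avg P X (meanTrace h z)
  set y := avg P X (form z u v)
  set x := ∑ i, conj (u i) * v i
  have key : y - g * x = g * ((z - (σ ^ 2 : ℝ) * s) * y - x) +
      g * (σ ^ 2 : ℝ) * (s - g) * y := by linear_combination (-y) * h5
  rw [key]
  refine (norm_add_le _ _).trans ?_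
  simp only [norm_mul]
  rw [norm_real, norm_of_nonneg (sq_nonneg σ)]
  calc _ ≤ A * (lawConst A * h) + A * A * (A * lawConst A * h) * A := by
        have := M.sigma_le
        gcongr
    _ = (A + A ^ 4) * lawConst A * h := by ring
    _ ≤ _ := by
      have : A + A ^ 4 ≤ 2 * A ^ 4 := by
        have := le_self_pow₀ hA (show 4 ≠ 0 by norm_num)
        linarith
      gcongr

lemma avg_normSq_eq {F : 𝕄 → ℂ} (hF : Tame F) :
    avg P X (fun Y => ‖F Y‖ ^ 2) = ‖avg P X F‖ ^ 2 + spread P X F := by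
  have e : ∀ x : ℂ, ((‖x‖ ^ 2 : ℝ) : ℂ) = x * conj x := fun x => by
    rw [Complex.mul_conj, Complex.normSq_eq_norm_sq]
  have hc : avg P X (fun Y => conj (F Y)) = conj (avg P X F) := integral_conj
  have hr : ∀ G : 𝕄 → ℝ, ((avg P X G : ℝ) : ℂ) = avg P X fun Y => (G Y : ℂ) := fun G =>
    integral_complex_ofReal.symm
  apply Complex.ofReal_injective
  change _ = ((_ + avg P X fun Y => ‖F Y - avg P X F‖ ^ 2 : ℝ) : ℂ)
  rw [Complex.ofReal_add]
  simp (disch := fun_prop) only [hr, e, map_sub, sub_mul, mul_sub, M.avg_sub, avg_mul_left,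
    avg_mul_right, avg_const, hc]
  ring

end Model

/-- The constant in the delocalization bound. -/
def delocConst (A : ℝ) : ℝ :=
  A ^ 2 * (1 + 2 * (A + 2 * A ^ 4 * lawConst A) ^ 2 + 2 * varConst A) + squareConst A

lemma delocConst_nonneg {A : ℝ} (hA : 1 ≤ A) : 0 ≤ delocConst A := by
  have := squareConst_nonneg hA
  have := varConst_nonneg hA
  unfold delocConst; positivity

namespace Model

variable (M : Model P X h A σ ρ)
include M

/-- Resolvents preserve the delocalization of vectors. -/
theorem avg_sum_cube_le {z g : ℂ} (hz : 1 ≤ A * |z.im|) (hg : SelfCons σ z g) {v : n → ℂ}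
    (hv : l2 v ≤ 1) {η : ℝ} (hη : 0 ≤ η) (hvη : ∀ i, ‖v i‖ ≤ η) :
    avg P X (fun Y => ∑ k, ‖(res z Y *ᵥ v) k‖ ^ 3) ≤ delocConst A * (h + η) := by
  have hA := M.one_le
  have hh := M.h_pos
  have hz0 := im_ne_of hz
  have hL := lawConst_nonneg hA
  have hV := varConst_nonneg hA
  have tw := fun k : n => tame_res_mulVec hz0 v k
  have tF : ∀ k : n, Tame fun Y => (((‖(res z Y *ᵥ v) k‖ ^ 2 : ℝ)) : ℂ) := fun k => by
    obtain ⟨m, C, hC⟩ := (tw k).norm.pow 2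
    exact ⟨Complex.measurable_ofReal.comp m, C, fun Y hY => by rw [norm_real]; exact hC Y hY⟩
  set δ := h + η with hδ
  have hδ0 : 0 < δ := by linarith
  set L := A + 2 * A ^ 4 * lawConst A with hLd
  have hL0 : 0 ≤ L := by positivity
  have h1 : ∀ k, avg P X (fun Y => ‖(res z Y *ᵥ v) k‖ ^ 2) ≤ (L ^ 2 + varConst A) * δ ^ 2 :=
      fun k => by
    have e1 := M.norm_avg_form_sub_le hz hg (l2_single k).le hv
    have e2 := M.spread_form_le hz (Pi.single k 1) v
    have e3 : (form z (Pi.single k 1) v : 𝕄 → ℂ) = fun Y => (res z Y *ᵥ v) k := by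
      funext Y; rw [form_single]
    have e4 : ∑ i, conj ((Pi.single k 1 : n → ℂ) i) * v i = v k := by
      rw [sum_eq_single k] <;> simp +contextual
    rw [e3, e4] at e1
    rw [e3, l2_single, one_mul] at e2
    rw [M.avg_normSq_eq (tw k)]
    have e5 : ‖avg P X (fun Y => (res z Y *ᵥ v) k)‖ ≤ L * δ := by
      have := norm_add_le (avg P X (fun Y => (res z Y *ᵥ v) k) - g * v k) (g * v k)
      rw [sub_add_cancel, norm_mul] at this
      have h3 := hg.norm_le hz (by linarith)
      have h4 : ‖g‖ * ‖v k‖ ≤ A * η := by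
        gcongr
        exact hvη k
      have h5 : 0 ≤ A * h := by positivity
      have h6 : 0 ≤ 2 * A ^ 4 * lawConst A * η := by positivity
      have h7 : L * δ = A * h + A * η + 2 * A ^ 4 * lawConst A * h + 2 * A ^ 4 * lawConst A * η := by
        rw [hLd, hδ]; ring
      linarith
    have e6 := pow_le_pow_left₀ (norm_nonneg _) e5 2
    have e7 : varConst A * (h ^ 2 * l2 v ^ 2) ≤ varConst A * δ ^ 2 := by
      have : h ^ 2 * l2 v ^ 2 ≤ δ ^ 2 * 1 ^ 2 := by
        have : h ≤ δ := by linarith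
        have := l2_nonneg v
        gcongr
      gcongr
      linarith
    rw [mul_pow] at e6
    linarith
  have h2 : ∑ k, avg P X (fun Y => ‖(res z Y *ᵥ v) k‖ ^ 2) ≤ A ^ 2 := by
    simp (disch := fun_prop) only [← M.avg_sum, ← l2_sq]
    refine (M.avg_mono (by simp only [l2_sq]; fun_prop) (Tame.const (A ^ 2))
      fun Y hY => ?_).trans (avg_const _).le
    exact pow_le_pow_left₀ (l2_nonneg _)
      ((l2_res_le hY hz v).trans (mul_le_of_le_one_right (by linarith) hv)) 2
  have h3 : ∀ k, avg P X (fun Y => ‖(res z Y *ᵥ v) k‖ ^ 4) =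
      avg P X (fun Y => ‖(res z Y *ᵥ v) k‖ ^ 2) ^ 2 +
      spread P X (fun Y => (((‖(res z Y *ᵥ v) k‖ ^ 2 : ℝ)) : ℂ)) := fun k => by
    have := M.avg_normSq_eq (tF k)
    have e1 : avg P X (fun Y => (((‖(res z Y *ᵥ v) k‖ ^ 2 : ℝ)) : ℂ)) =
        ((avg P X (fun Y => ‖(res z Y *ᵥ v) k‖ ^ 2) : ℝ) : ℂ) := integral_complex_ofReal
    rw [e1, norm_real, Real.norm_eq_abs, sq_abs] at this
    rw [← this]
    congr 1
    funext Y
    rw [norm_real, norm_of_nonneg (by positivity)]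
    ring
  have h4 : ∑ k, avg P X (fun Y => ‖(res z Y *ᵥ v) k‖ ^ 4) ≤
      (A ^ 2 * (L ^ 2 + varConst A) + squareConst A) * δ ^ 2 := by
    simp only [h3]
    rw [sum_add_distrib]
    have e1 := M.sum_spread_normSq_le hz hv
    have e2 : squareConst A * h ^ 2 ≤ squareConst A * δ ^ 2 := by
      have := squareConst_nonneg hA
      have : h ≤ δ := by linarith
      gcongr
    have e3 : ∑ k, avg P X (fun Y => ‖(res z Y *ᵥ v) k‖ ^ 2) ^ 2 ≤
        ∑ k, (L ^ 2 + varConst A) * δ ^ 2 * avg P X (fun Y => ‖(res z Y *ᵥ v) k‖ ^ 2) := by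
      gcongr with k
      rw [pow_two]
      exact mul_le_mul_of_nonneg_right (h1 k) (integral_nonneg fun w => by positivity)
    rw [← mul_sum] at e3
    have e4 := mul_le_mul_of_nonneg_left h2 (show 0 ≤ (L ^ 2 + varConst A) * δ ^ 2 by positivity)
    linarith
  have h10 : 0 ≤ A ^ 2 * (L ^ 2 + varConst A) * δ := by positivity
  calc _ ≤ avg P X (fun Y => ∑ k, (δ * ‖(res z Y *ᵥ v) k‖ ^ 2 +
          δ⁻¹ * ‖(res z Y *ᵥ v) k‖ ^ 4)) := by
        refine M.avg_mono (by fun_prop) (by fun_prop) fun Y hY => ?_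
        gcongr with k
        generalize ‖(res z Y *ᵥ v) k‖ = x
        have e1 : δ * x ^ 2 + δ⁻¹ * x ^ 4 - 2 * x ^ 3 = δ⁻¹ * (x * (x - δ)) ^ 2 := by
          field_simp; ring
        have e2 : 0 ≤ δ⁻¹ * (x * (x - δ)) ^ 2 := by positivity
        have e3 : 0 ≤ δ * x ^ 2 + δ⁻¹ * x ^ 4 := by positivity
        linarith
    _ = δ * (∑ k, avg P X (fun Y => ‖(res z Y *ᵥ v) k‖ ^ 2)) +
        δ⁻¹ * ∑ k, avg P X (fun Y => ‖(res z Y *ᵥ v) k‖ ^ 4) := by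
      simp (disch := fun_prop) only [M.avg_sum, M.avg_add, avg_mul_left, sum_add_distrib, mul_sum]
    _ ≤ δ * A ^ 2 + δ⁻¹ * ((A ^ 2 * (L ^ 2 + varConst A) + squareConst A) * δ ^ 2) := by gcongr
    _ = δ * A ^ 2 + (A ^ 2 * (L ^ 2 + varConst A) + squareConst A) * δ := by field_simp
    _ ≤ _ := by
      unfold delocConst
      linarith

/-- The total size of the error terms for delocalized families. -/
theorem errTotal_le (hT : T.Good c A) (b₀ : β) {g : β → ℂ} (hg : ∀ b, SelfCons σ (T.z b) (g b)) {η : ℝ}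
    (hη : 0 ≤ η) (huη : ∀ b i, ‖T.u b i‖ ≤ η) (hvη : ∀ b i, ‖T.v b i‖ ≤ η) :
    errTotal P X T h η ≤ (1 + 8 * A ^ 3 * delocConst A) * (h + η) := by
  have hA := M.one_le
  have hh := M.h_pos
  have hD := delocConst_nonneg hA
  have h1 : avg P X (fun Y => ∑ j, T.mass Y j ^ 3) ≤ avg P X (fun Y => 4 * A ^ 2 *
      ∑ b, ((∑ k, ‖T.left b Y k‖ ^ 3) + ∑ k, ‖T.right b Y k‖ ^ 3)) := by
    refine M.avg_mono (by fun_prop) (by fun_prop) fun Y hY => ?_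
    simp only [← sum_add_distrib]
    rw [sum_comm, mul_sum]
    gcongr with k
    have h3 := pow_sum_div_card_le_sum_pow (s := (univ : Finset β))
      (f := fun b => ‖T.left b Y k‖ + ‖T.right b Y k‖) (fun b _ => by positivity) 2
    have h4 : ∀ b, (‖T.left b Y k‖ + ‖T.right b Y k‖) ^ 3 ≤
        4 * (‖T.left b Y k‖ ^ 3 + ‖T.right b Y k‖ ^ 3) := fun b => by
      nlinarith [norm_nonneg (T.left b Y k), norm_nonneg (T.right b Y k),
        mul_nonneg (add_nonneg (norm_nonneg (T.left b Y k)) (norm_nonneg (T.right b Y k)))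
          (sq_nonneg (‖T.left b Y k‖ - ‖T.right b Y k‖))]
    have h5 : (0 : ℝ) < card β := by
      have : Nonempty β := ⟨b₀⟩
      exact_mod_cast Fintype.card_pos
    rw [div_le_iff₀ (by rw [card_univ]; positivity), card_univ] at h3
    have := hT.card_le
    calc _ ≤ (∑ b, (‖T.left b Y k‖ + ‖T.right b Y k‖) ^ 3) * (card β : ℝ) ^ 2 := h3
      _ ≤ (∑ b, 4 * (‖T.left b Y k‖ ^ 3 + ‖T.right b Y k‖ ^ 3)) * A ^ 2 := by
        gcongr with b
        exact h4 b
      _ = _ := by rw [← mul_sum]; ring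
  have h3 : ∑ b, avg P X (fun Y => (∑ k, ‖T.left b Y k‖ ^ 3) + ∑ k, ‖T.right b Y k‖ ^ 3) ≤ A * (2 * (delocConst A * (h + η))) := by
    refine (Finset.sum_le_card_nsmul _ _ (2 * (delocConst A * (h + η))) fun b _ => ?_).trans ?_
    · have := M.avg_sum_cube_le (hT.im b) (hg b) (hT.v_le b) hη (hvη b)
      have := M.avg_sum_cube_le (abs_im_conj (hT.im b)) (hg b).conjugate (hT.u_le b) hη (huη b)
      rw [M.avg_add (by fun_prop) (by fun_prop)]
      unfold left right
      linarith
    · rw [nsmul_eq_mul, card_univ]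
      have := hT.card_le
      gcongr
  rw [avg_mul_left, M.avg_sum (ι := β) (by fun_prop)] at h1
  have h4 := mul_le_mul_of_nonneg_left h3 (show 0 ≤ 4 * A ^ 2 by positivity)
  unfold errTotal
  linarith

end Model

lemma l2_smul_le {x y : n → ℂ} {a : ℝ} (ha : 0 ≤ a) (hxy : ∀ i, ‖x i‖ ≤ a * ‖y i‖) :
    l2 x ≤ a * l2 y := by
  refine le_of_sq_le_sq ?_ (mul_nonneg ha (l2_nonneg y))
  rw [mul_pow, l2_sq, l2_sq, mul_sum]
  gcongr with i
  rw [← mul_pow]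
  gcongr
  exact hxy i

lemma offSum_sub_smul (u : n → ℂ) (m f g : n → n → ℂ) (a : ℂ) :
    offSum u m f - a * offSum u m g = offSum u m fun i j => f i j - a * g i j := by
  simp only [offSum, mul_sum, ← sum_sub_distrib]
  refine sum_congr rfl fun i _ => sum_congr rfl fun j _ => ?_
  split_ifs <;> ring

/-- The covariance of `e` and `F`. -/
def cov (P : Measure Ω) (X : Ω → 𝕄) (e F : 𝕄 → ℂ) : ℂ := avg P X fun Y => F Y * (e Y - avg P X e)

namespace Model

variable (M : Model P X h A σ ρ) {e F G : Matrix n n ℂ → ℂ}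
include M

lemma cov_eq (he : Tame e) (hF : Tame F) :
    cov P X e F = avg P X (fun Y => F Y * e Y) - avg P X F * avg P X e := by
  simp (disch := fun_prop) only [cov, mul_sub, M.avg_sub, avg_mul_right]

lemma cov_add (he : Tame e) (hF : Tame F) (hG : Tame G) :
    cov P X e (fun Y => F Y + G Y) = cov P X e F + cov P X e G := by
  simp (disch := fun_prop) only [cov, add_mul, M.avg_add]

lemma cov_const_mul (a : ℂ) : cov P X e (fun Y => a * F Y) = a * cov P X e F := by
  simp only [cov, mul_assoc, avg_mul_left]

lemma cov_sum (he : Tame e) {ι : Type*} {s : Finset ι} {F : ι → 𝕄 → ℂ} (hF : ∀ i, Tame (F i)) :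
    cov P X e (fun Y => ∑ i ∈ s, F i Y) = ∑ i ∈ s, cov P X e (F i) := by
  simp (disch := fun_prop) only [cov, sum_mul, M.avg_sum]

lemma norm_cov_le (he : Tame e) (he1 : ∀ Y : 𝕄, Y.IsHermitian → ‖e Y‖ ≤ 1)
    (hF : Tame F) (a : ℂ) : ‖cov P X e F‖ ≤ 2 * avg P X (fun Y => ‖F Y - a‖) := by
  have e1 : cov P X e F = avg P X fun Y => (F Y - a) * (e Y - avg P X e) := by
    simp (disch := fun_prop) only [cov, sub_mul a, sub_mul, mul_sub, M.avg_sub, avg_mul_left,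
      avg_mul_right, avg_const]
    ring
  rw [e1, ← avg_mul_left]
  refine M.norm_avg_le_avg (by fun_prop) (by fun_prop) fun Y hY => ?_
  rw [norm_mul, mul_comm]
  gcongr
  linarith [norm_sub_le (e Y) (avg P X e), he1 Y hY, M.norm_avg_le he he1]

lemma avg_norm_form_sub_le {z : ℂ} (hz : 1 ≤ A * |z.im|) {u v : n → ℂ} {L : ℝ} (hL : 0 < L)
    (hu : l2 u ≤ L) (hv : l2 v ≤ 1) :
    avg P X (fun Y => ‖form z u v Y - avg P X (form z u v)‖) ≤ (varConst A + 1) * (h * L) := by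
  have hh := M.h_pos
  refine M.integral_norm_sub_avg_le (tame_form (im_ne_of hz) u v) (by positivity) ?_
  refine (M.spread_form_le hz u v).trans ?_
  have := varConst_nonneg M.one_le
  have := l2_nonneg u
  have := l2_nonneg v
  have : l2 u * l2 v ≤ L := by nlinarith
  rw [mul_pow h L]
  gcongr

lemma avg_norm_entry_sub_le {z : ℂ} (hz : 1 ≤ A * |z.im|) (j : n) :
    avg P X (fun Y => ‖res z Y j j - avg P X fun Y => res z Y j j‖) ≤
      (varConst A + 1) * (h * 1) := by
  simpa only [form_single_eq] using
    M.avg_norm_form_sub_le hz one_pos (l2_single j).le (l2_single j).le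

/-- Covariances with products of forms. -/
lemma norm_cov_entry_mul_form_le (he : Tame e)
    (he1 : ∀ Y : 𝕄, Y.IsHermitian → ‖e Y‖ ≤ 1) {z : ℂ} (hz : 1 ≤ A * |z.im|)
    {u v : n → ℂ} {L : ℝ} (hL : 0 < L) (hu : l2 u ≤ L) (hv : l2 v ≤ 1) (j : n) :
    ‖cov P X e (fun Y => res z Y j j * form z u v Y)‖ ≤ 4 * A * (varConst A + 1) * (h * L) := by
  have hA := M.one_le
  have hz0 := im_ne_of hz
  have h1 := M.avg_norm_entry_sub_le hz j
  have h2 := M.avg_norm_form_sub_le hz hL hu hv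
  set x := avg P X fun Y => res z Y j j
  set y := avg P X (form z u v)
  have hx : ‖x‖ ≤ A := M.norm_avg_le (by fun_prop) fun Y hY => norm_res_entry_le hY hz j j
  refine (M.norm_cov_le he he1 (by fun_prop) (x * y)).trans ?_
  calc _ ≤ 2 * avg P X (fun Y => A * L * ‖res z Y j j - x‖ + A * ‖form z u v Y - y‖) := by
        gcongr
        refine M.avg_mono (by fun_prop) (by fun_prop) fun Y hY => ?_
        have e1 : res z Y j j * form z u v Y - x * y = form z u v Y * (res z Y j j - x) +
          x * (form z u v Y - y) := by ring
        rw [e1]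
        refine (norm_add_le _ _).trans ?_
        rw [norm_mul, norm_mul]
        have h4 : ‖form z u v Y‖ ≤ A * L := (norm_form_le hY hz u v).trans (by
          have := mul_le_mul hu hv (l2_nonneg _) hL.le
          rw [mul_one] at this
          gcongr)
        gcongr
    _ = 2 * (A * L * avg P X (fun Y => ‖res z Y j j - x‖) +
          A * avg P X (fun Y => ‖form z u v Y - y‖)) := by
      simp (disch := fun_prop) only [M.avg_add, avg_mul_left]
    _ ≤ 2 * (A * L * ((varConst A + 1) * (h * 1)) + A * ((varConst A + 1) * (h * L))) := by gcongr
    _ = _ := by ring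

/-- The terms of second order without derivative of the oscillating factor. -/
lemma norm_offSum_cov_trace_le (he : Tame e)
    (he1 : ∀ Y : 𝕄, Y.IsHermitian → ‖e Y‖ ≤ 1) {z g : ℂ} (hz : 1 ≤ A * |z.im|)
    (hg : SelfCons σ z g) {u v : n → ℂ} (hu : l2 u ≤ 1) (hv : l2 v ≤ 1) :
    ‖offSum u (mom P X 1 1) (fun i j => cov P X e fun Y => res z Y j j * (res z Y *ᵥ v) i) -
      (σ ^ 2 : ℝ) * g * cov P X e (form z u v)‖ ≤
      12 * A ^ 2 * (varConst A + 1) * (1 + lawConst A) * h ^ 2 := by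
  have hA := M.one_le
  have hh := M.h_pos
  have hz0 := im_ne_of hz
  have hσ := M.sigma_le
  have hV := varConst_nonneg hA
  have hLw := lawConst_nonneg hA
  set τ : ℂ := ((σ ^ 2 * h ^ 2 : ℝ) : ℂ) with hτ
  have hτn : ‖τ‖ ≤ A * h ^ 2 := by rw [hτ, norm_real, norm_of_nonneg (by positivity)]; gcongr
  set q₁ : n → n → ℂ := fun j i => if i = j then 0 else u i * conj (mom P X 1 1 i j - τ) with hq₁
  set q₂ : n → n → ℂ := fun j i => (-conj τ * u j) * (Pi.single j 1 : n → ℂ) i with hq₂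
  set q : n → n → ℂ := fun j => q₁ j + q₂ j with hq
  have l₁ : ∀ j, l2 (q₁ j) ≤ A * h ^ 3 := fun j => by
    refine (l2_smul_le (y := u) (a := A * h ^ 3) (by positivity) fun i => ?_).trans
      (mul_le_of_le_one_right (by positivity) hu)
    simp only [hq₁]
    split_ifs with hij
    · rw [norm_zero]; positivity
    · rw [norm_mul, norm_conj, mul_comm]
      exact mul_le_mul_of_nonneg_right (M.norm_mom_abs_sub_le hij) (norm_nonneg _)
  have l₂ : ∀ j, l2 (q₂ j) ≤ A * h ^ 2 * ‖u j‖ := fun j => by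
    refine (l2_smul_le (y := Pi.single j 1) (a := A * h ^ 2 * ‖u j‖) (by positivity)
      fun i => ?_).trans (by rw [l2_single, mul_one])
    simp only [hq₂]
    rw [norm_mul, norm_mul, norm_neg, norm_conj]
    gcongr
  have lq : ∀ j, l2 (q j) ≤ A * h ^ 3 + A * h ^ 2 * ‖u j‖ := fun j =>
    (l2_add_le _ _).trans (add_le_add (l₁ j) (l₂ j))
  have e1 : offSum u (mom P X 1 1) (fun i j => cov P X e fun Y => res z Y j j *
      (res z Y *ᵥ v) i) = (σ ^ 2 : ℝ) * cov P X e (fun Y => meanTrace h z Y *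
      form z u v Y) + ∑ j, cov P X e (fun Y => res z Y j j * form z (q j) v Y) := by
    have e4 : (fun Y => (σ ^ 2 : ℝ) * (meanTrace h z Y * form z u v Y)) =
        fun Y => ∑ j, τ * (res z Y j j * form z u v Y) := by
      funext Y
      rw [meanTrace, ← mul_sum, ← sum_mul, hτ]
      push_cast; ring
    rw [← M.cov_const_mul, e4, M.cov_sum he (by fun_prop), ← sum_add_distrib, offSum, sum_comm]
    refine sum_congr rfl fun j _ => ?_
    rw [← M.cov_add he (by fun_prop) (by fun_prop)]
    simp only [form, mul_sum, ← sum_add_distrib]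
    rw [M.cov_sum he (by fun_prop)]
    refine sum_congr rfl fun i _ => ?_
    have e2 : (if i ≠ j then conj (u i) * (mom P X 1 1 i j * cov P X e fun Y => res z Y j j *
        (res z Y *ᵥ v) i) else 0) = (if i ≠ j then conj (u i) * mom P X 1 1 i j else 0) *
          cov P X e fun Y => res z Y j j * (res z Y *ᵥ v) i := by
      split_ifs <;> ring
    rw [e2, ← M.cov_const_mul]
    congr 1
    funext Y
    simp only [hq, hq₁, hq₂, Pi.add_apply, Pi.single_apply]
    by_cases hij : i = j
    · subst hij; simp; ring
    · simp [hij]; ring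
  have h1 : ‖∑ j, cov P X e (fun Y => res z Y j j * form z (q j) v Y)‖ ≤
      4 * A * (varConst A + 1) * (2 * A * h ^ 2) := by
    refine (norm_sum_le _ _).trans ((sum_le_sum fun j _ =>
      M.norm_cov_entry_mul_form_le he he1 hz (u := q j) (v := v)
      (L := A * h ^ 3 + A * h ^ 2 * ‖u j‖) (by positivity) (lq j) hv j).trans ?_)
    rw [← mul_sum, ← mul_sum, sum_add_distrib, ← mul_sum]
    have s1 := M.sum_norm_le hu
    have s2 : h * (A * (∑ _j : n, h ^ 3) + ∑ j, A * h ^ 2 * ‖u j‖) ≤ 2 * A * h ^ 2 := by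
      rw [← mul_sum, sum_const, card_univ, nsmul_eq_mul]
      have e5 : h * (A * (card n * h ^ 3) + A * h ^ 2 * ∑ j, ‖u j‖) =
        A * h ^ 2 * (card n * h ^ 2) + A * h ^ 2 * (h * ∑ j, ‖u j‖) := by ring
      rw [e5, M.card_eq]
      have := mul_le_mul_of_nonneg_left s1 (show 0 ≤ A * h ^ 2 by positivity)
      linarith
    exact mul_le_mul_of_nonneg_left s2 (by positivity)
  have ts : Tame (meanTrace h z : 𝕄 → ℂ) := tame_meanTrace h hz0
  set s := avg P X (meanTrace h z) with hs
  have h2 : ‖cov P X e (fun Y => (meanTrace h z Y - s) * form z u v Y)‖ ≤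
      2 * (A * ((varConst A + 1) * h ^ 2)) := by
    refine (M.norm_cov_le he he1 (by fun_prop) 0).trans ?_
    calc _ ≤ 2 * avg P X (fun Y => A * ‖meanTrace h z Y - s‖) := by
          gcongr
          refine M.avg_mono (by fun_prop) (by fun_prop) fun Y hY => ?_
          rw [sub_zero, norm_mul, mul_comm]
          gcongr
          exact M.norm_form_le_of_le_one hz hu hv hY
      _ ≤ _ := by
        rw [avg_mul_left]
        gcongr
        exact M.integral_norm_sub_avg_le ts (V := varConst A) (by positivity)
          ((M.spread_meanTrace_le hz).trans (le_of_eq (by ring)))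
  have h3 : ‖cov P X e (form z u v)‖ ≤ 2 * ((varConst A + 1) * (h * 1)) :=
    (M.norm_cov_le he he1 (by fun_prop) _).trans (by
      gcongr
      exact M.avg_norm_form_sub_le hz one_pos hu hv)
  have h4 := M.norm_avg_meanTrace_sub_le hz hg
  rw [← hs] at h4
  have e6 : cov P X e (fun Y => meanTrace h z Y * form z u v Y) =
      cov P X e (fun Y => (meanTrace h z Y - s) * form z u v Y) + s * cov P X e (form z u v) := by
    rw [← M.cov_const_mul, ← M.cov_add he (by fun_prop) (by fun_prop)]
    simp only [sub_mul, sub_add_cancel]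
  rw [e1, e6]
  generalize cov P X e (fun Y => (meanTrace h z Y - s) * form z u v Y) = k₁ at *
  generalize cov P X e (form z u v) = k₂ at *
  generalize ∑ j, cov P X e (fun Y => res z Y j j * form z (q j) v Y) = k₃ at *
  have key : (σ ^ 2 : ℝ) * (k₁ + s * k₂) + k₃ - (σ ^ 2 : ℝ) * g * k₂ =
    ((σ ^ 2 : ℝ) : ℂ) * k₁ + ((σ ^ 2 : ℝ) : ℂ) * ((s - g) * k₂) + k₃ := by ring
  rw [key]
  refine norm_add₃_le.trans ?_
  rw [norm_mul, norm_mul, norm_mul, norm_real, norm_of_nonneg (sq_nonneg σ)]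
  calc _ ≤ A * (2 * (A * ((varConst A + 1) * h ^ 2))) +
        A * ((A * lawConst A * h) * (2 * ((varConst A + 1) * (h * 1)))) +
        4 * A * (varConst A + 1) * (2 * A * h ^ 2) := by gcongr
    _ = A ^ 2 * (varConst A + 1) * (10 + 2 * lawConst A) * h ^ 2 := by ring
    _ ≤ A ^ 2 * (varConst A + 1) * (12 * (1 + lawConst A)) * h ^ 2 := by
      gcongr
      linarith
    _ = _ := by ring

/-- The terms of third order. -/
lemma norm_offSum_cov_diag_le (he : Tame e)
    (he1 : ∀ Y : 𝕄, Y.IsHermitian → ‖e Y‖ ≤ 1) {z : ℂ} (hz : 1 ≤ A * |z.im|)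
    {u v : n → ℂ} (hu : l2 u ≤ 1) (hv : l2 v ≤ 1) :
    ‖offSum u (mom P X 2 1) (fun i j => cov P X e fun Y => res z Y j j * res z Y i i *
      (res z Y *ᵥ v) j)‖ ≤ (1 + A) * A ^ 2 * (6 * varConst A + 6 * A ^ 2) * h ^ 2 := by
  have hA := M.one_le
  have hh := M.h_pos
  have hz0 := im_ne_of hz
  have hV := varConst_nonneg hA
  set r : n → ℂ := fun j => avg P X fun Y => res z Y j j with hr
  have hrA : ∀ j, ‖r j‖ ≤ A := fun j =>
    M.norm_avg_le (by fun_prop) fun Y hY => norm_res_entry_le hY hz j j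
  set d : n → ℝ := fun j => avg P X fun Y => ‖res z Y j j - r j‖ ^ 2 with hd
  have hdj : ∀ j, d j ≤ varConst A * h ^ 2 := fun j => by
    have := M.spread_form_le hz (Pi.single j 1) (Pi.single j 1)
    rwa [form_single_eq, l2_single, mul_one, one_pow, mul_one] at this
  set f : n → ℝ := fun j => avg P X fun Y => ‖(res z Y *ᵥ v) j‖ ^ 2 with hf
  have hfs : ∑ j, f j ≤ A ^ 2 := by
    simp (disch := fun_prop) only [hf, ← M.avg_sum, ← l2_sq]
    refine (M.avg_mono (by simp only [l2_sq]; fun_prop) (Tame.const (A ^ 2))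
      fun Y hY => ?_).trans (avg_const _).le
    exact pow_le_pow_left₀ (l2_nonneg _)
      ((l2_res_le hY hz v).trans (mul_le_of_le_one_right (by linarith) hv)) 2
  have c1 : ∀ i j, ‖cov P X e (fun Y => (res z Y j j * res z Y i i - r j * r i) *
      (res z Y *ᵥ v) j)‖ ≤ A * (d j + d i + 2 * f j) := fun i j => by
    refine (M.norm_cov_le he he1 (by fun_prop) 0).trans ?_
    have h1 : avg P X (fun Y => ‖(res z Y j j * res z Y i i - r j * r i) *
        (res z Y *ᵥ v) j - 0‖) ≤ avg P X (fun Y => A / 2 * (‖res z Y j j - r j‖ ^ 2 +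
          ‖res z Y i i - r i‖ ^ 2 + 2 * ‖(res z Y *ᵥ v) j‖ ^ 2)) := by
      refine M.avg_mono (by fun_prop) (by fun_prop) fun Y hY => ?_
      have e1 : res z Y j j * res z Y i i - r j * r i = res z Y i i * (res z Y j j - r j) +
        r j * (res z Y i i - r i) := by ring
      have h2 : ‖res z Y j j * res z Y i i - r j * r i‖ ≤
          A * ‖res z Y j j - r j‖ + A * ‖res z Y i i - r i‖ := by
        rw [e1]
        refine (norm_add_le _ _).trans ?_
        rw [norm_mul, norm_mul]
        gcongr
        exacts [norm_res_entry_le hY hz i i, hrA j]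
      rw [sub_zero, norm_mul]
      refine (mul_le_mul_of_nonneg_right h2 (norm_nonneg _)).trans ?_
      generalize ‖res z Y j j - r j‖ = x
      generalize ‖res z Y i i - r i‖ = y
      generalize ‖(res z Y *ᵥ v) j‖ = w
      have : 0 ≤ A / 2 * ((x - w) ^ 2 + (y - w) ^ 2) := by positivity
      linarith
    simp (disch := fun_prop) only [avg_mul_left, M.avg_add] at h1
    linarith
  set q : n → n → ℂ := fun i j => if i = j then 0 else conj (mom P X 2 1 i j * r j) with hq
  have lq : ∀ i, l2 (q i) ≤ (1 + A) * A * h ^ 2 := fun i => by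
    refine le_of_sq_le_sq ?_ (by positivity)
    rw [l2_sq]
    calc _ ≤ ∑ _j : n, ((1 + A) * h ^ 3 * A) ^ 2 := by
          gcongr with j
          simp only [hq]
          split_ifs
          · rw [norm_zero]; positivity
          · rw [norm_conj, norm_mul]
            gcongr
            exacts [M.norm_mom_le 2 1 (by norm_num) i j, hrA j]
      _ = _ := by
        rw [sum_const, card_univ, nsmul_eq_mul]
        linear_combination (((1 + A) * h ^ 2 * A) ^ 2) * M.card_eq
  have e1 : offSum u (mom P X 2 1) (fun i j => cov P X e fun Y => res z Y j j * res z Y i i *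
      (res z Y *ᵥ v) j) = offSum u (mom P X 2 1) (fun i j => cov P X e fun Y =>
        (res z Y j j * res z Y i i - r j * r i) * (res z Y *ᵥ v) j) +
        ∑ i, conj (u i) * (r i * cov P X e (form z (q i) v)) := by
    have e2 : ∀ i, (form z (q i) v : 𝕄 → ℂ) = fun Y => ∑ j, conj (q i j) * (res z Y *ᵥ v) j :=
      fun _ => rfl
    simp (disch := fun_prop) only [offSum, e2, M.cov_sum he, mul_sum, ← sum_add_distrib,
      M.cov_const_mul]
    refine sum_congr rfl fun i _ => sum_congr rfl fun j _ => ?_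
    have e3 : cov P X e (fun Y => res z Y j j * res z Y i i * (res z Y *ᵥ v) j) =
        cov P X e (fun Y => (res z Y j j * res z Y i i - r j * r i) * (res z Y *ᵥ v) j) +
        r j * r i * cov P X e (fun Y => (res z Y *ᵥ v) j) := by
      rw [← M.cov_const_mul, ← M.cov_add he (by fun_prop) (by fun_prop)]
      simp only [sub_mul, sub_add_cancel]
    rw [e3]
    simp only [hq]
    by_cases hij : i = j
    · simp [hij]
    · simp [hij]; ring
  have s1 := M.sum_norm_le hu
  have h1 : ‖offSum u (mom P X 2 1) (fun i j => cov P X e fun Y =>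
        (res z Y j j * res z Y i i - r j * r i) * (res z Y *ᵥ v) j)‖ ≤
      (1 + A) * A * (2 * varConst A + 2 * A ^ 2) * h ^ 2 := by
    calc _ ≤ ∑ i, ∑ j, ‖u i‖ * ((1 + A) * h ^ 3 * (A * (2 * (varConst A * h ^ 2) + 2 * f j))) := by
          refine norm_sum_le_of_le _ fun i _ => norm_sum_le_of_le _ fun j _ => ?_
          have f0 : 0 ≤ f j := integral_nonneg fun ω => by positivity
          split_ifs
          · rw [norm_mul, norm_mul, norm_conj]
            gcongr
            · exact M.norm_mom_le 2 1 (by norm_num) i j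
            · refine (c1 i j).trans ?_
              gcongr
              linarith [hdj i, hdj j]
          · rw [norm_zero]; positivity
      _ = (h * ∑ i, ‖u i‖) * ((1 + A) * h ^ 2 * (A * (2 * varConst A + 2 * ∑ j, f j))) := by
        simp only [← mul_sum, ← sum_mul, sum_add_distrib, sum_const, card_univ, nsmul_eq_mul]
        linear_combination (∑ i, ‖u i‖) * (1 + A) * h ^ 3 * A * 2 * varConst A * M.card_eq
      _ ≤ 1 * ((1 + A) * h ^ 2 * (A * (2 * varConst A + 2 * A ^ 2))) := by
        have : 0 ≤ ∑ j, f j := sum_nonneg fun j _ => integral_nonneg fun ω => by positivity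
        gcongr
      _ = _ := by ring
  have h2 : ‖∑ i, conj (u i) * (r i * cov P X e (form z (q i) v))‖ ≤
      A * (2 * (varConst A + 1) * ((1 + A) * A)) * h ^ 2 := by
    calc _ ≤ ∑ i, ‖u i‖ * (A * (2 * ((varConst A + 1) * (h * ((1 + A) * A * h ^ 2))))) := by
          refine norm_sum_le_of_le _ fun i _ => ?_
          rw [norm_mul, norm_mul, norm_conj]
          gcongr
          · exact hrA i
          · refine (M.norm_cov_le he he1 (by fun_prop) (avg P X (form z (q i) v))).trans ?_
            gcongr
            exact M.avg_norm_form_sub_le hz (by positivity) (lq i) hv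
      _ = (h * ∑ i, ‖u i‖) * (A * (2 * (varConst A + 1) * ((1 + A) * A)) * h ^ 2) := by
        rw [← sum_mul]; ring
      _ ≤ _ := mul_le_of_le_one_left (by positivity) s1
  rw [e1]
  refine (norm_add_le _ _).trans ((add_le_add h1 h2).trans ?_)
  rw [← add_mul]
  gcongr
  have a1 : (1 + A) * A * (2 * varConst A + 2 * A ^ 2) ≤
      (1 + A) * A ^ 2 * (2 * varConst A + 2 * A ^ 2) := by
    have := le_self_pow₀ hA (show 2 ≠ 0 by norm_num)
    gcongr
  have a2 : A * (2 * (varConst A + 1) * ((1 + A) * A)) =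
    (1 + A) * A ^ 2 * (2 * varConst A + 2) := by ring
  have a3 : 0 ≤ (1 + A) * A ^ 2 := by positivity
  have a4 : (1 + A) * A ^ 2 * (2 * varConst A + 2) ≤
      (1 + A) * A ^ 2 * (4 * varConst A + 4 * A ^ 2) := by
    have := one_le_pow₀ hA (n := 2)
    gcongr
    · linarith
    · linarith
  linarith

end Model

/-- The constant in the covariance identity. -/
def covConst (A : ℝ) : ℝ :=
  2 * (expConst A * (80 * A ^ 8) * (1 + 8 * A ^ 3 * delocConst A)) + 24 * A ^ 6 +
    12 * A ^ 2 * (varConst A + 1) * (1 + lawConst A) +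
    (1 + A) * A ^ 2 * (6 * varConst A + 6 * A ^ 2)

namespace Model

variable (M : Model P X h A σ ρ)
include M

/-- The covariance of a form and the oscillating factor. -/
theorem norm_cov_identity_le (hT : T.Good c A) (b : β) {g : β → ℂ}
    (hg : ∀ b, SelfCons σ (T.z b) (g b)) {η : ℝ} (hη : 0 ≤ η) (huη : ∀ b i, ‖T.u b i‖ ≤ η)
    (hvη : ∀ b i, ‖T.v b i‖ ≤ η) :
    ‖(T.z b - (σ ^ 2 : ℝ) * g b) * cov P X (T.osc h⁻¹ c) (T.formAt b) - I * h * (σ ^ 2 : ℝ) *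
        (ρ * avg P X (fun Y => ∑ i, ∑ j, conj (T.u b i) * T.termOsc c h⁻¹ b i j j Y) +
        avg P X (fun Y => ∑ i, ∑ j, conj (T.u b i) * T.termOsc c h⁻¹ b j i j Y))‖ ≤
      covConst A * (h * (h + η)) := by
  have hA := M.one_le
  have hh := M.h_pos
  have hcE := expConst_nonneg hA
  have hV := varConst_nonneg hA
  have hLw := lawConst_nonneg hA
  have he : Tame (T.osc h⁻¹ c) := by fun_prop
  have he1 : ∀ Y : 𝕄, Y.IsHermitian → ‖T.osc h⁻¹ c Y‖ ≤ 1 := fun Y hY =>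
    (norm_osc hY hT h⁻¹).le
  have hosc : T.osc h⁻¹ 0 = fun _ => 1 := funext (osc_zero _)
  have a1 := M.norm_main_identity_le hT b hη (huη b)
  have a0 := M.norm_main_identity_le hT.zero b hη (huη b)
  have b1 := M.norm_offSum_mainTerm_sub_le hT b hη (huη b)
  have b0 := M.norm_offSum_mainTerm_sub_le hT.zero b hη (huη b)
  have c1 := M.norm_offSum_cov_trace_le he he1 (hT.im b) (hg b) (hT.u_le b) (hT.v_le b)
  have c2 := M.norm_offSum_cov_diag_le he he1 (hT.im b) (hT.u_le b) (hT.v_le b)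
  have d1 := M.errTotal_le hT b hg hη huη hvη
  have hn := M.norm_avg_le he he1
  have hz := hT.im_ne b
  have e2 : offSum (T.u b) (mom P X 1 1) (fun i j => avg P X (T.term₂ c h⁻¹ b j j i)) -
      avg P X (T.osc h⁻¹ c) * offSum (T.u b) (mom P X 1 1)
        (fun i j => avg P X (T.term₂ 0 h⁻¹ b j j i)) = offSum (T.u b) (mom P X 1 1) (fun i j =>
        cov P X (T.osc h⁻¹ c) fun Y => res (T.z b) Y j j * (res (T.z b) Y *ᵥ T.v b) i) := by
    rw [offSum_sub_smul]
    simp (disch := fun_prop) only [M.cov_eq he, mul_comm (avg P X (T.osc h⁻¹ c))]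
    unfold term₂
    simp only [hosc, mul_one, right]
  have e3 : offSum (T.u b) (mom P X 2 1) (fun i j => avg P X (T.term₃ c h⁻¹ b j j i i j)) -
      avg P X (T.osc h⁻¹ c) * offSum (T.u b) (mom P X 2 1)
        (fun i j => avg P X (T.term₃ 0 h⁻¹ b j j i i j)) = offSum (T.u b) (mom P X 2 1)
        (fun i j => cov P X (T.osc h⁻¹ c) fun Y => res (T.z b) Y j j * res (T.z b) Y i i *
          (res (T.z b) Y *ᵥ T.v b) j) := by
    rw [offSum_sub_smul]
    simp (disch := fun_prop) only [M.cov_eq he, mul_comm (avg P X (T.osc h⁻¹ c))]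
    unfold term₃
    simp only [hosc, mul_one, right]
  rw [← e2] at c1
  rw [← e3] at c2
  have e1 := M.cov_eq he (M.tame_formAt hT b)
  change ‖_ - _ * cov P X (T.osc h⁻¹ c) (T.formAt b)‖ ≤ _ at c1
  rw [e1] at c1 ⊢
  simp only [hosc, termOsc_zero, mul_one, mul_zero, Finset.sum_const_zero, avg_const, add_zero,
    sub_zero] at a0 b0
  have d2 : expConst A * (80 * A ^ 8) * (h * errTotal P X T h η) ≤
      expConst A * (80 * A ^ 8) * (1 + 8 * A ^ 3 * delocConst A) * (h * (h + η)) := by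
    calc _ ≤ expConst A * (80 * A ^ 8) * (h * ((1 + 8 * A ^ 3 * delocConst A) *
          (h + η))) := by gcongr
      _ = _ := by ring
  change ‖T.z b * avg P X (T.formAt b) - _ - _‖ ≤ _ at a0
  generalize avg P X (fun Y => ∑ i, ∑ j, conj (T.u b i) * T.termOsc c h⁻¹ b i j j Y) = B at *
  generalize avg P X (fun Y => ∑ i, ∑ j, conj (T.u b i) * T.termOsc c h⁻¹ b j i j Y) = B' at *
  generalize avg P X (fun Y => T.formAt b Y * T.osc h⁻¹ c Y) = y₁ at *
  generalize avg P X (T.formAt b) = y₀ at *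
  generalize avg P X (T.osc h⁻¹ c) = a at *
  generalize offSum (T.u b) (mom P X 1 1) (fun i j => avg P X (T.term₂ c h⁻¹ b j j i)) = s₁ at *
  generalize offSum (T.u b) (mom P X 1 1) (fun i j => avg P X (T.term₂ 0 h⁻¹ b j j i)) = s₀ at *
  generalize offSum (T.u b) (mom P X 2 1) (fun i j => avg P X (T.term₃ c h⁻¹ b j j i i j)) = t₁ at *
  generalize offSum (T.u b) (mom P X 2 1) (fun i j => avg P X (T.term₃ 0 h⁻¹ b j j i i j)) = t₀ at *
  generalize offSum (T.u b) 1 (mainTerm P X h T c b) = m₁ at *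
  generalize offSum (T.u b) 1 (mainTerm P X h T 0 b) = m₀ at *
  generalize ∑ i, conj (T.u b i) * T.v b i = p at *
  generalize I * h * (σ ^ 2 : ℝ) * (ρ * B + B') = D at *
  have key : (T.z b - (σ ^ 2 : ℝ) * g b) * (y₁ - y₀ * a) - D = (T.z b * y₁ - p * a - m₁) -
      a * (T.z b * y₀ - p - m₀) + ((m₁ - s₁ - t₁ - D) - a * (m₀ - s₀ - t₀)) +
      ((s₁ - a * s₀) - (σ ^ 2 : ℝ) * g b * (y₁ - y₀ * a)) + (t₁ - a * t₀) := by ring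
  rw [key]
  have f1 := norm_add_le ((T.z b * y₁ - p * a - m₁) - a * (T.z b * y₀ - p - m₀) +
    ((m₁ - s₁ - t₁ - D) - a * (m₀ - s₀ - t₀)) +
      ((s₁ - a * s₀) - (σ ^ 2 : ℝ) * g b * (y₁ - y₀ * a))) (t₁ - a * t₀)
  have f2 := norm_add₃_le (a := (T.z b * y₁ - p * a - m₁) - a * (T.z b * y₀ - p - m₀))
    (b := (m₁ - s₁ - t₁ - D) - a * (m₀ - s₀ - t₀))
      (c := (s₁ - a * s₀) - (σ ^ 2 : ℝ) * g b * (y₁ - y₀ * a))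
  have f3 := norm_sub_le (T.z b * y₁ - p * a - m₁) (a * (T.z b * y₀ - p - m₀))
  have f4 := norm_sub_le (m₁ - s₁ - t₁ - D) (a * (m₀ - s₀ - t₀))
  rw [norm_mul] at f3 f4
  have f5 : ‖a‖ * ‖T.z b * y₀ - p - m₀‖ ≤ 1 * ‖T.z b * y₀ - p - m₀‖ := by gcongr
  have f6 : ‖a‖ * ‖m₀ - s₀ - t₀‖ ≤ 1 * ‖m₀ - s₀ - t₀‖ := by gcongr
  have hsq : h ^ 2 ≤ h * (h + η) := by nlinarith
  have g1 := mul_le_mul_of_nonneg_left hsq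
    (show 0 ≤ 12 * A ^ 2 * (varConst A + 1) * (1 + lawConst A) by positivity)
  have g2 := mul_le_mul_of_nonneg_left hsq
    (show 0 ≤ (1 + A) * A ^ 2 * (6 * varConst A + 6 * A ^ 2) by positivity)
  unfold covConst
  linarith

end Model

/-- The form `⟨u, (z - Y)⁻¹ (z' - Y)⁻¹ v⟩`. -/
def pairing (z z' : ℂ) (u v : n → ℂ) (Y : 𝕄) : ℂ :=
  ∑ j, conj ((res (conj z) Y *ᵥ u) j) * (res z' Y *ᵥ v) j

section Deterministic

variable {Y : Matrix n n ℂ} {z z' : ℂ} {A σ : ℝ} {u v : n → ℂ}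

lemma pairing_eq_form (hY : Y.IsHermitian) :
    pairing z z' u v Y = form z u (res z' Y *ᵥ v) Y := by rw [form_eq_left hY]; rfl

lemma form_sub (z : ℂ) (u v w : n → ℂ) (Y : 𝕄) :
    form z u v Y - form z u w Y = form z u (v - w) Y := by
  simp only [form, ← sum_sub_distrib, ← mul_sub, Matrix.mulVec_sub, Pi.sub_apply]

lemma form_smul (z a : ℂ) (u v : n → ℂ) (Y : 𝕄) : form z u (a • v) Y = a * form z u v Y := by
  simp only [form, mul_sum, Matrix.mulVec_smul, Pi.smul_apply, smul_eq_mul, mul_left_comm a]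

lemma sub_mul_pairing (hY : Y.IsHermitian) (hz : z.im ≠ 0) (hz' : z'.im ≠ 0) :
    (z' - z) * pairing z z' u v Y = form z u v Y - form z' u v Y := by
  rw [pairing_eq_form hY]
  unfold form
  rw [mul_sum, ← sum_sub_distrib]
  refine sum_congr rfl fun i _ => ?_
  have := congrFun (congrArg (fun B => B *ᵥ v) (resolvent_identity hY hz hz')) i
  simp only [Matrix.sub_mulVec, Matrix.smul_mulVec, ← Matrix.mulVec_mulVec, Pi.sub_apply,
    Pi.smul_apply, smul_eq_mul] at this
  linear_combination (-conj (u i)) * this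

lemma norm_pairing_le (hY : Y.IsHermitian) (hA : 0 ≤ A) (hz : 1 ≤ A * |z.im|)
    (hz' : 1 ≤ A * |z'.im|) (hu : l2 u ≤ 1) (hv : l2 v ≤ 1) : ‖pairing z z' u v Y‖ ≤ A ^ 2 := by
  refine (norm_sum_conj_mul_le _ _).trans ?_
  rw [pow_two]
  exact mul_le_mul ((l2_res_le hY (abs_im_conj hz) u).trans (mul_le_of_le_one_right hA hu))
    ((l2_res_le hY hz' v).trans (mul_le_of_le_one_right hA hv)) (l2_nonneg _) hA

lemma norm_pairing_sub_le (hY : Y.IsHermitian) (hA : 0 ≤ A) (hz : 1 ≤ A * |z.im|)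
    (hz' : 1 ≤ A * |z'.im|) (hu : l2 u ≤ 1) (hv : l2 v ≤ 1) :
    ‖pairing z z u v Y - pairing z z' u v Y‖ ≤ A ^ 3 * ‖z' - z‖ := by
  have h0 := im_ne_of hz
  have h0' := im_ne_of hz'
  have h1 := congrArg (fun B => B *ᵥ v) (resolvent_identity hY h0 h0')
  simp only [Matrix.sub_mulVec, Matrix.smul_mulVec, ← Matrix.mulVec_mulVec] at h1
  rw [pairing_eq_form hY, pairing_eq_form hY, form_sub, h1, form_smul, norm_mul]
  have h4 := (l2_res_le hY hz' v).trans (mul_le_of_le_one_right hA hv)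
  have := l2_nonneg (res z Y *ᵥ (res z' Y *ᵥ v))
  calc _ ≤ ‖z' - z‖ * (A * (1 * (A * A))) := by
        gcongr
        refine (norm_form_le hY hz u _).trans ?_
        gcongr
        exact (l2_res_le hY hz _).trans (by gcongr)
    _ = _ := by ring

lemma conj_resolvent_mulVec (hY : Y.IsHermitian) (hs : Yᵀ = Y) (z : ℂ) (u : n → ℂ) (i : n) :
    conj ((res (conj z) Y *ᵥ u) i) = (res z Y *ᵥ fun k => conj (u k)) i := by
  simp only [Matrix.mulVec, dotProduct, map_sum, map_mul]
  refine sum_congr rfl fun k _ => ?_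
  have h1 := congrFun (congrFun (conjTranspose_resolvent hY (conj z)) k) i
  rw [Complex.conj_conj, Matrix.conjTranspose_apply] at h1
  have h2 := congrFun (congrFun (transpose_resolvent hs z) k) i
  rw [Matrix.transpose_apply] at h2
  rw [RCLike.star_def] at h1
  rw [h1, h2]

namespace SelfCons

variable {g g' : ℂ} (hg : SelfCons σ z g) (hg' : SelfCons σ z' g')
include hg

lemma ne_zero : g ≠ 0 := fun h => by simpa [h] using hg.mul_sub_eq_one

include hg'

lemma sub_mul_mul : (z' - z) * (g * g') = (g - g') * (1 - (σ : ℂ) ^ 2 * g * g') := by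
  have h1 := hg.eq
  have h2 := hg'.eq
  linear_combination g * h2 - g' * h1

lemma one_sub_ne_zero : 1 - (σ : ℂ) ^ 2 * g * g' ≠ 0 ∨ z = z' := by
  by_contra! h
  have h1 := hg.sub_mul_mul hg'
  rw [h.1, mul_zero] at h1
  rcases mul_eq_zero.1 h1 with h2 | h2
  · exact h.2 (sub_eq_zero.1 h2).symm
  · rcases mul_eq_zero.1 h2 with h3 | h3
    · exact hg.ne_zero h3
    · exact hg'.ne_zero h3

lemma norm_le_mul_norm_one_sub (hz : 1 ≤ A * |z.im|) (hA : 0 ≤ A) (hs : z'.im = z.im) :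
    ‖g‖ ≤ A * ‖1 - (σ : ℂ) ^ 2 * g * g'‖ := by
  have h1 : 1 - (σ : ℂ) ^ 2 * g * g' = g * (z - (σ ^ 2 : ℝ) * (g + g')) := by
    have := hg.mul_sub_eq_one
    push_cast at this ⊢
    linear_combination -this
  have h2 : g'.im * z.im ≤ 0 := hs ▸ hg'.sign
  have h3 := one_le_mul_norm_sub (s := g + g') hz hA (sq_nonneg σ) (by
    rw [Complex.add_im, add_mul]; linarith [hg.sign])
  rw [h1, norm_mul]
  calc ‖g‖ = ‖g‖ * 1 := (mul_one _).symm
    _ ≤ ‖g‖ * (A * ‖z - (σ ^ 2 : ℝ) * (g + g')‖) := by gcongr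
    _ = _ := by ring

end SelfCons

end Deterministic

/-- The limit of `pairing` for orthonormal vectors. -/
def pairLim (σ : ℝ) (g g' : ℂ) : ℂ := g * g' / (1 - (σ : ℂ) ^ 2 * g * g')

lemma SelfCons.sub_eq {σ : ℝ} {z z' g g' : ℂ} (hg : SelfCons σ z g)
    (hg' : SelfCons σ z' g') (h : z ≠ z') : g - g' = (z' - z) * pairLim σ g g' := by
  have h1 := (hg.one_sub_ne_zero hg').resolve_right h
  rw [pairLim, mul_div_assoc', hg.sub_mul_mul hg', mul_div_cancel_right₀ _ h1]

/-- Continuity of the limiting pairing at the diagonal. -/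
lemma SelfCons.norm_pairLim_sub_le {σ A : ℝ} {z z' g g' : ℂ} (hg : SelfCons σ z g)
    (hg' : SelfCons σ z' g') (hz : 1 ≤ A * |z.im|) (hA : 1 ≤ A) (hσ : σ ^ 2 ≤ A)
    (hs : z'.im = z.im) (h : z ≠ z') :
    ‖pairLim σ g g - pairLim σ g g'‖ ≤ A ^ 4 * (‖z‖ + A ^ 2) * ‖z' - z‖ := by
  have h1 := (hg.one_sub_ne_zero hg').resolve_right h
  have n0 : 0 < ‖g‖ := norm_pos_iff.2 hg.ne_zero
  have d1 := hg.norm_le_mul_norm_one_sub hg hz (by linarith) rfl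
  have d2 := hg.norm_le_mul_norm_one_sub hg' hz (by linarith) hs
  have h2 : 1 - (σ : ℂ) ^ 2 * g * g ≠ 0 := fun h3 => by rw [h3, norm_zero, mul_zero] at d1; linarith
  have nA := hg'.norm_le (hs ▸ hz) (by linarith)
  have e1 : pairLim σ g g - pairLim σ g g' = g * (g - g') /
      ((1 - (σ : ℂ) ^ 2 * g * g) * (1 - (σ : ℂ) ^ 2 * g * g')) := by
    rw [pairLim, pairLim, div_sub_div _ _ h2 h1]
    congr 1
    ring
  rw [e1, hg.sub_eq hg' h, pairLim]
  have e2 : ∀ a b x y d : ℂ, a ≠ 0 → b ≠ 0 → g * (d * (x * y / b)) / (a * b) =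
    d * y * (g * x) / (a * b ^ 2) := fun a b x y d ha hb => by field_simp
  rw [e2 _ _ _ _ _ h2 h1, norm_div, norm_mul, norm_mul, norm_mul, norm_mul, norm_pow]
  have hgi : 1 ≤ ‖g‖ * (‖z‖ + A ^ 2) := by
    have := congrArg norm hg.mul_sub_eq_one
    rw [norm_mul, norm_one] at this
    rw [← this]
    have h3 := hg.norm_le hz (by linarith)
    gcongr
    refine (norm_sub_le _ _).trans ?_
    rw [norm_mul, norm_real, norm_of_nonneg (sq_nonneg σ), pow_two A]
    gcongr
  set a := ‖1 - (σ : ℂ) ^ 2 * g * g‖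
  set b := ‖1 - (σ : ℂ) ^ 2 * g * g'‖
  have ha : 0 < a := norm_pos_iff.2 h2
  have hb : 0 < b := norm_pos_iff.2 h1
  rw [div_le_iff₀ (by positivity)]
  have hz0 := norm_nonneg z
  have hd := norm_nonneg (z' - z)
  calc ‖z' - z‖ * ‖g'‖ * (‖g‖ * ‖g‖) ≤ ‖z' - z‖ * A * (‖g‖ * ‖g‖ * (‖g‖ * (‖z‖ + A ^ 2))) := by
        have := mul_le_mul_of_nonneg_left hgi (show 0 ≤ ‖g‖ * ‖g‖ by positivity)
        rw [mul_one] at this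
        gcongr
    _ ≤ ‖z' - z‖ * A * ((A * a) * (A * b) * ((A * b) * (‖z‖ + A ^ 2))) := by gcongr
    _ = _ := by ring

/-- The rate of convergence of forms. -/
def formConst (A : ℝ) : ℝ := varConst A + 1 + 2 * A ^ 4 * lawConst A

lemma formConst_nonneg {A : ℝ} (hA : 1 ≤ A) : 0 ≤ formConst A := by
  have := varConst_nonneg hA
  have := lawConst_nonneg hA
  unfold formConst; positivity

/-- The rate of convergence of pairings. -/
def pairConst (A : ℝ) (z z' : ℂ) : ℝ :=
  2 * formConst A + A ^ 3 + A ^ 4 * (‖z‖ + A ^ 2) + 2 * formConst A / ‖z' - z‖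

@[fun_prop]
lemma tame_pairing {z z' : ℂ} (hz : z.im ≠ 0) (hz' : z'.im ≠ 0) (u v : n → ℂ) :
    Tame (pairing z z' u v) :=
  Tame.sum fun j => (tame_res_mulVec (by simpa using hz) u j).star.mul (tame_res_mulVec hz' v j)

namespace Model

variable (M : Model P X h A σ ρ) {z z' g g' : ℂ} {u v : n → ℂ}
include M

lemma le_sqrt : h ≤ √h := by
  have h1 : √h ≤ 1 := Real.sqrt_le_one.2 M.h_le
  have h2 := Real.mul_self_sqrt M.h_pos.le
  nlinarith [Real.sqrt_nonneg h]

lemma avg_norm_form_sub_lim_le (hz : 1 ≤ A * |z.im|) (hg : SelfCons σ z g) (hu : l2 u ≤ 1)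
    (hv : l2 v ≤ 1) :
    avg P X (fun Y => ‖form z u v Y - g * ∑ i, conj (u i) * v i‖) ≤ formConst A * h := by
  have h1 := M.avg_norm_form_sub_le hz one_pos hu hv
  have h2 := M.norm_avg_form_sub_le hz hg hu hv
  have hz0 := im_ne_of hz
  set a := avg P X (form z u v)
  set x := g * ∑ i, conj (u i) * v i
  have h3 := M.avg_mono (F := fun Y => ‖form z u v Y - x‖)
    (G := fun Y => ‖form z u v Y - a‖ + ‖a - x‖) (by fun_prop) (by fun_prop)
      fun Y _ => norm_sub_le_norm_sub_add_norm_sub _ _ _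
  rw [M.avg_add (by fun_prop) (by fun_prop), avg_const] at h3
  unfold formConst
  linarith

lemma avg_norm_pairing_sub_le_of_ne (hz : 1 ≤ A * |z.im|) (hz' : 1 ≤ A * |z'.im|)
    (hg : SelfCons σ z g) (hg' : SelfCons σ z' g') (hne : z ≠ z') (hu : l2 u ≤ 1)
    (hv : l2 v ≤ 1) :
    avg P X (fun Y => ‖pairing z z' u v Y - pairLim σ g g' * ∑ i, conj (u i) * v i‖) ≤
      2 * formConst A / ‖z' - z‖ * h := by
  have h0 := im_ne_of hz
  have h0' := im_ne_of hz'
  have h1 := M.avg_norm_form_sub_lim_le hz hg hu hv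
  have h2 := M.avg_norm_form_sub_lim_le hz' hg' hu hv
  set s := ∑ i, conj (u i) * v i
  have hd : 0 < ‖z' - z‖ := norm_pos_iff.2 (sub_ne_zero.2 hne.symm)
  calc _ ≤ avg P X (fun Y => ‖z' - z‖⁻¹ * (‖form z u v Y - g * s‖ + ‖form z' u v Y - g' * s‖)) := by
        refine M.avg_mono (by fun_prop) (by fun_prop) fun Y hY => ?_
        rw [inv_mul_eq_div, le_div_iff₀ hd, mul_comm, ← norm_mul]
        have e : (z' - z) * (pairing z z' u v Y - pairLim σ g g' * s) =
            (form z u v Y - g * s) - (form z' u v Y - g' * s) := by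
          linear_combination sub_mul_pairing hY h0 h0' (u := u) (v := v) + s * hg.sub_eq hg' hne
        rw [e]
        exact norm_sub_le _ _
    _ ≤ ‖z' - z‖⁻¹ * (formConst A * h + formConst A * h) := by
      rw [avg_mul_left, M.avg_add (by fun_prop) (by fun_prop)]
      gcongr
    _ = _ := by ring

/-- Convergence of pairings. -/
theorem avg_norm_pairing_sub_le {g : ℂ → ℂ} (hgs : ∀ z : ℂ, z.im ≠ 0 → SelfCons σ z (g z))
    (hz : 1 ≤ A * |z.im|) (hz' : 1 ≤ A * |z'.im|) (hu : l2 u ≤ 1) (hv : l2 v ≤ 1) :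
    avg P X (fun Y => ‖pairing z z' u v Y - pairLim σ (g z) (g z') * ∑ i, conj (u i) * v i‖) ≤
      pairConst A z z' * √h := by
  have hA := M.one_le
  have hh := M.h_pos
  have hF := formConst_nonneg hA
  have h0 := im_ne_of hz
  have h0' := im_ne_of hz'
  have hr : 0 < √h := Real.sqrt_pos.2 hh
  have hrh : √h * √h = h := Real.mul_self_sqrt hh.le
  have hle := M.le_sqrt
  rcases ne_or_eq z z' with hne | rfl
  · refine (M.avg_norm_pairing_sub_le_of_ne hz hz' (hgs z h0) (hgs z' h0') hne hu hv).trans ?_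
    have : 0 ≤ 2 * formConst A / ‖z' - z‖ := by positivity
    have : 0 ≤ 2 * formConst A + A ^ 3 + A ^ 4 * (‖z‖ + A ^ 2) := by positivity
    unfold pairConst
    exact mul_le_mul (by linarith) hle hh.le (by linarith)
  set z' : ℂ := z + (√h : ℝ) with hzd
  have him : z'.im = z.im := by simp [hzd]
  have hz1 : 1 ≤ A * |z'.im| := him ▸ hz
  have h1 := im_ne_of hz1
  have hsub : z' - z = (√h : ℝ) := by simp [hzd]
  have hn : ‖z' - z‖ = √h := by rw [hsub, norm_real, norm_of_nonneg hr.le]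
  have hne : z ≠ z' := fun e => by rw [← e, sub_self, norm_zero] at hn; linarith
  have a1 := M.avg_norm_pairing_sub_le_of_ne hz hz1 (hgs z h0) (hgs z' h1) hne hu hv
  have a2 := (hgs z h0).norm_pairLim_sub_le (hgs z' h1) hz hA M.sigma_le him hne
  set s := ∑ i, conj (u i) * v i with hs
  have hs1 : ‖s‖ ≤ 1 := (norm_sum_conj_mul_le _ _).trans (mul_le_one₀ hu (l2_nonneg _) hv)
  rw [hn] at a1 a2
  have h3 : avg P X (fun Y => ‖pairing z z u v Y - pairLim σ (g z) (g z) * s‖) ≤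
      avg P X (fun Y => ‖pairing z z' u v Y - pairLim σ (g z) (g z') * s‖ +
        (A ^ 3 * √h + A ^ 4 * (‖z‖ + A ^ 2) * √h)) := by
    have := tame_pairing h0 h0 u v
    have := tame_pairing h0 h1 u v
    refine M.avg_mono (by fun_prop) (by fun_prop) fun Y hY => ?_
    have b1 := norm_pairing_sub_le hY (by linarith) hz hz1 hu hv
    rw [hn] at b1
    have e : pairing z z u v Y - pairLim σ (g z) (g z) * s =
        (pairing z z' u v Y - pairLim σ (g z) (g z') * s) +
        (pairing z z u v Y - pairing z z' u v Y) -
        (pairLim σ (g z) (g z) - pairLim σ (g z) (g z')) * s := by ring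
    rw [e]
    refine (norm_sub_le _ _).trans ?_
    have b2 := norm_add_le (pairing z z' u v Y - pairLim σ (g z) (g z') * s)
      (pairing z z u v Y - pairing z z' u v Y)
    have b3 : ‖(pairLim σ (g z) (g z) - pairLim σ (g z) (g z')) * s‖ ≤
        A ^ 4 * (‖z‖ + A ^ 2) * √h := by
      rw [norm_mul]
      exact (mul_le_of_le_one_right (norm_nonneg _) hs1).trans a2
    linarith
  refine h3.trans ?_
  have := tame_pairing h0 h1 u v
  rw [M.avg_add (by fun_prop) (by fun_prop), avg_const]
  have e2 : 2 * formConst A / √h * h = 2 * formConst A * √h := by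
    rw [div_mul_eq_mul_div, div_eq_iff hr.ne']
    linear_combination (-2 * formConst A) * hrh
  rw [e2] at a1
  have e3 : pairConst A z z = 2 * formConst A + A ^ 3 + A ^ 4 * (‖z‖ + A ^ 2) := by simp [pairConst]
  rw [e3]
  linarith

end Model

variable {g : ℂ → ℂ}

lemma l2_conj (u : n → ℂ) : l2 (fun i => conj (u i)) = l2 u := by
  refine (pow_left_inj₀ (l2_nonneg _) (l2_nonneg _) two_ne_zero).1 ?_
  simp [l2_sq]

/-- The limiting covariance of the fluctuations of two forms of a test family. -/
def covLim (σ ρ : ℝ) (g : ℂ → ℂ) (T : Family n β) (b b' : β) : ℂ :=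
  (σ : ℂ) ^ 2 * g (T.z b) * g (T.z b') * pairLim σ (g (T.z b')) (g (T.z b)) *
    ((∑ i, conj (T.u b i) * T.v b' i) * (∑ i, conj (T.u b' i) * T.v b i) +
      ρ * ((∑ i, conj (T.u b i) * conj (T.u b' i)) * ∑ i, T.v b' i * T.v b i))

lemma sum_termOsc_cross_eq (κ : ℝ) (b : β) (Y : 𝕄) :
    ∑ i, ∑ j, conj (T.u b i) * T.termOsc c κ b j i j Y = ∑ b', c b' *
      (form (T.z b') (T.u b) (T.v b') Y * pairing (T.z b') (T.z b) (T.u b') (T.v b) Y *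
        T.osc κ c Y) := by
  simp only [termOsc, cross, form, pairing, left, right, sum_mul_sum, sum_mul, mul_sum]
  rw [sum_comm]
  simp only [sum_comm (s := (univ : Finset n)) (t := (univ : Finset β))]
  refine sum_congr rfl fun b' _ => ?_
  exact sum_congr rfl fun i _ => sum_congr rfl fun j _ => by ring

lemma sum_termOsc_self_eq (κ : ℝ) (b : β) {Y : 𝕄} (hY : Y.IsHermitian) (hs : Yᵀ = Y) :
    ∑ i, ∑ j, conj (T.u b i) * T.termOsc c κ b i j j Y = ∑ b', c b' *
      (form (T.z b') (T.u b) (fun k => conj (T.u b' k)) Y *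
        pairing (T.z b') (T.z b) (fun k => conj (T.v b' k)) (T.v b) Y * T.osc κ c Y) := by
  have h1 : ∀ b' i, conj (T.left b' Y i) = (res (T.z b') Y *ᵥ fun k => conj (T.u b' k)) i :=
    fun b' i => conj_resolvent_mulVec hY hs _ _ i
  have h2 : ∀ b' j, conj ((res (conj (T.z b')) Y *ᵥ fun k => conj (T.v b' k)) j) =
      T.right b' Y j := fun b' j => by
    rw [conj_resolvent_mulVec hY hs]
    simp only [Complex.conj_conj]
    rfl
  simp only [termOsc, cross, form, pairing, h1, h2]
  simp only [right, sum_mul_sum, sum_mul, mul_sum]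
  simp only [sum_comm (s := (univ : Finset n)) (t := (univ : Finset β))]
  refine sum_congr rfl fun b' _ => ?_
  rw [sum_comm]
  exact sum_congr rfl fun i _ => sum_congr rfl fun j _ => by ring

namespace Model

variable (M : Model P X h A σ ρ)
include M

/-- The expectation of a product of a form, a pairing and a bounded factor. -/
lemma norm_avg_form_mul_pairing_sub_le
    (hgs : ∀ z : ℂ, z.im ≠ 0 → SelfCons σ z (g z)) {z z' : ℂ} (hz : 1 ≤ A * |z.im|)
    (hz' : 1 ≤ A * |z'.im|) {u v u' v' : n → ℂ} (hu : l2 u ≤ 1) (hv : l2 v ≤ 1) (hu' : l2 u' ≤ 1)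
    (hv' : l2 v' ≤ 1) {e : 𝕄 → ℂ} (he : Tame e)
    (he1 : ∀ Y : 𝕄, Y.IsHermitian → ‖e Y‖ ≤ 1) {D : ℝ} (hD : pairConst A z z' ≤ D) :
    ‖avg P X (fun Y => form z u v Y * pairing z z' u' v' Y * e Y) -
      g z * pairLim σ (g z) (g z') * ((∑ i, conj (u i) * v i) * ∑ i, conj (u' i) * v' i) *
        avg P X e‖ ≤ (A ^ 2 * formConst A + A * D) * √h := by
  have hA := M.one_le
  have hh := M.h_pos
  have hF := formConst_nonneg hA
  have h0 := im_ne_of hz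
  have h0' := im_ne_of hz'
  have hle := M.le_sqrt
  have a1 := M.avg_norm_form_sub_lim_le hz (hgs z h0) hu hv
  have a2 := M.avg_norm_pairing_sub_le hgs hz hz' hu' hv'
  have hs : ‖∑ i, conj (u i) * v i‖ ≤ 1 :=
    (norm_sum_conj_mul_le _ _).trans (mul_le_one₀ hu (l2_nonneg _) hv)
  have hg := (hgs z h0).norm_le hz (by linarith)
  set x := g z * ∑ i, conj (u i) * v i with hx
  set y := pairLim σ (g z) (g z') * ∑ i, conj (u' i) * v' i with hy
  have hx1 : ‖x‖ ≤ A := by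
    rw [hx, norm_mul]; exact (mul_le_of_le_one_right (norm_nonneg _) hs).trans hg
  have tp := tame_pairing h0 h0' u' v'
  have e1 : avg P X (fun Y => form z u v Y * pairing z z' u' v' Y * e Y) -
      g z * pairLim σ (g z) (g z') * ((∑ i, conj (u i) * v i) * ∑ i, conj (u' i) * v' i) *
        avg P X e = avg P X (fun Y => (form z u v Y * pairing z z' u' v' Y - x * y) * e Y) := by
    simp (disch := fun_prop) only [sub_mul, M.avg_sub, avg_mul_left]
    rw [hx, hy]
    ring
  rw [e1]
  have hA0 : 0 ≤ A * √h := by positivity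
  calc _ ≤ avg P X (fun Y => A ^ 2 * ‖form z u v Y - x‖ + A * ‖pairing z z' u' v' Y - y‖) := by
        refine M.norm_avg_le_avg (by fun_prop) (by fun_prop) fun Y hY => ?_
        have e2 : form z u v Y * pairing z z' u' v' Y - x * y = pairing z z' u' v' Y *
          (form z u v Y - x) + x * (pairing z z' u' v' Y - y) := by ring
        rw [norm_mul, e2]
        refine (mul_le_of_le_one_right (norm_nonneg _) (he1 Y hY)).trans
          ((norm_add_le _ _).trans ?_)
        rw [norm_mul, norm_mul]
        have := norm_pairing_le hY (by linarith) hz hz' hu' hv'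
        gcongr
    _ = A ^ 2 * avg P X (fun Y => ‖form z u v Y - x‖) +
        A * avg P X (fun Y => ‖pairing z z' u' v' Y - y‖) := by
      simp (disch := fun_prop) only [M.avg_add, avg_mul_left]
    _ ≤ A ^ 2 * (formConst A * √h) + A * (D * √h) := by
      gcongr
      · exact a1.trans (by gcongr)
      · exact a2.trans (by gcongr)
    _ = _ := by ring

/-- The limit of the terms containing the derivative of the oscillating factor. -/
lemma norm_avg_sum_sub_le (hgs : ∀ z : ℂ, z.im ≠ 0 → SelfCons σ z (g z))
    (hT : T.Good c A) (b : β) {D : ℝ} (hD : ∀ b b', pairConst A (T.z b') (T.z b) ≤ D)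
    {u u' v' : β → n → ℂ} {v : n → ℂ} (hu : ∀ b, l2 (u b) ≤ 1) (hu' : ∀ b, l2 (u' b) ≤ 1)
    (hv' : ∀ b, l2 (v' b) ≤ 1) (hv : l2 v ≤ 1) :
    ‖avg P X (fun Y => ∑ b', c b' * (form (T.z b') (u b') (v' b') Y *
        pairing (T.z b') (T.z b) (u' b') v Y * T.osc h⁻¹ c Y)) -
      (∑ b', c b' * (g (T.z b') * pairLim σ (g (T.z b')) (g (T.z b)) *
        ((∑ i, conj (u b' i) * v' b' i) * ∑ i, conj (u' b' i) * v i))) *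
        avg P X (T.osc h⁻¹ c)‖ ≤ A ^ 2 * ((A ^ 2 * formConst A + A * D) * √h) := by
  have hA := M.one_le
  have he : Tame (T.osc h⁻¹ c) := by fun_prop
  have he1 : ∀ Y : 𝕄, Y.IsHermitian → ‖T.osc h⁻¹ c Y‖ ≤ 1 := fun Y hY =>
    (norm_osc hY hT h⁻¹).le
  have hz := hT.im_ne
  have e1 : avg P X (fun Y => ∑ b', c b' * (form (T.z b') (u b') (v' b') Y *
        pairing (T.z b') (T.z b) (u' b') v Y * T.osc h⁻¹ c Y)) = ∑ b', c b' *
        avg P X (fun Y => form (T.z b') (u b') (v' b') Y *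
        pairing (T.z b') (T.z b) (u' b') v Y * T.osc h⁻¹ c Y) := by
    have := fun b' => tame_pairing (hz b') (hz b) (u' b') v
    have := fun b' => tame_form (hz b') (u b') (v' b')
    simp (disch := fun_prop) only [M.avg_sum, avg_mul_left]
  rw [e1, sum_mul, ← sum_sub_distrib]
  have h1 := fun b' => M.norm_avg_form_mul_pairing_sub_le hgs (hT.im b') (hT.im b) (hu b') (hv' b')
    (hu' b') hv he he1 (hD b b')
  have h0 : 0 ≤ (A ^ 2 * formConst A + A * D) * √h := (norm_nonneg _).trans (h1 b)
  calc _ ≤ ∑ _b' : β, A * ((A ^ 2 * formConst A + A * D) * √h) := by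
        refine norm_sum_le_of_le _ fun b' _ => ?_
        rw [mul_assoc, ← mul_sub, norm_mul]
        gcongr
        exacts [hT.c_le b', h1 b']
    _ = card β * (A * ((A ^ 2 * formConst A + A * D) * √h)) := by simp
    _ ≤ A * (A * ((A ^ 2 * formConst A + A * D) * √h)) := by gcongr; exact hT.card_le
    _ = _ := by ring

end Model

/-- The constant in the central limit theorem. -/
def cltConst (A D : ℝ) : ℝ := A * covConst A + 2 * (A ^ 4 * (A ^ 2 * formConst A + A * D))

lemma covConst_nonneg {A : ℝ} (hA : 1 ≤ A) : 0 ≤ covConst A := by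
  have := expConst_nonneg hA
  have := varConst_nonneg hA
  have := lawConst_nonneg hA
  have := delocConst_nonneg hA
  unfold covConst; positivity

lemma cltConst_nonneg {A D : ℝ} (hA : 1 ≤ A) (hD : 0 ≤ D) : 0 ≤ cltConst A D := by
  have := covConst_nonneg hA
  have := formConst_nonneg hA
  unfold cltConst; positivity

namespace Model

variable (M : Model P X h A σ ρ)
include M

/-- The covariance of a form and the oscillating factor in the limit. -/
theorem norm_cov_sub_le (hgs : ∀ z : ℂ, z.im ≠ 0 → SelfCons σ z (g z))
    (hρ : ρ = 0 ∨ ∀ w, (X w)ᵀ = X w) (hT : T.Good c A) (b : β) {D : ℝ}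
    (hD0 : 0 ≤ D) (hD : ∀ b b', pairConst A (T.z b') (T.z b) ≤ D) {η : ℝ} (hη : 0 ≤ η)
    (huη : ∀ b i, ‖T.u b i‖ ≤ η) (hvη : ∀ b i, ‖T.v b i‖ ≤ η) :
    ‖cov P X (T.osc h⁻¹ c) (T.formAt b) - I * h * (∑ b', c b' * covLim σ ρ g T b b') *
      avg P X (T.osc h⁻¹ c)‖ ≤ cltConst A D * (h * (√h + η)) := by
  have hA := M.one_le
  have hh := M.h_pos
  have hσ := M.sigma_le
  have hle := M.le_sqrt
  have a := M.norm_cov_identity_le hT b (g := fun b => g (T.z b)) (fun b => hgs _ (hT.im_ne b))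
    hη huη hvη
  have p1 := M.norm_avg_sum_sub_le hgs hT b hD (u := fun _ => T.u b) (v' := T.v) (u' := T.u)
    (v := T.v b) (fun _ => hT.u_le b) hT.u_le hT.v_le (hT.v_le b)
  set ε := A ^ 2 * ((A ^ 2 * formConst A + A * D) * √h) with hε
  have p2 : ‖ρ * avg P X (fun Y => ∑ i, ∑ j, conj (T.u b i) * T.termOsc c h⁻¹ b i j j Y) -
      ρ * ((∑ b', c b' * (g (T.z b') * pairLim σ (g (T.z b')) (g (T.z b)) *
        ((∑ i, conj (T.u b i) * conj (T.u b' i)) * ∑ i, T.v b' i * T.v b i))) *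
        avg P X (T.osc h⁻¹ c))‖ ≤ ε := by
    rcases hρ with hρ | hs
    · rw [hρ]
      simpa using (norm_nonneg _).trans p1
    · have := M.norm_avg_sum_sub_le hgs hT b hD (u := fun _ => T.u b)
        (v' := fun b' k => conj (T.u b' k)) (u' := fun b' k => conj (T.v b' k))
        (v := T.v b) (fun _ => hT.u_le b) (fun b' => (l2_conj _).trans_le (hT.v_le b'))
        (fun b' => (l2_conj _).trans_le (hT.u_le b')) (hT.v_le b)
      simp only [Complex.conj_conj] at this
      rw [avg, integral_congr_ae (ae_of_all _ fun w => sum_termOsc_self_eq h⁻¹ b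
        (M.isHermitian w) (hs w)), ← mul_sub, norm_mul, norm_real, Real.norm_eq_abs]
      exact (mul_le_of_le_one_left (norm_nonneg _) M.rho_le).trans this
  simp only [← sum_termOsc_cross_eq] at p1
  have hgb := (hgs _ (hT.im_ne b)).norm_le (hT.im b) (by linarith)
  have hg1 := (hgs _ (hT.im_ne b)).mul_sub_eq_one
  have e2 : ∑ b', c b' * covLim σ ρ g T b b' = g (T.z b) * (σ ^ 2 : ℝ) *
      (ρ * (∑ b', c b' * (g (T.z b') * pairLim σ (g (T.z b')) (g (T.z b)) *
        ((∑ i, conj (T.u b i) * conj (T.u b' i)) * ∑ i, T.v b' i * T.v b i))) +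
        ∑ b', c b' * (g (T.z b') * pairLim σ (g (T.z b')) (g (T.z b)) *
        ((∑ i, conj (T.u b i) * T.v b' i) * ∑ i, conj (T.u b' i) * T.v b i))) := by
    rw [mul_sum, ← sum_add_distrib, mul_sum]
    refine sum_congr rfl fun b' _ => ?_
    unfold covLim
    push_cast
    ring
  rw [e2]
  generalize avg P X (fun Y => ∑ i, ∑ j, conj (T.u b i) * T.termOsc c h⁻¹ b i j j Y) = B at *
  generalize avg P X (fun Y => ∑ i, ∑ j, conj (T.u b i) * T.termOsc c h⁻¹ b j i j Y) = B' at *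
  generalize (∑ b', c b' * (g (T.z b') * pairLim σ (g (T.z b')) (g (T.z b)) *
        ((∑ i, conj (T.u b i) * conj (T.u b' i)) * ∑ i, T.v b' i * T.v b i))) = s at *
  generalize (∑ b', c b' * (g (T.z b') * pairLim σ (g (T.z b')) (g (T.z b)) *
        ((∑ i, conj (T.u b i) * T.v b' i) * ∑ i, conj (T.u b' i) * T.v b i))) = s' at *
  generalize avg P X (T.osc h⁻¹ c) = a₀ at *
  generalize cov P X (T.osc h⁻¹ c) (T.formAt b) = k at *
  beta_reduce at a
  generalize g (T.z b) = γ at *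
  have key : k - I * h * (γ * (σ ^ 2 : ℝ) * (ρ * s + s')) * a₀ =
      γ * ((T.z b - (σ ^ 2 : ℝ) * γ) * k - I * h * (σ ^ 2 : ℝ) * (ρ * B + B')) +
      γ * (I * h * (σ ^ 2 : ℝ) * ((ρ * B - ρ * (s * a₀)) + (B' - s' * a₀))) := by
    linear_combination (-k) * hg1
  rw [key]
  refine (norm_add_le _ _).trans ?_
  rw [norm_mul, norm_mul γ, norm_mul, norm_mul, norm_mul, Complex.norm_I, one_mul, norm_real,
    norm_real, norm_of_nonneg hh.le, norm_of_nonneg (sq_nonneg σ)]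
  have f1 := (norm_add_le (ρ * B - ρ * (s * a₀)) (B' - s' * a₀)).trans (add_le_add p2 p1)
  have hcov := covConst_nonneg hA
  calc _ ≤ A * (covConst A * (h * (h + η))) + A * (h * A * (ε + ε)) := by
        have : 0 ≤ ε := (norm_nonneg _).trans p1
        gcongr
    _ ≤ A * (covConst A * (h * (√h + η))) + A * (h * A * (ε + ε)) := by gcongr
    _ = A * covConst A * (h * (√h + η)) +
        2 * (A ^ 4 * (A ^ 2 * formConst A + A * D)) * (h * √h) := by rw [hε]; ring
    _ ≤ A * covConst A * (h * (√h + η)) +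
        2 * (A ^ 4 * (A ^ 2 * formConst A + A * D)) * (h * (√h + η)) := by
      have := formConst_nonneg hA
      gcongr
      linarith
    _ = _ := by unfold cltConst; ring

end Model

lemma Family.lin_smul (t : ℝ) (Y : 𝕄) : T.lin (t • c) Y = t * T.lin c Y := by
  unfold lin
  rw [mul_sum]
  exact sum_congr rfl fun b _ => by rw [Pi.smul_apply, Complex.real_smul, mul_assoc]

lemma Family.Good.smul (hT : T.Good c A) {t : ℝ} (h0 : 0 ≤ t) (h1 : t ≤ 1) : T.Good (t • c) A where
  one_le := hT.one_le
  im := hT.im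
  u_le := hT.u_le
  v_le := hT.v_le
  card_le := hT.card_le
  c_le := fun b => by
    rw [Pi.smul_apply, norm_smul, norm_of_nonneg h0]
    exact (mul_le_of_le_one_left (norm_nonneg _) h1).trans (hT.c_le b)
  real := fun X hX => by rw [lin_smul, Complex.im_ofReal_mul, hT.real X hX, mul_zero]

/-- A characteristic function that nearly satisfies the differential equation of a Gaussian one
is nearly Gaussian. -/
lemma norm_sub_exp_le {φ φ' : ℝ → ℂ} {V : ℂ} {ε : ℝ} (h0 : φ 0 = 1)
    (hφ : ∀ t, HasDerivAt φ (φ' t) t)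
    (hε : ∀ t ∈ Set.Icc (0 : ℝ) 1, ‖φ' t + t * V * φ t‖ ≤ ε) :
    ‖φ 1 - exp (-V / 2)‖ ≤ ε * Real.exp ‖V‖ := by
  set ψ : ℝ → ℂ := fun t => φ t * exp ((t : ℂ) ^ 2 * V / 2) with hψ
  have hd : ∀ t : ℝ, HasDerivAt ψ ((φ' t + t * V * φ t) * exp ((t : ℂ) ^ 2 * V / 2)) t :=
      fun t => by
    have h1 : HasDerivAt (fun t : ℝ => ((t : ℂ) ^ 2 * V / 2)) (t * V) t := by
      have := (((hasDerivAt_id t).ofReal_comp.pow 2).mul_const V).div_const 2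
      refine this.congr_deriv ?_
      simp
      ring
    exact ((hφ t).mul h1.cexp).congr_deriv (by ring)
  have hε0 : 0 ≤ ε := (norm_nonneg _).trans (hε 0 (by simp))
  have hexp : ∀ s : ℂ, ‖s‖ ≤ ‖V‖ / 2 → ‖exp s‖ ≤ Real.exp (‖V‖ / 2) := fun s hs =>
    (Complex.norm_exp_le_exp_norm s).trans (Real.exp_le_exp.2 hs)
  have h1 := norm_image_sub_le_of_norm_deriv_le_segment_01' (f := ψ)
    (C := ε * Real.exp (‖V‖ / 2)) (fun t _ => (hd t).hasDerivWithinAt) fun t ht => by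
      rw [norm_mul]
      refine mul_le_mul (hε t (Set.Ico_subset_Icc_self ht)) (hexp _ ?_) (norm_nonneg _) hε0
      rw [norm_div, norm_mul, norm_pow, norm_real, norm_of_nonneg ht.1]
      simp only [Complex.norm_ofNat]
      gcongr
      exact mul_le_of_le_one_left (norm_nonneg _) (pow_le_one₀ ht.1 ht.2.le)
  have e1 : φ 1 - exp (-V / 2) = (ψ 1 - ψ 0) * exp (-V / 2) := by
    simp only [hψ, h0]
    rw [sub_mul, mul_assoc, ← Complex.exp_add]
    simp
    ring_nf
    simp
  rw [e1, norm_mul]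
  calc _ ≤ ε * Real.exp (‖V‖ / 2) * Real.exp (‖V‖ / 2) :=
        mul_le_mul h1 (hexp _ (by simp)) (norm_nonneg _) (by positivity)
    _ = _ := by rw [mul_assoc, ← Real.exp_add, add_halves]

namespace Model

variable (M : Model P X h A σ ρ)
include M

/-- The quantitative central limit theorem for linear combinations of forms. -/
theorem norm_charFun_sub_le (hgs : ∀ z : ℂ, z.im ≠ 0 → SelfCons σ z (g z))
    (hρ : ρ = 0 ∨ ∀ w, (X w)ᵀ = X w) (hT : T.Good c A) {D : ℝ}
    (hD0 : 0 ≤ D) (hD : ∀ b b', pairConst A (T.z b') (T.z b) ≤ D) {η : ℝ} (hη : 0 ≤ η)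
    (huη : ∀ b i, ‖T.u b i‖ ≤ η) (hvη : ∀ b i, ‖T.v b i‖ ≤ η) :
    ‖∫ w, exp (I * ((h⁻¹ : ℝ) * (T.lin c (X w) - avg P X (T.lin c)))) ∂P -
      exp (-(∑ b, ∑ b', c b * c b' * covLim σ ρ g T b b') / 2)‖ ≤
      A ^ 2 * cltConst A D * (√h + η) * Real.exp ‖∑ b, ∑ b', c b * c b' * covLim σ ρ g T b b'‖ := by
  have hA := M.one_le
  have hh := M.h_pos
  set V := ∑ b, ∑ b', c b * c b' * covLim σ ρ g T b b' with hV
  have tl : Tame (T.lin c) := tame_lin hT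
  set m := avg P X (T.lin c) with hm
  set ℓ : Ω → ℝ := fun w => (T.lin c (X w)).re - m.re with hℓ
  have him : m.im = 0 := by
    have : m.im = ∫ w, (T.lin c (X w)).im ∂P := (integral_im (M.integrable tl)).symm
    rw [this]
    simp [hT.real _ (M.isHermitian _)]
  have hℓc : ∀ w, ((ℓ w : ℝ) : ℂ) = T.lin c (X w) - m := fun w => by
    apply Complex.ext
    · simp [hℓ]
    · simp [him, hT.real _ (M.isHermitian w)]
  have hmeas : Measurable ℓ :=
    (Complex.measurable_re.comp (tl.1.comp M.measurable_matrix)).sub_const _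
  obtain ⟨C, hC⟩ := tl.2
  have hbd : ∀ w, |ℓ w| ≤ C + |m.re| := fun w =>
    (abs_sub _ _).trans (add_le_add ((Complex.abs_re_le_norm _).trans (hC _ (M.isHermitian w))) le_rfl)
  have hset : integrableExpSet ℓ P = Set.univ := by
    refine Set.eq_univ_of_forall fun t => ?_
    refine Integrable.of_bound (by fun_prop) (Real.exp (|t| * (C + |m.re|))) (ae_of_all _ fun w => ?_)
    rw [norm_of_nonneg (Real.exp_pos _).le]
    refine Real.exp_le_exp.2 ((le_abs_self _).trans ?_)
    rw [abs_mul]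
    exact mul_le_mul_of_nonneg_left (hbd w) (abs_nonneg _)
  set a : ℂ := I * (h⁻¹ : ℝ) with ha
  set φ : ℝ → ℂ := fun t => complexMGF ℓ P (t * a) with hφ
  set φ' : ℝ → ℂ := fun t => a * ∫ w, ℓ w * exp (t * a * ℓ w) ∂P with hφ'
  have hd : ∀ t, HasDerivAt φ (φ' t) t := fun t => by
    have h1 : HasDerivAt (fun t : ℝ => (t : ℂ) * a) a t := by
      simpa using (hasDerivAt_id t).ofReal_comp.mul_const a
    have h2 := hasDerivAt_complexMGF (X := ℓ) (μ := P) (z := t * a) (by rw [hset]; simp)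
    have h3 := HasDerivAt.scomp t h2 h1
    exact h3
  have e1 : ∀ t : ℝ, φ t = exp (-(t * a * m)) * avg P X (T.osc h⁻¹ (t • c)) := fun t => by
    simp only [hφ, complexMGF, avg]
    rw [← integral_const_mul]
    congr 1
    funext w
    rw [osc, lin_smul, ← Complex.exp_add, hℓc, ha]
    congr 1
    ring
  have e2 : ∀ t : ℝ, 0 ≤ t → t ≤ 1 → φ' t = a * (exp (-(t * a * m)) *
      cov P X (T.osc h⁻¹ (t • c)) (T.lin c)) := fun t h0 h1 => by
    have te : Tame (T.osc h⁻¹ (t • c)) := tame_osc (hT.smul h0 h1) h⁻¹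
    have e3 : cov P X (T.osc h⁻¹ (t • c)) (T.lin c) =
        avg P X fun Y => (T.lin c Y - m) * T.osc h⁻¹ (t • c) Y := by
      simp (disch := fun_prop) only [M.cov_eq te tl, sub_mul, M.avg_sub, avg_mul_left]
      rfl
    simp only [hφ']
    rw [e3, ← avg_mul_left, avg]
    congr 2
    funext w
    rw [osc, lin_smul, mul_left_comm (exp (-(t * a * m))), ← Complex.exp_add, hℓc, ha]
    congr 2
    ring
  have key := norm_sub_exp_le (φ := φ) (φ' := φ') (V := V)
    (ε := A ^ 2 * cltConst A D * (√h + η)) (by simp [hφ, complexMGF]) hd fun t ht => by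
    have hTt := hT.smul ht.1 ht.2
    have h1 := fun b => M.norm_cov_sub_le hgs hρ hTt b hD0 hD hη huη hvη
    have te : Tame (T.osc h⁻¹ (t • c)) := by fun_prop
    have e4 : cov P X (T.osc h⁻¹ (t • c)) (T.lin c) =
        ∑ b, c b * cov P X (T.osc h⁻¹ (t • c)) (T.formAt b) := by
      unfold lin
      have := M.tame_formAt hT
      simp (disch := fun_prop) only [M.cov_sum te, M.cov_const_mul]
    have e5 : φ' t + t * V * φ t = a * exp (-(t * a * m)) * ∑ b, c b *
        (cov P X (T.osc h⁻¹ (t • c)) (T.formAt b) - I * h *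
        (∑ b', (t • c) b' * covLim σ ρ g T b b') * avg P X (T.osc h⁻¹ (t • c))) := by
      rw [e1, e2 t ht.1 ht.2, e4]
      generalize avg P X (T.osc h⁻¹ (t • c)) = α
      generalize exp (-(t * a * m)) = ε
      simp only [mul_sub, sum_sub_distrib]
      have e6 : ∑ b, c b * (I * h * (∑ b', (t • c) b' * covLim σ ρ g T b b') * α) =
          I * h * t * V * α := by
        rw [hV]
        simp only [mul_sum, sum_mul, Pi.smul_apply, Complex.real_smul]
        exact sum_congr rfl fun b _ => sum_congr rfl fun b' _ => by ring
      have e7 : a * (I * h) = -1 := by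
        rw [ha]
        have : ((h⁻¹ : ℝ) : ℂ) * h = 1 := by rw [← Complex.ofReal_mul, inv_mul_cancel₀ hh.ne']; simp
        linear_combination (I ^ 2) * this + Complex.I_sq
      rw [e6]
      linear_combination (ε * t * V * α) * e7
    rw [e5, norm_mul, norm_mul]
    have n1 : ‖a‖ = h⁻¹ := by
      rw [ha, norm_mul, Complex.norm_I, one_mul, norm_real, norm_of_nonneg (by positivity)]
    have n2 : ‖exp (-(t * a * m))‖ = 1 := by
      rw [Complex.norm_exp, Real.exp_eq_one_iff]
      simp [ha, him]
    rw [n1, n2, mul_one]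
    have n3 : ‖∑ b, c b * (cov P X (T.osc h⁻¹ (t • c)) (T.formAt b) - I * h *
        (∑ b', (t • c) b' * covLim σ ρ g T b b') * avg P X (T.osc h⁻¹ (t • c)))‖ ≤
        A ^ 2 * (cltConst A D * (h * (√h + η))) := by
      have := cltConst_nonneg hA hD0
      calc _ ≤ ∑ _b : β, A * (cltConst A D * (h * (√h + η))) := by
            refine norm_sum_le_of_le _ fun b _ => ?_
            rw [norm_mul]
            gcongr
            exacts [hT.c_le b, h1 b]
        _ = card β * (A * (cltConst A D * (h * (√h + η)))) := by simp
        _ ≤ A * (A * (cltConst A D * (h * (√h + η)))) := by gcongr; exact hT.card_le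
        _ = _ := by ring
    calc _ ≤ h⁻¹ * (A ^ 2 * (cltConst A D * (h * (√h + η)))) := by gcongr
      _ = _ := by field_simp
  refine le_trans (le_of_eq ?_) key
  congr 2
  simp only [hφ, complexMGF]
  congr 1
  funext w
  rw [hℓc, ha]
  congr 1
  push_cast
  ring

end Model

section Stieltjes

variable {σ : ℝ} {z q : ℂ}

/-- Points off the real line in the coordinates of the Joukowsky map. -/
lemma exists_joukowsky (hσ : 0 < σ) (hz : z.im ≠ 0) :
    ∃ q : ℂ, q ≠ 0 ∧ ‖q‖ < 1 ∧ z * q = σ * (1 + q ^ 2) := by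
  have hσ0 : (σ : ℂ) ≠ 0 := by exact_mod_cast hσ.ne'
  obtain ⟨s, hs⟩ := IsAlgClosed.exists_pow_nat_eq ((z / σ) ^ 2 - 4) two_pos
  set q : ℂ := (z / σ + s) / 2 with hq
  have e1 : q * (z / σ - q) = 1 := by rw [hq]; linear_combination (-1 / 4 : ℂ) * hs
  have hq0 : q ≠ 0 := left_ne_zero_of_mul_eq_one e1
  have e2 : z * q = σ * (1 + q ^ 2) := by
    have : z = σ * (z / σ) := by field_simp
    rw [this]
    linear_combination σ * e1
  have hinv : q⁻¹ = z / σ - q := inv_eq_of_mul_eq_one_right e1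
  rcases lt_trichotomy ‖q‖ 1 with h | h | h
  · exact ⟨q, hq0, h, e2⟩
  · refine absurd ?_ hz
    have h1 : q⁻¹ = conj q := by rw [Complex.inv_def, Complex.normSq_eq_norm_sq, h]; simp
    have h2 : z = σ * (q + conj q) := by rw [← h1, hinv]; field_simp; ring
    rw [h2, Complex.im_ofReal_mul]
    simp
  · refine ⟨q⁻¹, inv_ne_zero hq0, by rw [norm_inv]; exact inv_lt_one_of_one_lt₀ h, ?_⟩
    field_simp
    linear_combination e2

open Real in
lemma stieltjes_eq (hσ : 0 < σ) (hz : z.im ≠ 0) (hq0 : q ≠ 0) (hq1 : ‖q‖ < 1)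
    (hq : z * q = σ * (1 + q ^ 2)) : stieltjes σ z = q / σ := by
  have hσ0 : (σ : ℂ) ≠ 0 := by exact_mod_cast hσ.ne'
  have hπ : (π : ℂ) ≠ 0 := by exact_mod_cast pi_ne_zero
  have hne : ∀ x : ℝ, z - x ≠ 0 := fun x h => hz (by simpa using congrArg Complex.im h)
  set K : ℝ → ℂ := fun θ => (z - (2 * σ * cos θ : ℝ))⁻¹ with hK
  have hKc : Continuous K := (by fun_prop : Continuous fun θ : ℝ =>
    z - ((2 * σ * cos θ : ℝ) : ℂ)).inv₀ fun θ => hne _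
  set f : ℝ → ℂ := fun θ => (1 - exp (2 * θ * I)) / 2 * K θ with hf
  have hfc : Continuous f := by fun_prop
  have h1 : stieltjes σ z = 2 / π * ∫ θ in (0 : ℝ)..π, ((sin θ ^ 2 : ℝ) : ℂ) * K θ := by
    have e1 : stieltjes σ z =
        ∫ x in (-(2 * σ))..(2 * σ), (semicircleDensity σ x : ℂ) / (z - x) := by
      rw [intervalIntegral.integral_of_le (by linarith), stieltjes, integral_Icc_eq_integral_Ioc]
    have e2 := intervalIntegral.integral_comp_smul_deriv (a := π) (b := 0)
      (f := fun θ => 2 * σ * cos θ) (f' := fun θ => 2 * σ * (-sin θ))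
      (g := fun x : ℝ => (semicircleDensity σ x : ℂ) / (z - x))
      (fun θ _ => (hasDerivAt_cos θ).const_mul (2 * σ)) (by fun_prop)
      (by unfold semicircleDensity; exact Continuous.div (by fun_prop) (by fun_prop) hne)
    simp only [cos_pi, cos_zero, mul_neg, mul_one] at e2
    rw [e1, ← e2, intervalIntegral.integral_symm, ← intervalIntegral.integral_neg,
      ← intervalIntegral.integral_const_mul]
    refine intervalIntegral.integral_congr fun θ hθ => ?_
    rw [Set.uIcc_of_le pi_nonneg] at hθ
    have hs := sin_nonneg_of_mem_Icc hθ
    have e3 : semicircleDensity σ (2 * σ * cos θ) = sin θ / (π * σ) := by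
      have : 4 * σ ^ 2 - (2 * σ * cos θ) ^ 2 = (2 * σ * sin θ) ^ 2 := by
        linear_combination (4 * σ ^ 2) * (sin_sq_add_cos_sq θ).symm
      rw [semicircleDensity, this, sqrt_sq (by positivity)]
      field_simp
    simp only [Function.comp, e3, hK, Complex.real_smul]
    push_cast
    field_simp
  have h2 : ∫ θ in (0 : ℝ)..(2 * π), f θ = 2 * ∫ θ in (0 : ℝ)..π, ((sin θ ^ 2 : ℝ) : ℂ) * K θ := by
    have hp : Function.Periodic f (2 * π) := fun θ => by
      simp only [hf, hK, cos_add_two_pi]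
      congr 3
      push_cast
      rw [show (2 * (θ + 2 * π) * I : ℂ) = 2 * θ * I + 2 * π * I +
        2 * π * I by ring, Complex.exp_periodic, Complex.exp_periodic]
    have e1 := hp.intervalIntegral_add_eq (-π) 0
    rw [zero_add, show -π + 2 * π = π by ring] at e1
    have e2 : ∫ θ in (-π)..0, f θ = ∫ θ in (0 : ℝ)..π, f (-θ) := by
      rw [intervalIntegral.integral_comp_neg]; simp
    have hfn : Continuous fun θ => f (-θ) := hfc.comp continuous_neg
    rw [← e1, ← intervalIntegral.integral_add_adjacent_intervals (hfc.intervalIntegrable _ _)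
      (hfc.intervalIntegrable _ _), e2, ← intervalIntegral.integral_add
      (hfn.intervalIntegrable _ _) (hfc.intervalIntegrable _ _),
      ← intervalIntegral.integral_const_mul]
    refine intervalIntegral.integral_congr fun θ _ => ?_
    have e3 : exp (2 * θ * I) + exp (2 * (-θ : ℝ) * I) = 2 - 4 * (sin θ : ℂ) ^ 2 := by
      have := Complex.two_cos (2 * θ)
      rw [Complex.cos_two_mul] at this
      push_cast
      rw [show (2 * -θ * I : ℂ) = -(2 * θ) * I by ring, ← this]
      linear_combination 4 * Complex.sin_sq_add_cos_sq (θ : ℂ)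
    simp only [hf, hK, cos_neg]
    push_cast at e3 ⊢
    linear_combination (-(z - 2 * σ * Complex.cos θ)⁻¹ / 2) * e3
  have h3 : ∫ θ in (0 : ℝ)..(2 * π), f θ = 2 * π * (q / (2 * σ)) := by
    have hn : ∀ ζ : ℂ, ‖ζ‖ ≤ 1 → 1 - q * ζ ≠ 0 := fun ζ hζ h => by
      have e1 : ‖q * ζ‖ = 1 := by rw [← sub_eq_zero.1 h, norm_one]
      rw [norm_mul] at e1
      nlinarith [norm_nonneg q, norm_nonneg ζ]
    set F : ℂ → ℂ := fun ζ => (1 - ζ ^ 2) * q / (2 * σ * (1 - q * ζ)) with hF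
    have hd : DiffContOnCl ℂ F (Metric.ball 0 |1|) := by
      refine DifferentiableOn.diffContOnCl fun ζ hζ => DifferentiableAt.differentiableWithinAt ?_
      have h4 : ‖ζ‖ ≤ 1 := by
        have := Metric.closure_ball_subset_closedBall hζ
        simpa using this
      refine DifferentiableAt.div (by fun_prop) (by fun_prop) ?_
      exact mul_ne_zero (mul_ne_zero two_ne_zero hσ0) (hn ζ h4)
    have e1 := hd.circleAverage_smul_div (w := q) (by simpa using hq1)
    rw [Real.circleAverage_def] at e1
    have e2 : F q = q / (2 * σ) := by
      have := hn q hq1.le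
      simp only [hF]
      rw [div_eq_div_iff (mul_ne_zero (mul_ne_zero two_ne_zero hσ0) this)
        (mul_ne_zero two_ne_zero hσ0)]
      ring
    rw [e2] at e1
    rw [← e1, Complex.real_smul]
    push_cast
    rw [← mul_assoc, mul_inv_cancel₀ (mul_ne_zero two_ne_zero hπ), one_mul]
    refine intervalIntegral.integral_congr fun θ _ => ?_
    have hζ : ‖circleMap 0 1 θ‖ = 1 := by simp
    have e4 : exp (2 * θ * I) = circleMap 0 1 θ ^ 2 := by
      simp [circleMap, ← Complex.exp_nat_mul]
      ring_nf
    have e5 : 2 * (cos θ : ℂ) * circleMap 0 1 θ = circleMap 0 1 θ ^ 2 + 1 := by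
      have : circleMap 0 1 θ = exp (θ * I) := by simp [circleMap]
      rw [this, Complex.ofReal_cos, Complex.two_cos, add_mul, ← Complex.exp_add, ← Complex.exp_add]
      simp [pow_two, ← Complex.exp_add]
    simp only [hf, hK, hF, e4, sub_zero, smul_eq_mul]
    set ζ := circleMap 0 1 θ
    have hζ0 : ζ ≠ 0 := norm_ne_zero_iff.1 (by rw [hζ]; exact one_ne_zero)
    have n1 := hn ζ hζ.le
    have n2 : ζ - q ≠ 0 := fun h => by rw [← sub_eq_zero.1 h, hζ] at hq1; exact lt_irrefl _ hq1
    have n3 := hne (2 * σ * cos θ)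
    have e6 : (z - (2 * σ * cos θ : ℝ)) * (q * ζ) = σ * ((1 - q * ζ) * (ζ - q)) := by
      push_cast at e5 ⊢
      linear_combination ζ * hq - (σ * q) * e5
    rw [← div_eq_mul_inv, div_div, div_mul_div_comm, div_eq_div_iff (mul_ne_zero two_ne_zero n3)
      (mul_ne_zero n2 (mul_ne_zero (mul_ne_zero two_ne_zero hσ0) n1))]
    linear_combination (-2 * (1 - ζ ^ 2)) * e6
  rw [h1]
  rw [h3] at h2
  have h4 : ∫ θ in (0 : ℝ)..π, ((sin θ ^ 2 : ℝ) : ℂ) * K θ = π * (q / (2 * σ)) := by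
    linear_combination (-1 / 2 : ℂ) * h2
  rw [h4]
  field_simp

theorem stieltjes_selfConsistent (hσ : 0 < σ) (hz : z.im ≠ 0) : SelfCons σ z (stieltjes σ z) := by
  obtain ⟨q, hq0, hq1, hq⟩ := exists_joukowsky hσ hz
  have hσ0 : (σ : ℂ) ≠ 0 := by exact_mod_cast hσ.ne'
  rw [stieltjes_eq hσ hz hq0 hq1 hq]
  refine ⟨by field_simp; linear_combination hq, ?_⟩
  have h1 : z = σ * (q⁻¹ + q) := by field_simp; linear_combination hq
  have hn : 0 < Complex.normSq q := Complex.normSq_pos.2 hq0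
  have h2 : Complex.normSq q < 1 := by
    rw [Complex.normSq_eq_norm_sq]; exact pow_lt_one₀ (norm_nonneg _) hq1 two_ne_zero
  rw [h1, Complex.im_ofReal_mul, Complex.add_im, Complex.inv_im, Complex.div_ofReal_im]
  have e : q.im / σ * (σ * (-q.im / Complex.normSq q + q.im)) =
      q.im ^ 2 * ((Complex.normSq q - 1) / Complex.normSq q) := by field_simp; ring
  rw [e]
  exact mul_nonpos_of_nonneg_of_nonpos (sq_nonneg _)
    (div_nonpos_of_nonpos_of_nonneg (by linarith) hn.le)

lemma norm_mul_stieltjes_lt (hσ : 0 < σ) (hz : z.im ≠ 0) : ‖(σ : ℂ) * stieltjes σ z‖ < 1 := by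
  obtain ⟨q, hq0, hq1, hq⟩ := exists_joukowsky hσ hz
  have hσ0 : (σ : ℂ) ≠ 0 := by exact_mod_cast hσ.ne'
  rwa [stieltjes_eq hσ hz hq0 hq1 hq, mul_div_cancel₀ _ hσ0]

lemma stieltjes_conj (σ : ℝ) (z : ℂ) : stieltjes σ (conj z) = conj (stieltjes σ z) := by
  unfold stieltjes
  rw [← integral_conj]
  simp

end Stieltjes

section EfronSteinInequality

variable {Ω : Type*} [MeasurableSpace Ω] {P : Measure Ω} [IsProbabilityMeasure P]

/-- The bias-variance decomposition. -/
lemma integral_norm_sub_sq {f : Ω → ℂ} (hf : Measurable f) {C : ℝ} (hC : ∀ w, ‖f w‖ ≤ C) (c : ℂ) :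
    ∫ w, ‖f w - c‖ ^ 2 ∂P = ∫ w, ‖f w - ∫ w', f w' ∂P‖ ^ 2 ∂P + ‖∫ w, f w ∂P - c‖ ^ 2 := by
  have hi : Integrable f P := .of_bound hf.aestronglyMeasurable C (ae_of_all _ hC)
  set m := ∫ w, f w ∂P with hm
  have h2 : Integrable (fun w => ‖f w - m‖ ^ 2) P :=
    .of_bound (by fun_prop) ((C + ‖m‖) ^ 2) (ae_of_all _ fun w => by
      rw [norm_of_nonneg (by positivity)]
      exact pow_le_pow_left₀ (norm_nonneg _) ((norm_sub_le _ _).trans (add_le_add (hC w) le_rfl)) 2)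
  have h3 : Integrable (fun w => (f w - m) * conj (m - c)) P :=
    (hi.sub (integrable_const _)).mul_const _
  have h4 : ∫ w, ((f w - m) * conj (m - c)).re ∂P = 0 := by
    have : ∫ w, (f w - m) * conj (m - c) ∂P = 0 := by
      rw [integral_mul_const, integral_sub hi (integrable_const _)]
      simp [← hm]
    have h5 := integral_re h3
    rw [this] at h5
    exact h5.trans (by simp)
  have e : ∀ w, ‖f w - c‖ ^ 2 = ‖f w - m‖ ^ 2 + ‖m - c‖ ^ 2 + 2 * ((f w - m) * conj (m - c)).re :=
      fun w => by
    rw [← Complex.normSq_eq_norm_sq, ← Complex.normSq_eq_norm_sq, ← Complex.normSq_eq_norm_sq,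
      ← Complex.normSq_add, sub_add_sub_cancel]
  have h6 : Integrable (fun w => ‖f w - m‖ ^ 2 + ‖m - c‖ ^ 2) P := h2.add (integrable_const _)
  simp only [e]
  have h7 : Integrable (fun w => 2 * ((f w - m) * conj (m - c)).re) P := h3.re.const_mul 2
  rw [integral_add h6 h7, integral_add h2 (integrable_const _), integral_const_mul, h4]
  simp

lemma efronStein_pi : ∀ (k : ℕ) (μ : Fin k → Measure ℂ) [∀ i, IsProbabilityMeasure (μ i)]
    {G : (Fin k → ℂ) → ℂ} (hG : Measurable G) {C : ℝ} (hC : ∀ x, ‖G x‖ ≤ C),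
    ∫ x, ‖G x - ∫ y, G y ∂Measure.pi μ‖ ^ 2 ∂Measure.pi μ ≤
      ∑ p, ∫ x, ‖G x - G (update x p 0)‖ ^ 2 ∂Measure.pi μ := by
  intro k
  induction k with
  | zero =>
    intro μ _ G hG C hC
    have : ∀ x, G x - ∫ y, G y ∂Measure.pi μ = 0 := fun x => by
      simp [show ∀ y, G y = G x from fun y => by rw [Subsingleton.elim y x]]
    simp [this]
  | succ k ih =>
    intro μ _ G hG C hC
    set ν := Measure.pi fun j : Fin k => μ j.succ with hν
    have hp : MeasurePreserving (fun x : Fin (k + 1) → ℂ => (x 0, fun j : Fin k => x j.succ))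
        (Measure.pi μ) ((μ 0).prod ν) := measurePreserving_piFinSuccAbove μ 0
    have hcons : Measurable fun p : ℂ × (Fin k → ℂ) => (Fin.cons p.1 p.2 : Fin (k + 1) → ℂ) :=
      measurable_pi_lambda _ fun i => by
        refine Fin.cases ?_ (fun j => ?_) i
        · exact measurable_fst
        · exact (measurable_pi_apply j).comp measurable_snd
    have hint : ∀ {E : Type} [NormedAddCommGroup E] [NormedSpace ℝ E] [MeasurableSpace E]
        [BorelSpace E] [SecondCountableTopology E] {F : (Fin (k + 1) → ℂ) → E}, Measurable F →
        ∫ x, F x ∂Measure.pi μ = ∫ p, F (Fin.cons p.1 p.2) ∂(μ 0).prod ν := by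
      intro E _ _ _ _ _ F hF
      have h1 := integral_map (μ := Measure.pi μ) (f := fun p => F (Fin.cons p.1 p.2))
        hp.measurable.aemeasurable (hF.comp hcons).aestronglyMeasurable
      rw [hp.map_eq] at h1
      rw [h1]
      exact integral_congr_ae (ae_of_all _ fun x => by
        change F x = F (Fin.cons (x 0) (Fin.tail x)); rw [Fin.cons_self_tail])
    have bd : ∀ x y, ‖‖G x - y‖ ^ 2‖ ≤ (C + ‖y‖) ^ 2 := fun x y => by
      rw [norm_of_nonneg (by positivity)]
      exact pow_le_pow_left₀ (norm_nonneg _) ((norm_sub_le _ _).trans (add_le_add (hC x) le_rfl)) 2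
    have bd2 : ∀ x y, ‖‖G x - G y‖ ^ 2‖ ≤ (C + C) ^ 2 := fun x y => (bd x (G y)).trans
      (pow_le_pow_left₀ (add_nonneg ((norm_nonneg _).trans (hC x)) (norm_nonneg _))
        (add_le_add le_rfl (hC y)) 2)
    have hH : Measurable fun p : ℂ × (Fin k → ℂ) => G (Fin.cons p.1 p.2) := hG.comp hcons
    have hHa : ∀ a, Measurable fun y : Fin k → ℂ => G (Fin.cons a y) := fun a =>
      hH.comp (measurable_const.prodMk measurable_id)
    set M : ℂ → ℂ := fun a => ∫ y, G (Fin.cons a y) ∂ν with hM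
    have hMm : Measurable M := (hH.stronglyMeasurable.integral_prod_right' (ν := ν)).measurable
    have hMC : ∀ a, ‖M a‖ ≤ C := fun a => by
      simpa using norm_integral_le_of_norm_le_const (μ := ν) (ae_of_all _ fun y => hC (Fin.cons a y))
    have hu : ∀ p, Measurable fun x : Fin (k + 1) → ℂ => ‖G x - G (update x p 0)‖ ^ 2 :=
      fun p => (hG.sub (hG.comp (f := fun x => update x p 0) (by fun_prop))).norm.pow_const 2
    set m := ∫ y, G y ∂Measure.pi μ with hm
    have hmM : m = ∫ a, M a ∂μ 0 := by
      rw [hm, hint hG, integral_prod _ (.of_bound hH.aestronglyMeasurable C (ae_of_all _ fun _ => hC _))]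
    have e1 : ∫ x, ‖G x - m‖ ^ 2 ∂Measure.pi μ =
        ∫ a, (∫ y, ‖G (Fin.cons a y) - M a‖ ^ 2 ∂ν + ‖M a - m‖ ^ 2) ∂μ 0 := by
      rw [hint ((hG.sub_const m).norm.pow_const 2), integral_prod _
        (.of_bound ((hH.sub_const m).norm.pow_const 2).aestronglyMeasurable _
          (ae_of_all _ fun _ => bd _ m))]
      exact integral_congr_ae (ae_of_all _ fun a => integral_norm_sub_sq (hHa a) (fun _ => hC _) m)
    have e2 : ∀ p, ∫ x, ‖G x - G (update x p 0)‖ ^ 2 ∂Measure.pi μ = ∫ a, ∫ y,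
        ‖G (Fin.cons a y) - G (update (Fin.cons a y : Fin (k + 1) → ℂ) p 0)‖ ^ 2 ∂ν ∂μ 0 :=
      fun p => by
        rw [hint (hu p)]
        exact integral_prod _ (.of_bound ((hu p).comp hcons).aestronglyMeasurable _
          (ae_of_all _ fun _ => bd2 _ _))
    have i2 : ∀ p, Integrable (fun a => ∫ y, ‖G (Fin.cons a y) -
        G (update (Fin.cons a y : Fin (k + 1) → ℂ) p 0)‖ ^ 2 ∂ν) (μ 0) := fun p =>
      (Integrable.of_bound (μ := (μ 0).prod ν) ((hu p).comp hcons).aestronglyMeasurable _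
          (ae_of_all _ fun _ => bd2 _ _)).integral_prod_left
    have i4 : Integrable (fun a => ∑ j : Fin k, ∫ y, ‖G (Fin.cons a y) -
        G (update (Fin.cons a y : Fin (k + 1) → ℂ) j.succ 0)‖ ^ 2 ∂ν) (μ 0) :=
      integrable_finsetSum _ fun j _ => i2 j.succ
    have i5 : ∀ c : ℂ, Integrable (fun a => ‖M a - c‖ ^ 2) (μ 0) := fun c =>
      .of_bound ((hMm.sub_const c).norm.pow_const 2).aestronglyMeasurable ((C + ‖c‖) ^ 2)
        (ae_of_all _ fun a => by
          rw [norm_of_nonneg (by positivity)]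
          exact pow_le_pow_left₀ (norm_nonneg _)
            ((norm_sub_le _ _).trans (add_le_add (hMC a) le_rfl)) 2)
    have e3 : ∫ a, ‖M a - m‖ ^ 2 ∂μ 0 ≤ ∫ a, ‖M a - M 0‖ ^ 2 ∂μ 0 := by
      have := integral_norm_sub_sq (P := μ 0) hMm hMC (M 0)
      rw [← hmM] at this
      linarith [sq_nonneg ‖m - M 0‖]
    have e4 : ∀ a, ‖M a - M 0‖ ^ 2 ≤ ∫ y, ‖G (Fin.cons a y) -
        G (update (Fin.cons a y : Fin (k + 1) → ℂ) 0 0)‖ ^ 2 ∂ν := fun a => by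
      have hb : ∀ a, Integrable (fun y => G (Fin.cons a y)) ν := fun a =>
        .of_bound (hHa a).aestronglyMeasurable C (ae_of_all _ fun _ => hC _)
      have := integral_norm_sub_sq (P := ν) ((hHa a).sub (hHa 0)) (C := C + C)
        (fun y => (norm_sub_le _ _).trans (add_le_add (hC _) (hC _))) 0
      simp only [sub_zero, Pi.sub_apply] at this
      rw [integral_sub (hb a) (hb 0)] at this
      simp only [Fin.update_cons_zero]
      rw [this]
      exact le_add_of_nonneg_left (integral_nonneg fun _ => by positivity)
    rw [e1, Fin.sum_univ_succ]
    simp only [e2]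
    calc _ ≤ ∫ a, ((∑ j : Fin k, ∫ y, ‖G (Fin.cons a y) -
          G (update (Fin.cons a y : Fin (k + 1) → ℂ) j.succ 0)‖ ^ 2 ∂ν) +
          ‖M a - m‖ ^ 2) ∂μ 0 := by
          refine integral_mono_of_nonneg (ae_of_all _ fun a => add_nonneg
            (integral_nonneg fun _ => by positivity) (by positivity)) (i4.add (i5 m))
            (ae_of_all _ fun a => add_le_add ?_ le_rfl)
          refine (ih (fun j => μ j.succ) (hHa a) (fun _ => hC _)).trans (le_of_eq ?_)
          simp only [Fin.cons_update]
          rfl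
      _ = (∑ j : Fin k, ∫ a, ∫ y, ‖G (Fin.cons a y) -
          G (update (Fin.cons a y : Fin (k + 1) → ℂ) j.succ 0)‖ ^ 2 ∂ν ∂μ 0) +
          ∫ a, ‖M a - m‖ ^ 2 ∂μ 0 := by
        rw [integral_add i4 (i5 m), integral_finsetSum _ fun j _ => i2 j.succ]
      _ ≤ _ := by
        have := integral_mono (i5 (M 0)) (i2 0) e4
        linarith

/-- The Efron–Stein inequality. -/
theorem efronStein {ι : Type} [Fintype ι] [DecidableEq ι] {ξ : ι → Ω → ℂ}
    (hξ : ∀ p, Measurable (ξ p)) (hi : iIndepFun ξ P) {G : (ι → ℂ) → ℂ} (hG : Measurable G) {C : ℝ}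
    (hC : ∀ x, ‖G x‖ ≤ C) :
    ∫ w, ‖G (fun p => ξ p w) - ∫ w', G (fun p => ξ p w') ∂P‖ ^ 2 ∂P ≤
      ∑ p, ∫ w, ‖G (fun p => ξ p w) - G (update (fun p => ξ p w) p 0)‖ ^ 2 ∂P := by
  set e := Fintype.equivFin ι
  have hm : Measurable fun w j => ξ (e.symm j) w := measurable_pi_lambda _ fun j => hξ _
  have hlaw := (iIndepFun_iff_map_fun_eq_pi_map fun j => (hξ (e.symm j)).aemeasurable).1
    (hi.precomp e.symm.injective)
  have he : Measurable fun x : Fin (card ι) → ℂ => fun p => x (e p) :=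
    measurable_pi_lambda _ fun p => measurable_pi_apply _
  have : ∀ j, IsProbabilityMeasure (P.map (ξ (e.symm j))) := fun j =>
    Measure.isProbabilityMeasure_map (hξ _).aemeasurable
  have key := efronStein_pi _ (fun j => P.map (ξ (e.symm j))) (hG.comp he) (fun x => hC _)
  have hGe := hG.comp he
  rw [← hlaw] at key
  have h1 : ∫ y, (G ∘ fun x p => x (e p)) y ∂P.map (fun w j => ξ (e.symm j) w) =
      ∫ w, G (fun p => ξ p w) ∂P := by
    rw [integral_map hm.aemeasurable hGe.aestronglyMeasurable]
    simp
  rw [h1, integral_map hm.aemeasurable ((hGe.sub_const _).norm.pow_const 2).aestronglyMeasurable,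
    ← e.sum_comp] at key
  simp only [Function.comp, e.symm_apply_apply] at key
  refine key.trans (le_of_eq (sum_congr rfl fun p _ => ?_))
  have h2 : Measurable fun x : Fin (card ι) → ℂ =>
      ‖G (fun q => x (e q)) - G (fun q => update x (e p) 0 (e q))‖ ^ 2 :=
    (hGe.sub (hGe.comp (f := fun x => update x (e p) 0) (by fun_prop))).norm.pow_const 2
  rw [integral_map hm.aemeasurable h2.aestronglyMeasurable]
  refine integral_congr_ae (ae_of_all _ fun w => ?_)
  have : (fun q => update (fun j => ξ (e.symm j) w) (e p) 0 (e q)) =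
      update (fun q => ξ q w) p 0 := by
    funext q
    simp [Function.update_apply]
  simp only [this, e.symm_apply_apply]

/-- Random variables each of which is independent of all the others together are independent. -/
lemma iIndepFun_of_forall {ι : Type} [Fintype ι] [DecidableEq ι] {ξ : ι → Ω → ℂ}
    (h : ∀ p, IndepFun (ξ p) (fun w (q : {q // q ≠ p}) => ξ q w) P) : iIndepFun ξ P := by
  rw [iIndepFun_iff_measure_inter_preimage_eq_mul]
  intro S sets hS
  induction S using Finset.induction_on with
  | empty => simp
  | insert p s hp ih =>
    rw [Finset.prod_insert hp, ← ih fun i hi => hS i (Finset.mem_insert_of_mem hi),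
      Finset.set_biInter_insert]
    have h1 := (h p).measure_inter_preimage_eq_mul (sets p)
      (Set.pi {q : {q // q ≠ p} | (q : ι) ∈ s} fun q => sets q) (hS p (Finset.mem_insert_self _ _))
      (.pi (Set.to_countable _) fun q hq => hS q (Finset.mem_insert_of_mem hq))
    have h2 : (fun w (q : {q // q ≠ p}) => ξ q w) ⁻¹'
        (Set.pi {q : {q // q ≠ p} | (q : ι) ∈ s} fun q => sets q) =
        ⋂ q ∈ s, ξ q ⁻¹' sets q := by
      ext w
      simp only [Set.mem_preimage, Set.mem_pi, Set.mem_setOf_eq, Subtype.forall, Set.mem_iInter]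
      exact ⟨fun H q hq => H q (fun hqp => hp (hqp ▸ hq)) hq, fun H q _ hq => H q hq⟩
    rwa [h2] at h1

/-- Functions of disjoint blocks of independent variables. -/
lemma indepFun_block {ι κ : Type} [Fintype κ] [DecidableEq κ] {Y : κ → Ω → ℝ} {ξ : ι → Ω → ℂ}
    (hY : iIndepFun Y P) (hm : ∀ k, Measurable (Y k)) (S : ι → Finset κ)
    (hS : ∀ p q, q ≠ p → Disjoint (S p) (S q)) (φ : ι → (κ → ℝ) → ℂ) (hφ : ∀ p, Measurable (φ p))
    (hφS : ∀ p x y, (∀ k ∈ S p, x k = y k) → φ p x = φ p y)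
    (hξ : ∀ p w, ξ p w = φ p (fun k => Y k w)) (p : ι) :
    IndepFun (ξ p) (fun w (q : {q // q ≠ p}) => ξ q w) P := by
  have h := hY.indepFun_finset (S p) (S p)ᶜ disjoint_compl_right hm
  let E : (T : Finset κ) → (T → ℝ) → κ → ℝ := fun T x k => if hk : k ∈ T then x ⟨k, hk⟩ else 0
  have hE : ∀ T, Measurable (E T) := fun T => measurable_pi_lambda _ fun k => by
    by_cases hk : k ∈ T
    · simpa [E, hk] using measurable_pi_apply _
    · simp [E, hk]
  have h1 := h.comp ((hφ p).comp (hE (S p)))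
    (measurable_pi_lambda (fun x (q : {q // q ≠ p}) => φ q (E (S p)ᶜ x))
      fun q => (hφ q).comp (hE _))
  have e1 : ξ p = (φ p ∘ E (S p)) ∘ fun w (i : S p) => Y i w := by
    funext w
    rw [hξ]
    exact hφS _ _ _ fun k hk => by simp [E, hk]
  have e2 : (fun w (q : {q // q ≠ p}) => ξ q w) =
      (fun x (q : {q // q ≠ p}) => φ q (E (S p)ᶜ x)) ∘ fun w (i : ((S p)ᶜ : Finset κ)) => Y i w := by
    funext w q
    rw [hξ]
    refine hφS _ _ _ fun k hk => ?_
    have : k ∉ S p := fun hk' => Finset.disjoint_left.1 (hS p q q.2) hk' hk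
    simp [E, this]
  rw [e1, e2]
  exact h1

end EfronSteinInequality

section Assembly

variable {Ω : Type*} [MeasurableSpace Ω] {P : Measure Ω} [IsProbabilityMeasure P] {N : ℕ}

/-- The positions above the diagonal. -/
abbrev UpperPair (N : ℕ) := {q : Fin N × Fin N // q.1 < q.2}

/-- The Hermitian matrix with zero diagonal and prescribed entries above it. -/
def assemble (x : UpperPair N → ℂ) : Matrix (Fin N) (Fin N) ℂ := Matrix.of fun i j =>
    if h : i < j then x ⟨(i, j), h⟩ else if h : j < i then conj (x ⟨(j, i), h⟩) else 0

lemma assemble_isHermitian (x : UpperPair N → ℂ) : (assemble x).IsHermitian := by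
  ext i j
  rcases lt_trichotomy i j with h | rfl | h
  · simp [assemble, h, h.not_gt]
  · simp [assemble]
  · simp [assemble, h, h.not_gt]

lemma assemble_eq {X : Matrix (Fin N) (Fin N) ℂ} (hX : X.IsHermitian) (h0 : ∀ i, X i i = 0) :
    assemble (fun p => X p.1.1 p.1.2) = X := by
  ext i j
  rcases lt_trichotomy i j with h | rfl | h
  · simp [assemble, h]
  · simp [assemble, h0]
  · simpa [assemble, h, h.not_gt] using hX.apply i j

lemma measurable_assemble : Measurable (assemble : (UpperPair N → ℂ) → Matrix (Fin N) (Fin N) ℂ) :=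
  measurable_matrix fun i j => by
    rcases lt_trichotomy i j with h | rfl | h
    · simpa [assemble, h] using measurable_pi_apply _
    · simp [assemble]
    · simp only [assemble, Matrix.of_apply, h, h.not_gt, dif_pos, dif_neg, not_false_eq_true]
      exact Complex.continuous_conj.measurable.comp (measurable_pi_apply _)

lemma erase_comm (X : Matrix (Fin N) (Fin N) ℂ) (i j : Fin N) : erase X i j = erase X j i :=
  sub_right_comm _ _ _

lemma erase_assemble (x : UpperPair N → ℂ) (p : UpperPair N) :
    erase (assemble x) p.1.1 p.1.2 = assemble (update x p 0) := by
  obtain ⟨⟨k, l⟩, hkl⟩ := p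
  have hkl' : k < l := hkl
  ext i j
  simp only [erase, Matrix.sub_apply, Matrix.single_apply, assemble, Matrix.of_apply,
    Function.update_apply, Subtype.mk.injEq, Prod.mk.injEq, hkl', dif_pos, hkl'.not_gt, dif_neg,
    not_false_eq_true]
  rcases lt_trichotomy i j with h | rfl | h
  · have : ¬ (l = i ∧ k = j) := by rintro ⟨rfl, rfl⟩; exact h.not_gt hkl'
    by_cases h1 : k = i ∧ l = j
    · obtain ⟨rfl, rfl⟩ := h1
      simp [h, this]
    · have h2 : ¬ (i = k ∧ j = l) := fun e => h1 ⟨e.1.symm, e.2.symm⟩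
      simp [h, this, h1, h2]
  · have h1 : ¬ (k = i ∧ l = i) := by rintro ⟨rfl, rfl⟩; exact lt_irrefl _ hkl'
    have h2 : ¬ (l = i ∧ k = i) := fun e => h1 ⟨e.2, e.1⟩
    simp [h1, h2]
  · have : ¬ (k = i ∧ l = j) := by rintro ⟨rfl, rfl⟩; exact h.not_gt hkl'
    by_cases h1 : l = i ∧ k = j
    · obtain ⟨rfl, rfl⟩ := h1
      simp [h, this, h.not_gt]
    · have h2 : ¬ (j = k ∧ i = l) := fun e => h1 ⟨e.2.symm, e.1.symm⟩
      simp [h, this, h1, h2, h.not_gt]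

variable {X : Ω → Matrix (Fin N) (Fin N) ℂ}

lemma indepFun_erase (hX : ∀ w, (X w).IsHermitian) (h0 : ∀ w i, X w i i = 0)
    (hi : ∀ p : UpperPair N, IndepFun (fun w => X w p.1.1 p.1.2)
      (fun w (q : {q // q ≠ p}) => X w q.1.1.1 q.1.1.2) P) (i j : Fin N) (hij : i ≠ j) :
    IndepFun (fun w => X w i j) (fun w => erase (X w) i j) P := by
  have key : ∀ i j (h : i < j), IndepFun (fun w => X w i j) (fun w => erase (X w) i j) P :=
      fun i j h => by
    let p : UpperPair N := ⟨(i, j), h⟩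
    have hΦ : Measurable fun (y : {q // q ≠ p} → ℂ) q => if hq : q = p then 0 else y ⟨q, hq⟩ :=
      measurable_pi_lambda _ fun q => by
        by_cases hq : q = p
        · simp [hq]
        · simpa [hq] using measurable_pi_apply _
    have h1 := (hi p).comp measurable_id (measurable_assemble.comp hΦ)
    have e : ∀ w, erase (X w) i j = assemble fun q => if q = p then 0 else X w q.1.1 q.1.2 :=
        fun w => by
      have h2 := erase_assemble (fun p => X w p.1.1 p.1.2) p
      rw [assemble_eq (hX w) (h0 w)] at h2
      refine h2.trans (congrArg assemble (funext fun q => ?_))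
      by_cases hq : q = p <;> simp [hq]
    simp only [e]
    exact h1
  rcases lt_or_gt_of_ne hij with h | h
  · exact key i j h
  · have h1 := (key j i h).comp Complex.continuous_conj.measurable measurable_id
    convert h1 using 1
    · exact funext fun w => ((hX w).apply i j).symm
    · exact funext fun w => erase_comm _ _ _

lemma efronStein_assemble (hX : ∀ w, (X w).IsHermitian) (h0 : ∀ w i, X w i i = 0)
    (hm : ∀ i j, Measurable fun w => X w i j)
    (hi : ∀ p : UpperPair N, IndepFun (fun w => X w p.1.1 p.1.2)
      (fun w (q : {q // q ≠ p}) => X w q.1.1.1 q.1.1.2) P)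
    {F : Matrix (Fin N) (Fin N) ℂ → ℂ} (hF : Tame F) :
    ∫ w, ‖F (X w) - avg P X F‖ ^ 2 ∂P ≤
      ∑ i, ∑ j, if i ≠ j then ∫ w, ‖F (X w) - F (erase (X w) i j)‖ ^ 2 ∂P else 0 := by
  obtain ⟨C, hC⟩ := hF.2
  have h := efronStein (ξ := fun (p : UpperPair N) w => X w p.1.1 p.1.2)
    (fun p => hm _ _) (iIndepFun_of_forall hi) (hF.1.comp measurable_assemble)
    (fun x => hC _ (assemble_isHermitian x))
  simp only [Function.comp, ← erase_assemble, assemble_eq (hX _) (h0 _)] at h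
  refine h.trans ?_
  rw [← Finset.sum_subtype (univ.filter fun q : Fin N × Fin N => q.1 < q.2)
    (fun q => by simp) (fun q => ∫ w, ‖F (X w) - F (erase (X w) q.1 q.2)‖ ^ 2 ∂P),
    ← Fintype.sum_prod_type', Finset.sum_filter]
  refine sum_le_sum fun q _ => ?_
  have : 0 ≤ ∫ w, ‖F (X w) - F (erase (X w) q.1 q.2)‖ ^ 2 ∂P :=
    integral_nonneg fun _ => by positivity
  split_ifs with h1 h2 h2
  · exact le_rfl
  · exact absurd h2 (by simpa using h1.ne)
  · exact this
  · exact le_rfl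

end Assembly

section Truncation

variable {Ω : Type*} [MeasurableSpace Ω] {P : Measure Ω} [IsProbabilityMeasure P]

/-- Truncation at level `L`. -/
def trunc (L : ℝ) (w : ℂ) : ℂ := if ‖w‖ ≤ L then w else 0

lemma measurable_trunc (L : ℝ) : Measurable (trunc L) :=
  Measurable.ite (measurableSet_le measurable_norm measurable_const) measurable_id measurable_const

lemma norm_trunc_le {L : ℝ} (hL : 0 ≤ L) (w : ℂ) : ‖trunc L w‖ ≤ L := by
  unfold trunc; split_ifs with h
  · exact h
  · simpa using hL

lemma norm_trunc_le_norm (L : ℝ) (w : ℂ) : ‖trunc L w‖ ≤ ‖w‖ := by unfold trunc; split_ifs <;> simp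

lemma trunc_conj (L : ℝ) (w : ℂ) : trunc L (conj w) = conj (trunc L w) := by
  unfold trunc; rw [norm_conj]; split_ifs <;> simp

lemma trunc_sub_le {L h : ℝ} (hL : 1 ≤ L) (hLh : L ^ 2 * h = 1) (w : ℂ) :
    ‖w - trunc L w‖ ≤ h * ‖w‖ ^ 4 ∧ ‖w ^ 2 - trunc L w ^ 2‖ ≤ h * ‖w‖ ^ 4 ∧
      |‖w‖ ^ 2 - ‖trunc L w‖ ^ 2| ≤ h * ‖w‖ ^ 4 := by
  have hh : 0 < h := by
    by_contra hc
    nlinarith [sq_nonneg L]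
  unfold trunc; split_ifs with hw
  · simp; positivity
  · push Not at hw
    have h1 : 1 ≤ h * ‖w‖ ^ 2 := by rw [← hLh, mul_comm]; gcongr
    have h2 : ‖w‖ ^ 2 ≤ h * ‖w‖ ^ 4 := by nlinarith [mul_le_mul_of_nonneg_right h1 (sq_nonneg ‖w‖)]
    have h3 : ‖w‖ ≤ ‖w‖ ^ 2 := by nlinarith
    refine ⟨by simpa using h3.trans h2, by simpa using h2, ?_⟩
    simpa [abs_of_nonneg] using h2

variable {w : Ω → ℂ} {L h C σ ρ : ℝ}

/-- The moments of a truncated and recentred random variable. -/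
lemma truncated_moments (hL : 1 ≤ L) (hLh : L ^ 2 * h = 1) (hwm : Measurable w)
    (hi : Integrable (fun ω => ‖w ω‖ ^ 4) P) (hC : ∫ ω, ‖w ω‖ ^ 4 ∂P ≤ C) (hw : ∫ ω, w ω ∂P = 0)
    (h2 : ∫ ω, ‖w ω‖ ^ 2 ∂P = σ ^ 2) (h3 : ∫ ω, w ω ^ 2 ∂P = ρ * σ ^ 2)
    {ξ : Ω → ℂ} (hξ : ∀ ω, ξ ω = h * (trunc L (w ω) - ∫ ω', trunc L (w ω') ∂P)) :
    (∀ ω, ‖ξ ω‖ ^ 2 ≤ 4 * h) ∧ ∫ ω, ξ ω ∂P = 0 ∧ ∫ ω, ‖ξ ω‖ ^ 4 ∂P ≤ 8 * (C + C ^ 4) * h ^ 4 ∧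
      |∫ ω, ‖ξ ω‖ ^ 2 ∂P - σ ^ 2 * h ^ 2| ≤ (C + C ^ 2) * h ^ 3 ∧
      ‖∫ ω, ξ ω ^ 2 ∂P - ρ * σ ^ 2 * h ^ 2‖ ≤ (C + C ^ 2) * h ^ 3 := by
  have hh : 0 < h := by
    by_contra hc
    nlinarith [sq_nonneg L]
  have hh1 : h ≤ 1 := hLh ▸ le_mul_of_one_le_left hh.le (one_le_pow₀ hL)
  have hC0 : 0 ≤ C := (integral_nonneg fun _ => by positivity).trans hC
  set T := fun ω => trunc L (w ω) with hT
  have hTm : Measurable T := (measurable_trunc L).comp hwm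
  have hTL : ∀ ω, ‖T ω‖ ≤ L := fun ω => norm_trunc_le (by linarith) _
  have hTi : Integrable T P := .of_bound hTm.aestronglyMeasurable L (ae_of_all _ hTL)
  have hTi2 : Integrable (fun ω => T ω ^ 2) P :=
    .of_bound (hTm.pow_const 2).aestronglyMeasurable (L ^ 2) (ae_of_all _ fun ω => by
      rw [norm_pow]; gcongr; exact hTL ω)
  have hTn2 : Integrable (fun ω => ‖T ω‖ ^ 2) P := by simpa using hTi2.norm
  have hw2 : Integrable (fun ω => w ω ^ 2) P :=
    (hi.add (integrable_const 1)).mono' (hwm.pow_const 2).aestronglyMeasurable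
      (ae_of_all _ fun ω => by
        rw [norm_pow]
        change _ ≤ ‖w ω‖ ^ 4 + 1
        nlinarith [sq_nonneg (‖w ω‖ ^ 2 - 1)])
  have hwn2 : Integrable (fun ω => ‖w ω‖ ^ 2) P := by simpa using hw2.norm
  have hwi : Integrable w P := (hwn2.add (integrable_const 1)).mono' hwm.aestronglyMeasurable
      (ae_of_all _ fun ω => by
        change _ ≤ ‖w ω‖ ^ 2 + 1
        nlinarith [sq_nonneg (‖w ω‖ - 1)])
  have bound : ∀ {E : Type} [NormedAddCommGroup E] [NormedSpace ℝ E] {f g : Ω → E},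
      Integrable f P → Integrable g P → (∀ ω, ‖f ω - g ω‖ ≤ h * ‖w ω‖ ^ 4) →
      ‖∫ ω, g ω ∂P - ∫ ω, f ω ∂P‖ ≤ C * h := by
    intro E _ _ f g hf hg hfg
    rw [norm_sub_rev, ← integral_sub hf hg]
    refine (norm_integral_le_of_norm_le (hi.const_mul h) (ae_of_all _ hfg)).trans ?_
    rw [integral_const_mul, mul_comm C]
    gcongr
  set m := ∫ ω, T ω ∂P with hm
  have hmC : ‖m‖ ≤ C * h := by simpa [hw] using bound hwi hTi fun ω => (trunc_sub_le hL hLh (w ω)).1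
  have hmC1 : ‖m‖ ≤ C := hmC.trans (mul_le_of_le_one_right hC0 hh1)
  have hmC2 : ‖m‖ ^ 2 ≤ C ^ 2 * h := (pow_le_pow_left₀ (norm_nonneg _) hmC 2).trans
    (by rw [mul_pow]; gcongr; nlinarith)
  have hmL : ‖m‖ ≤ L := by simpa using norm_integral_le_of_norm_le_const (μ := P) (ae_of_all _ hTL)
  have b2 := bound hwn2 hTn2 fun ω => (trunc_sub_le hL hLh (w ω)).2.2
  have b3 := bound hw2 hTi2 fun ω => (trunc_sub_le hL hLh (w ω)).2.1
  rw [h2] at b2; rw [h3] at b3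
  replace hξ : ∀ ω, ξ ω = h * (T ω - m) := hξ
  have hn : ∀ ω, ‖ξ ω‖ = h * ‖T ω - m‖ := fun ω => by
    rw [hξ, norm_mul, norm_real, norm_of_nonneg hh.le]
  simp only [hn]
  simp only [hξ]
  refine ⟨fun ω => ?_, ?_, ?_, ?_, ?_⟩
  · have : ‖T ω - m‖ ≤ 2 * L := (norm_sub_le _ _).trans (by linarith [hTL ω])
    calc (h * ‖T ω - m‖) ^ 2 ≤ (h * (2 * L)) ^ 2 := by gcongr
      _ = 4 * h * (L ^ 2 * h) := by ring
      _ = 4 * h := by rw [hLh, mul_one]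
  · rw [integral_const_mul, integral_sub hTi (integrable_const _)]
    simp [hm]
  · have b : ∀ ω, (h * ‖T ω - m‖) ^ 4 ≤ h ^ 4 * (8 * (‖w ω‖ ^ 4 + C ^ 4)) := fun ω => by
      rw [mul_pow]
      gcongr
      have h4 : ‖T ω - m‖ ≤ ‖w ω‖ + C :=
        (norm_sub_le _ _).trans (add_le_add (norm_trunc_le_norm _ _) hmC1)
      exact (pow_le_pow_left₀ (norm_nonneg _) h4 4).trans
        ((add_pow_le (norm_nonneg _) hC0 4).trans (by norm_num))
    refine (integral_mono_of_nonneg (ae_of_all _ fun ω => by positivity)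
      (((hi.add (integrable_const _)).const_mul _).const_mul _) (ae_of_all _ b)).trans ?_
    rw [integral_const_mul, integral_const_mul, integral_add' hi (integrable_const _)]
    simp only [integral_const, probReal_univ, one_smul]
    nlinarith [mul_le_mul_of_nonneg_left hC (by positivity : 0 ≤ 8 * h ^ 4)]
  · simp only [mul_pow]
    have e := integral_norm_sub_sq (P := P) hTm hTL 0
    simp only [sub_zero] at e
    rw [integral_const_mul, mul_comm _ (h ^ 2), ← mul_sub, abs_mul, abs_of_pos (by positivity),
      show (C + C ^ 2) * h ^ 3 = h ^ 2 * (C * h + C ^ 2 * h) by ring]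
    gcongr
    rw [Real.norm_eq_abs] at b2
    rw [← hm] at e
    have := sq_nonneg ‖m‖
    rw [abs_le] at b2 ⊢
    constructor <;> linarith
  · have e : ∫ ω, (h * (T ω - m)) ^ 2 ∂P = h ^ 2 * (∫ ω, T ω ^ 2 ∂P - m ^ 2) := by
      have e1 : ∀ ω, (h * (T ω - m)) ^ 2 = (h : ℂ) ^ 2 * (T ω ^ 2 - 2 * m * T ω + m ^ 2) :=
        fun ω => by ring
      have i1 : Integrable (fun ω => 2 * m * T ω) P := hTi.const_mul _
      have i2 : Integrable (fun ω => T ω ^ 2 - 2 * m * T ω) P := hTi2.sub i1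
      simp only [e1]
      rw [integral_const_mul, integral_add i2 (integrable_const _), integral_sub hTi2 i1,
        integral_const_mul]
      simp only [integral_const, probReal_univ, one_smul]
      rw [← hm]; ring
    rw [e, mul_comm _ ((h : ℂ) ^ 2), ← mul_sub, norm_mul, norm_pow, norm_real,
      norm_of_nonneg hh.le, sub_right_comm,
      show (C + C ^ 2) * h ^ 3 = h ^ 2 * (C * h + C ^ 2 * h) by ring]
    gcongr
    exact (norm_sub_le _ _).trans (add_le_add b3 (by rwa [norm_pow]))

end Truncation

section TruncatedModel

variable {Ω : Type*} [MeasurableSpace Ω] {P : Measure Ω} [IsProbabilityMeasure P] {N : ℕ}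
  {W : Ω → Matrix (Fin N) (Fin N) ℂ}

lemma rpow_quarter_sq (hN : 1 ≤ N) : 1 ≤ (N : ℝ) ^ ((1 : ℝ) / 4) ∧
    ((N : ℝ) ^ ((1 : ℝ) / 4)) ^ 2 * (1 / √N) = 1 := by
  have h1 : (1 : ℝ) ≤ N := by exact_mod_cast hN
  refine ⟨Real.one_le_rpow h1 (by norm_num), ?_⟩
  rw [← Real.rpow_natCast, ← Real.rpow_mul (by linarith), Real.sqrt_eq_rpow]
  norm_num
  exact mul_inv_cancel₀ (Real.rpow_pos_of_pos (by linarith) _).ne'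

lemma truncX_apply (w : Ω) (i j : Fin N) : truncX P W w i j =
    if i = j then 0 else ((1 / √N : ℝ) : ℂ) * (trunc ((N : ℝ) ^ ((1 : ℝ) / 4)) (W w i j) -
      ∫ w', trunc ((N : ℝ) ^ ((1 : ℝ) / 4)) (W w' i j) ∂P) := by
  by_cases h : i = j <;> simp [truncX, truncW, truncEntry, trunc, h]

lemma truncX_isHermitian (hW : ∀ w, (W w).IsHermitian) (w : Ω) : (truncX P W w).IsHermitian := by
  ext i j
  have e : ∀ w, W w j i = conj (W w i j) := fun w => ((hW w).apply j i).symm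
  rw [Matrix.conjTranspose_apply, truncX_apply, truncX_apply]
  by_cases h : i = j
  · simp [h]
  · simp only [h, Ne.symm h, if_false, e, trunc_conj, integral_conj, star_mul', star_sub,
      RCLike.star_def, Complex.conj_conj, Complex.conj_ofReal]

lemma integrable_of_lintegral_pow {w : Ω → ℂ} (hw : Measurable w) {C : NNReal} {k : ℕ}
    (h : ∫⁻ ω, ‖w ω‖ₑ ^ k ∂P ≤ C) :
    Integrable (fun ω => ‖w ω‖ ^ k) P ∧ ∫ ω, ‖w ω‖ ^ k ∂P ≤ C := by
  have e : ∀ ω, ‖w ω‖ₑ ^ k = ‖‖w ω‖ ^ k‖ₑ := fun ω => by simp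
  simp only [e] at h
  refine ⟨⟨by fun_prop, h.trans_lt ENNReal.coe_lt_top⟩, ?_⟩
  rw [← norm_of_nonneg (integral_nonneg fun ω => by positivity)]
  have h1 := (enorm_integral_le_lintegral_enorm (μ := P) fun ω => ‖w ω‖ ^ k).trans h
  rw [← ofReal_norm_eq_enorm, ENNReal.ofReal_le_iff_le_toReal (by simp)] at h1
  simpa using h1

lemma truncX_entryModel (hN : 1 ≤ N) (hm : ∀ i j, Measurable fun w => W w i j)
    (hW : ∀ w, (W w).IsHermitian) {C : NNReal}
    (hC : ∀ i j, i ≠ j → ∫⁻ w, ‖W w i j‖ₑ ^ 4 ∂P ≤ C) (hmean : ∀ i j, ∫ w, W w i j ∂P = 0)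
    {σ ρ : ℝ} (hρ : |ρ| ≤ 1) (h2 : ∀ i j, i < j → ∫ w, ‖W w i j‖ ^ 2 ∂P = σ ^ 2)
    (h3 : ∀ i j, i < j → ∫ w, W w i j ^ 2 ∂P = ρ * σ ^ 2)
    (hi : ∀ p : {q : Fin N × Fin N // q.1 < q.2}, IndepFun (fun w => truncX P W w p.1.1 p.1.2)
      (fun w (q : {q // q ≠ p}) => truncX P W w q.1.1.1 q.1.1.2) P) :
    Model P (truncX P W) (1 / √N) (8 * (C + C ^ 4) + (C + C ^ 2) + 1 + σ ^ 2) σ ρ := by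
  obtain ⟨hL, hLh⟩ := rpow_quarter_sq hN
  have hN0 : (1 : ℝ) ≤ N := by exact_mod_cast hN
  have hh : 0 < 1 / √N := by positivity
  have h0 : ∀ w i, truncX P W w i i = 0 := fun w i => by simp [truncX_apply]
  have hX := truncX_isHermitian (P := P) hW
  have hXm : ∀ i j, Measurable fun w => truncX P W w i j := fun i j => by
    simp only [truncX_apply]
    split_ifs
    · exact measurable_const
    · exact ((((measurable_trunc _).comp (hm i j)).sub_const _).const_mul _)
  have hc : ∀ i j w, W w i j = conj (W w j i) := fun i j w => ((hW w).apply i j).symm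
  have h2' : ∀ i j, i ≠ j → ∫ w, ‖W w i j‖ ^ 2 ∂P = σ ^ 2 := fun i j h => by
    rcases lt_or_gt_of_ne h with h | h
    · exact h2 i j h
    · simpa [hc i j] using h2 j i h
  have h3' : ∀ i j, i ≠ j → ∫ w, W w i j ^ 2 ∂P = ρ * σ ^ 2 := fun i j h => by
    rcases lt_or_gt_of_ne h with h | h
    · exact h3 i j h
    · have e : ∀ w, W w i j ^ 2 = conj (W w j i ^ 2) := fun w => by rw [hc i j, map_pow]
      simp only [e]
      rw [integral_conj, h3 j i h, map_mul, map_pow, Complex.conj_ofReal, Complex.conj_ofReal]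
  have key := fun i j (h : i ≠ j) => truncated_moments hL hLh (hm i j)
    (integrable_of_lintegral_pow (hm i j) (hC i j h)).1
    (integrable_of_lintegral_pow (hm i j) (hC i j h)).2 (hmean i j) (h2' i j h) (h3' i j h)
    (ξ := fun w => truncX P W w i j) fun w => by simp [truncX_apply, h]
  have hC0 : (0 : ℝ) ≤ C := C.2
  have hh1 : 1 / √N ≤ 1 := by
    rw [div_le_one (by positivity)]
    exact Real.one_le_sqrt.2 hN0
  have hcard : (card (Fin N) : ℝ) * (1 / √N) ^ 2 = 1 := by
    rw [div_pow, Real.sq_sqrt (by positivity), Fintype.card_fin]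
    field_simp
  generalize 1 / √N = h at *
  refine ⟨hh, hh1, hcard, ?_, ?_, hρ, hX, h0, hXm, fun w i j => ?_, indepFun_erase hX h0 hi,
    fun i j => ?_, fun i j => ?_, fun i j hij => (key i j hij).2.2.2.1.trans ?_,
    fun i j hij => (key i j hij).2.2.2.2.trans ?_, fun F hF => efronStein_assemble hX h0 hXm hi hF⟩
  · linarith [show 0 ≤ 8 * ((C : ℝ) + C ^ 4) + (C + C ^ 2) + σ ^ 2 by positivity]
  · linarith [show 0 ≤ 8 * ((C : ℝ) + C ^ 4) + (C + C ^ 2) + 1 by positivity]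
  · by_cases hij : i = j
    · simpa [hij, h0] using hh.le
    · exact (key i j hij).1 w
  · by_cases hij : i = j
    · simp [hij, h0]
    · exact (key i j hij).2.1
  · by_cases hij : i = j
    · simp only [hij, h0]
      simp
      positivity
    · refine (key i j hij).2.2.1.trans (mul_le_mul_of_nonneg_right ?_ (by positivity))
      linarith [show 0 ≤ ((C : ℝ) + C ^ 2) + 1 + σ ^ 2 by positivity]
  all_goals
    refine mul_le_mul_of_nonneg_right ?_ (by positivity)
    linarith [show 0 ≤ 8 * ((C : ℝ) + C ^ 4) + 1 + σ ^ 2 by positivity]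

end TruncatedModel

section Ensembles

variable {Ω : ℕ → Type*} [∀ N, MeasurableSpace (Ω N)] {P : ∀ N, Measure (Ω N)}
  [∀ N, IsProbabilityMeasure (P N)] {W : ∀ N, Ω N → Matrix (Fin N) (Fin N) ℂ} {σ ρ : ℝ}

lemma WignerMoments.memLp (h : WignerMoments P W) (N : ℕ) {i j : Fin N} (hij : i ≠ j) :
    MemLp (fun w => W N w i j) 2 (P N) := by
  obtain ⟨C, hC⟩ := h.fourth_moment
  have hm := h.measurable N i j
  have := (integrable_of_lintegral_pow hm (hC N i j hij)).1
  rw [memLp_two_iff_integrable_sq_norm hm.aestronglyMeasurable]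
  refine (this.add (integrable_const 1)).mono' (by fun_prop) (ae_of_all _ fun w => ?_)
  rw [norm_of_nonneg (by positivity)]
  change _ ≤ ‖W N w i j‖ ^ 4 + 1
  nlinarith [sq_nonneg (‖W N w i j‖ ^ 2 - 1)]

lemma WignerMoments.integral_re_im (h : WignerMoments P W) (N : ℕ) {i j : Fin N} (hij : i ≠ j) :
    ∫ w, (W N w i j).re ∂P N = 0 ∧ ∫ w, (W N w i j).im ∂P N = 0 := by
  have hi := (h.memLp N hij).integrable one_le_two
  exact ⟨(integral_re hi).trans (by rw [h.mean]; rfl), (integral_im hi).trans (by rw [h.mean]; rfl)⟩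

lemma IsRealWigner.entryModel (h : IsRealWigner P W σ) : ∃ A, ∀ N, 1 ≤ N →
    Model (P N) (truncX (P N) (W N)) (1 / √N) A σ 1 := by
  obtain ⟨C, hC⟩ := h.fourth_moment
  refine ⟨8 * (C + C ^ 4) + (C + C ^ 2) + 1 + σ ^ 2, fun N hN => ?_⟩
  have hre : ∀ w i j, W N w i j = ((W N w i j).re : ℂ) := fun w i j =>
    Complex.ext rfl (by simp [h.real_entries])
  have hv : ∀ i j, i < j → ∫ w, (W N w i j).re ^ 2 ∂P N = σ ^ 2 := fun i j hij =>
    (variance_of_integral_eq_zero (X := fun w => (W N w i j).re)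
      (h.measurable N i j).re.aemeasurable (h.integral_re_im N hij.ne).1).symm.trans
      (h.variance N i j hij)
  refine truncX_entryModel hN (h.measurable N) (h.isHermitian N) (hC N) (h.mean N) (by simp)
    (fun i j hij => ?_) (fun i j hij => ?_) (indepFun_block (h.indep N)
      (fun q => (h.measurable N _ _).re) (fun p => {⟨p.1, p.2.le⟩})
      (fun p q hpq => by simpa [Subtype.ext_iff] using hpq.symm)
      (fun p y => ((1 / √N : ℝ) : ℂ) * (trunc ((N : ℝ) ^ ((1 : ℝ) / 4)) (y ⟨p.1, p.2.le⟩) -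
        ∫ w', trunc ((N : ℝ) ^ ((1 : ℝ) / 4)) (W N w' p.1.1 p.1.2) ∂P N))
      (fun p => (((measurable_trunc _).comp (Complex.measurable_ofReal.comp
        (measurable_pi_apply _))).sub_const _).const_mul _)
      (fun p x y hxy => by simp [hxy ⟨p.1, p.2.le⟩ (by simp)]) fun p w => ?_)
  · rw [← hv i j hij]
    exact integral_congr_ae (ae_of_all _ fun w => by
      beta_reduce; rw [hre, norm_real, Real.norm_eq_abs, sq_abs, Complex.ofReal_re])
  · rw [Complex.ofReal_one, one_mul, ← Complex.ofReal_pow, ← hv i j hij, ← integral_complex_ofReal]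
    exact integral_congr_ae (ae_of_all _ fun w => by beta_reduce; rw [Complex.ofReal_pow, ← hre])
  · rw [truncX_apply, if_neg p.2.ne, ← hre]

lemma IsRealWigner.transpose_truncX (h : IsRealWigner P W σ) (N : ℕ) (w : Ω N) :
    (truncX (P N) (W N) w).transpose = truncX (P N) (W N) w := by
  have hs : ∀ w i j, W N w i j = W N w j i := fun w i j => by
    rw [← (h.isHermitian N w).apply i j]
    exact Complex.ext rfl (by simp [h.real_entries])
  ext i j
  rw [Matrix.transpose_apply, truncX_apply, truncX_apply]
  simp only [hs _ j i, eq_comm]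

lemma IsHermitianWigner.entryModel (h : IsHermitianWigner P W σ) : ∃ A, ∀ N, 1 ≤ N →
    Model (P N) (truncX (P N) (W N)) (1 / √N) A σ 0 := by
  obtain ⟨C, hC⟩ := h.fourth_moment
  refine ⟨8 * (C + C ^ 4) + (C + C ^ 2) + 1 + σ ^ 2, fun N hN => ?_⟩
  have hm := h.measurable N
  have hr : ∀ i j, i < j → ∫ w, (W N w i j).re ^ 2 ∂P N = σ ^ 2 / 2 := fun i j hij =>
    (variance_of_integral_eq_zero (X := fun w => (W N w i j).re)
      (hm i j).re.aemeasurable (h.integral_re_im N hij.ne).1).symm.trans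
      (h.variance_re N i j hij)
  have hj : ∀ i j, i < j → ∫ w, (W N w i j).im ^ 2 ∂P N = σ ^ 2 / 2 := fun i j hij =>
    (variance_of_integral_eq_zero (X := fun w => (W N w i j).im)
      (hm i j).im.aemeasurable (h.integral_re_im N hij.ne).2).symm.trans
      (h.variance_im N i j hij)
  have ir : ∀ i j, i < j → Integrable (fun w => (W N w i j).re ^ 2) (P N) := fun i j hij =>
    (h.memLp N hij.ne).re.integrable_sq
  have ij : ∀ i j, i < j → Integrable (fun w => (W N w i j).im ^ 2) (P N) := fun i j hij =>
    (h.memLp N hij.ne).im.integrable_sq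
  have hx : ∀ i j, i < j → ∫ w, (W N w i j).re * (W N w i j).im ∂P N = 0 := fun i j hij => by
    have h1 := (h.indep N).indepFun (i := .inl (.inl ⟨(i, j), hij⟩))
      (j := .inl (.inr ⟨(i, j), hij⟩)) (by simp)
    have h2 := h1.integral_fun_mul_eq_mul_integral (hm i j).re.aestronglyMeasurable
      (hm i j).im.aestronglyMeasurable
    exact h2.trans (by
      rw [show ∫ w, hermitianCoord (W N) (.inl (.inl ⟨(i, j), hij⟩)) w ∂P N = 0 from
        (h.integral_re_im N hij.ne).1, zero_mul])
  have hmc : ∀ k, Measurable (hermitianCoord (W N) k) := by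
    rintro ((q | q) | i)
    exacts [(hm _ _).re, (hm _ _).im, (hm _ _).re]
  refine truncX_entryModel hN hm (h.isHermitian N) (hC N) (h.mean N) (by simp)
    (fun i j hij => ?_) (fun i j hij => ?_) (indepFun_block (h.indep N) hmc
      (fun p => {.inl (.inl p), .inl (.inr p)})
      (fun p q hpq => by simp [hpq])
      (fun p y => ((1 / √N : ℝ) : ℂ) * (trunc ((N : ℝ) ^ ((1 : ℝ) / 4))
        (y (.inl (.inl p)) + y (.inl (.inr p)) * I) -
        ∫ w', trunc ((N : ℝ) ^ ((1 : ℝ) / 4)) (W N w' p.1.1 p.1.2) ∂P N))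
      (fun p => (((measurable_trunc _).comp (by fun_prop)).sub_const _).const_mul _)
      (fun p x y hxy => by
        simp only [hxy (.inl (.inl p)) (by simp), hxy (.inl (.inr p)) (by simp)]) fun p w => ?_)
  · have e : ∀ w, ‖W N w i j‖ ^ 2 = (W N w i j).re ^ 2 + (W N w i j).im ^ 2 := fun w => by
      rw [← Complex.normSq_eq_norm_sq, Complex.normSq_apply]; ring
    simp only [e]
    rw [integral_add (ir i j hij) (ij i j hij), hr i j hij, hj i j hij]; ring
  · have e : ∀ w, W N w i j ^ 2 = (((W N w i j).re ^ 2 - (W N w i j).im ^ 2 : ℝ) : ℂ) +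
        ((2 * ((W N w i j).re * (W N w i j).im) : ℝ) : ℂ) * I := fun w => by
      conv_lhs => rw [← Complex.re_add_im (W N w i j)]
      push_cast
      linear_combination ((W N w i j).im : ℂ) ^ 2 * Complex.I_sq
    have i1 : Integrable (fun w => (W N w i j).re ^ 2 - (W N w i j).im ^ 2) (P N) :=
      (ir i j hij).sub (ij i j hij)
    have i2 : Integrable (fun w => 2 * ((W N w i j).re * (W N w i j).im)) (P N) :=
      ((h.memLp N hij.ne).re.integrable_mul (h.memLp N hij.ne).im).const_mul 2
    simp only [e]
    rw [integral_add i1.ofReal (i2.ofReal.mul_const _), integral_mul_const,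
      integral_complex_ofReal, integral_complex_ofReal, integral_sub (ir i j hij) (ij i j hij),
      integral_const_mul, hx i j hij, hr i j hij, hj i j hij]
    simp
  · rw [truncX_apply, if_neg p.2.ne]
    simp [hermitianCoord, Complex.re_add_im]

end Ensembles

section GaussianSeries

variable {S : Type} [Countable S]

/-- The law of a family of independent standard Gaussian variables. -/
abbrev gaussSeq (S : Type) : Measure (S → ℝ) := Measure.infinitePi fun _ => gaussianReal 0 1

/-- A series in independent standard Gaussian variables. -/
def series (a : S → ℝ) (x : S → ℝ) : ℝ := ∑' s, a s * x s

lemma measurable_series (a : S → ℝ) : Measurable (series a) :=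
  .tsum fun s => (measurable_pi_apply s).const_mul _

lemma summable_mul_right_of {𝕜 : Type} [RCLike 𝕜] {a b : S → 𝕜} (ha : Summable a)
    (hb : Summable b) : Summable fun s => a s * b s :=
  .of_norm_bounded (ha.norm.mul_right (∑' s, ‖b s‖)) fun s => by
    rw [norm_mul]
    gcongr
    exact hb.norm.le_tsum s fun _ _ => norm_nonneg _

lemma ae_summable_series {a : S → ℝ} (ha : Summable a) :
    ∀ᵐ x ∂gaussSeq S, Summable fun s => a s * x s := by
  set M := ∫⁻ x, ‖x‖ₑ ∂gaussianReal 0 1 with hM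
  have hMf : M ≠ ⊤ := ((memLp_one_iff_integrable.1
    (memLp_id_gaussianReal (μ := 0) (v := 1) 1)).2).ne
  have h1 : ∀ s, ∫⁻ x : S → ℝ, ‖a s * x s‖ₑ ∂gaussSeq S = ‖a s‖ₑ * M := fun s => by
    simp only [enorm_mul]
    rw [lintegral_const_mul _ (by fun_prop), hM,
      ← Measure.infinitePi_map_eval (fun _ : S => gaussianReal 0 1) s,
      lintegral_map (by fun_prop) (by fun_prop)]
  have h2 : ∫⁻ x : S → ℝ, ∑' s, ‖a s * x s‖ₑ ∂gaussSeq S ≠ ⊤ := by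
    rw [lintegral_tsum fun s => Measurable.aemeasurable (by fun_prop)]
    simp only [h1]
    rw [ENNReal.tsum_mul_right]
    exact ENNReal.mul_ne_top (ENNReal.tsum_coe_ne_top_iff_summable.2 (NNReal.summable_coe.1 ha.norm)) hMf
  filter_upwards [ae_lt_top (Measurable.tsum fun s => by fun_prop) h2] with x hx
  exact (ENNReal.tsum_coe_ne_top_iff_summable.1 hx.ne).of_nnnorm

lemma map_series {a : S → ℝ} (ha : Summable a) :
    (gaussSeq S).map (series a) = gaussianReal 0 (∑' s, a s ^ 2).toNNReal := by
  classical
  refine Measure.ext_of_charFun (funext fun t => ?_)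
  have hfin : ∀ T : Finset S, ∫ x, exp (t * (∑ s ∈ T, a s * x s : ℝ) * I) ∂gaussSeq S =
      exp (-(t ^ 2 * ∑ s ∈ T, a s ^ 2 : ℝ) / 2) := fun T => by
    have hi : iIndepFun (fun (s : T) (x : S → ℝ) => x s) (gaussSeq S) :=
      (iIndepFun_infinitePi (P := fun _ : S => gaussianReal 0 1) (X := fun _ x => x)
        fun _ => measurable_id).precomp Subtype.val_injective
    have h1 := iIndepFun.integral_fun_prod_comp (𝕜 := ℂ) (f := fun (s : T) (y : ℝ) =>
      exp (t * (a s * y) * I)) hi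
      (fun s => (measurable_pi_apply _).aemeasurable) (fun s => by fun_prop)
    have h2 : ∀ s : S, ∫ x : S → ℝ, exp (t * (a s * x s) * I) ∂gaussSeq S =
        exp (-(t ^ 2 * a s ^ 2 : ℝ) / 2) := fun s => by
      have h3 := integral_map (μ := gaussSeq S) (φ := fun x => x s)
        (f := fun y : ℝ => exp (t * (a s * y) * I))
        (measurable_pi_apply s).aemeasurable (by fun_prop)
      rw [Measure.infinitePi_map_eval] at h3
      rw [← h3]
      have h4 := charFun_gaussianReal (μ := 0) (v := 1) (t * a s)
      rw [charFun_apply_real] at h4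
      convert h4 using 2
      · funext y; push_cast; ring_nf
      · push_cast; ring
    simp only [h2] at h1
    rw [Finset.prod_coe_sort T (fun s => exp (-(t ^ 2 * a s ^ 2 : ℝ) / 2)), ← Complex.exp_sum] at h1
    convert h1 using 1
    · refine integral_congr_ae (ae_of_all _ fun x => ?_)
      beta_reduce
      rw [Finset.prod_coe_sort T (fun s => exp (t * (a s * x s) * I)), ← Complex.exp_sum]
      push_cast
      rw [mul_sum, sum_mul]
    · push_cast
      rw [mul_sum, ← Finset.sum_neg_distrib, Finset.sum_div]
  rw [charFun_apply_real, integral_map (measurable_series a).aemeasurable (by fun_prop),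
    charFun_gaussianReal]
  refine tendsto_nhds_unique (f := fun T : Finset S =>
    ∫ x, exp (t * (∑ s ∈ T, a s * x s : ℝ) * I) ∂gaussSeq S) (l := atTop) ?_ ?_
  · refine tendsto_integral_filter_of_dominated_convergence (fun _ => 1)
      (Eventually.of_forall fun T => Measurable.aestronglyMeasurable (by fun_prop))
      (Eventually.of_forall fun T => ae_of_all _ fun x => ?_) (integrable_const _) ?_
    · rw [← Complex.ofReal_mul, Complex.norm_exp_ofReal_mul_I]
    · filter_upwards [ae_summable_series ha] with x hx
      have : Continuous fun y : ℝ => exp (t * y * I) := by fun_prop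
      exact (this.tendsto _).comp hx.hasSum
  · simp only [hfin]
    have h1 : Summable fun s => a s ^ 2 := by simpa only [sq] using summable_mul_right_of ha ha
    have h2 : Continuous fun y : ℝ => exp (-(t ^ 2 * y : ℝ) / 2) := by fun_prop
    have h3 := (h2.tendsto _).comp h1.hasSum
    rw [Real.coe_toNNReal _ (tsum_nonneg fun s => sq_nonneg _)]
    have e : (t : ℂ) * (0 : ℝ) * I - (∑' s, a s ^ 2 : ℝ) * t ^ 2 / 2 =
        -(t ^ 2 * ∑' s, a s ^ 2 : ℝ) / 2 := by push_cast; ring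
    rwa [e]

lemma series_finsetSum {ι : Type*} {a : ι → S → ℝ} {I : Finset ι} (ha : ∀ i ∈ I, Summable (a i))
    (c : ι → ℝ) : ∀ᵐ x ∂gaussSeq S,
      series (fun s => ∑ i ∈ I, c i * a i s) x = ∑ i ∈ I, c i * series (a i) x := by
  have h : ∀ᵐ x ∂gaussSeq S, ∀ i : I, Summable fun s => a i s * x s :=
    ae_all_iff.2 fun i => ae_summable_series (ha i i.2)
  filter_upwards [h] with x hx
  simp only [series, sum_mul, mul_assoc]
  rw [Summable.tsum_finsetSum fun i hi => (hx ⟨i, hi⟩).mul_left (c i)]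
  exact sum_congr rfl fun i hi => tsum_mul_left

lemma series_add {a b : S → ℝ} (ha : Summable a) (hb : Summable b) :
    ∀ᵐ x ∂gaussSeq S, series (fun s => a s + b s) x = series a x + series b x := by
  filter_upwards [ae_summable_series ha, ae_summable_series hb] with x hx hy
  simp only [series, add_mul]
  exact hx.tsum_add hy

lemma memLp_series {a : S → ℝ} (ha : Summable a) : MemLp (series a) 2 (gaussSeq S) := by
  have h := memLp_id_gaussianReal (μ := 0) (v := (∑' s, a s ^ 2).toNNReal) 2
  rw [← map_series ha] at h
  simpa using h.comp_of_map (measurable_series a).aemeasurable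

lemma integral_series {a : S → ℝ} (ha : Summable a) : ∫ x, series a x ∂gaussSeq S = 0 := by
  have h := integral_map (measurable_series a).aemeasurable (μ := gaussSeq S) (f := id)
    (by fun_prop)
  rw [map_series ha] at h
  simpa using h.symm

lemma integral_series_sq {a : S → ℝ} (ha : Summable a) :
    ∫ x, series a x ^ 2 ∂gaussSeq S = ∑' s, a s ^ 2 := by
  have h := variance_map (X := id) (Y := series a) (μ := gaussSeq S) (by fun_prop)
    (measurable_series a).aemeasurable
  rw [map_series ha, variance_id_gaussianReal, Function.id_comp,
    variance_of_integral_eq_zero (measurable_series a).aemeasurable (integral_series ha),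
    Real.coe_toNNReal _ (tsum_nonneg fun s => sq_nonneg _)] at h
  exact h.symm

lemma integral_series_mul {a b : S → ℝ} (ha : Summable a) (hb : Summable b) :
    ∫ x, series a x * series b x ∂gaussSeq S = ∑' s, a s * b s := by
  have h1 := series_add ha hb
  have h2 := integral_series_sq (ha.add hb)
  have ia := (memLp_series ha).integrable_sq
  have ib := (memLp_series hb).integrable_sq
  have iab : Integrable (fun x => 2 * (series a x * series b x)) (gaussSeq S) :=
    ((memLp_series ha).integrable_mul (memLp_series hb)).const_mul 2
  have i1 : Integrable (fun x => series a x ^ 2 + 2 * (series a x * series b x)) (gaussSeq S) :=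
    ia.add iab
  have sa : Summable fun s => a s ^ 2 := by simpa only [sq] using summable_mul_right_of ha ha
  have sb : Summable fun s => b s ^ 2 := by simpa only [sq] using summable_mul_right_of hb hb
  have sab := (summable_mul_right_of ha hb).mul_left 2
  have h3 : ∫ x, series (fun s => a s + b s) x ^ 2 ∂gaussSeq S =
      ∫ x, (series a x ^ 2 + 2 * (series a x * series b x) + series b x ^ 2) ∂gaussSeq S :=
    integral_congr_ae (h1.mono fun x hx => by beta_reduce; rw [hx]; ring)
  have h4 : ∑' s, (a s + b s) ^ 2 = ∑' s, (a s ^ 2 + 2 * (a s * b s) + b s ^ 2) :=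
    tsum_congr fun s => by ring
  rw [h3, h4, integral_add i1 ib, integral_add ia iab, integral_const_mul, integral_series_sq ha,
    integral_series_sq hb, (sa.add sab).tsum_add sb, sa.tsum_add sab, tsum_mul_left] at h2
  linarith

/-- The complex linear extension of `series`. -/
def cseries (a : S → ℂ) (x : S → ℝ) : ℂ :=
  series (fun s => (a s).re) x + series (fun s => (a s).im) x * I

lemma cseries_conj (a : S → ℂ) (x : S → ℝ) : cseries (fun s => conj (a s)) x = conj (cseries a x) := by
  simp [cseries, series, tsum_neg]

lemma measurable_cseries (a : S → ℂ) : Measurable (cseries a) :=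
  (Complex.measurable_ofReal.comp (measurable_series _)).add
    ((Complex.measurable_ofReal.comp (measurable_series _)).mul_const _)

/-- A real linear functional of finitely many complex series is a real series. -/
lemma linear_cseries {ι : Type*} {a : ι → S → ℂ} {I : Finset ι} (ha : ∀ i ∈ I, Summable (a i))
    (c : ι → ℂ) : ∀ᵐ x ∂gaussSeq S,
      series (fun s => (∑ i ∈ I, c i * a i s).re) x = (∑ i ∈ I, c i * cseries (a i) x).re := by
  have hr : ∀ i ∈ I, Summable fun s => (a i s).re := fun i hi => Complex.reCLM.summable (ha i hi)
  have hj : ∀ i ∈ I, Summable fun s => (a i s).im := fun i hi => Complex.imCLM.summable (ha i hi)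
  filter_upwards [series_finsetSum hr fun i => (c i).re, series_finsetSum hj fun i => -(c i).im,
    series_add (summable_sum fun i hi => (hr i hi).mul_left (c i).re)
      (summable_sum fun i hi => (hj i hi).mul_left (-(c i).im))] with x h1 h2 h3
  rw [h1, h2] at h3
  simp only [Complex.re_sum, Complex.mul_re, sub_eq_add_neg, ← neg_mul, sum_add_distrib]
  rw [h3]
  simp [cseries]

end GaussianSeries

section ComplexSeries

variable {S : Type} [Countable S]

lemma isGaussianProcess_cseries {T : Type*} {a : T → S → ℂ} (ha : ∀ t, Summable (a t)) :
    IsGaussianProcess (fun t => cseries (a t)) (gaussSeq S) := by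
  classical
  refine ⟨fun I => ⟨isGaussian_of_map_eq_gaussianReal fun L => ?_⟩⟩
  let c : T → ℂ := fun t => if ht : t ∈ I then
    ⟨L (Pi.single ⟨t, ht⟩ 1), -L (Pi.single ⟨t, ht⟩ Complex.I)⟩ else 0
  have hL : ∀ v : T → ℂ, L (I.restrict v) = (∑ t ∈ I, c t * v t).re := fun v => by
    have e : I.restrict v = ∑ t : I, ((v t).re • (Pi.single t 1 : I → ℂ) +
        (v t).im • (Pi.single t Complex.I : I → ℂ)) := by
      rw [← Finset.univ_sum_single (I.restrict v)]
      refine sum_congr rfl fun t _ => ?_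
      rw [← Pi.single_smul, ← Pi.single_smul, ← Pi.single_add]
      simp [Complex.re_add_im]
    rw [e, map_sum, Complex.re_sum, ← Finset.sum_coe_sort I]
    exact sum_congr rfl fun t _ => by simp [c, mul_comm]
  have hb : Summable fun s => (∑ t ∈ I, c t * a t s).re :=
    Complex.reCLM.summable (summable_sum fun t _ => (ha t).mul_left (c t))
  refine ⟨0, (∑' s, (∑ t ∈ I, c t * a t s).re ^ 2).toNNReal, ?_⟩
  rw [← map_series hb, Measure.map_map (by fun_prop)
    (g := L) (f := fun x => I.restrict fun t => cseries (a t) x)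
    (measurable_pi_lambda _ fun t => measurable_cseries _)]
  refine Measure.map_congr ((linear_cseries (I := I) (fun t _ => ha t) c).mono fun x hx => ?_)
  rw [hx]
  exact hL fun t => cseries (a t) x

lemma integral_cseries {a : S → ℂ} (ha : Summable a) : ∫ x, cseries a x ∂gaussSeq S = 0 := by
  have hr : Summable fun s => (a s).re := Complex.reCLM.summable ha
  have hj : Summable fun s => (a s).im := Complex.imCLM.summable ha
  have i1 : Integrable (series fun s => (a s).re) (gaussSeq S) := (memLp_series hr).integrable one_le_two
  have i2 : Integrable (series fun s => (a s).im) (gaussSeq S) := (memLp_series hj).integrable one_le_two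
  simp only [cseries]
  rw [integral_add i1.ofReal (i2.ofReal.mul_const _), integral_mul_const, integral_complex_ofReal,
    integral_complex_ofReal, integral_series hr, integral_series hj]
  simp

/-- The covariance of two complex series. -/
def dot (a b : S → ℂ) : ℂ := ∑' s, a s * b s

lemma summable_star {a : S → ℂ} (ha : Summable a) : Summable fun s => conj (a s) :=
  Complex.conjCLE.summable.2 ha

lemma dot_expand {a b a' b' : S → ℂ} (ha : Summable a) (hb : Summable b) (ha' : Summable a')
    (hb' : Summable b') (x y : ℂ) : ∑' s, (a s + x * a' s) * (b s + y * b' s) =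
      dot a b + y * dot a b' + x * (dot a' b + y * dot a' b') := by
  have h1 := summable_mul_right_of ha hb
  have h2 := (summable_mul_right_of ha hb').mul_left y
  have h3 := summable_mul_right_of ha' hb
  have h4 := (summable_mul_right_of ha' hb').mul_left y
  unfold dot
  rw [← tsum_mul_left, ← tsum_mul_left, ← h1.tsum_add h2, ← h3.tsum_add h4, ← tsum_mul_left,
    ← (h1.add h2).tsum_add ((h3.add h4).mul_left x)]
  exact tsum_congr fun s => by ring

lemma integral_re_mul_re {a b a' b' : S → ℂ} (ha : Summable a) (hb : Summable b)
    (ea : ∀ s, conj (a s) = a' s) (eb : ∀ s, conj (b s) = b' s) :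
    ((∫ x, series (fun s => (a s).re) x * series (fun s => (b s).re) x ∂gaussSeq S : ℝ) : ℂ) =
        (dot a b + dot a b' + dot a' b + dot a' b') / 4 ∧
    ((∫ x, series (fun s => (a s).re) x * series (fun s => (b s).im) x ∂gaussSeq S : ℝ) : ℂ) =
        (dot a b - dot a b' + dot a' b - dot a' b') / (4 * I) ∧
    ((∫ x, series (fun s => (a s).im) x * series (fun s => (b s).im) x ∂gaussSeq S : ℝ) : ℂ) =
        -(dot a b - dot a b' - dot a' b + dot a' b') / 4 := by
  have hr : ∀ {a : S → ℂ}, Summable a → Summable fun s => (a s).re :=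
    fun h => Complex.reCLM.summable h
  have hj : ∀ {a : S → ℂ}, Summable a → Summable fun s => (a s).im :=
    fun h => Complex.imCLM.summable h
  have ha' : Summable a' := (summable_congr ea).1 (summable_star ha)
  have hb' : Summable b' := (summable_congr eb).1 (summable_star hb)
  have key := dot_expand ha hb ha' hb'
  have k1 := key 1 1
  have k2 := key 1 (-1)
  have k3 := key (-1) (-1)
  have er : ∀ w : ℂ, (w.re : ℂ) = (w + 1 * conj w) / 2 := fun w => by rw [one_mul, Complex.re_eq_add_conj]
  have ei : ∀ w : ℂ, (w.im : ℂ) = (w + -1 * conj w) / (2 * I) := fun w => by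
    rw [Complex.im_eq_sub_conj]; ring
  rw [integral_series_mul (hr ha) (hr hb), integral_series_mul (hr ha) (hj hb),
    integral_series_mul (hj ha) (hj hb), Complex.ofReal_tsum, Complex.ofReal_tsum,
    Complex.ofReal_tsum]
  simp only [Complex.ofReal_mul, er, ei, ea, eb, div_mul_div_comm, tsum_div_const, k1, k2, k3]
  refine ⟨by ring, by rw [show 2 * (2 * I) = 4 * I by ring]; ring, ?_⟩
  rw [show 2 * I * (2 * I) = -4 by linear_combination 4 * Complex.I_sq]
  ring

lemma dot_sum {β : Type*} [Fintype β] {a : β → S → ℂ} (ha : ∀ b, Summable (a b)) (c : β → ℂ) :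
    ∑' s, (∑ b, c b * a b s) ^ 2 = ∑ b, ∑ b', c b * c b' * dot (a b) (a b') := by
  have h : ∀ b b', Summable fun s => c b * c b' * (a b s * a b' s) := fun b b' =>
    (summable_mul_right_of (ha b) (ha b')).mul_left _
  simp only [dot, ← tsum_mul_left]
  rw [tsum_congr fun s => show (∑ b, c b * a b s) ^ 2 = ∑ b, ∑ b', c b * c b' * (a b s * a b' s) by
      rw [sq, sum_mul_sum]
      exact sum_congr rfl fun _ _ => sum_congr rfl fun _ _ => by ring,
    Summable.tsum_finsetSum fun b _ => summable_sum fun b' _ => h b b']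
  exact sum_congr rfl fun b _ => Summable.tsum_finsetSum fun b' _ => h b b'

lemma integral_exp_series {a : S → ℝ} (ha : Summable a) : ∫ x, exp (series a x * I) ∂gaussSeq S =
      exp (-(∑' s, a s ^ 2 : ℝ) / 2) := by
  have h1 := charFun_apply_real (μ := (gaussSeq S).map (series a)) 1
  rw [integral_map (measurable_series a).aemeasurable (by fun_prop), map_series ha,
    charFun_gaussianReal, Real.coe_toNNReal _ (tsum_nonneg fun s => sq_nonneg _)] at h1
  simp only [Complex.ofReal_one, one_mul] at h1
  rw [← h1]
  congr 1
  push_cast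
  ring

end ComplexSeries

section LimitField

variable {m : ℕ} {σ ρ : ℝ}

/-- The entry `(l, p)` of `√(1 + ρ) / 2 (G + Gᵀ) + i √(1 - ρ) / 2 (G' - G'ᵀ)`, in terms of the
entries of the two real matrices `G` and `G'`. -/
def direction (ρ : ℝ) (l p : Fin m) (d : (Fin m × Fin m) × Bool) : ℂ :=
  if d.2 then I * (√(1 - ρ) / 2 : ℝ) *
    ((if d.1 = (l, p) then 1 else 0) - if d.1 = (p, l) then 1 else 0)
  else (√(1 + ρ) / 2 : ℝ) * ((if d.1 = (l, p) then 1 else 0) + if d.1 = (p, l) then 1 else 0)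

/-- The covariance structure of the entries of the Gaussian matrix. -/
def entryCov (ρ : ℝ) (l p l' p' : Fin m) : ℂ :=
  (if l = p' then 1 else 0) * (if l' = p then 1 else 0) +
    ρ * ((if l = l' then 1 else 0) * if p' = p then 1 else 0)

lemma entryCov_eq_zero {l p l' p' : Fin m} (h1 : ¬ (l = p' ∧ l' = p)) (h2 : ¬ (l = l' ∧ p' = p)) :
    entryCov ρ l p l' p' = 0 := by
  simp only [entryCov, ite_zero_mul_ite_zero, h1, h2, if_false, mul_zero, add_zero]

lemma conj_direction (l p : Fin m) (d : (Fin m × Fin m) × Bool) :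
    conj (direction ρ l p d) = direction ρ p l d := by
  obtain ⟨q, _ | _⟩ := d <;>
  · simp only [direction, apply_ite conj, map_mul, map_add, map_sub, Complex.conj_ofReal,
      Complex.conj_I, map_one, map_zero, if_true, Bool.false_eq_true, if_false]
    ring

lemma sum_direction (hρ : |ρ| ≤ 1) (l p l' p' : Fin m) :
    ∑ d, direction ρ l p d * direction ρ l' p' d = entryCov ρ l p l' p' := by
  have hρ' := abs_le.1 hρ
  have h1 : ((√(1 - ρ) : ℝ) : ℂ) ^ 2 = 1 - ρ := by
    rw [← Complex.ofReal_pow, Real.sq_sqrt (by linarith)]; simp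
  have h2 : ((√(1 + ρ) : ℝ) : ℂ) ^ 2 = 1 + ρ := by
    rw [← Complex.ofReal_pow, Real.sq_sqrt (by linarith)]; simp
  have hs : ∀ r r' : Fin m × Fin m, ∑ q : Fin m × Fin m,
      (if q = r then (1 : ℂ) else 0) * (if q = r' then 1 else 0) = if r = r' then 1 else 0 :=
    fun r r' => by simp [eq_comm]
  rw [Fintype.sum_prod_type, sum_congr rfl fun q _ => Fintype.sum_bool _]
  have e : ∀ q : Fin m × Fin m, direction ρ l p (q, true) * direction ρ l' p' (q, true) +
      direction ρ l p (q, false) * direction ρ l' p' (q, false) =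
      1 / 2 * ((if q = (l, p) then (1 : ℂ) else 0) * (if q = (p', l') then 1 else 0) +
        (if q = (p, l) then (1 : ℂ) else 0) * (if q = (l', p') then 1 else 0)) +
      ρ / 2 * ((if q = (l, p) then (1 : ℂ) else 0) * (if q = (l', p') then 1 else 0) +
        (if q = (p, l) then (1 : ℂ) else 0) * (if q = (p', l') then 1 else 0)) := fun q => by
    simp only [direction, if_true, Bool.false_eq_true, if_false]
    push_cast
    generalize (if q = (l, p) then (1 : ℂ) else 0) = x1
    generalize (if q = (p, l) then (1 : ℂ) else 0) = x2
    generalize (if q = (l', p') then (1 : ℂ) else 0) = x3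
    generalize (if q = (p', l') then (1 : ℂ) else 0) = x4
    linear_combination (x1 - x2) * (x3 - x4) / 4 * (√(1 - ρ) : ℂ) ^ 2 * Complex.I_sq -
      (x1 - x2) * (x3 - x4) / 4 * h1 + (x1 + x2) * (x3 + x4) / 4 * h2
  simp only [e, sum_add_distrib, ← mul_sum, hs, Prod.mk.injEq, entryCov]
  have e1 : (l = p' ∧ p = l') ↔ (l = p' ∧ l' = p) := by rw [eq_comm (a := p)]
  have e2 : (p = l' ∧ l = p') ↔ (l = p' ∧ l' = p) := by rw [eq_comm (a := p), and_comm]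
  have e3 : (l = l' ∧ p = p') ↔ (l = l' ∧ p' = p) := by rw [eq_comm (a := p)]
  have e4 : (p = p' ∧ l = l') ↔ (l = l' ∧ p' = p) := by rw [eq_comm (a := p), and_comm]
  simp only [ite_zero_mul_ite_zero, mul_one, e1, e2, e3, e4]
  ring

/-- The coefficients of the limiting field. -/
def fieldCoeff (σ ρ : ℝ) (l p : Fin m) (z : ℂ) (s : ℕ × ((Fin m × Fin m) × Bool)) : ℂ :=
  (σ : ℂ) ^ (s.1 + 1) * stieltjes σ z ^ (s.1 + 2) * direction ρ l p s.2

lemma hasSum_geometric_coeff (hσ : 0 < σ) {z z' : ℂ} (hz : z.im ≠ 0) (hz' : z'.im ≠ 0) :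
    ∑' k : ℕ, (σ : ℂ) ^ (k + 1) * stieltjes σ z ^ (k + 2) *
      ((σ : ℂ) ^ (k + 1) * stieltjes σ z' ^ (k + 2)) = covPi σ z z' := by
  have h1 := norm_mul_stieltjes_lt hσ hz
  have h2 := norm_mul_stieltjes_lt hσ hz'
  set g := stieltjes σ z with hg
  set g' := stieltjes σ z' with hg'
  have h3 : ‖(σ : ℂ) * g * (σ * g')‖ < 1 := by
    rw [norm_mul]; nlinarith [norm_nonneg ((σ : ℂ) * g), norm_nonneg ((σ : ℂ) * g')]
  have h4 : 1 - (σ : ℂ) ^ 2 * g * g' ≠ 0 := fun h => by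
    have : (σ : ℂ) * g * (σ * g') = 1 := by linear_combination -h
    rw [this] at h3; simp at h3
  rw [tsum_congr fun k : ℕ => show (σ : ℂ) ^ (k + 1) * g ^ (k + 2) * ((σ : ℂ) ^ (k + 1) *
    g' ^ (k + 2)) = σ ^ 2 * (g * g') ^ 2 * (σ * g * (σ * g')) ^ k by ring, tsum_mul_left,
    tsum_geometric_of_norm_lt_one h3, covPi, ← hg, ← hg',
    show (σ : ℂ) * g * (σ * g') = σ ^ 2 * g * g' by ring]
  field_simp
  ring

lemma summable_norm_coeff (hσ : 0 < σ) {z : ℂ} (hz : z.im ≠ 0) :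
    Summable fun k : ℕ => ‖(σ : ℂ) ^ (k + 1) * stieltjes σ z ^ (k + 2)‖ := by
  have h := (summable_geometric_of_lt_one (norm_nonneg _) (norm_mul_stieltjes_lt hσ hz)).mul_left
    ‖(σ : ℂ) * stieltjes σ z ^ 2‖
  refine h.congr fun k => ?_
  rw [← norm_pow, ← norm_mul]
  ring_nf

lemma summable_fieldCoeff (hσ : 0 < σ) {z : ℂ} (hz : z.im ≠ 0) (l p : Fin m) :
    Summable (fieldCoeff σ ρ l p z) :=
  summable_mul_of_summable_norm
    (f := fun k : ℕ => (σ : ℂ) ^ (k + 1) * stieltjes σ z ^ (k + 2)) (g := direction ρ l p)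
    (summable_norm_coeff hσ hz) Summable.of_finite

lemma dot_fieldCoeff (hσ : 0 < σ) (hρ : |ρ| ≤ 1) {z z' : ℂ} (hz : z.im ≠ 0) (hz' : z'.im ≠ 0)
    (l p l' p' : Fin m) : dot (fieldCoeff σ ρ l p z) (fieldCoeff σ ρ l' p' z') =
      covPi σ z z' * entryCov ρ l p l' p' := by
  have h1 := summable_mul_right_of (summable_norm_coeff hσ hz) (summable_norm_coeff hσ hz')
  simp only [← norm_mul] at h1
  rw [← hasSum_geometric_coeff hσ hz hz', ← sum_direction hρ, ← tsum_fintype (L := .unconditional _),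
    tsum_mul_tsum_of_summable_norm (f := fun k : ℕ => (σ : ℂ) ^ (k + 1) * stieltjes σ z ^ (k + 2) *
      ((σ : ℂ) ^ (k + 1) * stieltjes σ z' ^ (k + 2)))
      (g := fun d => direction ρ l p d * direction ρ l' p' d) h1 Summable.of_finite]
  exact tsum_congr fun s => by simp only [fieldCoeff]; ring

lemma conj_fieldCoeff (l p : Fin m) (z : ℂ) (s : ℕ × ((Fin m × Fin m) × Bool)) :
    conj (fieldCoeff σ ρ l p z s) = fieldCoeff σ ρ p l (conj z) s := by
  simp [fieldCoeff, stieltjes_conj, conj_direction]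

/-- The limiting field. -/
def limitField (σ ρ : ℝ) (z : ℂ) (x : ℕ × ((Fin m × Fin m) × Bool) → ℝ) : Matrix (Fin m) (Fin m) ℂ :=
  Matrix.of fun l p => cseries (fieldCoeff σ ρ l p z) x

lemma limitField_conj (l p : Fin m) (z : ℂ) (x : ℕ × ((Fin m × Fin m) × Bool) → ℝ) :
    limitField σ ρ z x l p = conj (limitField σ ρ (conj z) x p l) := by
  simp only [limitField, Matrix.of_apply, ← cseries_conj, conj_fieldCoeff, Complex.conj_conj]

theorem isLimitField (hσ : 0 < σ) (hρ : |ρ| ≤ 1) :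
    IsLimitField (gaussSeq (ℕ × ((Fin m × Fin m) × Bool))) σ ρ (limitField (m := m) σ ρ) := by
  have him : ∀ {z : ℂ}, z.im ≠ 0 → (conj z).im ≠ 0 := fun h => by simpa using h
  have hre : ∀ l p (z : ℂ) x, (limitField (m := m) σ ρ z x l p).re =
      series (fun s => (fieldCoeff σ ρ l p z s).re) x := fun l p z x => by simp [limitField, cseries]
  have hj : ∀ l p (z : ℂ) x, (limitField (m := m) σ ρ z x l p).im =
      series (fun s => (fieldCoeff σ ρ l p z s).im) x := fun l p z x => by simp [limitField, cseries]
  have cov := fun (l p : Fin m) (z₁ z₂ : ℂ) (h₁ : z₁.im ≠ 0) (h₂ : z₂.im ≠ 0) =>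
    integral_re_mul_re (summable_fieldCoeff (ρ := ρ) hσ h₁ l p)
      (summable_fieldCoeff (ρ := ρ) hσ h₂ l p) (conj_fieldCoeff l p z₁) (conj_fieldCoeff l p z₂)
  refine ⟨?_, fun l p _ => ?_, fun l p _ z hz => integral_cseries (summable_fieldCoeff hσ hz l p),
    fun l p _ z₁ z₂ h₁ h₂ => ?_, fun l p _ z₁ z₂ h₁ h₂ => ?_, fun l p _ z₁ z₂ h₁ h₂ => ?_,
    fun l p _ z _ x => limitField_conj l p z x⟩
  · refine IsGaussianProcess.iIndepFun_of_covariance_inner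
      (X := fun (q : {q : Fin m × Fin m // q.1 ≤ q.2}) (z : {z : ℂ // z.im ≠ 0}) x =>
        limitField σ ρ z x q.1.1 q.1.2)
      (isGaussianProcess_cseries fun t => summable_fieldCoeff hσ t.2.2 _ _)
      (fun q z => (measurable_cseries _).aemeasurable) ?_
    have hL : ∀ (x : ℂ) (l p : Fin m) (z : ℂ), z.im ≠ 0 →
        Summable (fun s => conj x * fieldCoeff σ ρ l p z s) ∧
        (fun w => inner ℝ x (limitField σ ρ z w l p)) =ᵐ[gaussSeq _]
          series fun s => (conj x * fieldCoeff σ ρ l p z s).re := fun x l p z hz => by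
      have h := summable_fieldCoeff (ρ := ρ) hσ hz l p
      refine ⟨h.mul_left _, (linear_cseries (I := {()}) (fun _ _ => h) fun _ => conj x).mono
        fun w hw => ?_⟩
      simpa [Complex.inner, limitField, mul_comm] using hw.symm
    rintro ⟨⟨l, p⟩, hlp⟩ ⟨⟨l', p'⟩, hlp'⟩ hne ⟨z, hz⟩ ⟨z', hz'⟩ x y
    obtain ⟨s1, e1⟩ := hL x l p z hz
    obtain ⟨s2, e2⟩ := hL y l' p' z' hz'
    have r1 : Summable fun s => (conj x * fieldCoeff σ ρ l p z s).re := Complex.reCLM.summable s1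
    have m1 := memLp_series r1
    have m2 := memLp_series (Complex.reCLM.summable s2)
    have h0 : entryCov ρ l p l' p' = 0 ∧ entryCov ρ l p p' l' = 0 ∧ entryCov ρ p l l' p' = 0 ∧
        entryCov ρ p l p' l' = 0 := by
      have hlp : l ≤ p := hlp
      have hlp' : l' ≤ p' := hlp'
      have h1 : ¬ (l = l' ∧ p' = p) := fun h => hne (by simp [h.1, h.2])
      have h2 : ¬ (l = p' ∧ l' = p) := fun h =>
        h1 ⟨le_antisymm (hlp.trans h.2.ge) (hlp'.trans h.1.ge), le_antisymm (h.1.ge.trans hlp)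
          (h.2.ge.trans hlp')⟩
      exact ⟨entryCov_eq_zero h2 h1, entryCov_eq_zero h1 h2,
        entryCov_eq_zero (fun h => h1 ⟨h.2.symm, h.1.symm⟩) (fun h => h2 ⟨h.2.symm, h.1.symm⟩),
        entryCov_eq_zero (fun h => h2 ⟨h.2.symm, h.1.symm⟩) (fun h => h1 ⟨h.2.symm, h.1.symm⟩)⟩
    have hd := fun (l p l' p' : Fin m) {z z' : ℂ} (hz : z.im ≠ 0) (hz' : z'.im ≠ 0) (x y : ℂ) =>
      show dot (fun s => x * fieldCoeff σ ρ l p z s) (fun s => y * fieldCoeff σ ρ l' p' z' s) =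
        x * y * (covPi σ z z' * entryCov ρ l p l' p') by
        rw [← dot_fieldCoeff hσ hρ hz hz', dot, dot, ← tsum_mul_left]
        exact tsum_congr fun s => by ring
    have key := (integral_re_mul_re s1 s2 (a' := fun s => x * fieldCoeff σ ρ p l (conj z) s)
      (b' := fun s => y * fieldCoeff σ ρ p' l' (conj z') s)
      (fun s => by simp [conj_fieldCoeff]) (fun s => by simp [conj_fieldCoeff])).1
    rw [hd _ _ _ _ hz hz', hd _ _ _ _ hz (him hz'), hd _ _ _ _ (him hz) hz',
      hd _ _ _ _ (him hz) (him hz'), h0.1, h0.2.1, h0.2.2.1, h0.2.2.2] at key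
    rw [covariance_eq_sub (m1.ae_eq e1.symm) (m2.ae_eq e2.symm), integral_congr_ae e1,
      integral_congr_ae (e1.mul e2), integral_series r1, zero_mul, sub_zero]
    simpa using key
  · exact isGaussianProcess_cseries fun t => summable_fieldCoeff hσ t.2 _ _
  all_goals
    have hc := cov l p z₁ z₂ h₁ h₂
    simp only [dot_fieldCoeff hσ hρ, h₁, h₂, him, ne_eq, not_false_eq_true, entryCov,
      eq_comm (a := p) (b := l)] at hc
    simp only [hre, hj, hc]
    rcases eq_or_ne l p with h | h
    · simp only [h, if_true]; ring
    · simp only [h, if_false, if_true]; ring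

end LimitField

section Convergence

/-- The Cramér–Wold form of Lévy's continuity theorem, for complex random vectors. -/
lemma tendstoInDistribution_of_tendsto_charFun {ι : Type} [Fintype ι] {Ω : ℕ → Type*}
    [∀ N, MeasurableSpace (Ω N)] {P : ∀ N, Measure (Ω N)} [∀ N, IsProbabilityMeasure (P N)]
    {Ω' : Type*} [MeasurableSpace Ω'] {Q : Measure Ω'} [IsProbabilityMeasure Q]
    {V : ∀ N, Ω N → ι → ℂ} {Z : Ω' → ι → ℂ} (hV : ∀ N, Measurable (V N)) (hZ : Measurable Z)
    (h : ∀ t : ι → ℂ, Tendsto (fun N => ∫ w, exp ((∑ q, conj (t q) * V N w q).re * I) ∂P N) atTop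
      (𝓝 (∫ w, exp ((∑ q, conj (t q) * Z w q).re * I) ∂Q))) :
    TendstoInDistribution V atTop Z P Q := by
  have hm : Measurable (WithLp.toLp 2 : (ι → ℂ) → PiLp 2 fun _ : ι => ℂ) := by fun_prop
  have e : ∀ (v : ι → ℂ) (t : PiLp 2 fun _ : ι => ℂ),
      inner ℝ (WithLp.toLp 2 v) t = (∑ q, conj (t q) * v q).re := fun v t => by
    rw [PiLp.inner_apply, Complex.re_sum]
    exact sum_congr rfl fun q _ => by simp [Complex.inner, mul_comm]
  have key : TendstoInDistribution (fun N w => WithLp.toLp 2 (V N w) : ∀ N, Ω N → PiLp 2 fun _ : ι => ℂ)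
      atTop (fun w => WithLp.toLp 2 (Z w)) P Q := by
    refine ⟨fun N => (hm.comp (hV N)).aemeasurable, (hm.comp hZ).aemeasurable,
      ProbabilityMeasure.tendsto_of_tendsto_charFun fun t => ?_⟩
    simp only [charFun_apply, ProbabilityMeasure.coe_mk]
    have hc : Continuous fun x : PiLp 2 fun _ : ι => ℂ => exp (inner ℝ x t * I) := by fun_prop
    have h1 := fun N => integral_map (μ := P N) (hm.comp (hV N)).aemeasurable
      hc.aestronglyMeasurable
    have h2 := integral_map (μ := Q) (hm.comp hZ).aemeasurable hc.aestronglyMeasurable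
    simp only [Function.comp_def] at h1 h2
    simp only [h1, h2]
    simp only [e]
    exact h t.ofLp
  exact key.continuous_comp (g := WithLp.ofLp) (by fun_prop)

end Convergence

section Model

variable {n : Type} [Fintype n] [DecidableEq n] {Ω : Type*} [MeasurableSpace Ω] {P : Measure Ω}
  {X : Ω → Matrix n n ℂ} {h A A' σ ρ : ℝ}

lemma Model.mono (M : Model P X h A σ ρ) (hA : A ≤ A') : Model P X h A' σ ρ := have h0 := M.h_pos
  { M with
    one_le := M.one_le.trans hA
    sigma_le := M.sigma_le.trans hA
    fourth := fun i j => (M.fourth i j).trans (by gcongr)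
    second := fun i j hij => (M.second i j hij).trans (by gcongr)
    square := fun i j hij => (M.square i j hij).trans (by gcongr) }

lemma conj_form (z : ℂ) {Y : Matrix n n ℂ} (hY : Y.IsHermitian) (u v : n → ℂ) :
    conj (form z u v Y) = form (conj z) v u Y := by
  rw [form_eq_left hY, form, map_sum]
  exact sum_congr rfl fun i _ => by rw [map_mul, Complex.conj_conj, mul_comm]

end Model

section SymmetricFamily

variable {ι : Type} [Fintype ι] {m : ℕ} (l p : ι → Fin m) (z : ι → ℂ)

/-- The test family consisting of the forms `⟨u_l, (z - X)⁻¹ u_p⟩` and their conjugates. -/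
def symFamily {n : Type} (U : Fin m → n → ℂ) : Family n (ι × Bool) where
  z b := if b.2 then conj (z b.1) else z b.1
  u b := U (if b.2 then p b.1 else l b.1)
  v b := U (if b.2 then l b.1 else p b.1)

/-- The coefficients which turn the symmetric family into a real linear form. -/
def symCoeff (t : ι → ℂ) (b : ι × Bool) : ℂ := if b.2 then t b.1 / 2 else conj (t b.1) / 2

lemma sum_symCoeff (t : ι → ℂ) (f : ι × Bool → ℂ) (hf : ∀ q, conj (f (q, false)) = f (q, true)) :
    ∑ b, symCoeff t b * f b = ((∑ q, conj (t q) * f (q, false)).re : ℝ) := by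
  rw [Fintype.sum_prod_type, Complex.re_eq_add_conj, map_sum, ← sum_add_distrib, Finset.sum_div]
  refine sum_congr rfl fun q _ => ?_
  rw [Fintype.sum_bool, ← hf]
  simp only [symCoeff, if_true, Bool.false_eq_true, if_false, map_mul, Complex.conj_conj]
  ring

lemma covLim_symFamily {n : Type} [Fintype n] [DecidableEq n] {σ ρ : ℝ} (hσ : 0 < σ)
    {U : Fin m → n → ℂ} (hz : ∀ q, (z q).im ≠ 0)
    (hU : ∀ l p, ∑ i, conj (U l i) * U p i = if l = p then 1 else 0)
    (hρ : ρ = 0 ∨ ∀ l i, conj (U l i) = U l i) (b b' : ι × Bool) :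
    covLim σ ρ (stieltjes σ) (symFamily l p z U) b b' =
      covPi σ (if b.2 then conj (z b.1) else z b.1) (if b'.2 then conj (z b'.1) else z b'.1) *
      entryCov ρ (if b.2 then p b.1 else l b.1) (if b.2 then l b.1 else p b.1)
        (if b'.2 then p b'.1 else l b'.1) (if b'.2 then l b'.1 else p b'.1) := by
  have hz' : ∀ b : ι × Bool, (if b.2 then conj (z b.1) else z b.1).im ≠ 0 := fun b => by
    split_ifs <;> simp [hz]
  have hne : 1 - (σ : ℂ) ^ 2 * stieltjes σ (if b.2 then conj (z b.1) else z b.1) *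
      stieltjes σ (if b'.2 then conj (z b'.1) else z b'.1) ≠ 0 := fun h0 => by
    have h1 := norm_mul_stieltjes_lt hσ (hz' b)
    have h2 := norm_mul_stieltjes_lt hσ (hz' b')
    have h3 := mul_lt_mul'' h1 h2 (norm_nonneg _) (norm_nonneg _)
    rw [← norm_mul, show ∀ g g' : ℂ, (σ : ℂ) * g * (σ * g') = 1 - (1 - σ ^ 2 * g * g') from
      fun g g' => by ring, h0] at h3
    simp at h3
  simp only [covLim, symFamily, entryCov, covPi, pairLim, hU]
  generalize (if b.2 then conj (z b.1) else z b.1) = w at *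
  generalize (if b'.2 then conj (z b'.1) else z b'.1) = w' at *
  have hρ' : ∀ l l' p p' : Fin m, (ρ : ℂ) * ((∑ i, conj (U l i) * conj (U l' i)) * ∑ i, U p' i * U p i) =
      ρ * ((if l = l' then 1 else 0) * if p' = p then 1 else 0) := fun l l' p p' => by
    rcases hρ with rfl | hr
    · simp
    · rw [← hU l l', ← hU p' p]
      simp only [hr]
  rw [hρ', mul_right_comm _ (stieltjes σ w') (stieltjes σ w)]
  field_simp
  ring

end SymmetricFamily

section FluctuationLimit

variable {ι : Type} [Fintype ι] {m : ℕ} {l p : ι → Fin m} {z : ι → ℂ} {σ ρ : ℝ}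

lemma symFamily_form_conj {n : Type} [Fintype n] [DecidableEq n] {U : Fin m → n → ℂ}
    {Y : Matrix n n ℂ} (hY : Y.IsHermitian) (q : ι) : conj ((symFamily l p z U).formAt (q, false) Y) =
      (symFamily l p z U).formAt (q, true) Y := by
  simp [Family.formAt, symFamily, conj_form _ hY]

/-- The total covariance of a real linear form in the limiting field. -/
def limitVar (σ ρ : ℝ) (l p : ι → Fin m) (z t : ι → ℂ) : ℂ :=
  ∑ b, ∑ b', symCoeff t b * symCoeff t b' *
    (covPi σ (if b.2 then conj (z b.1) else z b.1) (if b'.2 then conj (z b'.1) else z b'.1) *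
      entryCov ρ (if b.2 then p b.1 else l b.1) (if b.2 then l b.1 else p b.1)
        (if b'.2 then p b'.1 else l b'.1) (if b'.2 then l b'.1 else p b'.1))

lemma lin_symFamily {n : Type} [Fintype n] [DecidableEq n] {Ω : Type*} [MeasurableSpace Ω]
    {P : Measure Ω} [IsProbabilityMeasure P] {X : Ω → Matrix n n ℂ} {h A : ℝ}
    (M : Model P X h A σ ρ) (U : Fin m → n → ℂ) (t : ι → ℂ)
    (hT : (symFamily l p z U).Good (symCoeff t) A) (ω : Ω) :
    I * ((h⁻¹ : ℝ) * ((symFamily l p z U).lin (symCoeff t) (X ω) -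
      avg P X ((symFamily l p z U).lin (symCoeff t)))) =
    (∑ q, conj (t q) * ((h⁻¹ : ℝ) * (form (z q) (U (l q)) (U (p q)) (X ω) -
      ∫ ω', form (z q) (U (l q)) (U (p q)) (X ω') ∂P))).re * I := by
  have e1 := sum_symCoeff t (fun b => (symFamily l p z U).formAt b (X ω))
    (symFamily_form_conj (M.isHermitian ω))
  have e2 := sum_symCoeff t (fun b => ∫ ω', (symFamily l p z U).formAt b (X ω') ∂P) fun q => by
    rw [← integral_conj]
    exact integral_congr_ae (ae_of_all _ fun ω' => symFamily_form_conj (M.isHermitian ω') q)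
  have e3 : avg P X ((symFamily l p z U).lin (symCoeff t)) =
      ∑ b, symCoeff t b * ∫ ω', (symFamily l p z U).formAt b (X ω') ∂P := by
    simp only [avg, Family.lin]
    rw [integral_finsetSum univ fun b _ => (M.integrable (M.tame_formAt hT b)).const_mul _]
    simp only [integral_const_mul]
  rw [e3, e2, Family.lin, e1, mul_comm, ← Complex.ofReal_sub, ← Complex.sub_re,
    ← sum_sub_distrib, ← Complex.ofReal_mul, ← Complex.re_ofReal_mul, mul_sum]
  refine congrArg (fun w : ℂ => (w.re : ℂ) * I) (sum_congr rfl fun q _ => ?_)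
  simp only [Family.formAt, symFamily, Bool.false_eq_true, if_false]
  ring

theorem tendsto_charFun_forms {Ω : ℕ → Type*} [∀ N, MeasurableSpace (Ω N)]
    {P : ∀ N, Measure (Ω N)} [∀ N, IsProbabilityMeasure (P N)]
    {X : ∀ N, Ω N → Matrix (Fin N) (Fin N) ℂ} {A₀ : ℝ} (hσ : 0 < σ)
    (hM : ∀ N : ℕ, 1 ≤ N → Model (P N) (X N) (1 / √N) A₀ σ ρ)
    {U : ∀ N, Fin m → Fin N → ℂ}
    (hρ : ρ = 0 ∨ (∀ N w, (X N w).transpose = X N w) ∧ ∀ N l i, conj (U N l i) = U N l i)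
    (hU : ∀ᶠ N in atTop, ∀ l p, ∑ i, conj (U N l i) * U N p i = if l = p then 1 else 0)
    (hU0 : ∀ l, Tendsto (fun N => ‖U N l‖) atTop (𝓝 0)) (hz : ∀ q, (z q).im ≠ 0) (t : ι → ℂ) :
    Tendsto (fun N => ∫ w, exp ((∑ q, conj (t q) * ((√N : ℝ) *
      (form (z q) (U N (l q)) (U N (p q)) (X N w) -
        ∫ w', form (z q) (U N (l q)) (U N (p q)) (X N w') ∂P N))).re * I) ∂P N) atTop
      (𝓝 (exp (-limitVar σ ρ l p z t / 2))) := by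
  set zb : ι × Bool → ℂ := fun b => if b.2 then conj (z b.1) else z b.1 with hzb
  have hzb0 : ∀ b, (zb b).im ≠ 0 := fun b => by simp only [hzb]; split_ifs <;> simp [hz]
  set A := |A₀| + ∑ b, |(zb b).im|⁻¹ + card (ι × Bool) + ∑ b, ‖symCoeff t b‖ with hA
  have h1 : 0 ≤ ∑ b, |(zb b).im|⁻¹ := sum_nonneg fun _ _ => by positivity
  have h2 : 0 ≤ ∑ b, ‖symCoeff t b‖ := sum_nonneg fun _ _ => by positivity
  have h3 : (0 : ℝ) ≤ card (ι × Bool) := by positivity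
  have hA0 : A₀ ≤ A := by linarith [le_abs_self A₀]
  set D := ∑ b, ∑ b', |pairConst A (zb b') (zb b)| with hD
  have hDb : ∀ b b', pairConst A (zb b') (zb b) ≤ D := fun b b' => (le_abs_self _).trans
    ((single_le_sum (f := fun b' => |pairConst A (zb b') (zb b)|) (fun _ _ => abs_nonneg _)
      (mem_univ b')).trans (single_le_sum
      (f := fun b => ∑ b', |pairConst A (zb b') (zb b)|)
      (fun _ _ => sum_nonneg fun _ _ => abs_nonneg _) (mem_univ b)))
  have hη : Tendsto (fun N => ∑ l, ‖U N l‖) atTop (𝓝 0) := by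
    simpa using tendsto_finsetSum univ fun l _ => hU0 l
  have hh : Tendsto (fun N : ℕ => √(1 / √N)) atTop (𝓝 0) := by
    have := (tendsto_inv_atTop_zero.comp
      (Real.tendsto_sqrt_atTop.comp tendsto_natCast_atTop_atTop)).sqrt
    simpa [Function.comp_def] using this
  rw [tendsto_iff_norm_sub_tendsto_zero]
  refine squeeze_zero' (g := fun N : ℕ => A ^ 2 * cltConst A D * (√(1 / √N) +
    ∑ l, ‖U N l‖) * Real.exp ‖limitVar σ ρ l p z t‖) (.of_forall fun N => norm_nonneg _) ?_
    (by simpa using ((hh.add hη).const_mul _).mul_const _)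
  filter_upwards [hU, eventually_ge_atTop 1] with N hN h1N
  have M := (hM N h1N).mono hA0
  have hl2 : ∀ l, l2 (U N l) ≤ 1 := fun l => by
    have e : (l2 (U N l) : ℂ) ^ 2 = 1 := by
      rw [← Complex.ofReal_pow, l2_sq, Complex.ofReal_sum]
      simpa [Complex.conj_mul'] using hN l l
    have e' : l2 (U N l) ^ 2 = 1 := by exact_mod_cast e
    nlinarith [l2_nonneg (U N l)]
  have hT : (symFamily l p z (U N)).Good (symCoeff t) A := by
    refine ⟨M.one_le, fun b => ?_, fun b => hl2 _, fun b => hl2 _, by linarith [abs_nonneg A₀],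
      fun b => ?_, fun Y hY => ?_⟩
    · have h4 := single_le_sum (f := fun b => |(zb b).im|⁻¹) (fun _ _ => by positivity)
        (mem_univ b)
      have h5 : |(zb b).im|⁻¹ ≤ A := by linarith [abs_nonneg A₀]
      calc 1 = |(zb b).im|⁻¹ * |(zb b).im| := (inv_mul_cancel₀ (abs_ne_zero.2 (hzb0 b))).symm
        _ ≤ A * |(zb b).im| := by gcongr
    · have h4 := single_le_sum (f := fun b => ‖symCoeff t b‖) (fun _ _ => by positivity)
        (mem_univ b)
      linarith [abs_nonneg A₀]
    · rw [Family.lin, sum_symCoeff t _ (symFamily_form_conj hY), Complex.ofReal_im]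
  have hb : ∀ l i, ‖U N l i‖ ≤ ∑ l, ‖U N l‖ := fun l i => (norm_le_pi_norm _ i).trans
    (single_le_sum (f := fun l => ‖U N l‖) (fun _ _ => norm_nonneg _) (mem_univ l))
  have key := M.norm_charFun_sub_le (fun z hz => stieltjes_selfConsistent hσ hz)
    (hρ.imp_right fun h => h.1 N) hT (sum_nonneg fun _ _ => sum_nonneg fun _ _ =>
      abs_nonneg _) (fun b b' => hDb b b') (sum_nonneg fun _ _ => norm_nonneg _)
    (fun b i => hb _ i) (fun b i => hb _ i)
  simp only [lin_symFamily M (U N) t hT, covLim_symFamily l p z hσ hz hN (hρ.imp_right fun h => h.2 N)]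
    at key
  simp only [one_div, inv_inv] at key ⊢
  exact key

lemma integral_exp_limitField (hσ : 0 < σ) (hρ : |ρ| ≤ 1) (hz : ∀ q, (z q).im ≠ 0) (t : ι → ℂ) :
    ∫ x, exp ((∑ q, conj (t q) * limitField σ ρ (z q) x (l q) (p q)).re * I)
      ∂gaussSeq (ℕ × ((Fin m × Fin m) × Bool)) = exp (-limitVar σ ρ l p z t / 2) := by
  have hs := fun q => summable_fieldCoeff (ρ := ρ) hσ (hz q) (l q) (p q)
  have hr : Summable fun s => (∑ q, conj (t q) * fieldCoeff σ ρ (l q) (p q) (z q) s).re :=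
    Complex.reCLM.summable (summable_sum fun q _ => (hs q).mul_left _)
  have h1 := linear_cseries (I := univ) (fun q _ => hs q) fun q => conj (t q)
  have h3 : ∀ᵐ x ∂gaussSeq (ℕ × ((Fin m × Fin m) × Bool)),
      exp ((∑ q, conj (t q) * limitField σ ρ (z q) x (l q) (p q)).re * I) =
      exp (series (fun s => (∑ q, conj (t q) * fieldCoeff σ ρ (l q) (p q) (z q) s).re) x * I) :=
    h1.mono fun x hx => by rw [hx]; rfl
  rw [integral_congr_ae h3, integral_exp_series hr]
  let a : ι × Bool → ℕ × ((Fin m × Fin m) × Bool) → ℂ := fun b =>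
    fieldCoeff σ ρ (if b.2 then p b.1 else l b.1) (if b.2 then l b.1 else p b.1)
      (if b.2 then conj (z b.1) else z b.1)
  have hz' : ∀ b : ι × Bool, (if b.2 then conj (z b.1) else z b.1).im ≠ 0 := fun b => by
    split_ifs <;> simp [hz]
  have h2 := dot_sum (a := a) (fun b => summable_fieldCoeff hσ (hz' b) _ _) (symCoeff t)
  simp only [a, dot_fieldCoeff hσ hρ (hz' _) (hz' _)] at h2
  rw [limitVar, ← h2, Complex.ofReal_tsum]
  refine congrArg (fun w : ℂ => exp (-w / 2)) (tsum_congr fun s => ?_)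
  rw [Complex.ofReal_pow, sum_symCoeff t (fun b => a b s) fun q => by simp [a, conj_fieldCoeff]]
  simp [a]

end FluctuationLimit

end WignerFluct

end

theorem theorem1p7 {Ω : ℕ → Type*} [∀ N, MeasurableSpace (Ω N)]
    (P : ∀ N, Measure (Ω N)) [∀ N, IsProbabilityMeasure (P N)]
    (W : ∀ N, Ω N → Matrix (Fin N) (Fin N) ℂ) (σ : ℝ) (hσ : 0 < σ) (ρ : ℝ)
    (m : ℕ) (u : ∀ N, Fin m → EuclideanSpace ℂ (Fin N))
    (hW : (ρ = 1 ∧ WignerFluct.IsRealWigner P W σ ∧ ∀ N l i, (u N l i).im = 0) ∨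
      (ρ = 0 ∧ WignerFluct.IsHermitianWigner P W σ))
    (hu : ∀ᶠ N in atTop, Orthonormal ℂ (u N))
    (hu_inf : ∀ l, Tendsto (fun N => ‖WithLp.ofLp (u N l)‖) atTop (𝓝 0)) :
    ∃ (Ω' : Type) (_ : MeasurableSpace Ω') (Q : Measure Ω') (_ : IsProbabilityMeasure Q)
      (Γ : ℂ → Ω' → Matrix (Fin m) (Fin m) ℂ),
      WignerFluct.IsLimitField Q σ ρ Γ ∧
      ∀ (n : ℕ) (z : Fin n → ℂ), (∀ k, (z k).im ≠ 0) →
        TendstoInDistribution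
          (fun N (ω : Ω N) (k : Fin n) (l p : Fin m) =>
            WignerFluct.fluctMatrix (P N) (W N) (u N) (z k) ω l p)
          atTop
          (fun (ω : Ω') (k : Fin n) (l p : Fin m) => Γ (z k) ω l p) P Q := by
  open WignerFluct in
  have hρ : |ρ| ≤ 1 := by
    rcases hW with h | h <;> simp [h.1]
  have hWm : WignerMoments P W := by
    rcases hW with h | h
    exacts [h.2.1.toWignerMoments, h.2.toWignerMoments]
  obtain ⟨A, hM⟩ : ∃ A, ∀ N, 1 ≤ N →
      Model (P N) (truncX (P N) (W N)) (1 / Real.sqrt N) A σ ρ := by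
    rcases hW with ⟨rfl, h, _⟩ | ⟨rfl, h⟩
    exacts [h.entryModel, h.entryModel]
  refine ⟨_, _, gaussSeq (ℕ × ((Fin m × Fin m) × Bool)), inferInstance, limitField σ ρ,
    isLimitField hσ hρ, fun n z hz => ?_⟩
  have hform : ∀ N ω k l p, fluctMatrix (P N) (W N) (u N) (z k) ω l p = (Real.sqrt N : ℝ) *
      (form (z k) (u N l) (u N p) (truncX (P N) (W N) ω) -
        ∫ ω', form (z k) (u N l) (u N p) (truncX (P N) (W N) ω') ∂P N) := fun N ω k l p => rfl
  have hmeas : ∀ N k l p, Measurable fun ω => fluctMatrix (P N) (W N) (u N) (z k) ω l p := by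
    intro N k l p
    simp only [hform]
    refine (Measurable.sub_const ?_ _).const_mul _
    refine (tame_form (hz k) (u N l) (u N p)).1.comp (measurable_matrix fun i j => ?_)
    simp only [truncX_apply]
    split_ifs
    · exact measurable_const
    · exact (((measurable_trunc _).comp (hWm.measurable N i j)).sub_const _).const_mul _
  have key := tendstoInDistribution_of_tendsto_charFun (ι := Fin n × Fin m × Fin m) (P := P)
    (Q := gaussSeq (ℕ × ((Fin m × Fin m) × Bool)))
    (V := fun N ω q => fluctMatrix (P N) (W N) (u N) (z q.1) ω q.2.1 q.2.2)
    (Z := fun ω q => limitField σ ρ (z q.1) ω q.2.1 q.2.2)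
    (fun N => measurable_pi_lambda _ fun q => hmeas N _ _ _)
    (measurable_pi_lambda _ fun q => measurable_cseries _) fun t => by
      rw [integral_exp_limitField hσ hρ (fun q => hz q.1) t]
      simp only [hform]
      refine tendsto_charFun_forms (l := fun q : Fin n × Fin m × Fin m => q.2.1)
        (p := fun q => q.2.2) (z := fun q => z q.1) (U := fun N l => WithLp.ofLp (u N l)) hσ hM
        ?_ ?_ hu_inf (fun q => hz q.1) t
      · rcases hW with ⟨_, h, hr⟩ | h
        · exact .inr ⟨h.transpose_truncX, fun N l i => Complex.conj_eq_iff_im.2 (hr N l i)⟩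
        · exact .inl h.1
      · filter_upwards [hu] with N hN l p
        rw [← orthonormal_iff_ite.1 hN l p, PiLp.inner_apply]
        exact Finset.sum_congr rfl fun i _ => by simp [mul_comm]
  exact key.continuous_comp (g := fun v k l p => v (k, l, p)) (by fun_prop)
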